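/- Let $n>0$ and $\mathbb F=\mathbb F_2$. Gradings: in a bidegree $(i,j)$, $i$ is the cohomological and $j$ the $q$-degree. **The algebras.** Let $V$ be the set of subsets of $\{0,\dots,n\}$. For $0\le s\le n-1$ write $\mathbf x\xrightarrow{s}\mathbf y$ if $\mathbf y=\mathbf x\sqcup\{s,s+1\}$. Let $R_n$ be the unital $q$-graded $\mathbb F$-algebra generated by orthogonal idempotents $e(\mathbf x)$, $\mathbf x\in V$, of degree $0$ with $\sum_{\mathbf x} e(\mathbf x)=1$, and elements $r(\mathbf x\xrightarrow{s}\mathbf y)$ of degree $n-1-2s$ with $e(\mathbf x)\,r(\mathbf x\xrightarrow{s}\mathbf y)=r(\mathbf x\xrightarrow{s}\mathbf y)=r(\mathbf x\xrightarrow{s}\mathbf y)\,e(\mathbf y)$, subject to $r(\mathbf x\xrightarrow{s}\mathbf y)r(\mathbf y\xrightarrow{t}\mathbf w)=r(\mathbf x\xrightarrow{t}\mathbf z)r(\mathbf z\xrightarrow{s}\mathbf w)$. Let $R_n\otimes R_n$ be the $q$-graded tensor product over $\mathbb F$, also viewed as a DG algebra with zero differential in cohomological degree $0$. Let $R_n\boxtimes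 R_n$ be the $q$-graded DG $\mathbb F$-algebra generated by orthogonal idempotents $e(\mathbf x,\mathbf y)$ of bidegree $(0,0)$ with sum $1$ and by the following elements, each an arrow from the idempotent of its source to that of its target (in the same sense as above): * $a_s:(\mathbf x,\mathbf y)\to(\mathbf x',\mathbf y)$ for $\mathbf x\xrightarrow{s}\mathbf x'$, of bidegree $(0,n-1-2s)$; * $b_s:(\mathbf x,\mathbf y)\to(\mathbf x,\mathbf y')$ for $\mathbf y\xrightarrow{s}\mathbf y'$, of bidegree $(0,n-1-2s)$; * $c_s:(\mathbf x,\mathbf y)\to(\mathbf x',\mathbf y')$ for $\mathbf x\xrightarrow{s}\mathbf x'$ and $\mathbf y\xrightarrow{s+1}\mathbf y'$, of bidegree $(-1,(n-1-2s)+(n-1-2(s+1)))$. The relations are, between parallel paths whenever all the arrows in them exist: $a_sa_t=a_ta_s$, $b_sb_t=b_tb_s$, $a_sb_t=b_ta_s$ if $t\ne s+1$, $c_sb_t=b_tc_s$, $c_sa_t=a_tc_s$, $c_sc_t=c_tc_s$. The differential is zero on all the generators except $d(c_s)=a_sb_{s+1}+b_{s+1}a_s$, and it satisfies $d(uv)=d(u)v+u\,d(v)$.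 **The categories.** For a $q$-graded DG algebra $A$, $H^0(DG(A))$ is the category of $q$-graded left DG $A$-modules with morphisms the closed $A$-linear maps of bidegree $(0,0)$ modulo the exact ones; it has the shifts $(M[1])^{i,j}=M^{i+1,j}$, $(M\{1\})^{i,j}=M^{i,j+1}$ and the distinguished triangles given by mapping cones. $H^0(DGP(R_n\boxtimes R_n))$ is its full subcategory (for $A=R_n\boxtimes R_n$) on the smallest class of DG modules that contains all $P(\mathbf x,\mathbf y)=(R_n\boxtimes R_n)e(\mathbf x,\mathbf y)$ and is closed under isomorphisms, the shifts $[\pm1]$, $\{\pm1\}$ and mapping cones of closed degree-$(0,0)$ morphisms; $H^0(DGP(R_n\otimes R_n))$ is defined in the same way from $P'(\mathbf x,\mathbf y)=(R_n\otimes R_n)(e(\mathbf x)\otimes e(\mathbf y))$. For a $q$-graded algebra $B$, $K^b(B)$ is the homotopy category of bounded cochain complexes of finitely generated projective $q$-graded left $B$-modules, with grading-preserving maps. For each of these categories, $K_0$ denotes the Grothendieck group: the $\mathbb Z[q^{\pm1}]$-module generated by the classes $[X]$ of objects with the relations $[X\{1\}]=q[X]$, and $[Y]=[X]+[Z]$ for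 each distinguished triangle $X\to Y\to Z\to X[1]$. Put $P(\mathbf x)=R_ne(\mathbf x)$ and $K_0(R_n)=K_0(K^b(R_n))$. **Statement.** 1. $R_n\boxtimes R_n$ is formal, i.e. connected with its cohomology algebra $H(R_n\boxtimes R_n)$ by a zigzag of quasi-isomorphisms of $q$-graded DG algebras, and $H(R_n\boxtimes R_n)\cong R_n\otimes R_n$ as $q$-graded DG algebras (with zero differential). 2. There is an equivalence $E_1:H^0(DGP(R_n\boxtimes R_n))\to H^0(DGP(R_n\otimes R_n))$ with $E_1(P(\mathbf x,\mathbf y))\cong P'(\mathbf x,\mathbf y)$, and an equivalence $E_2:H^0(DGP(R_n\otimes R_n))\to K^b(R_n\otimes R_n)$ taking $P'(\mathbf x,\mathbf y)$ to the complex $P'(\mathbf x,\mathbf y)$ in degree $0$ (up to isomorphism), for all $\mathbf x,\mathbf y\in V$. Both commute with the shifts $[m]$, $m\in\mathbb Z$, and $\{1\}$, and under both a triangle is distinguished if and only if its image is. 3. $E_1$ and $E_2$ induce isomorphisms of $\mathbb Z[q^{\pm1}]$-modules $$K_0(H^0(DGP(R_n\boxtimes R_n)))\cong K_0(H^0(DGP(R_n\otimes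 R_n)))\cong K_0(K^b(R_n\otimes R_n)),$$ and there is an isomorphism $K_0(K^b(R_n\otimes R_n))\cong K_0(R_n)\otimes_{\mathbb Z[q^{\pm1}]}K_0(R_n)$ of $\mathbb Z[q^{\pm1}]$-modules with $[P'(\mathbf x,\mathbf y)]\mapsto[P(\mathbf x)]\otimes[P(\mathbf y)]$. In particular $K_0(H^0(DGP(R_n\boxtimes R_n)))\cong K_0(R_n)\otimes_{\mathbb Z[q^{\pm1}]}K_0(R_n)$. -/

import Mathlib

open CategoryTheory
open scoped TensorProduct LaurentPolynomial

noncomputable section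

namespace QDG

/-! ### Internal gradings -/

/-- The ground field with two elements. -/
abbrev F : Type := ZMod 2

section Internal

variable {G : Type} [DecidableEq G] {M : Type} [AddCommGroup M]
  {σ : Type} [SetLike σ M] [AddSubgroupClass σ M]

theorem isInternal_of_proj (ℳ : G → σ) (π : G → M →+ M)
    (h1 : ∀ g h m, m ∈ ℳ g → π h m = if g = h then m else 0)
    (h2 : ∀ m, m ∈ AddSubmonoid.closure {x : M | ∃ g, x ∈ ℳ g}) :
    DirectSum.IsInternal ℳ := by
  constructor
  · rw [injective_iff_map_eq_zero]
    intro x hx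
    have key : ∀ (h : G) (y : DirectSum G fun g => ℳ g),
        π h (DirectSum.coeAddMonoidHom ℳ y) = (y h : M) := by
      intro h y
      induction y using DirectSum.induction_on with
      | zero => simp
      | of i z =>
        rw [DirectSum.coeAddMonoidHom_of, h1 i h z z.2, DirectSum.of_apply]
        by_cases e : i = h
        · subst e; simp
        · simp [e]
      | add a b ha hb => simp [ha, hb]
    ext h
    rw [← key h x, hx]; simp
  · intro m
    induction h2 m using AddSubmonoid.closure_induction with
    | mem x hx =>
      obtain ⟨g, hg⟩ := hx
      exact ⟨DirectSum.of (fun g => ℳ g) g ⟨x, hg⟩, by simp⟩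
    | zero => exact ⟨0, by simp⟩
    | add x y _ _ hx hy =>
      obtain ⟨a, rfl⟩ := hx
      obtain ⟨b, rfl⟩ := hy
      exact ⟨a + b, by simp⟩

theorem exists_proj {ℳ : G → σ} (h : DirectSum.IsInternal ℳ) :
    ∃ π : G → M →+ M, (∀ g m, π g m ∈ ℳ g) ∧
      ∀ g h m, m ∈ ℳ g → π h m = if g = h then m else 0 := by
  let e := AddEquiv.ofBijective _ h
  refine ⟨fun g => ((AddSubgroupClass.subtype (ℳ g)).comp
    (DFinsupp.evalAddMonoidHom g)).comp e.symm.toAddMonoidHom, ?_, ?_⟩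
  · intro g m
    exact SetLike.coe_mem _
  · intro g h m hm
    have : e.symm m = DirectSum.of (fun g => ℳ g) g ⟨m, hm⟩ := by
      rw [AddEquiv.symm_apply_eq]
      exact (DirectSum.coeAddMonoidHom_of ℳ g ⟨m, hm⟩).symm
    change (((e.symm m) h : ℳ h) : M) = _
    rw [this, DirectSum.of_apply]
    by_cases e : g = h
    · subst e; simp
    · simp [e]

theorem mem_closure_grade {ℳ : G → σ} (h : DirectSum.IsInternal ℳ) (m : M) :
    m ∈ AddSubmonoid.closure {x : M | ∃ g, x ∈ ℳ g} := by
  obtain ⟨y, rfl⟩ := h.2 m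
  induction y using DirectSum.induction_on with
  | zero => simp
  | of i z =>
    rw [DirectSum.coeAddMonoidHom_of]
    exact AddSubmonoid.subset_closure ⟨i, z.2⟩
  | add a b ha hb => rw [map_add]; exact add_mem ha hb

theorem grade_induction {ℳ : G → σ} (h : DirectSum.IsInternal ℳ) {p : M → Prop}
    (hom : ∀ g, ∀ m ∈ ℳ g, p m) (zero : p 0) (add : ∀ x y, p x → p y → p (x + y)) (m : M) :
    p m := by
  obtain ⟨y, rfl⟩ := h.2 m
  induction y using DirectSum.induction_on with
  | zero => simpa using zero
  | of i z =>
    rw [DirectSum.coeAddMonoidHom_of]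
    exact hom i _ z.2
  | add a b ha hb => rw [map_add]; exact add _ _ ha hb

end Internal

/-! ### Graded algebras and DG algebras -/

/-- A `q`-graded (associative, unital) algebra over the field with two elements. -/
structure QAlgebra where
  carrier : Type
  [ring : Ring carrier]
  [algebra : Algebra F carrier]
  grade : ℤ → Submodule F carrier
  isInternal : DirectSum.IsInternal grade
  one_mem : (1 : carrier) ∈ grade 0
  mul_mem : ∀ {i j : ℤ} {a b : carrier}, a ∈ grade i → b ∈ grade j → a * b ∈ grade (i + j)

attribute [instance] QAlgebra.ring QAlgebra.algebra

/-- A `q`-graded DG algebra over the field with two elements; in a bidegree `(i, j)`, `i` is the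
cohomological degree and `j` is the `q`-degree. -/
structure QDGAlgebra where
  carrier : Type
  [ring : Ring carrier]
  [algebra : Algebra F carrier]
  grade : ℤ × ℤ → Submodule F carrier
  isInternal : DirectSum.IsInternal grade
  one_mem : (1 : carrier) ∈ grade 0
  mul_mem : ∀ {p r : ℤ × ℤ} {a b : carrier}, a ∈ grade p → b ∈ grade r → a * b ∈ grade (p + r)
  d : carrier →+ carrier
  d_mem : ∀ {p : ℤ × ℤ} {a : carrier}, a ∈ grade p → d a ∈ grade (p + (1, 0))
  d_d : ∀ a, d (d a) = 0
  d_one : d 1 = 0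
  d_mul : ∀ a b, d (a * b) = d a * b + a * d b

attribute [instance] QDGAlgebra.ring QDGAlgebra.algebra

/-- A `q`-graded algebra as a `q`-graded DG algebra with trivial differential, concentrated in
cohomological degree `0`. -/
def QAlgebra.toDG (A : QAlgebra) : QDGAlgebra where
  carrier := A.carrier
  grade p := if p.1 = 0 then A.grade p.2 else ⊥
  isInternal := by
    obtain ⟨π, -, hπ⟩ := exists_proj A.isInternal
    refine isInternal_of_proj _ (fun p => if p.1 = 0 then π p.2 else 0) ?_ ?_
    · rintro ⟨g1, g2⟩ ⟨h1, h2⟩ m hm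
      by_cases hg : g1 = 0
      · subst hg
        by_cases hh : h1 = 0
        · subst hh
          simp only [if_true] at hm ⊢
          rw [hπ g2 h2 m hm]
          simp
        · simp [hh, Ne.symm hh]
      · simp only [hg, if_false, Submodule.mem_bot] at hm
        subst hm
        simp
    · intro m
      refine AddSubmonoid.closure_mono ?_ (mem_closure_grade A.isInternal m)
      rintro x ⟨g, hg⟩
      exact ⟨(0, g), by simpa using hg⟩
  one_mem := by simpa using A.one_mem
  mul_mem := by
    rintro ⟨p1, p2⟩ ⟨r1, r2⟩ a b ha hb
    by_cases hp : p1 = 0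
    · by_cases hr : r1 = 0
      · subst hp hr
        simp only [if_true] at ha hb
        simpa using A.mul_mem ha hb
      · simp only [hr, if_false, Submodule.mem_bot] at hb
        subst hb; simp
    · simp only [hp, if_false, Submodule.mem_bot] at ha
      subst ha; simp
  d := 0
  d_mem := by intros; simp
  d_d := by intros; simp
  d_one := by simp
  d_mul := by intros; simp

/-! ### The cohomology algebra -/

namespace QDGAlgebra

variable (A : QDGAlgebra)

theorem char_two (a : A.carrier) : a + a = 0 := by
  have : (2 : F) • a = 0 := by
    rw [show (2 : F) = 0 from rfl, zero_smul]
  rwa [two_smul] at this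

theorem d_smul (c : F) (a : A.carrier) : A.d (c • a) = c • A.d a := by
  obtain rfl | rfl : c = 0 ∨ c = 1 := by revert c; decide
  · simp
  · simp

/-- The subalgebra of cocycles. -/
def cocycles : Subalgebra F A.carrier where
  carrier := {a | A.d a = 0}
  mul_mem' := by
    intro a b ha hb
    simp only [Set.mem_ofPred_eq] at ha hb ⊢
    rw [A.d_mul, ha, hb]; simp
  add_mem' := by
    intro a b ha hb
    simp only [Set.mem_ofPred_eq] at ha hb ⊢
    rw [map_add, ha, hb, add_zero]
  algebraMap_mem' := by
    intro c
    simp only [Set.mem_ofPred_eq]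
    rw [Algebra.algebraMap_eq_smul_one, A.d_smul, A.d_one, smul_zero]

theorem mem_cocycles {a : A.carrier} : a ∈ A.cocycles ↔ A.d a = 0 := Iff.rfl

/-- The two-sided ideal of coboundaries in the algebra of cocycles. -/
def coboundaries : Ideal A.cocycles where
  carrier := {z | ∃ a, A.d a = z}
  add_mem' := by
    rintro x y ⟨a, ha⟩ ⟨b, hb⟩
    exact ⟨a + b, by simp [ha, hb]⟩
  zero_mem' := ⟨0, by simp⟩
  smul_mem' := by
    rintro c x ⟨a, ha⟩
    refine ⟨c * a, ?_⟩
    rw [A.d_mul, ha, (A.mem_cocycles).1 c.2]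
    simp

theorem mem_coboundaries {z : A.cocycles} : z ∈ A.coboundaries ↔ ∃ a, A.d a = z := Iff.rfl

instance : A.coboundaries.IsTwoSided where
  mul_mem_of_left := by
    rintro x y ⟨a, ha⟩
    refine ⟨a * y, ?_⟩
    rw [A.d_mul, ha, (A.mem_cocycles).1 y.2]
    simp

/-- The underlying algebra `ker d / im d` of the cohomology of a DG algebra. -/
abbrev H : Type := A.cocycles ⧸ A.coboundaries

theorem proj_d {π : ℤ × ℤ → A.carrier →+ A.carrier}
    (hπ : ∀ g h m, m ∈ A.grade g → π h m = if g = h then m else 0) (p : ℤ × ℤ) (a : A.carrier) :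
    π (p + (1, 0)) (A.d a) = A.d (π p a) := by
  induction a using grade_induction A.isInternal with
  | hom g m hm =>
    rw [hπ _ _ _ (A.d_mem hm), hπ _ _ _ hm]
    simp only [add_left_inj]
    split_ifs <;> simp
  | zero => simp
  | add x y hx hy => simp [hx, hy]

/-- The homogeneous part of the cohomology in a given bidegree: the classes of the homogeneous
cocycles of this bidegree. -/
def gradeH (p : ℤ × ℤ) : Submodule F A.H :=
  ((A.grade p).comap A.cocycles.val.toLinearMap).map
    (Ideal.Quotient.mkₐ F A.coboundaries).toLinearMap

theorem mem_gradeH {p : ℤ × ℤ} {x : A.H} :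
    x ∈ A.gradeH p ↔ ∃ z : A.cocycles, (z : A.carrier) ∈ A.grade p ∧
      Ideal.Quotient.mk A.coboundaries z = x := Iff.rfl

theorem isInternal_gradeH : DirectSum.IsInternal A.gradeH := by
  obtain ⟨π, hπ1, hπ⟩ := exists_proj A.isInternal
  have hz : ∀ p (z : A.cocycles), π p z ∈ A.cocycles := by
    intro p z
    rw [mem_cocycles, ← proj_d A hπ, (A.mem_cocycles).1 z.2, map_zero]
  let πZ : ℤ × ℤ → A.cocycles →+ A.cocycles := fun p =>
    { toFun := fun z => ⟨π p z, hz p z⟩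
      map_zero' := by ext; simp
      map_add' := by intros; ext; simp }
  have hB : ∀ p, ∀ z ∈ A.coboundaries, πZ p z ∈ A.coboundaries := by
    rintro p z ⟨a, ha⟩
    refine ⟨π (p - (1, 0)) a, ?_⟩
    rw [← proj_d A hπ, ha]
    simp [πZ]
  let πH : ℤ × ℤ → A.H →+ A.H := fun p =>
    QuotientAddGroup.map A.coboundaries.toAddSubgroup A.coboundaries.toAddSubgroup (πZ p)
      (fun z hz => hB p z hz)
  have hπH : ∀ p z, πH p (Ideal.Quotient.mk A.coboundaries z) =
    Ideal.Quotient.mk A.coboundaries (πZ p z) := fun p z => rfl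
  refine isInternal_of_proj _ πH ?_ ?_
  · rintro g h m ⟨z, hz, rfl⟩
    change πH h (Ideal.Quotient.mk A.coboundaries z) =
      if g = h then Ideal.Quotient.mk A.coboundaries z else 0
    have : πZ h z = if g = h then z else 0 := by
      ext
      change π h z = _
      have hz' : (z : A.carrier) ∈ A.grade g := hz
      rw [hπ g h _ hz']
      split_ifs <;> simp
    rw [hπH, this]
    split_ifs <;> simp
  · intro m
    obtain ⟨z, rfl⟩ := Ideal.Quotient.mk_surjective m
    have key : ∃ s : Finset (ℤ × ℤ), (z : A.carrier) = ∑ p ∈ s, π p z := by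
      have : ∀ a : A.carrier, ∃ s : Finset (ℤ × ℤ), ∀ t, s ⊆ t → a = ∑ p ∈ t, π p a := by
        intro a
        induction a using grade_induction A.isInternal with
        | hom g m hm =>
          refine ⟨{g}, fun t ht => ?_⟩
          simp only [hπ g _ m hm]
          have : g ∈ t := ht (by simp)
          simp [this]
        | zero => exact ⟨∅, by simp⟩
        | add x y hx hy =>
          obtain ⟨s, hs⟩ := hx
          obtain ⟨t, ht⟩ := hy
          refine ⟨s ∪ t, fun u hu => ?_⟩
          simp only [map_add, Finset.sum_add_distrib]
          rw [← hs u (Finset.union_subset_left hu), ← ht u (Finset.union_subset_right hu)]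
      obtain ⟨s, hs⟩ := this z
      exact ⟨s, hs s subset_rfl⟩
    obtain ⟨s, hs⟩ := key
    have : z = ∑ p ∈ s, πZ p z := by
      ext
      rw [AddSubmonoidClass.coe_finsetSum]
      exact hs
    rw [this, map_sum]
    refine sum_mem fun p _ => AddSubmonoid.subset_closure ⟨p, πZ p z, ?_, rfl⟩
    exact hπ1 p z

/-- The cohomology of a `q`-graded DG algebra, as a `q`-graded DG algebra with trivial
differential. -/
def cohomology : QDGAlgebra where
  carrier := A.H
  grade := A.gradeH
  isInternal := A.isInternal_gradeH
  one_mem := ⟨1, A.one_mem, rfl⟩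
  mul_mem := by
    rintro p r _ _ ⟨x, hx, rfl⟩ ⟨y, hy, rfl⟩
    exact ⟨x * y, A.mul_mem hx hy, rfl⟩
  d := 0
  d_mem := by intros; simp
  d_d := by intros; simp
  d_one := by simp
  d_mul := by intros; simp

/-- Morphisms of `q`-graded DG algebras. -/
structure Hom (A B : QDGAlgebra) where
  toAlgHom : A.carrier →ₐ[F] B.carrier
  map_grade : ∀ {p : ℤ × ℤ} {a : A.carrier}, a ∈ A.grade p → toAlgHom a ∈ B.grade p
  map_d : ∀ a, toAlgHom (A.d a) = B.d (toAlgHom a)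

variable {A} {B : QDGAlgebra}

/-- The map induced on cocycles. -/
def Hom.mapCocycles (f : Hom A B) : A.cocycles →ₐ[F] B.cocycles :=
  (f.toAlgHom.comp A.cocycles.val).codRestrict B.cocycles (by
    intro z
    change B.d (f.toAlgHom z) = 0
    rw [← f.map_d, (A.mem_cocycles).1 z.2, map_zero])

/-- The map induced on cohomology. -/
def Hom.mapH (f : Hom A B) : A.H →+* B.H :=
  Ideal.Quotient.lift A.coboundaries
    ((Ideal.Quotient.mk B.coboundaries).comp f.mapCocycles.toRingHom) (by
      rintro z ⟨a, ha⟩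
      refine Ideal.Quotient.eq_zero_iff_mem.2 ⟨f.toAlgHom a, ?_⟩
      rw [← f.map_d, ha]
      rfl)

/-- A quasi-isomorphism: a morphism inducing a bijection on cohomology. -/
def Hom.IsQuasiIso (f : Hom A B) : Prop := Function.Bijective f.mapH

/-- Two `q`-graded DG algebras are quasi-isomorphic if they are connected by a zigzag of
quasi-isomorphisms of `q`-graded DG algebras. -/
def QuasiIsomorphic : QDGAlgebra → QDGAlgebra → Prop :=
  Relation.EqvGen fun A B => ∃ f : Hom A B, f.IsQuasiIso

variable (A) in
/-- A `q`-graded DG algebra is formal if it is quasi-isomorphic to its cohomology. -/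
def IsFormal : Prop := QuasiIsomorphic A A.cohomology

/-- Two `q`-graded DG algebras are isomorphic if there is a bijective morphism between them
(its inverse is then automatically a morphism). -/
def Isomorphic (A B : QDGAlgebra) : Prop := ∃ f : Hom A B, Function.Bijective f.toAlgHom

end QDGAlgebra

/-! ### Graded algebras by generators and relations -/

section Presentation

variable {X : Type} (rel : FreeAlgebra F X → FreeAlgebra F X → Prop)

/-- The algebra with generators `X` and relations `rel`. -/
abbrev Pres : Type := RingQuot rel

/-- The class of a generator. -/
def gen (x : X) : Pres rel := RingQuot.mkAlgHom F rel (FreeAlgebra.ι F x)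

theorem mkAlgHom_ι (x : X) : RingQuot.mkAlgHom F rel (FreeAlgebra.ι F x) = gen rel x := rfl

variable {G : Type} [AddCommGroup G] (deg : X → G)

/-- The homogeneous elements of degree `g`: the span of the products of generators of total
degree `g`. -/
def gradeOf (g : G) : Submodule F (Pres rel) :=
  Submodule.span F {a | ∃ l : List X, (l.map deg).sum = g ∧ (l.map (gen rel)).prod = a}

/-- The coaction `x ↦ x ⊗ deg x` on the free algebra; the relations are homogeneous if and only
if they are compatible with it. -/
def freeCoaction : FreeAlgebra F X →ₐ[F] AddMonoidAlgebra (Pres rel) G :=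
  FreeAlgebra.lift F fun x => AddMonoidAlgebra.single (deg x) (gen rel x)

theorem freeCoaction_ι (x : X) : freeCoaction rel deg (FreeAlgebra.ι F x) =
    AddMonoidAlgebra.single (deg x) (gen rel x) := by
  simp [freeCoaction]

theorem one_mem_gradeOf : (1 : Pres rel) ∈ gradeOf rel deg 0 :=
  Submodule.subset_span ⟨[], by simp, by simp⟩

theorem gen_mem_gradeOf (x : X) : gen rel x ∈ gradeOf rel deg (deg x) :=
  Submodule.subset_span ⟨[x], by simp, by simp⟩

theorem mul_mem_gradeOf {g h : G} {a b : Pres rel} (ha : a ∈ gradeOf rel deg g)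
    (hb : b ∈ gradeOf rel deg h) : a * b ∈ gradeOf rel deg (g + h) := by
  induction ha using Submodule.span_induction with
  | mem a ha =>
    obtain ⟨l, rfl, rfl⟩ := ha
    induction hb using Submodule.span_induction with
    | mem b hb =>
      obtain ⟨l', rfl, rfl⟩ := hb
      exact Submodule.subset_span ⟨l ++ l', by simp, by simp⟩
    | zero => simp
    | add x y _ _ hx hy => rw [mul_add]; exact add_mem hx hy
    | smul c x _ hx => rw [mul_smul_comm]; exact Submodule.smul_mem _ _ hx
  | zero => simp
  | add x y _ _ hx hy => rw [add_mul]; exact add_mem hx hy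
  | smul c x _ hx => rw [smul_mul_assoc]; exact Submodule.smul_mem _ _ hx

theorem pres_induction {p : Pres rel → Prop} (one : p 1) (gen : ∀ x, p (gen rel x))
    (mul : ∀ a b, p a → p b → p (a * b)) (add : ∀ a b, p a → p b → p (a + b))
    (zero : p 0) (a : Pres rel) : p a := by
  obtain ⟨a, rfl⟩ := RingQuot.mkAlgHom_surjective F rel a
  induction a using FreeAlgebra.induction with
  | grade0 c =>
    obtain rfl | rfl : c = 0 ∨ c = 1 := by revert c; decide
    · simpa using zero
    · simpa using one
  | grade1 x => exact gen x
  | mul a b ha hb => rw [map_mul]; exact mul _ _ ha hb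
  | add a b ha hb => rw [map_add]; exact add _ _ ha hb

theorem isInternal_gradeOf [DecidableEq G]
    (hrel : ∀ ⦃a b⦄, rel a b → freeCoaction rel deg a = freeCoaction rel deg b) :
    DirectSum.IsInternal (gradeOf rel deg) := by
  let ρ : Pres rel →ₐ[F] AddMonoidAlgebra (Pres rel) G :=
    RingQuot.liftAlgHom F ⟨freeCoaction rel deg, hrel⟩
  have hρg : ∀ x, ρ (gen rel x) = AddMonoidAlgebra.single (deg x) (gen rel x) := by
    intro x
    simp only [ρ, gen, RingQuot.liftAlgHom_mkAlgHom_apply]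
    exact freeCoaction_ι rel deg x
  have hρl : ∀ l : List X, ρ (l.map (gen rel)).prod =
      AddMonoidAlgebra.single (l.map deg).sum (l.map (gen rel)).prod := by
    intro l
    induction l with
    | nil => simp [AddMonoidAlgebra.one_def]
    | cons x l ih => simp [ih, hρg, AddMonoidAlgebra.single_mul_single]
  have hρ : ∀ g, ∀ m ∈ gradeOf rel deg g, ρ m = AddMonoidAlgebra.single g m := by
    intro g m hm
    induction hm using Submodule.span_induction with
    | mem a ha =>
      obtain ⟨l, rfl, rfl⟩ := ha
      exact hρl l
    | zero => simp
    | add x y _ _ hx hy => rw [map_add, hx, hy, AddMonoidAlgebra.single_add]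
    | smul c x _ hx => rw [map_smul, hx, AddMonoidAlgebra.smul_single]
  refine isInternal_of_proj _
    (fun h => AddMonoidHom.mk' (fun m => (ρ m).coeff h) (by intros; simp)) ?_ ?_
  · intro g h m hm
    simp only [AddMonoidHom.mk'_apply]
    rw [hρ g m hm]
    simp [Finsupp.single_apply]
  · intro m
    induction m using pres_induction with
    | one => exact AddSubmonoid.subset_closure ⟨0, one_mem_gradeOf rel deg⟩
    | gen x => exact AddSubmonoid.subset_closure ⟨_, gen_mem_gradeOf rel deg x⟩
    | zero => exact zero_mem _
    | add a b ha hb => exact add_mem ha hb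
    | mul a b ha hb =>
      induction ha using AddSubmonoid.closure_induction with
      | mem x hx =>
        obtain ⟨g, hg⟩ := hx
        induction hb using AddSubmonoid.closure_induction with
        | mem y hy =>
          obtain ⟨h, hh⟩ := hy
          exact AddSubmonoid.subset_closure ⟨g + h, mul_mem_gradeOf rel deg hg hh⟩
        | zero => simp
        | add x y _ _ hx hy => rw [mul_add]; exact add_mem hx hy
      | zero => simp
      | add x y _ _ hx hy => rw [add_mul]; exact add_mem hx hy

/-- The `q`-graded algebra with generators `X`, homogeneous relations `rel`, and the generator `x`
in degree `deg x`. -/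
def QAlgebra.ofPresentation (deg : X → ℤ)
    (hrel : ∀ ⦃a b⦄, rel a b → freeCoaction rel deg a = freeCoaction rel deg b) : QAlgebra where
  carrier := Pres rel
  grade := gradeOf rel deg
  isInternal := isInternal_gradeOf rel deg hrel
  one_mem := one_mem_gradeOf rel deg
  mul_mem := mul_mem_gradeOf rel deg

/-- The algebra map `x ↦ x + D x ε` which extends `x ↦ D x` by the Leibniz rule. -/
def freeLeibniz (D : X → Pres rel) : FreeAlgebra F X →ₐ[F] TrivSqZeroExt (Pres rel) (Pres rel) :=
  FreeAlgebra.lift F fun x => TrivSqZeroExt.inl (gen rel x) + TrivSqZeroExt.inr (D x)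

theorem freeLeibniz_ι (D : X → Pres rel) (x : X) : freeLeibniz rel D (FreeAlgebra.ι F x) =
    TrivSqZeroExt.inl (gen rel x) + TrivSqZeroExt.inr (D x) := by
  simp [freeLeibniz]

section

variable (D : X → Pres rel)
  (hD : ∀ ⦃a b⦄, rel a b → freeLeibniz rel D a = freeLeibniz rel D b)

/-- The map `a ↦ a + (d a) ε`. -/
def leibniz : Pres rel →ₐ[F] TrivSqZeroExt (Pres rel) (Pres rel) :=
  RingQuot.liftAlgHom F ⟨freeLeibniz rel D, hD⟩

/-- The derivation `d` of the algebra with generators `X` and relations `rel` which is given by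
`D` on the generators and extended by `d (a b) = d a b + a d b`. -/
def dOf : Pres rel →+ Pres rel :=
  AddMonoidHom.mk' (fun a => (leibniz rel D hD a).snd) (by intros; simp)

theorem leibniz_gen (x : X) : leibniz rel D hD (gen rel x) =
    TrivSqZeroExt.inl (gen rel x) + TrivSqZeroExt.inr (D x) := by
  simp only [leibniz, gen, RingQuot.liftAlgHom_mkAlgHom_apply]
  exact freeLeibniz_ι rel D x

theorem leibniz_fst (a : Pres rel) : (leibniz rel D hD a).fst = a := by
  induction a using pres_induction with
  | one => simp
  | gen x => simp [leibniz_gen]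
  | mul a b ha hb => simp [ha, hb]
  | add a b ha hb => simp [ha, hb]
  | zero => simp

theorem dOf_gen (x : X) : dOf rel D hD (gen rel x) = D x := by
  simp [dOf, leibniz_gen]

theorem dOf_one : dOf rel D hD 1 = 0 := by simp [dOf]

theorem dOf_mul (a b : Pres rel) :
    dOf rel D hD (a * b) = dOf rel D hD a * b + a * dOf rel D hD b := by
  simp [dOf, leibniz_fst, add_comm]

theorem pres_add_self (a : Pres rel) : a + a = 0 := by
  have : (2 : F) • a = 0 := by
    rw [show (2 : F) = 0 from rfl, zero_smul]
  rwa [two_smul] at this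

theorem dOf_dOf (h : ∀ x, dOf rel D hD (D x) = 0) (a : Pres rel) :
    dOf rel D hD (dOf rel D hD a) = 0 := by
  induction a using pres_induction with
  | one => simp [dOf_one]
  | gen x => rw [dOf_gen, h]
  | mul a b ha hb =>
    simp only [dOf_mul, map_add, ha, hb, zero_mul, mul_zero, zero_add, add_zero]
    exact pres_add_self rel _
  | add a b ha hb => simp [ha, hb]
  | zero => simp

theorem dOf_smul (c : F) (a : Pres rel) : dOf rel D hD (c • a) = c • dOf rel D hD a := by
  obtain rfl | rfl : c = 0 ∨ c = 1 := by revert c; decide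
  · simp
  · simp

theorem dOf_mem (u : G) (h : ∀ x, D x ∈ gradeOf rel deg (deg x + u)) {g : G} {a : Pres rel}
    (ha : a ∈ gradeOf rel deg g) : dOf rel D hD a ∈ gradeOf rel deg (g + u) := by
  induction ha using Submodule.span_induction with
  | mem a ha =>
    obtain ⟨l, rfl, rfl⟩ := ha
    induction l with
    | nil => simp [dOf_one]
    | cons x l ih =>
      simp only [List.map_cons, List.prod_cons, List.sum_cons, dOf_mul, dOf_gen]
      refine add_mem ?_ ?_
      · have := mul_mem_gradeOf rel deg (h x)
          (show (l.map (gen rel)).prod ∈ gradeOf rel deg (l.map deg).sum from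
            Submodule.subset_span ⟨l, rfl, rfl⟩)
        rwa [add_right_comm] at this
      · have := mul_mem_gradeOf rel deg (gen_mem_gradeOf rel deg x) ih
        rwa [← add_assoc] at this
  | zero => simp
  | add x y _ _ hx hy => rw [map_add]; exact add_mem hx hy
  | smul c x _ hx => rw [dOf_smul]; exact Submodule.smul_mem _ _ hx

end

/-- The `q`-graded DG algebra with generators `X`, homogeneous relations `rel`, the generator `x`
in bidegree `deg x`, and the differential given by `D` on the generators. -/
def QDGAlgebra.ofPresentation (deg : X → ℤ × ℤ)
    (hrel : ∀ ⦃a b⦄, rel a b → freeCoaction rel deg a = freeCoaction rel deg b)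
    (D : X → Pres rel)
    (hD : ∀ ⦃a b⦄, rel a b → freeLeibniz rel D a = freeLeibniz rel D b)
    (hD_mem : ∀ x, D x ∈ gradeOf rel deg (deg x + (1, 0)))
    (hDD : ∀ x, dOf rel D hD (D x) = 0) : QDGAlgebra where
  carrier := Pres rel
  grade := gradeOf rel deg
  isInternal := isInternal_gradeOf rel deg hrel
  one_mem := one_mem_gradeOf rel deg
  mul_mem := mul_mem_gradeOf rel deg
  d := dOf rel D hD
  d_mem := dOf_mem rel deg D hD (1, 0) hD_mem
  d_d := dOf_dOf rel D hD hDD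
  d_one := dOf_one rel D hD
  d_mul := dOf_mul rel D hD

end Presentation

/-! ### The tensor product of two graded algebras -/

namespace QAlgebra

variable (A B : QAlgebra)

/-- The part of degree `k` of the tensor product: the span of the `a ⊗ b` with `a`, `b`
homogeneous and `deg a + deg b = k`. -/
def gradeTensor (k : ℤ) : Submodule F (A.carrier ⊗[F] B.carrier) :=
  Submodule.span F {t | ∃ i j a b, i + j = k ∧ a ∈ A.grade i ∧ b ∈ B.grade j ∧ a ⊗ₜ[F] b = t}

theorem isInternal_gradeTensor : DirectSum.IsInternal (gradeTensor A B) := by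
  have hco : ∀ C : QAlgebra, ∃ ρ : C.carrier →ₗ[F] (ℤ →₀ C.carrier),
      ∀ i, ∀ c ∈ C.grade i, ρ c = Finsupp.single i c := by
    intro C
    let e := LinearEquiv.ofBijective (DirectSum.coeLinearMap C.grade) C.isInternal
    let s : (DirectSum ℤ fun i => C.grade i) →ₗ[F] (ℤ →₀ C.carrier) :=
      DirectSum.toModule F ℤ _ fun i => (Finsupp.lsingle i).comp (C.grade i).subtype
    refine ⟨s.comp e.symm.toLinearMap, fun i c hc => ?_⟩
    have : e.symm c = DirectSum.lof F ℤ (fun i => C.grade i) i ⟨c, hc⟩ := by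
      rw [LinearEquiv.symm_apply_eq]
      exact (DirectSum.coeLinearMap_lof C.grade i ⟨c, hc⟩).symm
    simp [this, s]
  obtain ⟨ρA, hA⟩ := hco A
  obtain ⟨ρB, hB⟩ := hco B
  let ρ : A.carrier ⊗[F] B.carrier →ₗ[F] (ℤ →₀ A.carrier ⊗[F] B.carrier) :=
    ((Finsupp.lmapDomain _ F fun p : ℤ × ℤ => p.1 + p.2).comp
      (finsuppTensorFinsupp F F A.carrier B.carrier ℤ ℤ).toLinearMap).comp
      (TensorProduct.map ρA ρB)
  have hρ : ∀ g, ∀ m ∈ gradeTensor A B g, ρ m = Finsupp.single g m := by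
    intro g m hm
    induction hm using Submodule.span_induction with
    | mem a ha =>
      obtain ⟨i, j, a, b, rfl, ha, hb, rfl⟩ := ha
      simp [ρ, hA i a ha, hB j b hb, Finsupp.mapDomain_single]
    | zero => simp
    | add x y _ _ hx hy => rw [map_add, hx, hy, Finsupp.single_add]
    | smul c x _ hx => rw [map_smul, hx, Finsupp.smul_single]
  refine isInternal_of_proj _
    (fun h => (Finsupp.applyAddHom h).comp ρ.toAddMonoidHom) ?_ ?_
  · intro g h m hm
    simp only [AddMonoidHom.comp_apply, LinearMap.toAddMonoidHom_coe, Finsupp.applyAddHom_apply]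
    rw [hρ g m hm, Finsupp.single_apply]
  · intro m
    induction m using TensorProduct.induction_on with
    | zero => exact zero_mem _
    | add x y hx hy => exact add_mem hx hy
    | tmul a b =>
      induction a using grade_induction A.isInternal with
      | hom i a ha =>
        induction b using grade_induction B.isInternal with
        | hom j b hb =>
          refine AddSubmonoid.subset_closure ⟨i + j, ?_⟩
          exact Submodule.subset_span ⟨i, j, a, b, rfl, ha, hb, rfl⟩
        | zero => simp
        | add x y hx hy => rw [TensorProduct.tmul_add]; exact add_mem hx hy
      | zero => simp
      | add x y hx hy => rw [TensorProduct.add_tmul]; exact add_mem hx hy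

/-- The tensor product, over the ground field, of two `q`-graded algebras. -/
def tensor : QAlgebra where
  carrier := A.carrier ⊗[F] B.carrier
  grade := gradeTensor A B
  isInternal := isInternal_gradeTensor A B
  one_mem := Submodule.subset_span ⟨0, 0, 1, 1, by simp, A.one_mem, B.one_mem, rfl⟩
  mul_mem := by
    intro p r x y hx hy
    induction hx using Submodule.span_induction with
    | mem a ha =>
      obtain ⟨i, j, a, b, rfl, ha, hb, rfl⟩ := ha
      induction hy using Submodule.span_induction with
      | mem a' ha' =>
        obtain ⟨i', j', a', b', rfl, ha', hb', rfl⟩ := ha'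
        refine Submodule.subset_span ⟨i + i', j + j', a * a', b * b', by ring,
          A.mul_mem ha ha', B.mul_mem hb hb', ?_⟩
        rw [Algebra.TensorProduct.tmul_mul_tmul]
      | zero => simp
      | add x y _ _ hx hy => rw [mul_add]; exact add_mem hx hy
      | smul c x _ hx => rw [mul_smul_comm]; exact Submodule.smul_mem _ _ hx
    | zero => simp
    | add x y _ _ hx hy => rw [add_mul]; exact add_mem hx hy
    | smul c x _ hx => rw [smul_mul_assoc]; exact Submodule.smul_mem _ _ hx

end QAlgebra

/-! ### The quiver `Γ_n` and the algebra `R_n` -/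

/-- The vertices of `Γ_n`: the strictly decreasing sequences with entries in `{0, …, n}`, that is,
the subsets of `{0, …, n}`. -/
abbrev V (n : ℕ) : Type := Finset (Fin (n + 1))

/-- There is an arrow `x → y` with label `s` in `Γ_n` if `y` is the disjoint union of `x` and
`{s, s + 1}`. -/
def IsArrow {n : ℕ} (s : Fin n) (x y : V n) : Prop :=
  s.castSucc ∉ x ∧ s.succ ∉ x ∧ y = insert s.succ (insert s.castSucc x)

/-- The generators of `R_n`. -/
inductive GenR (n : ℕ) : Type
  | e (x : V n)
  | r (s : Fin n) (x y : V n) (h : IsArrow s x y)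

namespace GenR

/-- The degree of the generators of `R_n`. -/
def deg {n : ℕ} : GenR n → ℤ
  | e _ => 0
  | r s _ _ _ => (n : ℤ) - 1 - 2 * (s : ℤ)

/-- The generators as elements of the free algebra. -/
abbrev ι {n : ℕ} (a : GenR n) : FreeAlgebra F (GenR n) := FreeAlgebra.ι F a

/-- The defining relations of `R_n`. -/
inductive Rel (n : ℕ) : FreeAlgebra F (GenR n) → FreeAlgebra F (GenR n) → Prop
  | idem (x : V n) : Rel n (ι (e x) * ι (e x)) (ι (e x))
  | orth (x y : V n) (h : x ≠ y) : Rel n (ι (e x) * ι (e y)) 0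
  | unit : Rel n (∑ x : V n, ι (e x)) 1
  | source (s : Fin n) (x y : V n) (h : IsArrow s x y) :
      Rel n (ι (e x) * ι (r s x y h)) (ι (r s x y h))
  | target (s : Fin n) (x y : V n) (h : IsArrow s x y) :
      Rel n (ι (r s x y h) * ι (e y)) (ι (r s x y h))
  | comm (s t : Fin n) (x y z w : V n) (h₁ : IsArrow s x y) (h₂ : IsArrow t y w)
      (h₃ : IsArrow t x z) (h₄ : IsArrow s z w) :
      Rel n (ι (r s x y h₁) * ι (r t y w h₂)) (ι (r t x z h₃) * ι (r s z w h₄))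

theorem gen_eq {n : ℕ} {a b : FreeAlgebra F (GenR n)} (h : Rel n a b) :
    RingQuot.mkAlgHom F (Rel n) a = RingQuot.mkAlgHom F (Rel n) b :=
  RingQuot.mkAlgHom_rel F h

theorem rel_coaction (n : ℕ) ⦃a b : FreeAlgebra F (GenR n)⦄ (h : Rel n a b) :
    freeCoaction (Rel n) deg a = freeCoaction (Rel n) deg b := by
  have h' := gen_eq h
  cases h with
  | unit =>
    simp only [map_sum, map_one, mkAlgHom_ι] at h'
    simp only [map_sum, freeCoaction_ι, map_one, deg]
    rw [AddMonoidAlgebra.one_def, ← h']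
    exact (map_sum (AddMonoidAlgebra.singleAddHom (R := Pres (Rel n)) (0 : ℤ)) _ _).symm
  | orth x y h =>
    simp only [map_mul, map_zero, mkAlgHom_ι] at h'
    simp only [map_mul, map_zero, freeCoaction_ι, AddMonoidAlgebra.single_mul_single, h',
      AddMonoidAlgebra.single_zero]
  | idem | source | target =>
    simp only [map_mul, mkAlgHom_ι] at h'
    simp only [map_mul, freeCoaction_ι, AddMonoidAlgebra.single_mul_single, h', deg, zero_add,
      add_zero]
  | comm =>
    simp only [map_mul, mkAlgHom_ι] at h'
    simp only [map_mul, freeCoaction_ι, AddMonoidAlgebra.single_mul_single, h', deg]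
    rw [add_comm]

end GenR

/-- The `q`-graded algebra `R_n`. -/
def R (n : ℕ) : QAlgebra := QAlgebra.ofPresentation (GenR.Rel n) GenR.deg (GenR.rel_coaction n)

/-- The idempotent `e(x)` of `R_n`. -/
def R.e {n : ℕ} (x : V n) : (R n).carrier := gen (GenR.Rel n) (GenR.e x)

theorem R.e_mul_e {n : ℕ} (x : V n) : R.e x * R.e x = R.e x :=
  (map_mul _ _ _).symm.trans (GenR.gen_eq (GenR.Rel.idem x))

theorem R.e_mem {n : ℕ} (x : V n) : R.e x ∈ (R n).grade 0 :=
  gen_mem_gradeOf (GenR.Rel n) GenR.deg (GenR.e x)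

/-- The `q`-graded algebra `R_n ⊗ R_n`. -/
def RR (n : ℕ) : QAlgebra := (R n).tensor (R n)

/-- The idempotent `e(x) ⊗ e(y)` of `R_n ⊗ R_n`. -/
def RR.e {n : ℕ} (x y : V n) : (RR n).carrier :=
  (R.e x ⊗ₜ[F] R.e y : (R n).carrier ⊗[F] (R n).carrier)

theorem RR.e_mul_e {n : ℕ} (x y : V n) : RR.e x y * RR.e x y = RR.e x y := by
  refine (Algebra.TensorProduct.tmul_mul_tmul _ _ _ _).trans ?_
  rw [R.e_mul_e, R.e_mul_e]
  rfl

theorem RR.e_mem {n : ℕ} (x y : V n) : RR.e x y ∈ (RR n).grade 0 := by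
  change RR.e x y ∈ QAlgebra.gradeTensor (R n) (R n) 0
  exact Submodule.subset_span ⟨0, 0, _, _, by simp, R.e_mem x, R.e_mem y, rfl⟩

/-! ### The quiver `Γ_n ⊠ Γ_n` and the DG algebra `R_n ⊠ R_n` -/

/-- The generators of `R_n ⊠ R_n`: the vertices of `Γ_n ⊠ Γ_n`, which are the pairs of vertices of
`Γ_n`, and its three kinds of arrows, with labels `(s, ∅)`, `(∅, s)` and `(s, s + 1)`. -/
inductive GenB (n : ℕ) : Type
  | e (x y : V n)
  | l (s : Fin n) (x x' y : V n) (h : IsArrow s x x')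
  | r (s : Fin n) (x y y' : V n) (h : IsArrow s y y')
  | c (s t : Fin n) (hst : (t : ℕ) = s + 1) (x x' y y' : V n) (h : IsArrow s x x')
      (h' : IsArrow t y y')

namespace GenB

/-- The cohomological degree and the `q`-degree of the generators of `R_n ⊠ R_n`. -/
def deg {n : ℕ} : GenB n → ℤ × ℤ
  | e _ _ => (0, 0)
  | l s _ _ _ _ => (0, (n : ℤ) - 1 - 2 * (s : ℤ))
  | r s _ _ _ _ => (0, (n : ℤ) - 1 - 2 * (s : ℤ))
  | c s t _ _ _ _ _ _ _ => (-1, ((n : ℤ) - 1 - 2 * (s : ℤ)) + ((n : ℤ) - 1 - 2 * (t : ℤ)))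

/-- The generators as elements of the free algebra. -/
abbrev ι {n : ℕ} (a : GenB n) : FreeAlgebra F (GenB n) := FreeAlgebra.ι F a

/-- The defining relations of `R_n ⊠ R_n`. -/
inductive Rel (n : ℕ) : FreeAlgebra F (GenB n) → FreeAlgebra F (GenB n) → Prop
  | idem (x y : V n) : Rel n (ι (e x y) * ι (e x y)) (ι (e x y))
  | orth (x y x' y' : V n) (h : (x, y) ≠ (x', y')) : Rel n (ι (e x y) * ι (e x' y')) 0
  | unit : Rel n (∑ p : V n × V n, ι (e p.1 p.2)) 1
  | source_l (s : Fin n) (x x' y : V n) (h : IsArrow s x x') :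
      Rel n (ι (e x y) * ι (l s x x' y h)) (ι (l s x x' y h))
  | target_l (s : Fin n) (x x' y : V n) (h : IsArrow s x x') :
      Rel n (ι (l s x x' y h) * ι (e x' y)) (ι (l s x x' y h))
  | source_r (s : Fin n) (x y y' : V n) (h : IsArrow s y y') :
      Rel n (ι (e x y) * ι (r s x y y' h)) (ι (r s x y y' h))
  | target_r (s : Fin n) (x y y' : V n) (h : IsArrow s y y') :
      Rel n (ι (r s x y y' h) * ι (e x y')) (ι (r s x y y' h))
  | source_c (s t : Fin n) (hst : (t : ℕ) = s + 1) (x x' y y' : V n) (h : IsArrow s x x')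
      (h' : IsArrow t y y') :
      Rel n (ι (e x y) * ι (c s t hst x x' y y' h h')) (ι (c s t hst x x' y y' h h'))
  | target_c (s t : Fin n) (hst : (t : ℕ) = s + 1) (x x' y y' : V n) (h : IsArrow s x x')
      (h' : IsArrow t y y') :
      Rel n (ι (c s t hst x x' y y' h h') * ι (e x' y')) (ι (c s t hst x x' y y' h h'))
  | r_r (s t : Fin n) (x y y' y'' y''' : V n) (h₁ : IsArrow s y y') (h₂ : IsArrow t y' y''')
      (h₃ : IsArrow t y y'') (h₄ : IsArrow s y'' y''') :
      Rel n (ι (r s x y y' h₁) * ι (r t x y' y''' h₂))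
        (ι (r t x y y'' h₃) * ι (r s x y'' y''' h₄))
  | l_l (s t : Fin n) (x x' x'' x''' y : V n) (h₁ : IsArrow s x x') (h₂ : IsArrow t x' x''')
      (h₃ : IsArrow t x x'') (h₄ : IsArrow s x'' x''') :
      Rel n (ι (l s x x' y h₁) * ι (l t x' x''' y h₂))
        (ι (l t x x'' y h₃) * ι (l s x'' x''' y h₄))
  | l_r (s t : Fin n) (hst : (t : ℕ) ≠ s + 1) (x x' y y' : V n) (h₁ : IsArrow s x x')
      (h₂ : IsArrow t y y') :
      Rel n (ι (l s x x' y h₁) * ι (r t x' y y' h₂))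
        (ι (r t x y y' h₂) * ι (l s x x' y' h₁))
  | c_r (s s' t : Fin n) (hs : (s' : ℕ) = s + 1) (x x' y y' y'' y''' : V n)
      (h : IsArrow s x x') (h₁ : IsArrow s' y y') (h₂ : IsArrow t y' y''')
      (h₃ : IsArrow t y y'') (h₄ : IsArrow s' y'' y''') :
      Rel n (ι (c s s' hs x x' y y' h h₁) * ι (r t x' y' y''' h₂))
        (ι (r t x y y'' h₃) * ι (c s s' hs x x' y'' y''' h h₄))
  | c_l (s s' t : Fin n) (hs : (s' : ℕ) = s + 1) (x x' x'' x''' y y' : V n)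
      (h₁ : IsArrow s x x') (h : IsArrow s' y y') (h₂ : IsArrow t x' x''')
      (h₃ : IsArrow t x x'') (h₄ : IsArrow s x'' x''') :
      Rel n (ι (c s s' hs x x' y y' h₁ h) * ι (l t x' x''' y' h₂))
        (ι (l t x x'' y h₃) * ι (c s s' hs x'' x''' y y' h₄ h))
  | c_c (s s' t t' : Fin n) (hs : (s' : ℕ) = s + 1) (ht : (t' : ℕ) = t + 1)
      (x x' x'' x''' y y' y'' y''' : V n)
      (h₁ : IsArrow s x x') (k₁ : IsArrow s' y y')
      (h₂ : IsArrow t x' x''') (k₂ : IsArrow t' y' y''')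
      (h₃ : IsArrow t x x'') (k₃ : IsArrow t' y y'')
      (h₄ : IsArrow s x'' x''') (k₄ : IsArrow s' y'' y''') :
      Rel n (ι (c s s' hs x x' y y' h₁ k₁) * ι (c t t' ht x' x''' y' y''' h₂ k₂))
        (ι (c t t' ht x x'' y y'' h₃ k₃) * ι (c s s' hs x'' x''' y'' y''' h₄ k₄))

/-- The differential on the generators. -/
def D {n : ℕ} : GenB n → Pres (Rel n)
  | e _ _ => 0
  | l _ _ _ _ _ => 0
  | r _ _ _ _ _ => 0
  | c s t _ x x' y y' h h' =>
      gen (Rel n) (l s x x' y h) * gen (Rel n) (r t x' y y' h') +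
        gen (Rel n) (r t x y y' h') * gen (Rel n) (l s x x' y' h)

theorem gen_eq {n : ℕ} {a b : FreeAlgebra F (GenB n)} (h : Rel n a b) :
    RingQuot.mkAlgHom F (Rel n) a = RingQuot.mkAlgHom F (Rel n) b :=
  RingQuot.mkAlgHom_rel F h

theorem rel_coaction (n : ℕ) ⦃a b : FreeAlgebra F (GenB n)⦄ (h : Rel n a b) :
    freeCoaction (Rel n) deg a = freeCoaction (Rel n) deg b := by
  have h' := gen_eq h
  cases h with
  | unit =>
    simp only [map_sum, map_one, mkAlgHom_ι] at h'
    simp only [map_sum, freeCoaction_ι, map_one, deg]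
    rw [AddMonoidAlgebra.one_def, ← h']
    exact (map_sum (AddMonoidAlgebra.singleAddHom (R := Pres (Rel n)) (0 : ℤ × ℤ)) _ _).symm
  | orth x y h =>
    simp only [map_mul, map_zero, mkAlgHom_ι] at h'
    simp only [map_mul, map_zero, freeCoaction_ι, AddMonoidAlgebra.single_mul_single, h',
      AddMonoidAlgebra.single_zero]
  | idem | source_l | target_l | source_r | target_r | source_c | target_c =>
    simp only [map_mul, mkAlgHom_ι] at h'
    simp only [map_mul, freeCoaction_ι, AddMonoidAlgebra.single_mul_single, h', deg, zero_add,
      add_zero, Prod.mk_zero_zero]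
  | r_r | l_l | l_r | c_r | c_l | c_c =>
    simp only [map_mul, mkAlgHom_ι] at h'
    simp only [map_mul, freeCoaction_ι, AddMonoidAlgebra.single_mul_single, h', deg]
    rw [add_comm]

theorem arrow_ne {n : ℕ} {s t : Fin n} {x x' x'' : V n} (h : IsArrow s x x')
    (h' : IsArrow t x' x'') : t ≠ s := by
  rintro rfl
  obtain ⟨-, -, rfl⟩ := h
  exact h'.1 (by simp)

theorem rel_leibniz (n : ℕ) ⦃a b : FreeAlgebra F (GenB n)⦄ (h : Rel n a b) :
    freeLeibniz (Rel n) D a = freeLeibniz (Rel n) D b := by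
  have h' := gen_eq h
  have two := pres_add_self (Rel n)
  ext
  · have hfst : ∀ a, (freeLeibniz (Rel n) D a).fst = RingQuot.mkAlgHom F (Rel n) a := by
      intro a
      induction a using FreeAlgebra.induction with
      | grade0 c => rw [AlgHom.commutes, AlgHom.commutes]; rfl
      | grade1 x => simp [freeLeibniz_ι, mkAlgHom_ι]
      | mul a b ha hb => simp [ha, hb]
      | add a b ha hb => simp [ha, hb]
    rw [hfst, hfst, h']
  cases h with
  | unit => simp [freeLeibniz_ι, D, TrivSqZeroExt.snd_sum]
  | idem | orth => simp [freeLeibniz_ι, D]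
  | source_l | target_l | source_r | target_r => simp [freeLeibniz_ι, D]
  | source_c s t hst x x' y y' h k =>
    have e1 := gen_eq (Rel.source_l s x x' y h)
    have e2 := gen_eq (Rel.source_r t x y y' k)
    simp only [map_mul, mkAlgHom_ι] at e1 e2
    simp [freeLeibniz_ι, D, mul_add, ← mul_assoc, e1, e2]
  | target_c s t hst x x' y y' h k =>
    have e1 := gen_eq (Rel.target_r t x' y y' k)
    have e2 := gen_eq (Rel.target_l s x x' y' h)
    simp only [map_mul, mkAlgHom_ι] at e1 e2
    simp [freeLeibniz_ι, D, add_mul, mul_assoc, e1, e2]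
  | r_r | l_l | l_r => simp [freeLeibniz_ι, D]
  | c_r s s' t hs x x' y y' y'' y''' h h₁ h₂ h₃ h₄ =>
    have hne : (t : ℕ) ≠ s + 1 := by
      rw [← hs]; exact fun e => arrow_ne h₁ h₂ (Fin.ext e)
    have e1 := gen_eq (Rel.r_r s' t x' y y' y'' y''' h₁ h₂ h₃ h₄)
    have e2 := gen_eq (Rel.l_r s t hne x x' y y'' h h₃)
    have e3 := gen_eq (Rel.l_r s t hne x x' y' y''' h h₂)
    have e4 := gen_eq (Rel.r_r s' t x y y' y'' y''' h₁ h₂ h₃ h₄)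
    simp only [map_mul, mkAlgHom_ι] at e1 e2 e3 e4
    simp only [map_mul, freeLeibniz_ι, TrivSqZeroExt.snd_mul,
      TrivSqZeroExt.fst_inl, TrivSqZeroExt.fst_inr, TrivSqZeroExt.snd_add, TrivSqZeroExt.snd_inl,
      TrivSqZeroExt.snd_inr, D, smul_eq_mul, op_smul_eq_mul, zero_add, add_zero, mul_zero,
      zero_mul, mul_add, add_mul]
    simp only [mul_assoc, e1, e3]
    simp only [← mul_assoc, e2, e4]
  | c_l s s' t hs x x' x'' x''' y y' h₁ h h₂ h₃ h₄ =>
    have hne : (s' : ℕ) ≠ t + 1 := by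
      rw [hs]; exact fun e => arrow_ne h₁ h₂ (Fin.ext (by omega))
    have e1 := gen_eq (Rel.l_r t s' hne x' x''' y y' h₂ h)
    have e2 := gen_eq (Rel.l_l s t x x' x'' x''' y h₁ h₂ h₃ h₄)
    have e3 := gen_eq (Rel.l_l s t x x' x'' x''' y' h₁ h₂ h₃ h₄)
    have e4 := gen_eq (Rel.l_r t s' hne x x'' y y' h₃ h)
    simp only [map_mul, mkAlgHom_ι] at e1 e2 e3 e4
    simp only [map_mul, freeLeibniz_ι, TrivSqZeroExt.snd_mul,
      TrivSqZeroExt.fst_inl, TrivSqZeroExt.fst_inr, TrivSqZeroExt.snd_add, TrivSqZeroExt.snd_inl,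
      TrivSqZeroExt.snd_inr, D, smul_eq_mul, op_smul_eq_mul, zero_add, add_zero, mul_zero,
      zero_mul, mul_add, add_mul]
    simp only [mul_assoc, ← e1, e3]
    simp only [← mul_assoc, e2, e4]
  | c_c s s' t t' hs ht x x' x'' x''' y y' y'' y''' h₁ k₁ h₂ k₂ h₃ k₃ h₄ k₄ =>
    have a1 := gen_eq (Rel.c_r t t' s' ht x' x''' y y'' y' y''' h₂ k₃ k₄ k₁ k₂)
    have a2 := gen_eq (Rel.c_l t t' s ht x x'' x' x''' y y'' h₃ k₃ h₄ h₁ h₂)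
    have a3 := gen_eq (Rel.c_l t t' s ht x x'' x' x''' y' y''' h₃ k₂ h₄ h₁ h₂)
    have a4 := gen_eq (Rel.c_r t t' s' ht x x'' y y'' y' y''' h₃ k₃ k₄ k₁ k₂)
    have b1 := gen_eq (Rel.c_l s s' t hs x x' x'' x''' y y' h₁ k₁ h₂ h₃ h₄)
    have b2 := gen_eq (Rel.c_r s s' t' hs x'' x''' y y' y'' y''' h₄ k₁ k₂ k₃ k₄)
    have b3 := gen_eq (Rel.c_r s s' t' hs x x' y y' y'' y''' h₁ k₁ k₂ k₃ k₄)
    have b4 := gen_eq (Rel.c_l s s' t hs x x' x'' x''' y'' y''' h₁ k₄ h₂ h₃ h₄)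
    simp only [map_mul, mkAlgHom_ι] at a1 a2 a3 a4 b1 b2 b3 b4
    simp only [map_mul, freeLeibniz_ι, TrivSqZeroExt.snd_mul,
      TrivSqZeroExt.fst_inl, TrivSqZeroExt.fst_inr, TrivSqZeroExt.snd_add, TrivSqZeroExt.snd_inl,
      TrivSqZeroExt.snd_inr, D, smul_eq_mul, op_smul_eq_mul, mul_add, add_mul]
    have T1 : ∀ {p q r p' q' r' m : Pres (Rel n)}, p * q = q' * m → m * r = r' * p' →
        p * (q * r) = q' * r' * p' := by
      intro p q r p' q' r' m hm hm'
      rw [← mul_assoc, hm, mul_assoc, hm', mul_assoc]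
    rw [T1 b1 b2, T1 b3 b4, ← T1 a2 a1, ← T1 a4 a3]
    simp only [mul_zero, zero_mul, zero_add, add_zero]
    abel

theorem D_mem {n : ℕ} (a : GenB n) : D a ∈ gradeOf (Rel n) deg (deg a + (1, 0)) := by
  cases a with
  | e | l | r => exact zero_mem _
  | c s t hst x x' y y' h h' =>
    refine add_mem ?_ ?_
    · have := mul_mem_gradeOf (Rel n) deg (gen_mem_gradeOf (Rel n) deg (l s x x' y h))
        (gen_mem_gradeOf (Rel n) deg (r t x' y y' h'))
      simpa [deg] using this
    · have := mul_mem_gradeOf (Rel n) deg (gen_mem_gradeOf (Rel n) deg (r t x y y' h'))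
        (gen_mem_gradeOf (Rel n) deg (l s x x' y' h))
      rw [add_comm] at this
      simpa [deg] using this

theorem d_D {n : ℕ} (a : GenB n) : dOf (Rel n) D (rel_leibniz n) (D a) = 0 := by
  cases a with
  | e | l | r => simp [D]
  | c => simp only [D, map_add, dOf_mul, dOf_gen]; simp

end GenB

/-- The `q`-graded DG algebra `R_n ⊠ R_n`. -/
def RB (n : ℕ) : QDGAlgebra :=
  QDGAlgebra.ofPresentation (GenB.Rel n) GenB.deg (GenB.rel_coaction n) GenB.D
    (GenB.rel_leibniz n) GenB.D_mem GenB.d_D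

/-- The idempotent `e(x, y)` of `R_n ⊠ R_n`. -/
def RB.e {n : ℕ} (x y : V n) : (RB n).carrier := gen (GenB.Rel n) (GenB.e x y)

theorem RB.e_mul_e {n : ℕ} (x y : V n) : RB.e x y * RB.e x y = RB.e x y :=
  (map_mul _ _ _).symm.trans (GenB.gen_eq (GenB.Rel.idem x y))

theorem RB.e_mem {n : ℕ} (x y : V n) : RB.e x y ∈ (RB n).grade 0 :=
  gen_mem_gradeOf (GenB.Rel n) GenB.deg (GenB.e x y)

theorem RB.d_e {n : ℕ} (x y : V n) : (RB n).d (RB.e x y) = 0 :=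
  dOf_gen (GenB.Rel n) GenB.D (GenB.rel_leibniz n) (GenB.e x y)

/-! ### Gradings on submodules, products, and shifted gradings -/

section

variable {G : Type} [DecidableEq G]

theorem isInternal_shift [AddCommGroup G] {M : Type} [AddCommGroup M] {ℳ : G → AddSubgroup M}
    (h : DirectSum.IsInternal ℳ) (u : G) : DirectSum.IsInternal fun g => ℳ (g + u) := by
  obtain ⟨π, -, hπ⟩ := exists_proj h
  refine isInternal_of_proj _ (fun g => π (g + u)) ?_ ?_
  · intro g k m hm
    rw [hπ _ _ _ hm]
    simp only [add_left_inj]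
  · intro m
    refine AddSubmonoid.closure_mono ?_ (mem_closure_grade h m)
    rintro x ⟨g, hg⟩
    exact ⟨g - u, by simpa using hg⟩

theorem isInternal_prod {M N : Type} [AddCommGroup M] [AddCommGroup N] {ℳ : G → AddSubgroup M}
    {𝒩 : G → AddSubgroup N} (hM : DirectSum.IsInternal ℳ) (hN : DirectSum.IsInternal 𝒩) :
    DirectSum.IsInternal fun g => (ℳ g).prod (𝒩 g) := by
  obtain ⟨π, -, hπ⟩ := exists_proj hM
  obtain ⟨ρ, -, hρ⟩ := exists_proj hN
  refine isInternal_of_proj _ (fun g => (π g).prodMap (ρ g)) ?_ ?_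
  · rintro g k ⟨m, n⟩ ⟨hm, hn⟩
    change (π k m, ρ k n) = _
    rw [hπ _ _ _ hm, hρ _ _ _ hn]
    split_ifs <;> rfl
  · rintro ⟨m, n⟩
    have : (m, n) = (m, 0) + (0, n) := by simp
    rw [this]
    refine add_mem ?_ ?_
    · induction m using grade_induction hM with
      | hom g m hm => exact AddSubmonoid.subset_closure ⟨g, hm, zero_mem _⟩
      | zero => exact zero_mem _
      | add x y hx hy => simpa using add_mem (hx (by simp)) (hy (by simp))
    · induction n using grade_induction hN with
      | hom g n hn => exact AddSubmonoid.subset_closure ⟨g, zero_mem _, hn⟩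
      | zero => exact zero_mem _
      | add x y hx hy => simpa using add_mem (hx (by simp)) (hy (by simp))

theorem isInternal_punit : DirectSum.IsInternal fun _ : G => (⊤ : AddSubgroup PUnit.{1}) :=
  isInternal_of_proj _ (fun _ => 0) (fun _ _ _ _ => rfl) (fun m => by
    rw [Subsingleton.elim m 0]; exact zero_mem _)

/-- The grading on the left ideal `A e` induced by a grading on `A`. -/
def gradeIdem {A : Type} [Ring A] [Algebra F A] (𝒜 : G → Submodule F A) (e : A) (g : G) :
    AddSubgroup (Ideal.span {e} : Ideal A) :=
  (𝒜 g).toAddSubgroup.comap (Submodule.subtype (Ideal.span {e} : Ideal A)).toAddMonoidHom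

theorem isInternal_gradeIdem {A : Type} [Ring A] [Algebra F A] {𝒜 : G → Submodule F A}
    (h : DirectSum.IsInternal 𝒜) {e : A} (he : ∀ g, ∀ a ∈ 𝒜 g, a * e ∈ 𝒜 g) :
    DirectSum.IsInternal (gradeIdem 𝒜 e) := by
  obtain ⟨π, -, hπ⟩ := exists_proj h
  have hπe : ∀ g a, π g (a * e) = π g a * e := by
    intro g a
    induction a using grade_induction h with
    | hom k m hm =>
      rw [hπ _ _ _ hm, hπ _ _ _ (he _ _ hm)]
      split_ifs <;> simp
    | zero => simp
    | add x y hx hy => simp [add_mul, hx, hy]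
  have hπ' : ∀ g, ∀ m : (Ideal.span {e} : Ideal A), π g m ∈ (Ideal.span {e} : Ideal A) := by
    rintro g ⟨m, hm⟩
    obtain ⟨a, rfl⟩ := Ideal.mem_span_singleton'.1 hm
    exact Ideal.mem_span_singleton'.2 ⟨π g a, (hπe g a).symm⟩
  refine isInternal_of_proj _ (fun g => AddMonoidHom.mk' (fun m => ⟨π g m, hπ' g m⟩) ?_) ?_ ?_
  · intro a b
    ext
    simp
  · intro g k m hm
    ext
    simp only [AddMonoidHom.mk'_apply]
    rw [hπ g k m hm]
    split_ifs <;> rfl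
  · rintro ⟨m, hm⟩
    obtain ⟨a, rfl⟩ := Ideal.mem_span_singleton'.1 hm
    induction a using grade_induction h with
    | hom g a ha => exact AddSubmonoid.subset_closure ⟨g, he g a ha⟩
    | zero =>
      have : (⟨0 * e, hm⟩ : (Ideal.span {e} : Ideal A)) = 0 := by ext; simp
      rw [this]; exact zero_mem _
    | add x y hx hy =>
      have hx' := hx (Ideal.mem_span_singleton'.2 ⟨x, rfl⟩)
      have hy' := hy (Ideal.mem_span_singleton'.2 ⟨y, rfl⟩)
      have : (⟨(x + y) * e, hm⟩ : (Ideal.span {e} : Ideal A)) =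
          ⟨x * e, Ideal.mem_span_singleton'.2 ⟨x, rfl⟩⟩ +
            ⟨y * e, Ideal.mem_span_singleton'.2 ⟨y, rfl⟩⟩ := by
        ext; simp [add_mul]
      rw [this]; exact add_mem hx' hy'

end

/-! ### DG modules -/

/-- A left `q`-graded DG module over a `q`-graded DG algebra. -/
structure DGMod (A : QDGAlgebra) where
  carrier : Type
  [addCommGroup : AddCommGroup carrier]
  [module : Module A.carrier carrier]
  grade : ℤ × ℤ → AddSubgroup carrier
  isInternal : DirectSum.IsInternal grade
  smul_mem : ∀ {p r : ℤ × ℤ} {a : A.carrier} {m : carrier},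
    a ∈ A.grade p → m ∈ grade r → a • m ∈ grade (p + r)
  d : carrier →+ carrier
  d_mem : ∀ {p : ℤ × ℤ} {m : carrier}, m ∈ grade p → d m ∈ grade (p + (1, 0))
  d_d : ∀ m, d (d m) = 0
  d_smul : ∀ (a : A.carrier) (m : carrier), d (a • m) = A.d a • m + a • d m

attribute [instance] DGMod.addCommGroup DGMod.module

namespace DGMod

variable {A : QDGAlgebra}

theorem char_two (M : DGMod A) (m : M.carrier) : m + m = 0 := by
  have : ((1 : A.carrier) + 1) • m = 0 := by rw [A.char_two, zero_smul]
  rwa [add_smul, one_smul] at this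

/-- The space of left `A`-module maps of degree `(i, 0)`. -/
def homDeg (M N : DGMod A) (i : ℤ) : AddSubgroup (M.carrier →ₗ[A.carrier] N.carrier) where
  carrier := {f | ∀ p, ∀ m ∈ M.grade p, f m ∈ N.grade (p + (i, 0))}
  add_mem' hf hg p m hm := add_mem (hf p m hm) (hg p m hm)
  zero_mem' _ _ _ := zero_mem _
  neg_mem' hf p m hm := neg_mem (hf p m hm)

/-- The differential `d f = d ∘ f + f ∘ d` on the space of left `A`-module maps. -/
def dHom (M N : DGMod A) :
    (M.carrier →ₗ[A.carrier] N.carrier) →+ (M.carrier →ₗ[A.carrier] N.carrier) where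
  toFun f :=
    { toFun := fun m => N.d (f m) + f (M.d m)
      map_add' := by intro x y; simp only [map_add]; abel
      map_smul' := by
        intro a m
        simp only [map_smul, M.d_smul, N.d_smul, map_add, RingHom.id_apply, smul_add]
        have := N.char_two (A.d a • f m)
        calc A.d a • f m + a • N.d (f m) + (A.d a • f m + a • f (M.d m))
            = (A.d a • f m + A.d a • f m) + (a • N.d (f m) + a • f (M.d m)) := by abel
          _ = _ := by rw [this, zero_add] }
  map_zero' := by ext; simp
  map_add' f g := by
    ext m
    simp only [LinearMap.add_apply, map_add, LinearMap.coe_mk, AddHom.coe_mk]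
    abel

theorem dHom_apply {M N : DGMod A} (f : M.carrier →ₗ[A.carrier] N.carrier) (m : M.carrier) :
    dHom M N f m = N.d (f m) + f (M.d m) := rfl

/-- The closed morphisms of degree `i`. -/
def closed (M N : DGMod A) (i : ℤ) : AddSubgroup (M.carrier →ₗ[A.carrier] N.carrier) :=
  homDeg M N i ⊓ (dHom M N).ker

/-- The exact morphisms of degree `i`. -/
def exact (M N : DGMod A) (i : ℤ) : AddSubgroup (M.carrier →ₗ[A.carrier] N.carrier) :=
  (homDeg M N (i - 1)).map (dHom M N)

theorem closed_comm {M N : DGMod A} {i : ℤ} (f : closed M N i) (m : M.carrier) :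
    N.d (f.1 m) = f.1 (M.d m) := by
  have h := LinearMap.congr_fun (AddMonoidHom.mem_ker.1 f.2.2) m
  rw [dHom_apply, LinearMap.zero_apply] at h
  have h2 := N.char_two (f.1 (M.d m))
  exact add_right_cancel (h.trans h2.symm)

theorem closed_mem {M N : DGMod A} (f : closed M N 0) {p : ℤ × ℤ} {m : M.carrier}
    (hm : m ∈ M.grade p) : f.1 m ∈ N.grade p := by
  have := f.2.1 p m hm
  rwa [show p + ((0 : ℤ), (0 : ℤ)) = p from add_zero p] at this

theorem mem_closed {M N : DGMod A} {f : M.carrier →ₗ[A.carrier] N.carrier}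
    (h : ∀ p, ∀ m ∈ M.grade p, f m ∈ N.grade p) (h' : ∀ m, N.d (f m) = f (M.d m)) :
    f ∈ closed M N 0 := by
  refine ⟨fun p m hm => ?_, AddMonoidHom.mem_ker.2 ?_⟩
  · rw [show p + ((0 : ℤ), (0 : ℤ)) = p from add_zero p]
    exact h p m hm
  ext m
  rw [dHom_apply, h', N.char_two, LinearMap.zero_apply]

/-- The category `Z^0(DG(A))`: its objects are the DG modules, its morphisms are the closed
morphisms of degree `0`. -/
instance : Category (DGMod A) where
  Hom M N := closed M N 0
  id M := ⟨LinearMap.id, mem_closed (fun _ _ h => h) (fun _ => rfl)⟩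
  comp f g := ⟨g.1.comp f.1, mem_closed (fun _ _ h => closed_mem g (closed_mem f h))
    (fun m => by
      rw [LinearMap.comp_apply, LinearMap.comp_apply, closed_comm g, closed_comm f])⟩

theorem hom_ext {M N : DGMod A} {f g : M ⟶ N} (h : ∀ m, f.1 m = g.1 m) : f = g :=
  Subtype.ext (LinearMap.ext h)

@[simp] theorem id_apply (M : DGMod A) (m : M.carrier) : (𝟙 M : M ⟶ M).1 m = m := rfl

@[simp] theorem comp_apply {M N K : DGMod A} (f : M ⟶ N) (g : N ⟶ K) (m : M.carrier) :
    (f ≫ g).1 m = g.1 (f.1 m) := rfl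

/-- Two closed morphisms of degree `0` are homotopic if their difference is exact. -/
def homotopic : HomRel (DGMod A) := fun M N f g => f.1 - g.1 ∈ exact M N 0

instance : Congruence (homotopic (A := A)) where
  equivalence := fun {M N} =>
    { refl := fun f => by
        change f.1 - f.1 ∈ _
        rw [sub_self]; exact zero_mem _
      symm := fun {f g} h => by
        change g.1 - f.1 ∈ _
        rw [← neg_sub]; exact neg_mem h
      trans := fun {f g k} h h' => by
        change f.1 - k.1 ∈ _
        rw [← sub_add_sub_cancel f.1 g.1 k.1]; exact add_mem h h' }
  comp_left := by
    rintro M N K f g g' ⟨h, hh, e⟩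
    refine ⟨h.comp f.1, fun p m hm => hh p _ (closed_mem f hm), ?_⟩
    ext m
    have := LinearMap.congr_fun e (f.1 m)
    rw [dHom_apply] at this ⊢
    rw [LinearMap.comp_apply, LinearMap.comp_apply, ← closed_comm f]
    exact this
  comp_right := by
    rintro M N K f f' g ⟨h, hh, e⟩
    refine ⟨g.1.comp h, fun p m hm => closed_mem g (hh p _ hm), ?_⟩
    ext m
    have := congrArg g.1 (LinearMap.congr_fun e m)
    rw [dHom_apply, map_add] at this
    rw [dHom_apply, LinearMap.comp_apply, LinearMap.comp_apply, closed_comm g, this]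
    simp

/-- The DG module `M` with the bidegrees shifted by `u`, i.e. its part of bidegree `p` is the part
of bidegree `p + u` of `M`. -/
def regrade (u : ℤ × ℤ) (M : DGMod A) : DGMod A where
  carrier := M.carrier
  grade p := M.grade (p + u)
  isInternal := isInternal_shift M.isInternal u
  smul_mem := by
    intro p r a m ha hm
    rw [add_assoc]
    exact M.smul_mem ha hm
  d := M.d
  d_mem := by
    intro p m hm
    rw [add_right_comm]
    exact M.d_mem hm
  d_d := M.d_d
  d_smul := M.d_smul

/-- The functor shifting the bidegrees by `u`. -/
def regradeFunctor (u : ℤ × ℤ) : DGMod A ⥤ DGMod A where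
  obj M := M.regrade u
  map f := ⟨f.1, mem_closed (fun _ _ h => closed_mem f h) (closed_comm f)⟩

theorem homotopic_regrade (u : ℤ × ℤ) {M N : DGMod A} {f g : M ⟶ N} (h : homotopic f g) :
    homotopic ((regradeFunctor u).map f) ((regradeFunctor u).map g) := by
  obtain ⟨k, hk, e⟩ := h
  refine ⟨k, fun p m hm => ?_, e⟩
  change k m ∈ N.grade (p + _ + u)
  rw [add_right_comm]
  exact hk _ m hm

/-- The identity map as an isomorphism between two DG modules which only differ by the names of
their bidegrees. -/
def regradeIso (M : DGMod A) {u v : ℤ × ℤ} (h : u = v) : M.regrade u ≅ M.regrade v where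
  hom := ⟨LinearMap.id, mem_closed (by subst h; exact fun _ _ h => h) (fun _ => rfl)⟩
  inv := ⟨LinearMap.id, mem_closed (by subst h; exact fun _ _ h => h) (fun _ => rfl)⟩

theorem eqToHom_regrade (M : DGMod A) {u v : ℤ × ℤ} (h : u = v)
    (h' : M.regrade u = M.regrade v) (m : M.carrier) : (eqToHom h' : M.regrade u ⟶ M.regrade v).1 m = m := by
  subst h
  rfl

/-- The shift functors `[n]`, with `(M[n])^{i,j} = M^{i+n,j}`. -/
def shiftMkCore (A : QDGAlgebra) : ShiftMkCore (DGMod A) ℤ where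
  F n := regradeFunctor (n, 0)
  zero := NatIso.ofComponents (fun M =>
    { hom := ⟨LinearMap.id, mem_closed (fun p m h => by
        change m ∈ M.grade (p + 0) at h
        rwa [add_zero] at h) (fun _ => rfl)⟩
      inv := ⟨LinearMap.id, mem_closed (fun p m h => by
        change m ∈ M.grade (p + 0)
        rwa [add_zero]) (fun _ => rfl)⟩ })
  add n m := NatIso.ofComponents (fun M =>
    { hom := ⟨LinearMap.id, mem_closed (fun p x h => by
        change x ∈ M.grade (p + (n + m, 0)) at h
        change x ∈ M.grade (p + (m, 0) + (n, 0))
        have e : p + (m, 0) + (n, 0) = p + (n + m, 0) := by ext <;> simp; ring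
        rwa [e]) (fun _ => rfl)⟩
      inv := ⟨LinearMap.id, mem_closed (fun p x h => by
        change x ∈ M.grade (p + (m, 0) + (n, 0)) at h
        change x ∈ M.grade (p + (n + m, 0))
        have e : p + (m, 0) + (n, 0) = p + (n + m, 0) := by ext <;> simp; ring
        rwa [e] at h) (fun _ => rfl)⟩ })
  assoc_hom_app m₁ m₂ m₃ M := by
    refine hom_ext fun m => ?_
    exact (eqToHom_regrade M (u := (m₁ + m₂ + m₃, 0)) (v := (m₁ + (m₂ + m₃), 0))
      (by rw [add_assoc]) _ m).symm
  zero_add_hom_app n M := by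
    refine hom_ext fun m => ?_
    exact (eqToHom_regrade M (u := (0 + n, 0)) (v := (n, 0)) (by rw [zero_add]) _ m).symm
  add_zero_hom_app n M := by
    refine hom_ext fun m => ?_
    exact (eqToHom_regrade M (u := (n + 0, 0)) (v := (n, 0)) (by rw [add_zero]) _ m).symm

instance : HasShift (DGMod A) ℤ := hasShiftMk (DGMod A) ℤ (shiftMkCore A)

theorem shift_obj (M : DGMod A) (n : ℤ) : M⟦n⟧ = M.regrade (n, 0) := rfl

/-- The shift functors `{k}`, with `(M{k})^{i,j} = M^{i,j+k}`. -/
abbrev qShift (k : ℤ) : DGMod A ⥤ DGMod A := regradeFunctor (0, k)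

/-- The mapping cone `C(f) = N ⊕ M[1]` with the differential `(n, m) ↦ (d n + f m, d m)`. -/
def cone {M N : DGMod A} (f : M ⟶ N) : DGMod A where
  carrier := N.carrier × M.carrier
  grade p := (N.grade p).prod (M.grade (p + (1, 0)))
  isInternal := isInternal_prod N.isInternal (isInternal_shift M.isInternal (1, 0))
  smul_mem := by
    rintro p r a ⟨n, m⟩ ha ⟨hn, hm⟩
    refine ⟨N.smul_mem ha hn, ?_⟩
    rw [add_assoc]
    exact M.smul_mem ha hm
  d := AddMonoidHom.mk' (fun x => (N.d x.1 + f.1 x.2, M.d x.2)) (by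
    intro x y
    ext
    · simp only [Prod.fst_add, Prod.snd_add, map_add]; abel
    · simp)
  d_mem := by
    rintro p ⟨n, m⟩ ⟨hn, hm⟩
    exact ⟨add_mem (N.d_mem hn) (closed_mem f hm), M.d_mem hm⟩
  d_d := by
    rintro ⟨n, m⟩
    ext
    · simp only [AddMonoidHom.mk'_apply, map_add, N.d_d, zero_add, closed_comm f]
      exact N.char_two _
    · simp [M.d_d]
  d_smul := by
    rintro a ⟨n, m⟩
    ext
    · simp only [AddMonoidHom.mk'_apply, Prod.smul_mk, Prod.mk_add_mk, N.d_smul, map_smul,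
        smul_add]
      abel
    · simp [M.d_smul]

/-- The inclusion `N ⟶ C(f)`. -/
def coneIn {M N : DGMod A} (f : M ⟶ N) : N ⟶ cone f :=
  ⟨LinearMap.inl A.carrier N.carrier M.carrier,
    mem_closed (fun _ _ h => ⟨h, zero_mem _⟩) (fun n => by
      change ((N.d n + f.1 0, M.d 0) : N.carrier × M.carrier) = (N.d n, 0)
      simp)⟩

/-- The projection `C(f) ⟶ M[1]`. -/
def coneOut {M N : DGMod A} (f : M ⟶ N) : cone f ⟶ M⟦(1 : ℤ)⟧ :=
  ⟨LinearMap.snd A.carrier N.carrier M.carrier,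
    mem_closed (N := M.regrade (1, 0)) (fun _ _ h => h.2) (fun _ => rfl)⟩

/-- The DG module `A e`, for an idempotent `e` of bidegree `(0, 0)` with `d e = 0`. -/
def ofIdem (A : QDGAlgebra) (e : A.carrier) (h0 : e ∈ A.grade 0) (hd : A.d e = 0) : DGMod A where
  carrier := (Ideal.span {e} : Ideal A.carrier)
  grade := gradeIdem A.grade e
  isInternal := isInternal_gradeIdem A.isInternal fun g a ha => by
    simpa using A.mul_mem ha h0
  smul_mem := fun ha hm => A.mul_mem ha hm
  d := AddMonoidHom.mk' (fun m => ⟨A.d m, by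
      obtain ⟨m, hm⟩ := m
      obtain ⟨a, rfl⟩ := Ideal.mem_span_singleton'.1 hm
      refine Ideal.mem_span_singleton'.2 ⟨A.d a, ?_⟩
      rw [A.d_mul, hd, mul_zero, add_zero]⟩) (by intros; ext; simp)
  d_mem := fun hm => A.d_mem hm
  d_d := fun m => by ext; exact A.d_d m
  d_smul := fun a m => by ext; exact A.d_mul a m

end DGMod

open CategoryTheory.Pretriangulated CategoryTheory.Limits

/-! ### Triangles, the Grothendieck group, and equivalences of triangulated categories -/

/-- A class of distinguished triangles and a degree shift `{1}` on a category with a shift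
`[n]`. -/
class TriangData (C : Type 1) [Category.{0} C] [HasShift C ℤ] where
  dist : Set (Triangle C)
  q : C ⥤ C

/-- The full subcategory on a class of objects which is stable under the shifts, with those
triangles which are distinguished in the ambient category. -/
@[reducible] def TriangData.fullSub {C : Type 1} [Category.{0} C] [HasShift C ℤ] [TriangData C]
    (P : ObjectProperty C) [P.IsStableUnderShift ℤ]
    (hP : ∀ X, P X → P ((TriangData.q (C := C)).obj X)) : TriangData P.FullSubcategory where
  dist := {T | P.ι.mapTriangle.obj T ∈ TriangData.dist (C := C)}
  q := P.lift (P.ι ⋙ TriangData.q) fun X => hP _ X.property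

section K0

open scoped LaurentPolynomial

variable (C : Type 1) [Category.{0} C] [HasShift C ℤ] [TriangData C]

/-- The relations of the Grothendieck group: `[X{1}] = q [X]`, and `[Y] = [X] + [Z]` for every
distinguished triangle `X → Y → Z → X[1]`. -/
def K0Rel : Submodule ℤ[T;T⁻¹] (C →₀ ℤ[T;T⁻¹]) :=
  Submodule.span _
    ({v | ∃ X : C, v = Finsupp.single ((TriangData.q (C := C)).obj X) 1 -
        Finsupp.single X (LaurentPolynomial.T 1)} ∪
      {v | ∃ T ∈ TriangData.dist (C := C), v = Finsupp.single T.obj₂ 1 -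
        (Finsupp.single T.obj₁ 1 + Finsupp.single T.obj₃ 1)})

/-- The Grothendieck group, as a module over `ℤ[q, q⁻¹]`. -/
abbrev K0 : Type 1 := (C →₀ ℤ[T;T⁻¹]) ⧸ K0Rel C

variable {C} in
/-- The class of an object in the Grothendieck group. -/
def K0.mk (X : C) : K0 C := (K0Rel C).mkQ (Finsupp.single X 1)

end K0

/-- An equivalence of triangulated categories with a degree shift: it commutes with the shifts
`[n]` and `{1}`, and a triangle is distinguished if and only if its image is distinguished. -/
structure TriangEquiv (C D : Type 1) [Category.{0} C] [HasShift C ℤ] [TriangData C]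
    [Category.{0} D] [HasShift D ℤ] [TriangData D] where
  equiv : C ≌ D
  commShift : equiv.functor.CommShift ℤ
  dist_iff : ∀ T : Triangle C, T ∈ TriangData.dist (C := C) ↔
    equiv.functor.mapTriangle.obj T ∈ TriangData.dist (C := D)
  qIso : TriangData.q ⋙ equiv.functor ≅ equiv.functor ⋙ TriangData.q

/-! ### The homotopy category of DG modules and the category `H^0(DGP(A))` -/

section H0

variable (A : QDGAlgebra)

/-- The `0`-th homology category `H^0(DG(A))`: the objects are the DG modules over `A`, the
morphisms are the closed morphisms of degree `0` modulo the exact ones. -/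
abbrev H0DG : Type 1 := CategoryTheory.Quotient (DGMod.homotopic (A := A))

instance : HomRel.IsCompatibleWithShift (DGMod.homotopic (A := A)) ℤ where
  condition n _ _ _ _ h := DGMod.homotopic_regrade (n, 0) h

/-- The functor `Z^0(DG(A)) ⥤ H^0(DG(A))`. -/
abbrev toH0 : DGMod A ⥤ H0DG A := CategoryTheory.Quotient.functor _

variable {A} in
/-- The triangle `M → N → C(f) → M[1]` in `H^0(DG(A))`. -/
def coneTriangle {M N : DGMod A} (f : M ⟶ N) : Triangle (H0DG A) :=
  Triangle.mk ((toH0 A).map f) ((toH0 A).map (DGMod.coneIn f))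
    ((toH0 A).map (DGMod.coneOut f) ≫ ((toH0 A).commShiftIso (1 : ℤ)).hom.app M)

instance : TriangData (H0DG A) where
  dist := {T | ∃ (M N : DGMod A) (f : M ⟶ N), Nonempty (T ≅ coneTriangle f)}
  q := CategoryTheory.Quotient.lift _ (DGMod.qShift 1 ⋙ toH0 A) fun _ _ _ _ h =>
    CategoryTheory.Quotient.sound _ (DGMod.homotopic_regrade (0, 1) h)

variable {A} {ι : Type} (P : ι → DGMod A)

/-- The objects of `DGP(A)`: the smallest class of DG modules which contains the modules `P i` and
is closed under the shifts `[n]` and `{k}`, for all integers `n` and `k`, under mapping cones of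
closed morphisms of degree `0`, and (as a strictly full subcategory is) under isomorphisms. -/
inductive Gen : DGMod A → Prop
  | base (i : ι) : Gen (P i)
  | iso (M N : DGMod A) (e : M ≅ N) : Gen M → Gen N
  | shift (n : ℤ) (M : DGMod A) : Gen M → Gen (M⟦n⟧)
  | qShift (k : ℤ) (M : DGMod A) : Gen M → Gen ((DGMod.qShift k).obj M)
  | cone (M N : DGMod A) (f : M ⟶ N) : Gen M → Gen N → Gen (DGMod.cone f)

/-- The objects of `H^0(DGP(A))`. -/
def genProp : ObjectProperty (H0DG A) := fun X => Gen P X.as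

instance : (genProp P).IsStableUnderShift ℤ where
  isStableUnderShiftBy n :=
    { le_shift := by
        intro X hX
        obtain ⟨M⟩ := X
        change genProp P (((toH0 A).obj M)⟦n⟧)
        rw [CategoryTheory.Quotient.functor_obj_shift]
        exact Gen.shift n M hX }

/-- The full subcategory `H^0(DGP(A))` of `H^0(DG(A))` generated by the modules `P i`. -/
abbrev H0DGP : Type 1 := (genProp P).FullSubcategory

instance : TriangData (H0DGP P) :=
  TriangData.fullSub (genProp P) fun _ h => Gen.qShift 1 _ h

/-- The generator `P i` as an object of `H^0(DGP(A))`. -/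
def H0DGP.base (i : ι) : H0DGP P := ⟨(toH0 A).obj (P i), Gen.base i⟩

end H0

/-! ### Graded modules and the category `K^b(A)` -/

/-- A left `q`-graded module over a `q`-graded algebra. -/
structure GrMod (A : QAlgebra) where
  carrier : Type
  [addCommGroup : AddCommGroup carrier]
  [module : Module A.carrier carrier]
  grade : ℤ → AddSubgroup carrier
  isInternal : DirectSum.IsInternal grade
  smul_mem : ∀ {i j : ℤ} {a : A.carrier} {m : carrier},
    a ∈ A.grade i → m ∈ grade j → a • m ∈ grade (i + j)

attribute [instance] GrMod.addCommGroup GrMod.module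

namespace GrMod

variable {A : QAlgebra}

/-- The grading-preserving module maps. -/
def maps (M N : GrMod A) : AddSubgroup (M.carrier →ₗ[A.carrier] N.carrier) where
  carrier := {f | ∀ i, ∀ m ∈ M.grade i, f m ∈ N.grade i}
  add_mem' hf hg i m hm := add_mem (hf i m hm) (hg i m hm)
  zero_mem' _ _ _ := zero_mem _
  neg_mem' hf i m hm := neg_mem (hf i m hm)

/-- The category of graded modules and grading-preserving module maps. -/
instance : Category (GrMod A) where
  Hom M N := maps M N
  id M := ⟨LinearMap.id, fun _ _ h => h⟩
  comp f g := ⟨g.1.comp f.1, fun i m h => g.2 i _ (f.2 i m h)⟩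

theorem hom_ext {M N : GrMod A} {f g : M ⟶ N} (h : ∀ m, f.1 m = g.1 m) : f = g :=
  Subtype.ext (LinearMap.ext h)

instance : Preadditive (GrMod A) where
  homGroup M N := inferInstanceAs (AddCommGroup (maps M N))
  add_comp _ _ _ f f' g := hom_ext fun m => map_add g.1 (f.1 m) (f'.1 m)
  comp_add _ _ _ _ _ _ := rfl

/-- The zero module. -/
def zeroObj (A : QAlgebra) : GrMod A where
  carrier := PUnit
  grade _ := ⊤
  isInternal := isInternal_punit
  smul_mem _ _ := trivial

theorem isZero_of_subsingleton (M : GrMod A) [Subsingleton M.carrier] : IsZero M := by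
  refine (IsZero.iff_id_eq_zero M).2 (hom_ext fun m => Subsingleton.elim _ _)

theorem subsingleton_of_isZero {M : GrMod A} (h : IsZero M) : Subsingleton M.carrier := by
  have e := (IsZero.iff_id_eq_zero M).1 h
  refine subsingleton_of_forall_eq 0 fun m => ?_
  exact LinearMap.congr_fun (congrArg Subtype.val e) m

instance : HasZeroObject (GrMod A) :=
  ⟨zeroObj A, by
    have : Subsingleton (zeroObj A).carrier := inferInstanceAs (Subsingleton PUnit)
    exact isZero_of_subsingleton _⟩

/-- The direct sum of two graded modules. -/
def prod (M N : GrMod A) : GrMod A where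
  carrier := M.carrier × N.carrier
  grade i := (M.grade i).prod (N.grade i)
  isInternal := isInternal_prod M.isInternal N.isInternal
  smul_mem ha hm := ⟨M.smul_mem ha hm.1, N.smul_mem ha hm.2⟩

/-- The direct sum of two graded modules, with its projections and inclusions. -/
def prodBicone (M N : GrMod A) : BinaryBicone M N where
  pt := prod M N
  fst := ⟨LinearMap.fst A.carrier M.carrier N.carrier, fun _ _ h => h.1⟩
  snd := ⟨LinearMap.snd A.carrier M.carrier N.carrier, fun _ _ h => h.2⟩
  inl := ⟨LinearMap.inl A.carrier M.carrier N.carrier, fun _ _ h => ⟨h, zero_mem _⟩⟩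
  inr := ⟨LinearMap.inr A.carrier M.carrier N.carrier, fun _ _ h => ⟨zero_mem _, h⟩⟩
  inl_fst := rfl
  inl_snd := rfl
  inr_fst := rfl
  inr_snd := rfl

instance : HasBinaryBiproducts (GrMod A) where
  has_binary_biproduct M N := hasBinaryBiproduct_of_total (prodBicone M N) (hom_ext fun m => by
    exact Prod.ext (add_zero _) (zero_add _))

/-- The shift functor `{k}`, with `(M{k})^j = M^{j+k}`. -/
def qShift (k : ℤ) : GrMod A ⥤ GrMod A where
  obj M :=
    { carrier := M.carrier
      grade := fun j => M.grade (j + k)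
      isInternal := isInternal_shift M.isInternal k
      smul_mem := by
        intro i j a m ha hm
        rw [add_assoc]
        exact M.smul_mem ha hm }
  map f := ⟨f.1, fun _ m h => f.2 _ m h⟩

instance (k : ℤ) : (qShift (A := A) k).Additive where
  map_add := rfl

/-- The graded module `A e`, for an idempotent `e` of degree `0`. -/
def ofIdem (A : QAlgebra) (e : A.carrier) (h0 : e ∈ A.grade 0) : GrMod A where
  carrier := (Ideal.span {e} : Ideal A.carrier)
  grade := gradeIdem A.grade e
  isInternal := isInternal_gradeIdem A.isInternal fun g a ha => by
    simpa using A.mul_mem ha h0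
  smul_mem := fun ha hm => A.mul_mem ha hm

/-- A graded module is finitely generated projective if its underlying module is. -/
def IsFGProj (M : GrMod A) : Prop :=
  Module.Finite A.carrier M.carrier ∧ Module.Projective A.carrier M.carrier

theorem isFGProj_of_isZero {M : GrMod A} (h : IsZero M) : M.IsFGProj := by
  have := subsingleton_of_isZero h
  exact ⟨inferInstance, inferInstance⟩

theorem isFGProj_of_iso {M N : GrMod A} (e : M ≅ N) (h : M.IsFGProj) : N.IsFGProj := by
  let e' : M.carrier ≃ₗ[A.carrier] N.carrier :=
    LinearEquiv.ofLinearMap e.hom.1 e.inv.1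
      (congrArg Subtype.val e.inv_hom_id) (congrArg Subtype.val e.hom_inv_id)
  obtain ⟨h1, h2⟩ := h
  exact ⟨Module.Finite.equiv e', Module.Projective.of_equiv e'⟩

theorem isFGProj_ofIdem (A : QAlgebra) (e : A.carrier) (h0 : e ∈ A.grade 0) (he : e * e = e) :
    (ofIdem A e h0).IsFGProj := by
  have hmem : ∀ a : A.carrier, a * e ∈ (Ideal.span {e} : Ideal A.carrier) :=
    fun a => Ideal.mem_span_singleton'.2 ⟨a, rfl⟩
  let s : A.carrier →ₗ[A.carrier] (Ideal.span {e} : Ideal A.carrier) :=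
    (LinearMap.mulRight A.carrier e).codRestrict _ hmem
  have hs : s.comp (Submodule.subtype _) = LinearMap.id := by
    ext ⟨m, hm⟩
    obtain ⟨a, rfl⟩ := Ideal.mem_span_singleton'.1 hm
    change a * e * e = a * e
    rw [mul_assoc, he]
  refine ⟨?_, Module.Projective.of_split _ s hs⟩
  exact Module.Finite.of_surjective s fun m => ⟨m.1, LinearMap.congr_fun hs m⟩

end GrMod

section Kb

variable (A : QAlgebra)

/-- The homotopy category of cochain complexes of graded modules, with the distinguished triangles
given by mapping cones and with the degree shift `{1}`. -/
abbrev HGr : Type 1 := HomotopyCategory (GrMod A) (ComplexShape.up ℤ)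

instance : TriangData (HGr A) where
  dist := distTriang (HGr A)
  q := (GrMod.qShift 1).mapHomotopyCategory _

/-- The bounded cochain complexes of finitely generated projective graded modules. -/
def IsBddFGProj (K : CochainComplex (GrMod A) ℤ) : Prop :=
  (∀ i, (K.X i).IsFGProj) ∧ ∃ a b : ℤ, ∀ i, (i < a ∨ b < i) → IsZero (K.X i)

/-- The objects of `K^b(A)`. -/
def kbProp : ObjectProperty (HGr A) := fun K => IsBddFGProj A K.as

instance : (kbProp A).IsStableUnderShift ℤ where
  isStableUnderShiftBy n :=
    { le_shift := by
        intro K hK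
        obtain ⟨K, rfl⟩ := K.quotient_obj_surjective
        rw [ObjectProperty.prop_shift_iff, HomotopyCategory.shift_quotient_obj]
        obtain ⟨h, a, b, hab⟩ := hK
        exact ⟨fun i => h (i + n), a - n, b - n, fun i hi => hab (i + n) (by omega)⟩ }

/-- The homotopy category `K^b(A)` of bounded cochain complexes of finitely generated projective
graded `A`-modules. -/
abbrev Kb : Type 1 := (kbProp A).FullSubcategory

theorem kbProp_q (K : HGr A) (hK : kbProp A K) :
    kbProp A ((TriangData.q (C := HGr A)).obj K) := by
  obtain ⟨h, a, b, hab⟩ := hK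
  refine ⟨fun i => h i, a, b, fun i hi => ?_⟩
  have := GrMod.subsingleton_of_isZero (hab i hi)
  have h' : Subsingleton (((GrMod.qShift 1).obj (K.as.X i)).carrier) := this
  change IsZero ((GrMod.qShift 1).obj (K.as.X i))
  exact GrMod.isZero_of_subsingleton _

instance : TriangData (Kb A) := TriangData.fullSub (kbProp A) (kbProp_q A)

variable {A} in
/-- A finitely generated projective graded module as a complex concentrated in degree `0`. -/
def Kb.single (M : GrMod A) (hM : M.IsFGProj) : Kb A where
  obj := (HomotopyCategory.quotient _ _).obj ((HomologicalComplex.single _ _ 0).obj M)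
  property := by
    refine ⟨fun i => ?_, 0, 0, fun i hi => ?_⟩
    · by_cases h : i = 0
      · subst h
        exact GrMod.isFGProj_of_iso
          (HomologicalComplex.singleObjXSelf (ComplexShape.up ℤ) 0 M).symm hM
      · exact GrMod.isFGProj_of_isZero
          (HomologicalComplex.isZero_single_obj_X (ComplexShape.up ℤ) 0 M i h)
    · exact HomologicalComplex.isZero_single_obj_X (ComplexShape.up ℤ) 0 M i (by omega)

end Kb

/-! ### The indecomposable projective modules over `R_n ⊠ R_n`, `R_n ⊗ R_n` and `R_n` -/

/-- The DG module `P(x, y) = (R_n ⊠ R_n) e(x, y)`. -/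
def RB.P (n : ℕ) (p : V n × V n) : DGMod (RB n) :=
  DGMod.ofIdem (RB n) (RB.e p.1 p.2) (RB.e_mem p.1 p.2) (RB.d_e p.1 p.2)

/-- The DG module `P'(x, y) = (R_n ⊗ R_n) (e(x) ⊗ e(y))` over `R_n ⊗ R_n`, the latter being viewed
as a DG algebra with trivial differential. -/
def RR.P (n : ℕ) (p : V n × V n) : DGMod (RR n).toDG :=
  DGMod.ofIdem (RR n).toDG (RR.e p.1 p.2) (RR.e_mem p.1 p.2) rfl

/-- The graded module `P'(x, y) = (R_n ⊗ R_n) (e(x) ⊗ e(y))` as an object of `K^b(R_n ⊗ R_n)`. -/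
def RR.PKb (n : ℕ) (p : V n × V n) : Kb (RR n) :=
  Kb.single (GrMod.ofIdem (RR n) (RR.e p.1 p.2) (RR.e_mem p.1 p.2))
    (GrMod.isFGProj_ofIdem _ _ _ (RR.e_mul_e p.1 p.2))

/-- The graded module `P(x) = R_n e(x)` as an object of `K^b(R_n)`. -/
def R.PKb (n : ℕ) (x : V n) : Kb (R n) :=
  Kb.single (GrMod.ofIdem (R n) (R.e x) (R.e_mem x)) (GrMod.isFGProj_ofIdem _ _ _ (R.e_mul_e x))

end QDG

end

noncomputable section

namespace QDG

set_option linter.unusedSectionVars false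

/-! ### Arrows -/

section Arrows

variable {n : ℕ}

/-! Sort the arrows of `R_n ⊠ R_n` into slots, the slot `k` containing `a_{k-1}`, `b_k` and
`c_{k-1}`. Elements of different slots commute. Along a path a label can be used only once in each
coordinate, so the only paths inside a slot are `1, a, b, ab, ba, c`, with `d c = ab + ba`. This
six-dimensional complex retracts onto the span of `1, a, b` and `ab = ba`, by the homotopy `ba ↦ c`.
Performing the local retractions in all slots shows that the projection `R_n ⊠ R_n → R_n ⊗ R_n`
which kills the `c` is surjective with acyclic kernel. No normal form theorem is needed for this.
The algebra acts on families, indexed by pairs of vertices, of functions on words, through local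
operators, and evaluating words as paths recovers every element from its action on the empty words
(`eq_sum_evalVec`). A second action, with commuting `a`, `b` and with `c = 0`, factors through `R_n
⊗ R_n`, and the local projections intertwine the two. So a cocycle in the kernel of the projection
has closed coordinates with vanishing projection; these have primitives made of words that contain a
`c` (`exists_d_eq`, `proj_ker_acyclic`). Formality follows. Now let `A → B` be a surjection with
acyclic kernel `I`. Base change is `M ↦ M / I M`. Every `M` in `DGP(A)` is graded projective, all
closed maps from it to acyclic modules are null-homotopic, and `I M` is acyclic: this holds for `A
e` and passes to shifts and cones. A closed map `M / I M → N / I N` lifts to a graded map; its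
failure to commute with `d` takes values in the acyclic module `I N` and can be corrected.
Homotopies are lifted in the same way. Hence base change is full on closed morphisms and faithful up
to homotopy, and by induction on cones it is essentially surjective. This is `E₁`. If the
differential of `B` vanishes, then DG modules are complexes of graded modules, and `H^0(DG(B))`
embeds fully faithfully in the homotopy category, cones going to mapping cones. The embedding also
settles all questions about triangles: a fully faithful functor to a pretriangulated category
reflects distinguished triangles as soon as it preserves them and every morphism has a cone
(`mem_dist_of_map`). Its restriction is `E₂`. That every bounded complex of projectives is reached
uses that `R_n ⊗ R_n` is directed: arrows enlarge the vertices, so Nakayama's lemma is an induction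
on the height, finitely generated graded projective modules are sums of shifted `B e_i`
(`exists_free`), and a bounded complex is an iterated cone of its terms. The classes of the
generators span `K₀`, by induction on cones. They are independent because the Euler characteristic
of the morphisms to the shifts of the simple module at `j` is additive on triangles and takes the
value `δ_ij` on the projective module at `i`. So `K₀` is free on the vertices for `R_n`, and free on
the pairs of vertices for `R_n ⊗ R_n`. -/

theorem IsArrow.target_unique {s : Fin n} {x y y' : V n} (h : IsArrow s x y) (h' : IsArrow s x y') :
    y = y' := h.2.2.trans h'.2.2.symm

/-- The pairs `{s, s + 1}` and `{t, t + 1}` added along a path are disjoint from each other and from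
`x`, so they can be added in the other order. This supplies the second path which a commutation
relation presupposes. -/
theorem IsArrow.diamond {s t : Fin n} {x y w : V n} (h : IsArrow s x y) (h' : IsArrow t y w) :
    ∃ z, IsArrow t x z ∧ IsArrow s z w := by
  obtain ⟨h1, h2, rfl⟩ := h
  obtain ⟨k1, k2, rfl⟩ := h'
  simp only [Finset.mem_insert, not_or] at k1 k2
  refine ⟨_, ⟨k1.2.2, k2.2.2, rfl⟩, ?_, ?_, ?_⟩
  · simp only [Finset.mem_insert, not_or]
    exact ⟨Ne.symm k2.2.1, Ne.symm k1.2.1, h1⟩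
  · simp only [Finset.mem_insert, not_or]
    exact ⟨Ne.symm k2.1, Ne.symm k1.1, h2⟩
  · ext a
    simp only [Finset.mem_insert]
    tauto

theorem IsArrow.not_repeat {s : Fin n} {x y w : V n} (h : IsArrow s x y) : ¬ IsArrow s y w :=
  fun h' => GenB.arrow_ne h h' rfl

/-- A move in one of the two coordinates: no move, or an arrow with a given label. -/
def OptArrow (o : Option (Fin n)) (x y : V n) : Prop :=
  match o with
  | none => x = y
  | some s => IsArrow s x y

theorem OptArrow.target_unique {o : Option (Fin n)} {x y y' : V n} (h : OptArrow o x y)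
    (h' : OptArrow o x y') : y = y' := by
  cases o with
  | none => exact (show x = y from h).symm.trans h'
  | some s => exact IsArrow.target_unique h h'

theorem OptArrow.diamond {o o' : Option (Fin n)} {x y w : V n} (h : OptArrow o x y)
    (h' : OptArrow o' y w) : ∃ z, OptArrow o' x z ∧ OptArrow o z w := by
  cases o with
  | none => obtain rfl : x = y := h; exact ⟨w, h', rfl⟩
  | some s =>
    cases o' with
    | none => obtain rfl : y = w := h'; exact ⟨x, rfl, h⟩
    | some t => exact IsArrow.diamond h h'

/-- A pair of simultaneous moves in the two coordinates. -/
def PairArrow (m : Option (Fin n) × Option (Fin n)) (p p' : V n × V n) : Prop :=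
  OptArrow m.1 p.1 p'.1 ∧ OptArrow m.2 p.2 p'.2

theorem PairArrow.target_unique {m : Option (Fin n) × Option (Fin n)} {p p' p'' : V n × V n}
    (h : PairArrow m p p') (h' : PairArrow m p p'') : p' = p'' :=
  Prod.ext (h.1.target_unique h'.1) (h.2.target_unique h'.2)

theorem PairArrow.diamond {m m' : Option (Fin n) × Option (Fin n)} {p q w : V n × V n}
    (h : PairArrow m p q) (h' : PairArrow m' q w) : ∃ z, PairArrow m' p z ∧ PairArrow m z w := by
  obtain ⟨z₁, a₁, b₁⟩ := h.1.diamond h'.1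
  obtain ⟨z₂, a₂, b₂⟩ := h.2.diamond h'.2
  exact ⟨(z₁, z₂), ⟨a₁, a₂⟩, ⟨b₁, b₂⟩⟩

end Arrows

/-! ### Generators of `R_n ⊠ R_n` and the commuting global elements -/

/-- The algebra underlying `R_n ⊠ R_n`. -/
abbrev PB (n : ℕ) : Type := Pres (GenB.Rel n)

namespace PB

open GenB (Rel)

variable {n : ℕ}

/-- The idempotent of a vertex of `Γ_n ⊠ Γ_n`. -/
abbrev e (p : V n × V n) : PB n := gen (Rel n) (GenB.e p.1 p.2)

/-- The differential of `R_n ⊠ R_n`. -/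
abbrev d : PB n →+ PB n := dOf (Rel n) GenB.D (GenB.rel_leibniz n)

theorem rel_mul {a b u v : GenB n} (h : Rel n (GenB.ι a * GenB.ι b) (GenB.ι u * GenB.ι v)) :
    gen (Rel n) a * gen (Rel n) b = gen (Rel n) u * gen (Rel n) v := by
  simpa only [map_mul, mkAlgHom_ι] using GenB.gen_eq h

theorem rel_single {a b u : GenB n} (h : Rel n (GenB.ι a * GenB.ι b) (GenB.ι u)) :
    gen (Rel n) a * gen (Rel n) b = gen (Rel n) u := by
  simpa only [map_mul, mkAlgHom_ι] using GenB.gen_eq h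

theorem e_mul_self (p : V n × V n) : e p * e p = e p := rel_single (Rel.idem _ _)

theorem e_mul_ne {p p' : V n × V n} (h : p ≠ p') : e p * e p' = 0 := by
  simpa only [map_mul, mkAlgHom_ι, map_zero] using GenB.gen_eq (Rel.orth p.1 p.2 p'.1 p'.2 h)

theorem sum_e : ∑ p : V n × V n, e p = 1 := by
  simpa only [map_sum, mkAlgHom_ι, map_one] using GenB.gen_eq (Rel.unit (n := n))

theorem d_e (p : V n × V n) : d (e p) = 0 := dOf_gen _ _ _ _

theorem d_mul (a b : PB n) : d (a * b) = d a * b + a * d b := dOf_mul _ _ _ a b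

/-- The idempotents sum to one, so identities between global elements can be checked at one source
vertex at a time. -/
theorem ext_left {u v : PB n} (h : ∀ p, e p * u = e p * v) : u = v := by
  rw [← one_mul u, ← one_mul v, ← sum_e, Finset.sum_mul, Finset.sum_mul]
  exact Finset.sum_congr rfl fun p _ => h p

open Classical in
/-- The generator of a given kind between two vertices, or zero if there is no such generator. -/
def arr (m : Option (Fin n) × Option (Fin n)) (p p' : V n × V n) : PB n :=
  match m with
  | (some s, none) => if h : IsArrow s p.1 p'.1 ∧ p.2 = p'.2 then
      gen (Rel n) (GenB.l s p.1 p'.1 p.2 h.1) else 0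
  | (none, some t) => if h : IsArrow t p.2 p'.2 ∧ p.1 = p'.1 then
      gen (Rel n) (GenB.r t p.1 p.2 p'.2 h.1) else 0
  | (some s, some t) =>
      if h : (t : ℕ) = s + 1 ∧ IsArrow s p.1 p'.1 ∧ IsArrow t p.2 p'.2 then
        gen (Rel n) (GenB.c s t h.1 p.1 p'.1 p.2 p'.2 h.2.1 h.2.2) else 0
  | (none, none) => 0

theorem arr_l {s : Fin n} {x x' : V n} (y : V n) (h : IsArrow s x x') :
    arr (some s, none) (x, y) (x', y) = gen (Rel n) (GenB.l s x x' y h) := by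
  simp [arr, h]

theorem arr_r {t : Fin n} (x : V n) {y y' : V n} (h : IsArrow t y y') :
    arr (none, some t) (x, y) (x, y') = gen (Rel n) (GenB.r t x y y' h) := by
  simp [arr, h]

theorem arr_c {s t : Fin n} (hst : (t : ℕ) = s + 1) {x x' y y' : V n} (h : IsArrow s x x')
    (h' : IsArrow t y y') :
    arr (some s, some t) (x, y) (x', y') = gen (Rel n) (GenB.c s t hst x x' y y' h h') := by
  simp [arr, h, h', hst]

/-- Zero is one of the cases since it is the default value of `arr`. The equations for `m` allow the
kinds of generators which cannot occur to be discarded. -/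
theorem arr_cases (m : Option (Fin n) × Option (Fin n)) {P : (V n × V n) → (V n × V n) → PB n → Prop}
    (h0 : ∀ p p', P p p' 0)
    (hl : ∀ s x x' y h, m = (some s, none) → P (x, y) (x', y) (gen (Rel n) (GenB.l s x x' y h)))
    (hr : ∀ t x y y' h, m = (none, some t) → P (x, y) (x, y') (gen (Rel n) (GenB.r t x y y' h)))
    (hc : ∀ s t hst x x' y y' h h', m = (some s, some t) →
      P (x, y) (x', y') (gen (Rel n) (GenB.c s t hst x x' y y' h h')))
    (p p' : V n × V n) : P p p' (arr m p p') := by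
  obtain ⟨x, y⟩ := p
  obtain ⟨x', y'⟩ := p'
  rcases m with ⟨_ | s, _ | t⟩
  · exact h0 _ _
  · by_cases h : IsArrow t y y' ∧ x = x'
    · obtain ⟨h, rfl⟩ := h
      rw [arr_r x h]; exact hr _ _ _ _ h rfl
    · simp only [arr, h, dite_false]; exact h0 _ _
  · by_cases h : IsArrow s x x' ∧ y = y'
    · obtain ⟨h, rfl⟩ := h
      rw [arr_l y h]; exact hl _ _ _ _ h rfl
    · simp only [arr, h, dite_false]; exact h0 _ _
  · by_cases h : (t : ℕ) = s + 1 ∧ IsArrow s x x' ∧ IsArrow t y y'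
    · obtain ⟨h, h', h''⟩ := h
      rw [arr_c h h' h'']; exact hc _ _ _ _ _ _ _ _ _ rfl
    · simp only [arr, h, dite_false]; exact h0 _ _

theorem arr_eq_zero {m : Option (Fin n) × Option (Fin n)} {p p' : V n × V n}
    (h : ¬ PairArrow m p p') : arr m p p' = 0 := by
  revert h
  refine arr_cases m (P := fun p p' u => ¬ PairArrow m p p' → u = 0) (fun _ _ _ => rfl)
    ?_ ?_ ?_ p p'
  · rintro s x x' y h rfl k; exact (k ⟨h, rfl⟩).elim
  · rintro s x x' y h rfl k; exact (k ⟨rfl, h⟩).elim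
  · rintro s t _ x x' y y' h h' rfl k; exact (k ⟨h, h'⟩).elim

theorem e_mul_arr (m : Option (Fin n) × Option (Fin n)) (p p' : V n × V n) :
    e p * arr m p p' = arr m p p' := by
  refine arr_cases m (P := fun p p' u => e p * u = u) (fun _ _ => mul_zero _) ?_ ?_ ?_ p p'
  · intros; exact rel_single (Rel.source_l _ _ _ _ _)
  · intros; exact rel_single (Rel.source_r _ _ _ _ _)
  · intros; exact rel_single (Rel.source_c _ _ _ _ _ _ _ _ _)

theorem arr_mul_e (m : Option (Fin n) × Option (Fin n)) (p p' : V n × V n) :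
    arr m p p' * e p' = arr m p p' := by
  refine arr_cases m (P := fun p p' u => u * e p' = u) (fun _ _ => zero_mul _) ?_ ?_ ?_ p p'
  · intros; exact rel_single (Rel.target_l _ _ _ _ _)
  · intros; exact rel_single (Rel.target_r _ _ _ _ _)
  · intros; exact rel_single (Rel.target_c _ _ _ _ _ _ _ _ _)

/-- The sum of all generators of a given kind. -/
def tot (m : Option (Fin n) × Option (Fin n)) : PB n := ∑ p, ∑ p', arr m p p'

theorem e_mul_tot (m : Option (Fin n) × Option (Fin n)) (p : V n × V n) :
    e p * tot m = ∑ p', arr m p p' := by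
  rw [tot, Finset.mul_sum, Finset.sum_eq_single p]
  · rw [Finset.mul_sum]
    exact Finset.sum_congr rfl fun p' _ => e_mul_arr m p p'
  · intro q _ hq
    rw [Finset.mul_sum]
    refine Finset.sum_eq_zero fun p' _ => ?_
    rw [← e_mul_arr, ← mul_assoc, e_mul_ne hq.symm, zero_mul]
  · simp

/-- Labels determine targets, so a single summand starts at `p`. Hence the global sums carry the
same information as the individual arrows. -/
theorem e_mul_tot_of {m : Option (Fin n) × Option (Fin n)} {p p' : V n × V n}
    (h : PairArrow m p p') : e p * tot m = arr m p p' := by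
  rw [e_mul_tot, Finset.sum_eq_single p']
  · exact fun q _ hq => arr_eq_zero fun k => hq (k.target_unique h)
  · simp

theorem e_mul_tot_eq_zero {m : Option (Fin n) × Option (Fin n)} {p : V n × V n}
    (h : ∀ p', ¬ PairArrow m p p') : e p * tot m = 0 := by
  rw [e_mul_tot]
  exact Finset.sum_eq_zero fun q _ => arr_eq_zero (h q)

theorem arr_mul (m : Option (Fin n) × Option (Fin n)) (p p' : V n × V n) (u : PB n) :
    arr m p p' * u = arr m p p' * (e p' * u) := by
  rw [← mul_assoc, arr_mul_e]

theorem e_mul_tot_mul (m : Option (Fin n) × Option (Fin n)) {p p' : V n × V n}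
    (h : PairArrow m p p') (u : PB n) : e p * (tot m * u) = arr m p p' * (e p' * u) := by
  rw [← mul_assoc, e_mul_tot_of h, arr_mul]

theorem e_mul_tot_mul_eq_zero (m : Option (Fin n) × Option (Fin n)) {p : V n × V n}
    (h : ∀ p', ¬ PairArrow m p p') (u : PB n) : e p * (tot m * u) = 0 := by
  rw [← mul_assoc, e_mul_tot_eq_zero h, zero_mul]

theorem e_tot_tot {m m' : Option (Fin n) × Option (Fin n)} {p q w : V n × V n}
    (h : PairArrow m p q) (h' : PairArrow m' q w) :
    e p * (tot m * tot m') = arr m p q * arr m' q w := by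
  rw [e_mul_tot_mul _ h, e_mul_tot_of h']

theorem e_tot_tot_eq_zero {m m' : Option (Fin n) × Option (Fin n)} {p : V n × V n}
    (h : ∀ q w, PairArrow m p q → ¬ PairArrow m' q w) :
    e p * (tot m * tot m') = 0 := by
  by_cases k : ∃ q, PairArrow m p q
  · obtain ⟨q, k⟩ := k
    rw [e_mul_tot_mul _ k, e_mul_tot_eq_zero fun w => h q w k, mul_zero]
  · exact e_mul_tot_mul_eq_zero _ (fun q hq => k ⟨q, hq⟩) _

theorem tot_mul_tot_eq_zero {m m' : Option (Fin n) × Option (Fin n)}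
    (h : ∀ p q w : V n × V n, PairArrow m p q → ¬ PairArrow m' q w) : tot m * tot m' = 0 :=
  ext_left fun p => by rw [e_tot_tot_eq_zero (h p), mul_zero]

/-- Compare at each vertex `p`. By the diamond property, a path with the moves `m, m'` leaves `p` if
and only if one with the moves `m', m` does. If there is none then both sides vanish at `p`;
otherwise each side is a single path and the hypothesis, a defining relation in the applications,
identifies them. -/
theorem tot_commute {m m' : Option (Fin n) × Option (Fin n)}
    (H : ∀ {p q q' w : V n × V n}, PairArrow m p q → PairArrow m' q w → PairArrow m' p q' →
      PairArrow m q' w → arr m p q * arr m' q w = arr m' p q' * arr m q' w) :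
    Commute (tot m) (tot m') := by
  refine ext_left fun p => ?_
  by_cases k : ∃ q w, PairArrow m p q ∧ PairArrow m' q w
  · obtain ⟨q, w, h, h'⟩ := k
    obtain ⟨z, k, k'⟩ := h.diamond h'
    rw [e_tot_tot h h', e_tot_tot k k', H h h' k k']
  · rw [e_tot_tot_eq_zero fun q w h h' => k ⟨q, w, h, h'⟩, e_tot_tot_eq_zero]
    intro q w h h'
    obtain ⟨z, a, b⟩ := h.diamond h'
    exact k ⟨z, w, a, b⟩

theorem tot_l_l (s t : Fin n) : Commute (tot (some s, none)) (tot (some t, none)) := by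
  refine tot_commute ?_
  rintro ⟨x, y⟩ ⟨x', y'⟩ ⟨x'', y''⟩ ⟨x''', y'''⟩ ⟨h₁, k₁⟩ ⟨h₂, k₂⟩ ⟨h₃, k₃⟩ ⟨h₄, k₄⟩
  obtain rfl : y = y' := k₁
  obtain rfl : y = y''' := k₂
  obtain rfl : y = y'' := k₃
  rw [arr_l y h₁, arr_l y h₂, arr_l y h₃, arr_l y h₄]
  exact rel_mul (Rel.l_l _ _ _ _ _ _ _ _ _ _ _)

theorem tot_r_r (s t : Fin n) : Commute (tot (none, some s)) (tot (none, some t)) := by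
  refine tot_commute ?_
  rintro ⟨x, y⟩ ⟨x', y'⟩ ⟨x'', y''⟩ ⟨x''', y'''⟩ ⟨k₁, h₁⟩ ⟨k₂, h₂⟩ ⟨k₃, h₃⟩ ⟨k₄, h₄⟩
  obtain rfl : x = x' := k₁
  obtain rfl : x = x''' := k₂
  obtain rfl : x = x'' := k₃
  rw [arr_r x h₁, arr_r x h₂, arr_r x h₃, arr_r x h₄]
  exact rel_mul (Rel.r_r _ _ _ _ _ _ _ _ _ _ _)

theorem tot_l_r {s t : Fin n} (hst : (t : ℕ) ≠ s + 1) :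
    Commute (tot (some s, none)) (tot (none, some t)) := by
  refine tot_commute ?_
  rintro ⟨x, y⟩ ⟨x', y'⟩ ⟨x'', y''⟩ ⟨x''', y'''⟩ ⟨h₁, k₁⟩ ⟨k₂, h₂⟩ ⟨k₃, h₃⟩ ⟨h₄, k₄⟩
  obtain rfl : y = y' := k₁
  obtain rfl : x' = x''' := k₂
  obtain rfl : x = x'' := k₃
  obtain rfl : y'' = y''' := k₄
  rw [arr_l y h₁, arr_r x' h₂, arr_r x h₃, arr_l y'' h₄]
  exact rel_mul (Rel.l_r _ _ hst _ _ _ _ _ _)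

theorem tot_c_r {s s' : Fin n} (hs : (s' : ℕ) = s + 1) (t : Fin n) :
    Commute (tot (some s, some s')) (tot (none, some t)) := by
  refine tot_commute ?_
  rintro ⟨x, y⟩ ⟨x', y'⟩ ⟨x'', y''⟩ ⟨x''', y'''⟩ ⟨h₁, k₁⟩ ⟨h₂, k₂⟩ ⟨h₃, k₃⟩ ⟨h₄, k₄⟩
  obtain rfl : x' = x''' := h₂
  obtain rfl : x = x'' := h₃
  rw [arr_c hs h₁ k₁, arr_r x' k₂, arr_r x k₃, arr_c hs h₄ k₄]
  exact rel_mul (Rel.c_r _ _ _ _ _ _ _ _ _ _ _ _ _ _ _)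

theorem tot_c_l {s s' : Fin n} (hs : (s' : ℕ) = s + 1) (t : Fin n) :
    Commute (tot (some s, some s')) (tot (some t, none)) := by
  refine tot_commute ?_
  rintro ⟨x, y⟩ ⟨x', y'⟩ ⟨x'', y''⟩ ⟨x''', y'''⟩ ⟨h₁, k₁⟩ ⟨h₂, k₂⟩ ⟨h₃, k₃⟩ ⟨h₄, k₄⟩
  obtain rfl : y' = y''' := k₂
  obtain rfl : y = y'' := k₃
  rw [arr_c hs h₁ k₁, arr_l y' h₂, arr_l y h₃, arr_c hs h₄ k₄]
  exact rel_mul (Rel.c_l _ _ _ _ _ _ _ _ _ _ _ _ _ _ _)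

theorem tot_c_c {s s' t t' : Fin n} (hs : (s' : ℕ) = s + 1) (ht : (t' : ℕ) = t + 1) :
    Commute (tot (some s, some s')) (tot (some t, some t')) := by
  refine tot_commute ?_
  rintro ⟨x, y⟩ ⟨x', y'⟩ ⟨x'', y''⟩ ⟨x''', y'''⟩ ⟨h₁, k₁⟩ ⟨h₂, k₂⟩ ⟨h₃, k₃⟩ ⟨h₄, k₄⟩
  rw [arr_c hs h₁ k₁, arr_c ht h₂ k₂, arr_c ht h₃ k₃, arr_c hs h₄ k₄]
  exact rel_mul (Rel.c_c _ _ _ _ _ _ _ _ _ _ _ _ _ _ _ _ _ _ _ _ _ _)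

/-- After a move with label `s` the first coordinate contains `s`, which blocks another move with
this label. -/
theorem tot_mul_tot_fst (s : Fin n) (o o' : Option (Fin n)) :
    tot (some s, o) * tot (some s, o') = 0 :=
  tot_mul_tot_eq_zero fun _ _ _ h h' => IsArrow.not_repeat h.1 h'.1

theorem tot_mul_tot_snd (t : Fin n) (o o' : Option (Fin n)) :
    tot (o, some t) * tot (o', some t) = 0 :=
  tot_mul_tot_eq_zero fun _ _ _ h h' => IsArrow.not_repeat h.2 h'.2

/-- The arrow in the middle does not change the first coordinate, so the second `a_s` is still
blocked by the first one. This also covers `t = s + 1`, where `a_s` and `b_t` do not commute. -/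
theorem tot_l_r_l (s t : Fin n) :
    tot (some s, none) * (tot (none, some t) * tot (some s, none)) = 0 := by
  refine ext_left fun p => ?_
  rw [mul_zero]
  by_cases k : ∃ q, PairArrow (some s, none) p q
  · obtain ⟨q, k⟩ := k
    rw [e_mul_tot_mul _ k, e_tot_tot_eq_zero, mul_zero]
    intro w z h h'
    have : q.1 = w.1 := h.1
    exact IsArrow.not_repeat k.1 (this ▸ h'.1)
  · exact e_mul_tot_mul_eq_zero _ (fun q hq => k ⟨q, hq⟩) _

theorem tot_r_l_r (s t : Fin n) :
    tot (none, some t) * (tot (some s, none) * tot (none, some t)) = 0 := by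
  refine ext_left fun p => ?_
  rw [mul_zero]
  by_cases k : ∃ q, PairArrow (none, some t) p q
  · obtain ⟨q, k⟩ := k
    rw [e_mul_tot_mul _ k, e_tot_tot_eq_zero, mul_zero]
    intro w z h h'
    have : q.2 = w.2 := h.2
    exact IsArrow.not_repeat k.2 (this ▸ h'.2)
  · exact e_mul_tot_mul_eq_zero _ (fun q hq => k ⟨q, hq⟩) _

theorem d_e_mul (p : V n × V n) (u : PB n) : d (e p * u) = e p * d u := by
  rw [d_mul, d_e, zero_mul, zero_add]

theorem d_tot_l (s : Fin n) : d (tot (some s, none)) = 0 := by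
  simp only [tot, map_sum]
  refine Finset.sum_eq_zero fun p _ => Finset.sum_eq_zero fun p' _ => ?_
  refine arr_cases (some s, none) (P := fun p p' u => d u = 0) (fun _ _ => map_zero _) ?_ ?_ ?_ p p'
  · intros; exact dOf_gen _ _ _ _
  · intros; exact dOf_gen _ _ _ _
  · simp

theorem d_tot_r (s : Fin n) : d (tot (none, some s)) = 0 := by
  simp only [tot, map_sum]
  refine Finset.sum_eq_zero fun p _ => Finset.sum_eq_zero fun p' _ => ?_
  refine arr_cases (none, some s) (P := fun p p' u => d u = 0) (fun _ _ => map_zero _) ?_ ?_ ?_ p p'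
  · intros; exact dOf_gen _ _ _ _
  · intros; exact dOf_gen _ _ _ _
  · simp

theorem d_tot_c {s t : Fin n} (hst : (t : ℕ) = s + 1) : d (tot (some s, some t)) =
    tot (some s, none) * tot (none, some t) + tot (none, some t) * tot (some s, none) := by
  refine ext_left fun p => ?_
  obtain ⟨x, y⟩ := p
  rw [← d_e_mul, mul_add]
  by_cases k : ∃ q : V n × V n, PairArrow (some s, some t) (x, y) q
  · obtain ⟨⟨x', y'⟩, h, h'⟩ := k
    rw [e_mul_tot_of ⟨h, h'⟩, arr_c hst h h', e_tot_tot (m := (some s, none)) (m' := (none, some t)) (p := (x, y)) (q := (x', y)) (w := (x', y')) ⟨h, rfl⟩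
      ⟨rfl, h'⟩, e_tot_tot (m := (none, some t)) (m' := (some s, none)) (p := (x, y)) (q := (x, y')) (w := (x', y')) ⟨rfl, h'⟩ ⟨h, rfl⟩, arr_l y h, arr_l y' h,
      arr_r x h', arr_r x' h']
    exact dOf_gen _ _ _ _
  -- A path of either order from `(x, y)` would consist of an arrow `s` at `x` and an arrow `t` at
  -- `y`, and these form a diagonal move. So without a diagonal move all three terms vanish.
  · rw [e_mul_tot_eq_zero fun q hq => k ⟨q, hq⟩, e_tot_tot_eq_zero, e_tot_tot_eq_zero]
    · simp
    · intro q w h h'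
      have h1 : x = q.1 := h.1
      exact k ⟨(w.1, q.2), h1 ▸ h'.1, h.2⟩
    · intro q w h h'
      have h1 : y = q.2 := h.2
      exact k ⟨(q.1, w.2), h.1, h1 ▸ h'.2⟩

end PB

/-! ### Local words -/

namespace PB

open GenB (Rel)

variable {n : ℕ}

/-- The sum of the arrows with label `(s, ∅)`, where the slot `k` is `s + 1`. -/
def slotA (k : Fin (n + 1)) : PB n := Fin.cases 0 (fun s => tot (some s, none)) k

/-- The sum of the arrows with label `(∅, k)`. -/
def slotB (k : Fin (n + 1)) : PB n := Fin.lastCases 0 (fun t => tot (none, some t)) k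

/-- The sum of the arrows with label `(s, s + 1)`, where the slot `k` is `s + 1`. -/
def slotC (k : Fin (n + 1)) : PB n :=
  Fin.cases 0 (fun s => Fin.lastCases 0 (fun t => tot (some s, some t)) s.succ) k

theorem slotA_succ (s : Fin n) : slotA s.succ = tot (some s, none) := rfl

theorem slotB_castSucc (t : Fin n) : slotB t.castSucc = tot (none, some t) := by
  simp [slotB]

theorem slotA_zero : slotA (0 : Fin (n + 1)) = 0 := rfl

theorem slotB_last : slotB (Fin.last n) = 0 := by simp [slotB]

theorem slotC_zero : slotC (0 : Fin (n + 1)) = 0 := rfl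

/-- The label `s` of the first coordinate and the label `s + 1` of the second one share a slot. Of
the `n + 1` slots the first has no `a`, the last has no `b`, and neither of these has a `c`; the
missing elements are zero. -/
theorem slot_eq {s t : Fin n} (hst : (t : ℕ) = s + 1) : s.succ = t.castSucc :=
  Fin.ext (by simp [hst])

theorem slotC_succ {s t : Fin n} (hst : (t : ℕ) = s + 1) :
    slotC s.succ = tot (some s, some t) := by
  change Fin.lastCases (motive := fun _ => PB n) _ _ s.succ = _
  rw [slot_eq hst]
  simp

theorem slotC_last : slotC (Fin.last n) = 0 := by
  rcases n with _ | n
  · rfl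
  · rw [← Fin.succ_last]
    change Fin.lastCases (motive := fun _ => PB (n + 1)) _ _ (Fin.last n).succ = _
    rw [Fin.succ_last, Fin.lastCases_last]

/-- Every slot is the first one, the last one, or belongs to a pair of consecutive labels. -/
theorem slot_cases {P : Fin (n + 1) → Prop} (h0 : P 0) (hl : P (Fin.last n))
    (h : ∀ s t : Fin n, (t : ℕ) = s + 1 → P s.succ) (k : Fin (n + 1)) : P k := by
  by_cases hk : (k : ℕ) = 0
  · rwa [show k = 0 from Fin.ext hk]
  by_cases hk' : (k : ℕ) = n
  · rwa [show k = Fin.last n from Fin.ext hk']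
  have := k.2
  have e : k = (⟨(k : ℕ) - 1, by omega⟩ : Fin n).succ := Fin.ext (by simp; omega)
  rw [e]
  exact h _ ⟨k, by omega⟩ (by simp; omega)

theorem slotA_cases {P : PB n → Fin (n + 1) → Prop} (h0 : P 0 0)
    (h : ∀ s : Fin n, P (tot (some s, none)) s.succ) (k : Fin (n + 1)) : P (slotA k) k := by
  cases k using Fin.cases with
  | zero => exact h0
  | succ s => exact h s

theorem slotB_cases {P : PB n → Fin (n + 1) → Prop} (h0 : P 0 (Fin.last n))
    (h : ∀ s : Fin n, P (tot (none, some s)) s.castSucc) (k : Fin (n + 1)) : P (slotB k) k := by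
  cases k using Fin.lastCases with
  | last => rw [slotB_last]; exact h0
  | cast s => rw [slotB_castSucc]; exact h s

theorem slotC_cases {P : PB n → Fin (n + 1) → Prop} (h0 : ∀ k, P 0 k)
    (h : ∀ s t : Fin n, (t : ℕ) = s + 1 → P (tot (some s, some t)) s.succ) (k : Fin (n + 1)) :
    P (slotC k) k := by
  refine slot_cases (P := fun k => P (slotC k) k) ?_ ?_ ?_ k
  · exact h0 _
  · rw [slotC_last]; exact h0 _
  · intro s t hst
    rw [slotC_succ hst]; exact h s t hst

theorem slotA_slotA (j k : Fin (n + 1)) : Commute (slotA j) (slotA k : PB n) := by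
  refine slotA_cases (P := fun u _ => Commute u (slotA k)) (Commute.zero_left _) (fun s => ?_) j
  refine slotA_cases (P := fun u _ => Commute _ u) (Commute.zero_right _) (fun t => ?_) k
  exact tot_l_l s t

theorem slotB_slotB (j k : Fin (n + 1)) : Commute (slotB j) (slotB k : PB n) := by
  refine slotB_cases (P := fun u _ => Commute u (slotB k)) (Commute.zero_left _) (fun s => ?_) j
  refine slotB_cases (P := fun u _ => Commute _ u) (Commute.zero_right _) (fun t => ?_) k
  exact tot_r_r s t

/-- Distinct slots exclude precisely the pairs `a_s`, `b_{s+1}`, whose commutator is the coboundary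
of `c_s`. -/
theorem slotA_slotB {j k : Fin (n + 1)} (h : j ≠ k) : Commute (slotA j) (slotB k : PB n) := by
  revert h
  refine slotA_cases (P := fun u j => j ≠ k → Commute u (slotB k))
    (fun _ => Commute.zero_left _) (fun s => ?_) j
  refine slotB_cases (P := fun u k => s.succ ≠ k → Commute _ u)
    (fun _ => Commute.zero_right _) (fun t h => ?_) k
  exact tot_l_r fun e => h (slot_eq e)

theorem slotC_slotA (j k : Fin (n + 1)) : Commute (slotC j) (slotA k : PB n) := by
  refine slotC_cases (P := fun u _ => Commute u (slotA k)) (fun _ => Commute.zero_left _)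
    (fun s s' hs => ?_) j
  refine slotA_cases (P := fun u _ => Commute _ u) (Commute.zero_right _) (fun t => ?_) k
  exact tot_c_l hs t

theorem slotC_slotB (j k : Fin (n + 1)) : Commute (slotC j) (slotB k : PB n) := by
  refine slotC_cases (P := fun u _ => Commute u (slotB k)) (fun _ => Commute.zero_left _)
    (fun s s' hs => ?_) j
  refine slotB_cases (P := fun u _ => Commute _ u) (Commute.zero_right _) (fun t => ?_) k
  exact tot_c_r hs t

theorem slotC_slotC (j k : Fin (n + 1)) : Commute (slotC j) (slotC k : PB n) := by
  refine slotC_cases (P := fun u _ => Commute u (slotC k)) (fun _ => Commute.zero_left _)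
    (fun s s' hs => ?_) j
  refine slotC_cases (P := fun u _ => Commute _ u) (fun _ => Commute.zero_right _)
    (fun t t' ht => ?_) k
  exact tot_c_c hs ht

theorem slotA_mul_slotA (k : Fin (n + 1)) : slotA k * slotA k = (0 : PB n) :=
  slotA_cases (P := fun u _ => u * u = 0) (mul_zero _) (fun s => tot_mul_tot_fst s _ _) k

theorem slotB_mul_slotB (k : Fin (n + 1)) : slotB k * slotB k = (0 : PB n) :=
  slotB_cases (P := fun u _ => u * u = 0) (mul_zero _) (fun s => tot_mul_tot_snd s _ _) k

theorem slotC_mul_slotC (k : Fin (n + 1)) : slotC k * slotC k = (0 : PB n) :=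
  slotC_cases (P := fun u _ => u * u = 0) (fun _ => mul_zero _)
    (fun s _ _ => tot_mul_tot_fst s _ _) k

theorem slotC_mul_slotA (k : Fin (n + 1)) : slotC k * slotA k = (0 : PB n) :=
  slotC_cases (P := fun u k => u * slotA k = 0) (fun _ => zero_mul _)
    (fun s _ _ => tot_mul_tot_fst s _ _) k

theorem slotC_mul_slotB (k : Fin (n + 1)) : slotC k * slotB k = (0 : PB n) :=
  slotC_cases (P := fun u k => u * slotB k = 0) (fun _ => zero_mul _)
    (fun s t hst => by rw [slot_eq hst, slotB_castSucc]; exact tot_mul_tot_snd t _ _) k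

theorem slotA_mul_slotC (k : Fin (n + 1)) : slotA k * slotC k = (0 : PB n) := by
  rw [← (slotC_slotA k k).eq, slotC_mul_slotA]

theorem slotB_mul_slotC (k : Fin (n + 1)) : slotB k * slotC k = (0 : PB n) := by
  rw [← (slotC_slotB k k).eq, slotC_mul_slotB]

theorem slotA_slotB_slotA (k : Fin (n + 1)) : slotA k * (slotB k * slotA k) = (0 : PB n) := by
  refine slotB_cases (P := fun u k => slotA k * (u * slotA k) = 0) (by simp) (fun t => ?_) k
  refine slotA_cases (P := fun u _ => u * (_ * u) = 0) (by simp) (fun s => ?_) _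
  exact tot_l_r_l s t

theorem slotB_slotA_slotB (k : Fin (n + 1)) : slotB k * (slotA k * slotB k) = (0 : PB n) := by
  refine slotB_cases (P := fun u k => u * (slotA k * u) = 0) (by simp) (fun t => ?_) k
  refine slotA_cases (P := fun u _ => _ * (u * _) = 0) (by simp) (fun s => ?_) _
  exact tot_r_l_r s t

theorem d_slotA (k : Fin (n + 1)) : d (slotA k : PB n) = 0 :=
  slotA_cases (P := fun u _ => d u = 0) (map_zero _) d_tot_l k

theorem d_slotB (k : Fin (n + 1)) : d (slotB k : PB n) = 0 :=
  slotB_cases (P := fun u _ => d u = 0) (map_zero _) d_tot_r k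

theorem d_slotC (k : Fin (n + 1)) :
    d (slotC k : PB n) = slotA k * slotB k + slotB k * slotA k := by
  refine slot_cases (P := fun k => d (slotC k : PB n) = slotA k * slotB k + slotB k * slotA k)
    ?_ ?_ ?_ k
  · simp [slotA_zero, slotC_zero]
  · simp [slotB_last, slotC_last]
  · intro s t hst
    rw [slotC_succ hst, d_tot_c hst, slotA_succ, slot_eq hst, slotB_castSucc]

end PB

/-! ### Local operators -/

section LocalOps

variable {K S : Type} [DecidableEq K] [Fintype S]

/-- The operator on functions on words which acts on the letter in the slot `k` by a matrix. -/
def localOp (k : K) (m : Matrix S S F) : Module.End F ((K → S) → F) where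
  toFun v w := ∑ t, m (w k) t * v (Function.update w k t)
  map_add' u v := by ext w; simp [mul_add, Finset.sum_add_distrib]
  map_smul' c v := by ext w; simp [Finset.mul_sum, mul_left_comm]

theorem localOp_apply (k : K) (m : Matrix S S F) (v : (K → S) → F) (w : K → S) :
    localOp k m v w = ∑ t, m (w k) t * v (Function.update w k t) := rfl

theorem localOp_mul (k : K) (m m' : Matrix S S F) :
    localOp k (m * m') = localOp k m * localOp k m' := by
  ext v w
  simp only [Module.End.mul_apply, localOp_apply, Matrix.mul_apply, Finset.mul_sum,
    Finset.sum_mul, Function.update_self, Function.update_idem]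
  rw [Finset.sum_comm]
  simp only [mul_assoc]

theorem localOp_add (k : K) (m m' : Matrix S S F) :
    localOp k (m + m') = localOp k m + localOp k m' := by
  ext v w
  simp [localOp_apply, add_mul, Finset.sum_add_distrib]

theorem localOp_zero (k : K) : localOp k (0 : Matrix S S F) = 0 := by
  ext v w
  simp [localOp_apply]

theorem localOp_one [DecidableEq S] (k : K) : localOp k (1 : Matrix S S F) = 1 := by
  ext v w
  simp [localOp_apply, Matrix.one_apply]

theorem localOp_commute {j k : K} (h : j ≠ k) (m m' : Matrix S S F) :
    Commute (localOp j m) (localOp k m') := by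
  ext v w
  simp only [Module.End.mul_apply, localOp_apply, Finset.mul_sum]
  rw [Finset.sum_comm]
  refine Finset.sum_congr rfl fun t _ => Finset.sum_congr rfl fun u _ => ?_
  rw [Function.update_of_ne h, Function.update_of_ne h.symm, Function.update_comm h,
    mul_left_comm]

variable [Fintype K] [DecidableEq S]

theorem localOp_single (k : K) (m : Matrix S S F) (w : K → S) :
    localOp k m (Pi.single w 1) = ∑ r, m r (w k) • Pi.single (Function.update w k r) 1 := by
  ext u
  simp only [localOp_apply, Finset.sum_apply, Pi.smul_apply, smul_eq_mul]
  -- `localOp` pulls functions back along the change of a letter. The sum over `t` only sees `t = w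
  -- k`, the sum over `r` only sees `r = u k`, and for these letters `u` changed to `t` is `w` if
  -- and only if `w` changed to `r` is `u`.
  have key : ∀ t r : S, t = w k → r = u k → ((Pi.single w (1 : F) : (K → S) → F)
      (Function.update u k t) = (Pi.single (Function.update w k r) (1 : F) : (K → S) → F) u) := by
    rintro t r rfl rfl
    simp only [Pi.single_apply]
    congr 1
    simp only [eq_iff_iff]
    constructor
    · intro h
      rw [← h]; simp
    · intro h
      conv_rhs => rw [← Function.update_eq_self k w]
      rw [h, Function.update_idem]
  rw [Finset.sum_eq_single (w k), Finset.sum_eq_single (u k)]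
  · rw [key _ _ rfl rfl]
  · intro r _ hr
    rw [Pi.single_apply, if_neg, mul_zero]
    rintro rfl
    exact hr (by simp)
  · simp
  · intro t _ ht
    rw [Pi.single_apply, if_neg, mul_zero]
    intro h
    exact ht (by rw [← h]; simp)
  · simp

end LocalOps

/-! ### Ordered products -/

section ListProd

variable {A : Type} [Ring A]

/-- The factor `x` moves past the entries in front of the `k`-th one. With `x` in the slot `k`, left
multiplication becomes an operation on a single letter. -/
theorem mul_prod_ofFn {m : ℕ} (g : Fin m → A) (k : Fin m) (x : A)
    (h : ∀ j, j ≠ k → Commute x (g j)) :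
    x * (List.ofFn g).prod = (List.ofFn (Function.update g k (x * g k))).prod := by
  induction m with
  | zero => exact k.elim0
  | succ m ih =>
    rw [List.ofFn_succ, List.prod_cons, List.ofFn_succ, List.prod_cons]
    cases k using Fin.cases with
    | zero =>
      rw [Function.update_self, mul_assoc]
      congr 3
    | succ k =>
      rw [Function.update_of_ne (Fin.succ_ne_zero k).symm, ← mul_assoc,
        (h 0 (Fin.succ_ne_zero k).symm).eq, mul_assoc, ih (fun i => g i.succ) k
          (fun j hj => h _ fun e => hj (Fin.succ_injective _ e))]
      congr 3
      ext j
      by_cases e : j = k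
      · subst e; simp
      · rw [Function.update_of_ne e, Function.update_of_ne fun h => e (Fin.succ_injective _ h)]

theorem derivation_prod_ofFn {m : ℕ} (D : A →+ A) (h1 : D 1 = 0)
    (hD : ∀ a b, D (a * b) = D a * b + a * D b) (g : Fin m → A) :
    D (List.ofFn g).prod = ∑ k, (List.ofFn (Function.update g k (D (g k)))).prod := by
  induction m with
  | zero => simp [h1]
  | succ m ih =>
    rw [List.ofFn_succ, List.prod_cons, hD, ih, Fin.sum_univ_succ, Finset.mul_sum]
    congr 1
    · rw [List.ofFn_succ, List.prod_cons, Function.update_self]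
      congr 3
    · refine Finset.sum_congr rfl fun k _ => ?_
      rw [List.ofFn_succ, List.prod_cons, Function.update_of_ne (Fin.succ_ne_zero k).symm]
      congr 3
      ext j
      by_cases e : j = k
      · subst e; simp
      · rw [Function.update_of_ne e, Function.update_of_ne fun h => e (Fin.succ_injective _ h)]

end ListProd

/-! ### The local complex -/

/-- The paths in one slot: the empty one, the two arrows `a` and `b`, their two products, and the
arrow `c`. -/
inductive Letter : Type
  | o | a | b | ab | ba | c
  deriving DecidableEq

namespace Letter

instance : Fintype Letter := ⟨{o, a, b, ab, ba, c}, fun x => by cases x <;> decide⟩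

theorem sum_eq {M : Type} [AddCommMonoid M] (f : Letter → M) :
    ∑ r, f r = f o + f a + f b + f ab + f ba + f c := by
  change ∑ r ∈ {o, a, b, ab, ba, c}, f r = _
  simp only [Finset.sum_insert, Finset.mem_insert, Finset.mem_singleton, Finset.sum_singleton,
    reduceCtorEq, or_self, not_false_eq_true, add_assoc]

/-- Left multiplication by `a`. -/
def matA : Matrix Letter Letter F
  | a, o => 1
  | ab, b => 1
  | _, _ => 0

/-- Left multiplication by `b`. -/
def matB : Matrix Letter Letter F
  | b, o => 1
  | ba, a => 1
  | _, _ => 0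

/-- Left multiplication by `c`. -/
def matC : Matrix Letter Letter F
  | c, o => 1
  | _, _ => 0

/-- The differential. -/
def matD : Matrix Letter Letter F
  | ab, c => 1
  | ba, c => 1
  | _, _ => 0

/-- The contracting homotopy. -/
def matH : Matrix Letter Letter F
  | c, ba => 1
  | _, _ => 0

/-- The projection onto the words in commuting letters. -/
def matP : Matrix Letter Letter F
  | o, o => 1
  | a, a => 1
  | b, b => 1
  | ab, ab => 1
  | ab, ba => 1
  | _, _ => 0

/-- Multiplication by `a` on the words in commuting letters. -/
def matA' : Matrix Letter Letter F
  | a, o => 1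
  | ab, b => 1
  | _, _ => 0

/-- Multiplication by `b` on the words in commuting letters. -/
def matB' : Matrix Letter Letter F
  | b, o => 1
  | ab, a => 1
  | _, _ => 0

theorem matD_matA : matD * matA = matA * matD := by decide +kernel
theorem matD_matB : matD * matB = matB * matD := by decide +kernel
theorem matD_matC : matD * matC + matC * matD = matA * matB + matB * matA := by decide +kernel
theorem matD_matD : matD * matD = 0 := by decide +kernel
-- The only nonzero differential is `c ↦ ab + ba`, and the only nonzero value of the homotopy is `ba
-- ↦ c`. Their commutator fixes `c` and maps `ba` to `ab + ba`; accordingly `matP` kills `c` and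
-- replaces `ba` by `ab`.
theorem matD_matH : matD * matH + matH * matD = 1 + matP := by decide +kernel
theorem matP_matA : matP * matA = matA' * matP := by decide +kernel
theorem matP_matB : matP * matB = matB' * matP := by decide +kernel
-- The factor zero stands for the operator by which `c` acts on commuting words, so that the
-- identity has the same form as those for `a` and `b`.
theorem matP_matC : matP * matC = 0 * matP := by decide +kernel
theorem matA'_matB' : matA' * matB' = matB' * matA' := by decide +kernel

end Letter

namespace PB

open Letter

variable {n : ℕ}

/-- The path in the slot `k` which corresponds to a letter. -/
def letter (k : Fin (n + 1)) : Letter → PB n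
  | o => 1
  | a => slotA k
  | b => slotB k
  | ab => slotA k * slotB k
  | ba => slotB k * slotA k
  | c => slotC k

/-- The path which corresponds to a word. -/
def word (w : Fin (n + 1) → Letter) : PB n := (List.ofFn fun k => letter k (w k)).prod

/-- The linear extension of `word`. -/
def evalWord : ((Fin (n + 1) → Letter) → F) →ₗ[F] PB n := Fintype.linearCombination F word

theorem evalWord_single (w : Fin (n + 1) → Letter) : evalWord (Pi.single w 1) = word w := by
  simp [evalWord, Fintype.linearCombination_apply_single]

/-- A product is multilinear in its factors, so a matrix acting on one letter substitutes a linear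
combination of letters for the corresponding factor. -/
theorem evalWord_localOp_single (k : Fin (n + 1)) (m : Matrix Letter Letter F)
    (w : Fin (n + 1) → Letter) : evalWord (localOp k m (Pi.single w 1)) =
      (List.ofFn (Function.update (fun j => letter j (w j)) k
        (∑ r, m r (w k) • letter k r))).prod := by
  have h := (MultilinearMap.mkPiAlgebraFin F (n + 1) (PB n)).map_update_sum Finset.univ k
    (fun r => m r (w k) • letter k r) (fun j => letter j (w j))
  simp only [MultilinearMap.mkPiAlgebraFin_apply, MultilinearMap.map_update_smul] at h
  rw [h, localOp_single, map_sum]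
  refine Finset.sum_congr rfl fun r _ => ?_
  rw [map_smul, evalWord_single, word]
  congr 3
  ext j
  by_cases e : j = k
  · subst e; simp
  · simp [Function.update_of_ne e]

theorem evalWord_induction {P : ((Fin (n + 1) → Letter) → F) → Prop} (h0 : P 0)
    (h : ∀ w, P (Pi.single w 1)) (hadd : ∀ u v, P u → P v → P (u + v))
    (v : (Fin (n + 1) → Letter) → F) : P v := by
  have : v = ∑ w, v w • (Pi.single w 1 : (Fin (n + 1) → Letter) → F) := by
    ext u
    simp [Finset.sum_apply, Pi.single_apply]
  rw [this]
  refine Finset.sum_induction _ P hadd h0 fun w _ => ?_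
  obtain e | e : v w = 0 ∨ v w = 1 := by generalize v w = x; revert x; decide
  · rw [e, zero_smul]; exact h0
  · rw [e, one_smul]; exact h w

/-- Since `x` commutes with the letters of the other slots, its multiplication table against the six
letters of the slot `k` determines left multiplication on all words. -/
theorem mul_evalWord (k : Fin (n + 1)) (m : Matrix Letter Letter F) (x : PB n)
    (hx : ∀ j, j ≠ k → ∀ t, Commute x (letter j t))
    (hm : ∀ t, x * letter k t = ∑ r, m r t • letter k r) (v : (Fin (n + 1) → Letter) → F) :
    evalWord (localOp k m v) = x * evalWord v := by
  induction v using evalWord_induction with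
  | h0 => simp
  | h w =>
    rw [evalWord_localOp_single, evalWord_single, word, mul_prod_ofFn _ k x fun j hj => hx j hj _,
      hm]
  | hadd u v hu hv => rw [map_add, map_add, map_add, hu, hv, mul_add]

theorem slotA_evalWord (k : Fin (n + 1)) (v : (Fin (n + 1) → Letter) → F) :
    evalWord (localOp k matA v) = slotA k * evalWord v := by
  refine mul_evalWord k _ _ ?_ ?_ v
  · intro j hj t
    have hA := slotA_slotA k j
    have hB := slotA_slotB hj.symm
    cases t with
    | o => exact Commute.one_right _
    | a => exact hA
    | b => exact hB
    | ab => exact hA.mul_right hB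
    | ba => exact hB.mul_right hA
    | c => exact (slotC_slotA j k).symm
  · intro t
    cases t <;> simp [sum_eq, letter, matA, slotA_mul_slotA, slotA_mul_slotC,
      ← mul_assoc]
    -- The case left over is `a · ba`, which vanishes since the label of `a` cannot be repeated.
    rw [mul_assoc, slotA_slotB_slotA]

theorem slotB_evalWord (k : Fin (n + 1)) (v : (Fin (n + 1) → Letter) → F) :
    evalWord (localOp k matB v) = slotB k * evalWord v := by
  refine mul_evalWord k _ _ ?_ ?_ v
  · intro j hj t
    have hA := (slotA_slotB hj).symm
    have hB := slotB_slotB k j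
    cases t with
    | o => exact Commute.one_right _
    | a => exact hA
    | b => exact hB
    | ab => exact hA.mul_right hB
    | ba => exact hB.mul_right hA
    | c => exact (slotC_slotB j k).symm
  · intro t
    cases t <;> simp [sum_eq, letter, matB, slotB_mul_slotB, slotB_mul_slotC,
      ← mul_assoc]
    rw [mul_assoc, slotB_slotA_slotB]

theorem slotC_evalWord (k : Fin (n + 1)) (v : (Fin (n + 1) → Letter) → F) :
    evalWord (localOp k matC v) = slotC k * evalWord v := by
  refine mul_evalWord k _ _ ?_ ?_ v
  · intro j hj t
    have hA := slotC_slotA k j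
    have hB := slotC_slotB k j
    cases t with
    | o => exact Commute.one_right _
    | a => exact hA
    | b => exact hB
    | ab => exact hA.mul_right hB
    | ba => exact hB.mul_right hA
    | c => exact slotC_slotC k j
  · intro t
    cases t <;> simp [sum_eq, letter, matC, slotC_mul_slotA, slotC_mul_slotB, slotC_mul_slotC,
      ← mul_assoc]

theorem d_letter (k : Fin (n + 1)) (t : Letter) :
    d (letter k t) = ∑ r, matD r t • letter k r := by
  cases t <;> simp [sum_eq, letter, matD, d_slotA, d_slotB, d_slotC, d_mul, dOf_one]

theorem d_evalWord (v : (Fin (n + 1) → Letter) → F) :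
    d (evalWord v) = evalWord (∑ k, localOp k matD v) := by
  induction v using evalWord_induction with
  | h0 => simp
  | h w =>
    rw [evalWord_single, word, derivation_prod_ofFn d (dOf_one _ _ _) d_mul, map_sum]
    refine Finset.sum_congr rfl fun k _ => ?_
    rw [evalWord_localOp_single, d_letter]
  | hadd u v hu hv => simp only [map_add, Finset.sum_add_distrib, hu, hv]

/-- The only letter in the image of the homotopy is `c`, so each resulting product has a factor in
the line spanned by `slotC k`. This keeps primitives inside the kernel of any map that kills the
`c`. -/
theorem evalWord_matH {M : Type} [Ring M] [Algebra F M] (f : PB n →ₐ[F] M)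
    (hf : ∀ k, f (slotC k) = 0) (k : Fin (n + 1)) (v : (Fin (n + 1) → Letter) → F) :
    f (evalWord (localOp k matH v)) = 0 := by
  induction v using evalWord_induction with
  | h0 => simp
  | h w =>
    rw [evalWord_localOp_single, map_list_prod, List.map_ofFn]
    refine List.prod_eq_zero ?_
    rw [List.mem_ofFn]
    refine ⟨k, ?_⟩
    rw [Function.comp_apply, Function.update_self, sum_eq]
    have : ∀ r t, r ≠ c → matH r t = 0 := by intro r t; cases r <;> cases t <;> decide
    simp [this, letter, hf]
  | hadd u v hu hv => simp only [map_add, hu, hv, add_zero]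

/-! ### The contraction -/

theorem end_add_self {X : Type} (T : Module.End F (X → F)) : T + T = 0 :=
  LinearMap.ext fun v => funext fun x => CharTwo.add_self_eq_zero (T v x)

/-- The differential on functions on words. -/
def wordD : Module.End F ((Fin (n + 1) → Letter) → F) := ∑ k, localOp k matD

/-- The local differentials of the other slots commute with the operator and appear twice, so they
cancel in characteristic two. Only the slot `k` contributes. -/
theorem wordD_localOp (k : Fin (n + 1)) (m m' : Matrix Letter Letter F)
    (h : matD * m + m * matD = m') :
    wordD * localOp k m + localOp k m * wordD = localOp k m' := by
  rw [wordD, Finset.sum_mul, Finset.mul_sum, ← Finset.sum_add_distrib, Finset.sum_eq_single k]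
  · rw [← localOp_mul, ← localOp_mul, ← localOp_add, h]
  · intro j _ hj
    rw [(localOp_commute hj matD m).eq]
    exact end_add_self _
  · simp

/-- The projection onto commuting words, in the slots of a list. -/
def listP (l : List (Fin (n + 1))) : Module.End F ((Fin (n + 1) → Letter) → F) :=
  (l.map fun k => localOp k matP).prod

theorem listP_cons (k : Fin (n + 1)) (l : List (Fin (n + 1))) :
    listP (k :: l) = localOp k matP * listP l := by simp [listP]

theorem listP_not_mem {l : List (Fin (n + 1))} {k : Fin (n + 1)} (hk : k ∉ l)
    (m : Matrix Letter Letter F) : listP l * localOp k m = localOp k m * listP l := by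
  induction l with
  | nil => simp [listP]
  | cons j l ih =>
    simp only [List.mem_cons, not_or] at hk
    rw [listP_cons, mul_assoc, ih hk.2, ← mul_assoc, (localOp_commute (Ne.symm hk.1) _ _).eq,
      mul_assoc]

/-- Without repetitions in the list, `matP` is applied exactly once in the slot `k`; the remaining
factors act in other slots and commute. -/
theorem listP_mem {l : List (Fin (n + 1))} (hl : l.Nodup) {k : Fin (n + 1)} (hk : k ∈ l)
    {m m' : Matrix Letter Letter F} (h : matP * m = m' * matP) :
    listP l * localOp k m = localOp k m' * listP l := by
  induction l with
  | nil => simp at hk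
  | cons j l ih =>
    rw [List.nodup_cons] at hl
    rw [listP_cons, mul_assoc]
    by_cases e : k = j
    · subst e
      rw [listP_not_mem hl.1, ← mul_assoc, ← localOp_mul, h, localOp_mul, mul_assoc]
    · rw [ih hl.2 ((List.mem_cons.1 hk).resolve_left e), ← mul_assoc,
        (localOp_commute (Ne.symm e) _ _).eq, mul_assoc]

/-- The retraction is performed one slot at a time. On closed vectors each local projection differs
from the identity by a boundary, and the primitives add up. They are kept in the span of the images
of the local homotopies because those words contain a `c`. -/
theorem listP_homotopy (l : List (Fin (n + 1))) (v : (Fin (n + 1) → Letter) → F)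
    (hv : wordD v = 0) : wordD (listP l v) = 0 ∧
      ∃ u ∈ Submodule.span F {x | ∃ k y, localOp k matH y = x}, v = wordD u + listP l v := by
  induction l with
  | nil => exact ⟨hv, 0, zero_mem _, by simp [listP]⟩
  | cons k l ih =>
    obtain ⟨h, u, hu, e⟩ := ih
    have key := LinearMap.congr_fun (wordD_localOp k matH _ matD_matH) (listP l v)
    simp only [LinearMap.add_apply, Module.End.mul_apply, h, map_zero, add_zero, localOp_add,
      localOp_one, Module.End.one_apply] at key
    have e' : localOp k matP (listP l v) = wordD (localOp k matH (listP l v)) + listP l v := by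
      rw [key, add_comm (listP l v), add_assoc]
      rw [show listP l v + listP l v = 0 from funext fun _ => CharTwo.add_self_eq_zero _, add_zero]
    have hDD : ∀ w : (Fin (n + 1) → Letter) → F, wordD (wordD w) = 0 := by
      intro w
      have : (wordD : Module.End F ((Fin (n + 1) → Letter) → F)) * wordD = 0 := by
        have h2 : ∀ j : Fin (n + 1), wordD * localOp j matD = localOp j matD * wordD := by
          intro j
          have := wordD_localOp j matD 0 (by rw [matD_matD]; simp)
          rw [localOp_zero] at this
          exact (add_right_cancel (this.trans (end_add_self _).symm))
        -- The square of a local differential vanishes, and the mixed products occur in equal pairs.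
        -- No Koszul signs are needed in characteristic two.
        have h3 : ∀ s : Finset (Fin (n + 1)), (∑ j ∈ s, localOp j matD :
            Module.End F ((Fin (n + 1) → Letter) → F)) * ∑ j ∈ s, localOp j matD = 0 := by
          intro s
          induction s using Finset.induction_on with
          | empty => simp
          | insert j s hj ih =>
            rw [Finset.sum_insert hj, add_mul, mul_add, mul_add, ih, ← localOp_mul, matD_matD,
              localOp_zero, zero_add, add_zero, Finset.mul_sum, Finset.sum_mul,
              ← Finset.sum_add_distrib]
            refine Finset.sum_eq_zero fun i hi => ?_
            have : j ≠ i := fun e => hj (e ▸ hi)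
            rw [(localOp_commute this matD matD).eq]
            exact end_add_self _
        exact h3 _
      exact LinearMap.congr_fun this w
    refine ⟨?_, u + localOp k matH (listP l v), add_mem hu (Submodule.subset_span ⟨_, _, rfl⟩), ?_⟩
    · rw [listP_cons, Module.End.mul_apply, e', map_add, hDD, h, add_zero]
    · rw [listP_cons, Module.End.mul_apply, e', map_add, add_assoc,
        ← add_assoc (wordD (localOp k matH (listP l v))),
        show wordD (localOp k matH (listP l v)) + wordD (localOp k matH (listP l v)) = 0 from
          funext fun _ => CharTwo.add_self_eq_zero _, zero_add]
      exact e

end PB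

/-! ### The representation of `R_n ⊠ R_n` on words -/

section MoveOp

variable {I L : Type} [Fintype I] [DecidableEq I] [AddCommGroup L] [Module F L]

/-- The operator on vectors which maps the coordinate `p'` to the coordinate `p` by `T`. -/
def moveOp (p p' : I) (T : Module.End F L) : Module.End F (I → L) :=
  (LinearMap.single F (fun _ => L) p).comp (T.comp (LinearMap.proj p'))

theorem moveOp_apply (p p' : I) (T : Module.End F L) (v : I → L) :
    moveOp p p' T v = Pi.single p (T (v p')) := rfl

theorem moveOp_mul (p p' p'' : I) (T U : Module.End F L) :
    moveOp p p' T * moveOp p' p'' U = moveOp p p'' (T * U) := by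
  refine LinearMap.ext fun v => ?_
  simp [moveOp_apply]

theorem moveOp_mul_ne {p p' r s : I} (h : p' ≠ r) (T U : Module.End F L) :
    moveOp p p' T * moveOp r s U = 0 := by
  refine LinearMap.ext fun v => ?_
  simp [moveOp_apply, h]

theorem sum_moveOp : ∑ p : I, moveOp p p (1 : Module.End F L) = 1 := by
  refine LinearMap.ext fun v => ?_
  simp only [LinearMap.sum_apply, moveOp_apply, Module.End.one_apply]
  exact Finset.univ_sum_single v

/-- An operator acting on all coordinates. -/
def diagOp (T : Module.End F L) : Module.End F (I → L) :=
  LinearMap.pi fun p => T.comp (LinearMap.proj p)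

theorem diagOp_apply (T : Module.End F L) (v : I → L) (p : I) : diagOp T v p = T (v p) := rfl

theorem diagOp_mul_moveOp (T U : Module.End F L) (p p' : I) :
    diagOp T * moveOp p p' U = moveOp p p' (T * U) := by
  refine LinearMap.ext fun v => funext fun q => ?_
  simp only [Module.End.mul_apply, diagOp_apply, moveOp_apply, Pi.single_apply]
  split_ifs <;> simp

theorem moveOp_mul_diagOp (T U : Module.End F L) (p p' : I) :
    moveOp p p' U * diagOp T = moveOp p p' (U * T) := rfl

theorem moveOp_add (p p' : I) (T U : Module.End F L) :
    moveOp p p' (T + U) = moveOp p p' T + moveOp p p' U := by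
  refine LinearMap.ext fun v => ?_
  simp [moveOp_apply, Pi.single_add]

theorem moveOp_zero (p p' : I) : moveOp p p' (0 : Module.End F L) = 0 := by
  refine LinearMap.ext fun v => ?_
  simp [moveOp_apply]

end MoveOp

/-- Operators in slots such that those in different slots commute. -/
structure SlotOps (n : ℕ) (A : Type) [Ring A] where
  a : Fin (n + 1) → A
  b : Fin (n + 1) → A
  c : Fin (n + 1) → A
  aa : ∀ {j k}, j ≠ k → Commute (a j) (a k)
  ab : ∀ {j k}, j ≠ k → Commute (a j) (b k)
  bb : ∀ {j k}, j ≠ k → Commute (b j) (b k)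
  ca : ∀ {j k}, j ≠ k → Commute (c j) (a k)
  cb : ∀ {j k}, j ≠ k → Commute (c j) (b k)
  cc : ∀ {j k}, j ≠ k → Commute (c j) (c k)

namespace PB

open GenB (Rel)

variable {n : ℕ}

section Rep

variable {L : Type} [AddCommGroup L] [Module F L]
  (σ : SlotOps n (Module.End F L))

/-- The action of the generators of `R_n ⊠ R_n` given by operators in slots. -/
def repGen : GenB n → Module.End F (V n × V n → L)
  | .e x y => moveOp (x, y) (x, y) 1
  | .l s x x' y _ => moveOp (x, y) (x', y) (σ.a s.succ)
  | .r t x y y' _ => moveOp (x, y) (x, y') (σ.b t.castSucc)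
  | .c s _ _ x x' y y' _ _ => moveOp (x, y) (x', y') (σ.c s.succ)

/-- Two consecutive arrows in the same coordinate have different labels and therefore act in
different slots. The relation `a_s b_t = b_t a_s` is imposed only for `t ≠ s + 1`, which again means
different slots. So commutation across slots is all that the relations ask for, and nothing is
required inside a slot. -/
theorem repGen_rel ⦃u v : FreeAlgebra F (GenB n)⦄ (h : Rel n u v) :
    FreeAlgebra.lift F (repGen σ) u = FreeAlgebra.lift F (repGen σ) v := by
  have succ_ne : ∀ {s t : Fin n}, s ≠ t → s.succ ≠ t.succ :=
    fun h e => h (Fin.succ_injective _ e)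
  have cast_ne : ∀ {s t : Fin n}, s ≠ t → s.castSucc ≠ t.castSucc :=
    fun h e => h (Fin.castSucc_injective _ e)
  cases h with
  | orth x y x' y' h =>
    simp only [map_mul, FreeAlgebra.lift_ι_apply, repGen, map_zero]
    exact moveOp_mul_ne h _ _
  | unit =>
    simp only [map_sum, FreeAlgebra.lift_ι_apply, repGen, map_one]
    exact sum_moveOp
  | idem | source_l | target_l | source_r | target_r | source_c | target_c =>
    simp only [map_mul, FreeAlgebra.lift_ι_apply, repGen, moveOp_mul, one_mul, mul_one]
  | r_r s t x y y' y'' y''' h₁ h₂ =>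
    simp only [map_mul, FreeAlgebra.lift_ι_apply, repGen, moveOp_mul]
    rw [(σ.bb (cast_ne (GenB.arrow_ne h₁ h₂).symm)).eq]
  | l_l s t x x' x'' x''' y h₁ h₂ =>
    simp only [map_mul, FreeAlgebra.lift_ι_apply, repGen, moveOp_mul]
    rw [(σ.aa (succ_ne (GenB.arrow_ne h₁ h₂).symm)).eq]
  | l_r s t hst =>
    simp only [map_mul, FreeAlgebra.lift_ι_apply, repGen, moveOp_mul]
    rw [(σ.ab fun e => hst (by simpa using (congrArg Fin.val e).symm)).eq]
  | c_r s s' t hs x x' y y' y'' y''' h h₁ h₂ =>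
    simp only [map_mul, FreeAlgebra.lift_ι_apply, repGen, moveOp_mul]
    rw [slot_eq hs, (σ.cb (cast_ne (GenB.arrow_ne h₁ h₂).symm)).eq]
  | c_l s s' t hs x x' x'' x''' y y' h₁ h h₂ =>
    simp only [map_mul, FreeAlgebra.lift_ι_apply, repGen, moveOp_mul]
    rw [(σ.ca (succ_ne (GenB.arrow_ne h₁ h₂).symm)).eq]
  | c_c s s' t t' hs ht x x' x'' x''' y y' y'' y''' h₁ k₁ h₂ k₂ =>
    simp only [map_mul, FreeAlgebra.lift_ι_apply, repGen, moveOp_mul]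
    rw [(σ.cc (succ_ne (GenB.arrow_ne h₁ h₂).symm)).eq]

/-- The representation of `R_n ⊠ R_n` given by operators in slots. -/
def rep : PB n →ₐ[F] Module.End F (V n × V n → L) :=
  RingQuot.liftAlgHom F ⟨FreeAlgebra.lift F (repGen σ), repGen_rel σ⟩

theorem rep_gen (x : GenB n) : rep σ (gen (Rel n) x) = repGen σ x := by
  simp [rep, gen, RingQuot.liftAlgHom_mkAlgHom_apply]

theorem diagOp_rep {σ τ : SlotOps n (Module.End F L)} {T : Module.End F L}
    (ha : ∀ s : Fin n, T * σ.a s.succ = τ.a s.succ * T)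
    (hb : ∀ t : Fin n, T * σ.b t.castSucc = τ.b t.castSucc * T)
    (hc : ∀ s : Fin n, T * σ.c s.succ = τ.c s.succ * T) (u : PB n) :
    diagOp T * rep σ u = rep τ u * diagOp T := by
  induction u using pres_induction with
  | one => simp
  | gen x =>
    rw [rep_gen, rep_gen]
    cases x <;> simp only [repGen, diagOp_mul_moveOp, moveOp_mul_diagOp, mul_one, one_mul, ha, hb, hc]
  | mul a b h1 h2 => rw [map_mul, map_mul, ← mul_assoc, h1, mul_assoc, h2, mul_assoc]
  | add a b h1 h2 => rw [map_add, map_add, mul_add, add_mul, h1, h2]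
  | zero => simp

end Rep

open Letter

/-- The slot operators on functions on words. -/
def wordOps (n : ℕ) : SlotOps n (Module.End F ((Fin (n + 1) → Letter) → F)) where
  a k := localOp k matA
  b k := localOp k matB
  c k := localOp k matC
  aa h := localOp_commute h _ _
  ab h := localOp_commute h _ _
  bb h := localOp_commute h _ _
  ca h := localOp_commute h _ _
  cb h := localOp_commute h _ _
  cc h := localOp_commute h _ _

/-- The slot operators on functions on words in commuting letters. -/
def wordOps' (n : ℕ) : SlotOps n (Module.End F ((Fin (n + 1) → Letter) → F)) where
  a k := localOp k matA'
  b k := localOp k matB'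
  c k := localOp k 0
  aa h := localOp_commute h _ _
  ab h := localOp_commute h _ _
  bb h := localOp_commute h _ _
  ca h := localOp_commute h _ _
  cb h := localOp_commute h _ _
  cc h := localOp_commute h _ _

/-- The right-hand side is a commutator, hence a derivation in `u`, so generators suffice.
Idempotents and the arrows `a`, `b` commute with the differential on words; for `c` the claim is the
local identity `matD_matC`. -/
theorem rep_d (u : PB n) : rep (wordOps n) (d u) =
    diagOp wordD * rep (wordOps n) u + rep (wordOps n) u * diagOp wordD := by
  have two : ∀ T : Module.End F (V n × V n → (Fin (n + 1) → Letter) → F), T + T = 0 :=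
    fun T => LinearMap.ext fun v => funext fun p => funext fun x =>
      CharTwo.add_self_eq_zero (T v p x)
  have comm : ∀ k m, matD * m = m * matD → wordD * localOp k m =
      (localOp k m * wordD : Module.End F ((Fin (n + 1) → Letter) → F)) := by
    intro k m h
    have h0 : matD * m + m * matD = 0 := by
      rw [h]; ext i j; exact CharTwo.add_self_eq_zero _
    have := wordD_localOp k m 0 h0
    rw [localOp_zero] at this
    exact add_right_cancel (this.trans (end_add_self _).symm)
  induction u using pres_induction with
  | one => rw [dOf_one, map_zero, map_one, mul_one, one_mul, two]
  | gen x =>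
    rw [dOf_gen]
    cases x with
    | e => simp only [GenB.D, map_zero, rep_gen, repGen, diagOp_mul_moveOp, moveOp_mul_diagOp,
        mul_one, one_mul, two]
    | l => simp only [GenB.D, map_zero, rep_gen, repGen, diagOp_mul_moveOp, moveOp_mul_diagOp,
        wordOps, comm _ _ matD_matA, two]
    | r => simp only [GenB.D, map_zero, rep_gen, repGen, diagOp_mul_moveOp, moveOp_mul_diagOp,
        wordOps, comm _ _ matD_matB, two]
    | c s t hst =>
      simp only [GenB.D, map_add, map_mul, rep_gen, repGen, diagOp_mul_moveOp, moveOp_mul_diagOp,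
        wordOps, moveOp_mul, ← moveOp_add, wordD_localOp _ _ _ matD_matC, slot_eq hst,
        ← localOp_mul, ← localOp_add]
  | mul a b h1 h2 =>
    rw [d_mul, map_add, map_mul, map_mul, map_mul, h1, h2, add_mul, mul_add]
    simp only [mul_assoc]
    rw [add_assoc, ← add_assoc (rep (wordOps n) a * (diagOp wordD * rep (wordOps n) b)), two,
      zero_add]
  | add a b h1 h2 =>
    simp only [map_add, h1, h2, mul_add, add_mul]
    abel
  | zero => simp

/-- The empty word, based at a vertex. -/
def baseVec (q : V n × V n) : V n × V n → (Fin (n + 1) → Letter) → F :=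
  Pi.single q (Pi.single (fun _ => o) 1)

/-- The element of `R_n ⊠ R_n` ending in `q` with given coordinates. -/
def evalVec (q : V n × V n) : (V n × V n → (Fin (n + 1) → Letter) → F) →+ PB n where
  toFun v := ∑ p, e p * evalWord (v p) * e q
  map_zero' := by simp
  map_add' u v := by simp [mul_add, add_mul, Finset.sum_add_distrib]

theorem evalVec_apply (q : V n × V n) (v : V n × V n → (Fin (n + 1) → Letter) → F) :
    evalVec q v = ∑ p, e p * evalWord (v p) * e q := rfl

theorem evalVec_single (q p : V n × V n) (v : (Fin (n + 1) → Letter) → F) :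
    evalVec q (Pi.single p v) = e p * evalWord v * e q := by
  rw [evalVec_apply, Finset.sum_eq_single p]
  · simp
  · intro r _ hr; simp [Pi.single_eq_of_ne hr]
  · simp

theorem evalVec_baseVec (q : V n × V n) : evalVec q (baseVec q) = e q := by
  rw [baseVec, evalVec_single, evalWord_single]
  have : word (fun _ : Fin (n + 1) => o) = 1 := by simp [word, letter]
  rw [this, mul_one, e_mul_self]

/-- The local matrices were chosen as the multiplication tables of the slots, so the formal action
becomes left multiplication after evaluation. Evaluation need not be injective: a word which does
not fit its vertices just evaluates to zero. -/
theorem evalVec_rep (q : V n × V n) (u : PB n) (v : V n × V n → (Fin (n + 1) → Letter) → F) :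
    evalVec q (rep (wordOps n) u v) = u * evalVec q v := by
  have key : ∀ (m : Option (Fin n) × Option (Fin n)) (p p' : V n × V n) (x : PB n)
      (v : V n × V n → (Fin (n + 1) → Letter) → F),
      PairArrow m p p' → arr m p p' = x → x * evalVec q v = e p * (tot m * evalWord (v p')) * e q := by
    rintro m p p' x v h rfl
    rw [e_mul_tot_mul m h, evalVec_apply, Finset.mul_sum, Finset.sum_eq_single p']
    · simp only [mul_assoc]
    · intro r _ hr
      rw [mul_assoc, arr_mul, ← mul_assoc (e p'), e_mul_ne hr.symm, zero_mul, mul_zero]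
    · simp
  induction u using pres_induction generalizing v with
  | one => simp
  | gen x =>
    rw [rep_gen]
    cases x with
    | e x y =>
      rw [repGen, moveOp_apply, evalVec_single, evalVec_apply, Finset.mul_sum,
        Finset.sum_eq_single (x, y)]
      · rw [← mul_assoc, ← mul_assoc]
        change _ = e (x, y) * e (x, y) * _ * _
        rw [e_mul_self]; rfl
      · intro r _ hr
        rw [← mul_assoc, ← mul_assoc]
        change e (x, y) * e r * _ * _ = _
        rw [e_mul_ne hr.symm, zero_mul, zero_mul]
      · simp
    | l s x x' y h =>
      rw [repGen, moveOp_apply, evalVec_single, key (some s, none) (x, y) (x', y) _ _ ⟨h, rfl⟩ (arr_l y h)]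
      exact congrArg (fun t => e (x, y) * t * e q) (slotA_evalWord _ _)
    | r t x y y' h =>
      rw [repGen, moveOp_apply, evalVec_single, key (none, some t) (x, y) (x, y') _ _ ⟨rfl, h⟩ (arr_r x h)]
      refine congrArg (fun t => e (x, y) * t * e q) ((slotB_evalWord _ _).trans ?_)
      rw [slotB_castSucc]
    | c s t hst x x' y y' h h' =>
      rw [repGen, moveOp_apply, evalVec_single,
        key (some s, some t) (x, y) (x', y') _ _ ⟨h, h'⟩ (arr_c hst h h')]
      refine congrArg (fun t => e (x, y) * t * e q) ((slotC_evalWord _ _).trans ?_)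
      rw [slotC_succ hst]
  | mul a b h1 h2 => rw [map_mul, Module.End.mul_apply, h1, h2, mul_assoc]
  | add a b h1 h2 => rw [map_add, LinearMap.add_apply, map_add, h1, h2, add_mul]
  | zero => simp

/-- Let `u` act on the empty words, whose evaluations are the idempotents with sum one. This lets
elements be handled through coordinates without any linear independence of paths. -/
theorem eq_sum_evalVec (u : PB n) : u = ∑ q, evalVec q (rep (wordOps n) u (baseVec q)) := by
  simp only [evalVec_rep, evalVec_baseVec]
  rw [← Finset.mul_sum, sum_e, mul_one]

theorem d_evalVec (q : V n × V n) (v : V n × V n → (Fin (n + 1) → Letter) → F) :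
    d (evalVec q v) = evalVec q (diagOp wordD v) := by
  simp only [evalVec_apply, map_sum, d_mul, d_e, zero_mul, zero_add, mul_zero, add_zero,
    d_evalWord, diagOp_apply, wordD, LinearMap.sum_apply]

theorem wordD_empty : wordD (Pi.single (fun _ : Fin (n + 1) => o) 1) = 0 := by
  simp only [wordD, LinearMap.sum_apply, localOp_single]
  refine Finset.sum_eq_zero fun k _ => Finset.sum_eq_zero fun r _ => ?_
  have : ∀ r, matD r o = 0 := by intro r; cases r <;> decide
  rw [this, zero_smul]

/-- A cocycle of `R_n ⊠ R_n` on which the representation on words in commuting letters vanishes is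
the coboundary of an element in the ideal generated by the arrows `c`. -/
theorem exists_d_eq {u : PB n} (hd : d u = 0) (hu : rep (wordOps' n) u = 0) :
    ∃ w : PB n, d w = u ∧ ∀ {M : Type} [Ring M] [Algebra F M] (f : PB n →ₐ[F] M),
      (∀ k, f (slotC k) = 0) → f w = 0 := by
  -- The product of all local projections intertwines the two representations, and the commuting one
  -- vanishes on `u`.
  have hP : ∀ q p, listP (List.finRange (n + 1)) (rep (wordOps n) u (baseVec q) p) = 0 := by
    intro q p
    have h1 : ∀ k, k ∈ List.finRange (n + 1) := List.mem_finRange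
    have h2 := List.nodup_finRange (n + 1)
    have := diagOp_rep (σ := wordOps n) (τ := wordOps' n) (T := listP (List.finRange (n + 1)))
      (fun s => listP_mem h2 (h1 _) matP_matA) (fun s => listP_mem h2 (h1 _) matP_matB)
      (fun s => listP_mem h2 (h1 _) matP_matC) u
    rw [hu, zero_mul] at this
    exact congrFun (LinearMap.congr_fun this (baseVec q)) p
  -- The empty word is closed, so the image of a base vector under a cocycle is closed.
  have hD : ∀ q p, wordD (rep (wordOps n) u (baseVec q) p) = 0 := by
    intro q p
    have h := LinearMap.congr_fun (rep_d u) (baseVec q)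
    rw [hd, map_zero, LinearMap.add_apply, Module.End.mul_apply, Module.End.mul_apply] at h
    have hb : diagOp wordD (baseVec q) = 0 := by
      funext r
      rw [diagOp_apply, baseVec]
      by_cases e : r = q
      · subst e; simp [wordD_empty]
      · simp [e]
    rw [hb, map_zero, add_zero] at h
    exact (congrFun h p).symm
  choose w hw hw' using fun q p => (listP_homotopy (List.finRange (n + 1)) _ (hD q p)).2
  refine ⟨∑ q, evalVec q (w q), ?_, ?_⟩
  · rw [map_sum]
    conv_rhs => rw [eq_sum_evalVec u]
    refine Finset.sum_congr rfl fun q _ => ?_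
    rw [d_evalVec]
    congr 1
    funext p
    rw [diagOp_apply, hw' q p, hP q p, add_zero]
  · intro M _ _ f hf
    -- The coordinates of the primitive are combinations of words produced by the local homotopies,
    -- and each of these contains a `c`.
    have : ∀ x ∈ Submodule.span F {x : (Fin (n + 1) → Letter) → F | ∃ k y, localOp k matH y = x},
        f (evalWord x) = 0 := by
      intro x hx
      induction hx using Submodule.span_induction with
      | mem x hx => obtain ⟨k, y, rfl⟩ := hx; exact evalWord_matH f hf k y
      | zero => simp
      | add x y _ _ h1 h2 => simp [h1, h2]
      | smul c x _ h => simp [h]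
    rw [map_sum]
    refine Finset.sum_eq_zero fun q _ => ?_
    rw [evalVec_apply, map_sum]
    refine Finset.sum_eq_zero fun p _ => ?_
    rw [map_mul, map_mul, this _ (hw q p), mul_zero, zero_mul]

end PB

/-! ### Relations in `R_n` -/

namespace PR

open GenR (Rel)

variable {n : ℕ}

theorem rel_mul {a b u v : GenR n} (h : Rel n (GenR.ι a * GenR.ι b) (GenR.ι u * GenR.ι v)) :
    gen (Rel n) a * gen (Rel n) b = gen (Rel n) u * gen (Rel n) v := by
  simpa only [map_mul, mkAlgHom_ι] using GenR.gen_eq h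

theorem rel_single {a b u : GenR n} (h : Rel n (GenR.ι a * GenR.ι b) (GenR.ι u)) :
    gen (Rel n) a * gen (Rel n) b = gen (Rel n) u := by
  simpa only [map_mul, mkAlgHom_ι] using GenR.gen_eq h

/-- The idempotent of a vertex of `Γ_n`. -/
abbrev e (x : V n) : Pres (Rel n) := gen (Rel n) (GenR.e x)

theorem e_mul_self (x : V n) : e x * e x = e x := rel_single (Rel.idem x)

theorem e_mul_ne {x y : V n} (h : x ≠ y) : e x * e y = 0 := by
  simpa only [map_mul, mkAlgHom_ι, map_zero] using GenR.gen_eq (Rel.orth x y h)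

theorem sum_e : ∑ x : V n, e x = 1 := by
  simpa only [map_sum, mkAlgHom_ι, map_one] using GenR.gen_eq (Rel.unit (n := n))

/-- An algebra map out of `R_n`. -/
def lift {M : Type} [Ring M] [Algebra F M] (g : GenR n → M)
    (he : ∀ x, g (.e x) * g (.e x) = g (.e x)) (hne : ∀ x y, x ≠ y → g (.e x) * g (.e y) = 0)
    (h1 : ∑ x, g (.e x) = 1)
    (hs : ∀ s x y h, g (.e x) * g (.r s x y h) = g (.r s x y h))
    (ht : ∀ s x y h, g (.r s x y h) * g (.e y) = g (.r s x y h))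
    (hc : ∀ s t x y z w h₁ h₂ h₃ h₄, g (.r s x y h₁) * g (.r t y w h₂) =
      g (.r t x z h₃) * g (.r s z w h₄)) : Pres (Rel n) →ₐ[F] M :=
  RingQuot.liftAlgHom F ⟨FreeAlgebra.lift F g, by
    intro a b h
    cases h with
    | unit => simpa only [map_sum, FreeAlgebra.lift_ι_apply, map_one] using h1
    | orth x y h => simpa only [map_mul, FreeAlgebra.lift_ι_apply, map_zero] using hne x y h
    | idem x => simpa only [map_mul, FreeAlgebra.lift_ι_apply] using he x
    | source => simpa only [map_mul, FreeAlgebra.lift_ι_apply] using hs _ _ _ _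
    | target => simpa only [map_mul, FreeAlgebra.lift_ι_apply] using ht _ _ _ _
    | comm => simpa only [map_mul, FreeAlgebra.lift_ι_apply] using hc _ _ _ _ _ _ _ _ _ _⟩

theorem lift_gen {M : Type} [Ring M] [Algebra F M] (g : GenR n → M) (he hne h1 hs ht hc)
    (x : GenR n) : lift g he hne h1 hs ht hc (gen (Rel n) x) = g x := by
  simp [lift, gen, RingQuot.liftAlgHom_mkAlgHom_apply]

end PR

/-! ### The projection from `R_n ⊠ R_n` to `R_n ⊗ R_n` -/

namespace PB

open GenB (Rel)

variable {n : ℕ}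

/-- The algebra underlying `R_n ⊗ R_n`. -/
abbrev PRR (n : ℕ) : Type := Pres (GenR.Rel n) ⊗[F] Pres (GenR.Rel n)

/-- The projection `R_n ⊠ R_n → R_n ⊗ R_n` on the generators. -/
def projGen : GenB n → PRR n
  | .e x y => PR.e x ⊗ₜ[F] PR.e y
  | .l s x x' y h => gen (GenR.Rel n) (.r s x x' h) ⊗ₜ[F] PR.e y
  | .r t x y y' h => PR.e x ⊗ₜ[F] gen (GenR.Rel n) (.r t y y' h)
  | .c _ _ _ _ _ _ _ _ _ => 0

theorem projGen_rel ⦃u v : FreeAlgebra F (GenB n)⦄ (h : Rel n u v) :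
    FreeAlgebra.lift F (projGen (n := n)) u = FreeAlgebra.lift F projGen v := by
  cases h with
  | orth x y x' y' h =>
    simp only [map_mul, FreeAlgebra.lift_ι_apply, projGen, map_zero,
      Algebra.TensorProduct.tmul_mul_tmul]
    by_cases e : x = x'
    · subst e
      have hy : y ≠ y' := by rintro rfl; exact h rfl
      rw [PR.e_mul_ne hy, TensorProduct.tmul_zero]
    · rw [PR.e_mul_ne e, TensorProduct.zero_tmul]
  | unit =>
    simp only [map_sum, FreeAlgebra.lift_ι_apply, projGen, map_one]
    rw [Fintype.sum_prod_type]
    simp only [← TensorProduct.tmul_sum, ← TensorProduct.sum_tmul, PR.sum_e]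
    rfl
  | idem | source_l | target_l | source_r | target_r =>
    simp only [map_mul, FreeAlgebra.lift_ι_apply, projGen, Algebra.TensorProduct.tmul_mul_tmul,
      PR.e_mul_self, PR.rel_single (GenR.Rel.source _ _ _ _),
      PR.rel_single (GenR.Rel.target _ _ _ _)]
  | source_c | target_c | c_c | c_r | c_l =>
    simp only [map_mul, FreeAlgebra.lift_ι_apply, projGen, mul_zero, zero_mul]
  | r_r s t x y y' y'' y''' h₁ h₂ h₃ h₄ =>
    simp only [map_mul, FreeAlgebra.lift_ι_apply, projGen, Algebra.TensorProduct.tmul_mul_tmul]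
    rw [PR.rel_mul (GenR.Rel.comm s t _ _ _ _ h₁ h₂ h₃ h₄)]
  | l_l s t x x' x'' x''' y h₁ h₂ h₃ h₄ =>
    simp only [map_mul, FreeAlgebra.lift_ι_apply, projGen, Algebra.TensorProduct.tmul_mul_tmul]
    rw [PR.rel_mul (GenR.Rel.comm s t _ _ _ _ h₁ h₂ h₃ h₄)]
  | l_r s t hst =>
    simp only [map_mul, FreeAlgebra.lift_ι_apply, projGen, Algebra.TensorProduct.tmul_mul_tmul,
      PR.rel_single (GenR.Rel.source _ _ _ _), PR.rel_single (GenR.Rel.target _ _ _ _)]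

/-- The projection `R_n ⊠ R_n → R_n ⊗ R_n`. -/
def proj (n : ℕ) : PB n →ₐ[F] PRR n :=
  RingQuot.liftAlgHom F ⟨FreeAlgebra.lift F projGen, projGen_rel⟩

theorem proj_gen (x : GenB n) : proj n (gen (Rel n) x) = projGen x := by
  simp [proj, gen, RingQuot.liftAlgHom_mkAlgHom_apply]

/-- The image is a subalgebra. It contains `x ⊗ 1` and `1 ⊗ x` for each generator `x`: expanding the
unit as the sum of the idempotents writes them as sums of images of generators. -/
theorem proj_surjective : Function.Surjective (proj n) := by
  rw [← AlgHom.range_eq_top, eq_top_iff]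
  have hmem : ∀ x : GenB n, projGen x ∈ (proj n).range := fun x => ⟨gen (Rel n) x, proj_gen x⟩
  have hl : ∀ a : Pres (GenR.Rel n), a ⊗ₜ[F] (1 : Pres (GenR.Rel n)) ∈ (proj n).range := by
    intro a
    induction a using pres_induction with
    | one => exact one_mem _
    | gen x =>
      rw [← PR.sum_e, TensorProduct.tmul_sum]
      refine sum_mem fun y _ => ?_
      cases x with
      | e x => exact hmem (.e x y)
      | r s x x' h => exact hmem (.l s x x' y h)
    | mul a b h1 h2 =>
      have := mul_mem h1 h2
      rwa [Algebra.TensorProduct.tmul_mul_tmul, mul_one] at this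
    | add a b h1 h2 => rw [TensorProduct.add_tmul]; exact add_mem h1 h2
    | zero => rw [TensorProduct.zero_tmul]; exact zero_mem _
  have hr : ∀ a : Pres (GenR.Rel n), (1 : Pres (GenR.Rel n)) ⊗ₜ[F] a ∈ (proj n).range := by
    intro a
    induction a using pres_induction with
    | one => exact one_mem _
    | gen x =>
      rw [← PR.sum_e, TensorProduct.sum_tmul]
      refine sum_mem fun y _ => ?_
      cases x with
      | e x => exact hmem (.e y x)
      | r s x x' h => exact hmem (.r s y x x' h)
    | mul a b h1 h2 =>
      have := mul_mem h1 h2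
      rwa [Algebra.TensorProduct.tmul_mul_tmul, mul_one] at this
    | add a b h1 h2 => rw [TensorProduct.tmul_add]; exact add_mem h1 h2
    | zero => rw [TensorProduct.tmul_zero]; exact zero_mem _
  intro t _
  induction t using TensorProduct.induction_on with
  | zero => exact zero_mem _
  | add x y hx hy => exact add_mem (hx trivial) (hy trivial)
  | tmul a b =>
    have := mul_mem (hl a) (hr b)
    rwa [Algebra.TensorProduct.tmul_mul_tmul, mul_one, one_mul] at this

theorem e_mul_gen_ne {p q : V n × V n} (h : p ≠ q) {x : PB n} (hx : e q * x = x) : e p * x = 0 := by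
  rw [← hx, ← mul_assoc, e_mul_ne h, zero_mul]

theorem mul_eq_zero_of_ne {p q : V n × V n} (h : p ≠ q) {x y : PB n} (hx : x * e p = x)
    (hy : e q * y = y) : x * y = 0 := by
  rw [← hx, mul_assoc, e_mul_gen_ne h hy, mul_zero]

/-! ### Maps out of `R_n ⊠ R_n` which factor through `R_n ⊗ R_n` -/

section Universal

variable {M : Type} [Ring M] [Algebra F M] (f : PB n →ₐ[F] M)

theorem sum_mul_sum_eq (u v : V n → PB n) (h : ∀ i j, i ≠ j → u i * v j = 0) :
    (∑ i, f (u i)) * ∑ j, f (v j) = ∑ i, f (u i * v i) := by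
  rw [Finset.sum_mul_sum]
  refine Finset.sum_congr rfl fun i _ => ?_
  rw [Finset.sum_eq_single i]
  · rw [map_mul]
  · intro j _ hj
    rw [← map_mul, h i j hj.symm, map_zero]
  · simp

theorem l_source {s : Fin n} {x x' : V n} (y : V n) (h : IsArrow s x x') :
    e (x, y) * gen (Rel n) (.l s x x' y h) = gen (Rel n) (.l s x x' y h) :=
  rel_single (Rel.source_l _ _ _ _ _)

theorem l_target {s : Fin n} {x x' : V n} (y : V n) (h : IsArrow s x x') :
    gen (Rel n) (.l s x x' y h) * e (x', y) = gen (Rel n) (.l s x x' y h) :=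
  rel_single (Rel.target_l _ _ _ _ _)

theorem r_source {s : Fin n} (x : V n) {y y' : V n} (h : IsArrow s y y') :
    e (x, y) * gen (Rel n) (.r s x y y' h) = gen (Rel n) (.r s x y y' h) :=
  rel_single (Rel.source_r _ _ _ _ _)

theorem r_target {s : Fin n} (x : V n) {y y' : V n} (h : IsArrow s y y') :
    gen (Rel n) (.r s x y y' h) * e (x, y') = gen (Rel n) (.r s x y y' h) :=
  rel_single (Rel.target_r _ _ _ _ _)

/-- The left generators. -/
def leftGen : GenR n → V n → PB n
  | .e x, y => e (x, y)
  | .r s x x' h, y => gen (Rel n) (.l s x x' y h)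

/-- The right generators. -/
def rightGen : GenR n → V n → PB n
  | .e y, x => e (x, y)
  | .r s y y' h, x => gen (Rel n) (.r s x y y' h)

theorem leftGen_mul_ne (a b : GenR n) {y y' : V n} (h : y ≠ y') :
    leftGen a y * leftGen b y' = 0 := by
  have key : ∀ x x', ((x, y) : V n × V n) ≠ (x', y') := fun x x' e => h (Prod.ext_iff.1 e).2
  cases a <;> cases b
  · exact e_mul_ne (key _ _)
  · exact mul_eq_zero_of_ne (key _ _) (e_mul_self _) (l_source _ _)
  · exact mul_eq_zero_of_ne (key _ _) (l_target _ _) (e_mul_self _)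
  · exact mul_eq_zero_of_ne (key _ _) (l_target _ _) (l_source _ _)

theorem rightGen_mul_ne (a b : GenR n) {x x' : V n} (h : x ≠ x') :
    rightGen a x * rightGen b x' = 0 := by
  have key : ∀ y y', ((x, y) : V n × V n) ≠ (x', y') := fun y y' e => h (Prod.ext_iff.1 e).1
  cases a <;> cases b
  · exact e_mul_ne (key _ _)
  · exact mul_eq_zero_of_ne (key _ _) (e_mul_self _) (r_source _ _)
  · exact mul_eq_zero_of_ne (key _ _) (r_target _ _) (e_mul_self _)
  · exact mul_eq_zero_of_ne (key _ _) (r_target _ _) (r_source _ _)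

/-- The map on the left factor induced by an algebra map out of `R_n ⊠ R_n`. -/
def liftLeft : Pres (GenR.Rel n) →ₐ[F] M :=
  PR.lift (fun a => ∑ y, f (leftGen a y))
    (fun x => by
      rw [sum_mul_sum_eq f _ _ fun _ _ h => leftGen_mul_ne _ _ h]
      exact Finset.sum_congr rfl fun y _ => congrArg f (e_mul_self _))
    (fun x x' h => by
      rw [sum_mul_sum_eq f _ _ fun _ _ h => leftGen_mul_ne _ _ h]
      refine Finset.sum_eq_zero fun y _ => ?_
      change f (e (x, y) * e (x', y)) = 0
      rw [e_mul_ne fun e => h (Prod.ext_iff.1 e).1, map_zero])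
    (by
      rw [← Fintype.sum_prod_type' fun x y => f (leftGen (.e x) y), ← map_one f, ← sum_e, map_sum]
      rfl)
    (fun s x x' h => by
      rw [sum_mul_sum_eq f _ _ fun _ _ h => leftGen_mul_ne _ _ h]
      exact Finset.sum_congr rfl fun y _ => congrArg f (l_source _ _))
    (fun s x x' h => by
      rw [sum_mul_sum_eq f _ _ fun _ _ h => leftGen_mul_ne _ _ h]
      exact Finset.sum_congr rfl fun y _ => congrArg f (l_target _ _))
    (fun s t x y z w h₁ h₂ h₃ h₄ => by
      rw [sum_mul_sum_eq f _ _ fun _ _ h => leftGen_mul_ne _ _ h,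
        sum_mul_sum_eq f _ _ fun _ _ h => leftGen_mul_ne _ _ h]
      exact Finset.sum_congr rfl fun y _ => congrArg f (rel_mul (Rel.l_l _ _ _ _ _ _ _ _ _ _ _)))

/-- The map on the right factor induced by an algebra map out of `R_n ⊠ R_n`. -/
def liftRight : Pres (GenR.Rel n) →ₐ[F] M :=
  PR.lift (fun a => ∑ y, f (rightGen a y))
    (fun x => by
      rw [sum_mul_sum_eq f _ _ fun _ _ h => rightGen_mul_ne _ _ h]
      exact Finset.sum_congr rfl fun y _ => congrArg f (e_mul_self _))
    (fun x x' h => by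
      rw [sum_mul_sum_eq f _ _ fun _ _ h => rightGen_mul_ne _ _ h]
      refine Finset.sum_eq_zero fun y _ => ?_
      change f (e (y, x) * e (y, x')) = 0
      rw [e_mul_ne fun e => h (Prod.ext_iff.1 e).2, map_zero])
    (by
      rw [← Fintype.sum_prod_type_right' fun x y => f (rightGen (.e y) x), ← map_one f, ← sum_e,
        map_sum]
      rfl)
    (fun s x x' h => by
      rw [sum_mul_sum_eq f _ _ fun _ _ h => rightGen_mul_ne _ _ h]
      exact Finset.sum_congr rfl fun y _ => congrArg f (r_source _ _))
    (fun s x x' h => by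
      rw [sum_mul_sum_eq f _ _ fun _ _ h => rightGen_mul_ne _ _ h]
      exact Finset.sum_congr rfl fun y _ => congrArg f (r_target _ _))
    (fun s t x y z w h₁ h₂ h₃ h₄ => by
      rw [sum_mul_sum_eq f _ _ fun _ _ h => rightGen_mul_ne _ _ h,
        sum_mul_sum_eq f _ _ fun _ _ h => rightGen_mul_ne _ _ h]
      exact Finset.sum_congr rfl fun y _ => congrArg f (rel_mul (Rel.r_r _ _ _ _ _ _ _ _ _ _ _)))

theorem liftLeft_gen (a : GenR n) :
    liftLeft f (gen (GenR.Rel n) a) = ∑ y, f (leftGen a y) := PR.lift_gen _ _ _ _ _ _ _ a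

theorem liftRight_gen (a : GenR n) :
    liftRight f (gen (GenR.Rel n) a) = ∑ y, f (rightGen a y) := PR.lift_gen _ _ _ _ _ _ _ a

theorem sum_mul_sum_single (u v : V n → PB n) (i₀ j₀ : V n)
    (h : ∀ i j, (i ≠ i₀ ∨ j ≠ j₀) → u i * v j = 0) :
    (∑ i, f (u i)) * ∑ j, f (v j) = f (u i₀) * f (v j₀) := by
  rw [Finset.sum_mul_sum, Finset.sum_eq_single i₀, Finset.sum_eq_single j₀]
  · intro j _ hj; rw [← map_mul, h _ _ (Or.inr hj), map_zero]
  · simp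
  · intro i _ hi
    exact Finset.sum_eq_zero fun j _ => by rw [← map_mul, h _ _ (Or.inl hi), map_zero]
  · simp

/-- The source of a generator. -/
def _root_.QDG.GenR.src : GenR n → V n
  | .e x => x
  | .r _ x _ _ => x

/-- The target of a generator. -/
def _root_.QDG.GenR.tgt : GenR n → V n
  | .e x => x
  | .r _ _ y _ => y

theorem leftGen_src (a : GenR n) (y : V n) : e (a.src, y) * leftGen a y = leftGen a y := by
  cases a
  · exact e_mul_self _
  · exact l_source _ _

theorem leftGen_tgt (a : GenR n) (y : V n) : leftGen a y * e (a.tgt, y) = leftGen a y := by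
  cases a
  · exact e_mul_self _
  · exact l_target _ _

theorem rightGen_src (a : GenR n) (x : V n) : e (x, a.src) * rightGen a x = rightGen a x := by
  cases a
  · exact e_mul_self _
  · exact r_source _ _

theorem rightGen_tgt (a : GenR n) (x : V n) : rightGen a x * e (x, a.tgt) = rightGen a x := by
  cases a
  · exact e_mul_self _
  · exact r_target _ _

/-- Just one pair of summands is composable: the left generator has to be taken over the source of
`b`, and the right one over the target of `a`. -/
theorem liftLeft_mul_liftRight_gen (a b : GenR n) :
    liftLeft f (gen (GenR.Rel n) a) * liftRight f (gen (GenR.Rel n) b) =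
      f (leftGen a b.src) * f (rightGen b a.tgt) := by
  rw [liftLeft_gen, liftRight_gen]
  refine sum_mul_sum_single f _ _ _ _ ?_
  intro i j h
  refine mul_eq_zero_of_ne ?_ (leftGen_tgt a i) (rightGen_src b j)
  intro e
  rw [Prod.mk.injEq] at e
  rcases h with h | h
  · exact h e.2
  · exact h e.1.symm

theorem liftRight_mul_liftLeft_gen (a b : GenR n) :
    liftRight f (gen (GenR.Rel n) b) * liftLeft f (gen (GenR.Rel n) a) =
      f (rightGen b a.src) * f (leftGen a b.tgt) := by
  rw [liftLeft_gen, liftRight_gen]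
  refine sum_mul_sum_single f _ _ _ _ ?_
  intro i j h
  refine mul_eq_zero_of_ne ?_ (rightGen_tgt b i) (leftGen_src a j)
  intro e
  rw [Prod.mk.injEq] at e
  rcases h with h | h
  · exact h e.1
  · exact h e.2.symm

variable (hcomm : ∀ (s t : Fin n) (x x' y y' : V n) (h : IsArrow s x x') (h' : IsArrow t y y'),
  f (gen (Rel n) (.l s x x' y h)) * f (gen (Rel n) (.r t x' y y' h')) =
    f (gen (Rel n) (.r t x y y' h')) * f (gen (Rel n) (.l s x x' y' h)))
  (hc : ∀ s t hst x x' y y' h h', f (gen (Rel n) (.c s t hst x x' y y' h h')) = 0)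

include hcomm

/-- Induction on both arguments reduces to two generators. If one of them is an idempotent, the
source and target relations give the claim; for two arrows it is the hypothesis. -/
theorem lift_commute (a b : Pres (GenR.Rel n)) : Commute (liftLeft f a) (liftRight f b) := by
  induction a using pres_induction with
  | one => rw [map_one]; exact Commute.one_left _
  | mul a b h1 h2 => rw [map_mul]; exact h1.mul_left h2
  | add a b h1 h2 => rw [map_add]; exact h1.add_left h2
  | zero => rw [map_zero]; exact Commute.zero_left _
  | gen x =>
    induction b using pres_induction with
    | one => rw [map_one]; exact Commute.one_right _
    | mul a b h1 h2 => rw [map_mul]; exact h1.mul_right h2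
    | add a b h1 h2 => rw [map_add]; exact h1.add_right h2
    | zero => rw [map_zero]; exact Commute.zero_right _
    | gen y =>
      refine (liftLeft_mul_liftRight_gen f x y).trans
        (Eq.trans ?_ (liftRight_mul_liftLeft_gen f x y).symm)
      rcases x with x | ⟨s, x, x', h⟩ <;> rcases y with y | ⟨t, y, y', h'⟩
      · rfl
      · rw [← map_mul, ← map_mul]
        exact congrArg f ((r_source _ _).trans (r_target _ _).symm)
      · rw [← map_mul, ← map_mul]
        exact congrArg f ((l_target _ _).trans (l_source _ _).symm)
      · exact hcomm s t x x' y y' h h'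

include hc

/-- An algebra map out of `R_n ⊠ R_n` which maps `c` to zero, and `a`, `b` to commuting elements,
vanishes on the kernel of the projection to `R_n ⊗ R_n`. -/
theorem eq_zero_of_proj_eq_zero {u : PB n} (hu : proj n u = 0) : f u = 0 := by
  -- The commuting maps on the two factors define a map on the tensor product, and `f` is its
  -- composite with the projection since both agree on generators.
  let τ : PRR n →ₐ[F] M :=
    Algebra.TensorProduct.lift (liftLeft f) (liftRight f) (lift_commute f hcomm)
  have hτ : ∀ u, τ (proj n u) = f u := by
    intro u
    induction u using pres_induction with
    | one => rw [map_one, map_one, map_one]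
    | mul a b h1 h2 => rw [map_mul, map_mul, map_mul, h1, h2]
    | add a b h1 h2 => rw [map_add, map_add, map_add, h1, h2]
    | zero => rw [map_zero, map_zero, map_zero]
    | gen x =>
      rw [proj_gen]
      cases x with
      | e x y =>
        rw [projGen, Algebra.TensorProduct.lift_tmul, liftLeft_mul_liftRight_gen, ← map_mul]
        exact congrArg f (e_mul_self _)
      | l s x x' y h =>
        rw [projGen, Algebra.TensorProduct.lift_tmul, liftLeft_mul_liftRight_gen, ← map_mul]
        exact congrArg f (l_target _ _)
      | r s x y y' h =>
        rw [projGen, Algebra.TensorProduct.lift_tmul, liftLeft_mul_liftRight_gen, ← map_mul]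
        exact congrArg f (r_source _ _)
      | c => rw [projGen, map_zero, hc]
  rw [← hτ, hu, map_zero]

end Universal

theorem proj_slotC (k : Fin (n + 1)) : proj n (slotC k) = 0 := by
  refine slotC_cases (P := fun u _ => proj n u = 0) (fun _ => map_zero _) (fun s t _ => ?_) k
  simp only [tot, map_sum]
  refine Finset.sum_eq_zero fun p _ => Finset.sum_eq_zero fun p' _ => ?_
  refine arr_cases (some s, some t) (P := fun p p' u => proj n u = 0) (fun _ _ => map_zero _)
    ?_ ?_ ?_ p p'
  · simp
  · simp
  · intros; exact proj_gen _

/-- The kernel of the projection `R_n ⊠ R_n → R_n ⊗ R_n` is acyclic. -/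
theorem proj_ker_acyclic {u : PB n} (hd : d u = 0) (hu : proj n u = 0) :
    ∃ w, d w = u ∧ proj n w = 0 := by
  -- On commuting words `a` and `b` commute even inside a slot and `c` acts by zero, so this
  -- representation factors through the projection.
  have h : rep (wordOps' n) u = 0 := by
    refine eq_zero_of_proj_eq_zero (rep (wordOps' n)) ?_ ?_ hu
    · intro s t x x' y y' h h'
      simp only [rep_gen, repGen, moveOp_mul]
      by_cases e : s.succ = t.castSucc
      · simp only [wordOps', e, ← localOp_mul, Letter.matA'_matB']
      · rw [((wordOps' n).ab e).eq]
    · intros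
      rw [rep_gen, repGen]
      change moveOp _ _ (localOp _ 0) = 0
      rw [localOp_zero, moveOp_zero]
  obtain ⟨w, hw, hw'⟩ := exists_d_eq hd h
  exact ⟨w, hw, hw' (M := PRR n) (proj n) proj_slotC⟩

/-- The target has no differential. The only generator to check is `c`, and both summands of `d c`
have the same image, so they cancel in characteristic two. -/
theorem proj_d (u : PB n) : proj n (d u) = 0 := by
  induction u using pres_induction with
  | one => rw [dOf_one, map_zero]
  | mul a b h1 h2 => rw [d_mul, map_add, map_mul, map_mul, h1, h2, zero_mul, mul_zero, add_zero]
  | add a b h1 h2 => rw [map_add, map_add, h1, h2, add_zero]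
  | zero => rw [map_zero, map_zero]
  | gen x =>
    rw [dOf_gen]
    cases x with
    | c s t hst x x' y y' h h' =>
      rw [GenB.D, map_add, map_mul, map_mul, proj_gen, proj_gen, proj_gen, proj_gen, projGen,
        projGen, projGen, projGen, Algebra.TensorProduct.tmul_mul_tmul,
        Algebra.TensorProduct.tmul_mul_tmul, PR.rel_single (GenR.Rel.source _ _ _ _),
        PR.rel_single (GenR.Rel.target _ _ _ _), PR.rel_single (GenR.Rel.source _ _ _ _),
        PR.rel_single (GenR.Rel.target _ _ _ _)]
      exact (RR n).toDG.char_two _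
    | _ => rw [GenB.D, map_zero]

end PB

/-! ### Formality -/

namespace QDGAlgebra

theorem Hom.mapH_mk {A B : QDGAlgebra} (f : Hom A B) (z : A.cocycles) :
    f.mapH (Ideal.Quotient.mk A.coboundaries z) =
      Ideal.Quotient.mk B.coboundaries (f.mapCocycles z) := rfl

/-- A surjective morphism with acyclic kernel to a graded algebra is a quasi-isomorphism. -/
theorem Hom.isQuasiIso_of_acyclic {A B : QDGAlgebra} (f : Hom A B)
    (hf : Function.Surjective f.toAlgHom)
    (hk : ∀ a, f.toAlgHom a = 0 → A.d a = 0 → ∃ b, f.toAlgHom b = 0 ∧ A.d b = a) :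
    f.IsQuasiIso := by
  constructor
  · intro x y hxy
    obtain ⟨z, rfl⟩ := Ideal.Quotient.mk_surjective x
    obtain ⟨z', rfl⟩ := Ideal.Quotient.mk_surjective y
    rw [mapH_mk, mapH_mk, Ideal.Quotient.eq, mem_coboundaries] at hxy
    obtain ⟨b, hb⟩ := hxy
    obtain ⟨a, rfl⟩ := hf b
    have hb' : B.d (f.toAlgHom a) = f.toAlgHom z - f.toAlgHom z' := hb
    -- The difference of the two cocycles becomes a closed element of the kernel after adding the
    -- coboundary of a lift of `b`; adding and subtracting agree here.
    obtain ⟨w, -, hw⟩ := hk (z - z' + A.d a)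
      (by rw [map_add, f.map_d, hb', map_sub]; exact B.char_two _)
      (by rw [map_add, map_sub, A.d_d, (A.mem_cocycles).1 z.2, (A.mem_cocycles).1 z'.2, sub_zero,
        add_zero])
    rw [Ideal.Quotient.eq, mem_coboundaries]
    refine ⟨w + a, ?_⟩
    rw [map_add, hw, add_assoc, A.char_two, add_zero]
    rfl
  · intro x
    obtain ⟨z, rfl⟩ := Ideal.Quotient.mk_surjective x
    obtain ⟨a, ha⟩ := hf z
    -- An arbitrary preimage of a cocycle has its differential in the kernel; subtracting a
    -- primitive that lies in the kernel makes the preimage closed.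
    obtain ⟨b, hb, hb'⟩ := hk (A.d a) (by rw [f.map_d, ha]; exact (B.mem_cocycles).1 z.2) (A.d_d _)
    have hab : A.d (a + b) = 0 := by rw [map_add, hb']; exact A.char_two _
    refine ⟨Ideal.Quotient.mk _ ⟨a + b, hab⟩, ?_⟩
    rw [mapH_mk]
    congr 1
    ext
    change f.toAlgHom (a + b) = z
    rw [map_add, hb, add_zero, ha]

/-- The map from the cohomology to a graded algebra with trivial differential. -/
def Hom.ofCohomology {A : QDGAlgebra} {B : QAlgebra} (f : Hom A B.toDG) :
    Hom A.cohomology B.toDG where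
  toAlgHom := Ideal.Quotient.liftₐ A.coboundaries (f.toAlgHom.comp A.cocycles.val) (by
    rintro z ⟨a, ha⟩
    change f.toAlgHom z = 0
    rw [← ha, f.map_d]
    rfl)
  map_grade := by
    rintro p _ ⟨z, hz, rfl⟩
    exact f.map_grade hz
  map_d _ := by
    change Ideal.Quotient.liftₐ A.coboundaries (f.toAlgHom.comp A.cocycles.val) _ 0 = 0
    exact map_zero _

theorem Hom.ofCohomology_bijective {A : QDGAlgebra} {B : QAlgebra} (f : Hom A B.toDG)
    (hf : f.IsQuasiIso) : Function.Bijective f.ofCohomology.toAlgHom := by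
  constructor
  · rw [injective_iff_map_eq_zero]
    intro x hx
    obtain ⟨z, rfl⟩ := Ideal.Quotient.mk_surjective x
    refine hf.1 (a₂ := Ideal.Quotient.mk A.coboundaries 0) ?_
    rw [mapH_mk, mapH_mk, Ideal.Quotient.eq, mem_coboundaries]
    refine ⟨0, ?_⟩
    rw [map_zero, map_zero, sub_zero]
    exact hx.symm
  · intro b
    obtain ⟨x, hx⟩ := hf.2 (Ideal.Quotient.mk _ ⟨b, rfl⟩)
    obtain ⟨z, rfl⟩ := Ideal.Quotient.mk_surjective x
    refine ⟨Ideal.Quotient.mk _ z, ?_⟩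
    rw [mapH_mk, Ideal.Quotient.eq, mem_coboundaries] at hx
    obtain ⟨a, ha⟩ := hx
    exact (sub_eq_zero.1 ha.symm)

theorem Hom.isQuasiIso_of_bijective {A B : QDGAlgebra} (f : Hom A B)
    (hf : Function.Bijective f.toAlgHom) : f.IsQuasiIso := by
  refine f.isQuasiIso_of_acyclic hf.2 fun a ha _ => ⟨0, map_zero _, ?_⟩
  rw [map_zero, (injective_iff_map_eq_zero _).1 hf.1 a ha]

end QDGAlgebra

/-- The grading of `R_n ⊗ R_n`. -/
def PB.gradeRR (n : ℕ) (p : ℤ × ℤ) : Submodule F (PB.PRR n) := (RR n).toDG.grade p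

theorem PB.tmul_mem_gradeRR {n : ℕ} (x y : GenR n) : (gen (GenR.Rel n) x ⊗ₜ[F] gen (GenR.Rel n) y :
    PB.PRR n) ∈ PB.gradeRR n (0, x.deg + y.deg) := by
  have hR : ∀ x : GenR n, gen (GenR.Rel n) x ∈ (R n).grade x.deg :=
    gen_mem_gradeOf (GenR.Rel n) GenR.deg
  exact Submodule.subset_span (s := {t : (R n).carrier ⊗[F] (R n).carrier | ∃ i j a b,
    i + j = x.deg + y.deg ∧ a ∈ (R n).grade i ∧ b ∈ (R n).grade j ∧ a ⊗ₜ[F] b = t})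
    ⟨_, _, _, _, rfl, hR x, hR y, rfl⟩

theorem PB.proj_mem {n : ℕ} {p : ℤ × ℤ} {a : PB n} (ha : a ∈ gradeOf (GenB.Rel n) GenB.deg p) :
    PB.proj n a ∈ PB.gradeRR n p := by
  have hgen : ∀ x : GenB n, PB.projGen x ∈ PB.gradeRR n (GenB.deg x) := by
    intro x
    cases x with
    | e x y => exact PB.tmul_mem_gradeRR (.e x) (.e y)
    | l s x x' y h =>
      have := PB.tmul_mem_gradeRR (.r s x x' h) (.e y)
      rwa [show (GenR.e y).deg = 0 from rfl, add_zero] at this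
    | r s x y y' h =>
      have := PB.tmul_mem_gradeRR (.e x) (.r s y y' h)
      rwa [show (GenR.e x).deg = 0 from rfl, zero_add] at this
    | c => exact zero_mem _
  induction ha using Submodule.span_induction with
  | mem a ha =>
    obtain ⟨l, rfl, rfl⟩ := ha
    induction l with
    | nil =>
      simp only [List.map_nil, List.prod_nil, map_one]
      exact (RR n).toDG.one_mem
    | cons x l ih =>
      simp only [List.map_cons, List.prod_cons, map_mul, PB.proj_gen, List.sum_cons]
      exact (RR n).toDG.mul_mem (hgen x) ih
  | zero => rw [map_zero]; exact zero_mem _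
  | add x y _ _ hx hy => rw [map_add]; exact add_mem hx hy
  | smul c x _ hx => rw [map_smul]; exact Submodule.smul_mem _ _ hx

/-- The projection `R_n ⊠ R_n → R_n ⊗ R_n` as a morphism of `q`-graded DG algebras. -/
def RB.proj (n : ℕ) : QDGAlgebra.Hom (RB n) (RR n).toDG where
  toAlgHom := PB.proj n
  map_grade := PB.proj_mem
  map_d := PB.proj_d

theorem RB.proj_surjective (n : ℕ) : Function.Surjective (RB.proj n).toAlgHom := PB.proj_surjective

theorem RB.proj_acyclic {n : ℕ} (a : (RB n).carrier) (h : (RB.proj n).toAlgHom a = 0)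
    (h' : (RB n).d a = 0) : ∃ b, (RB.proj n).toAlgHom b = 0 ∧ (RB n).d b = a := by
  obtain ⟨w, h1, h2⟩ := PB.proj_ker_acyclic (n := n) h' h
  exact ⟨w, h2, h1⟩

theorem RB.cohomology_isomorphic (n : ℕ) :
    QDGAlgebra.Isomorphic (RB n).cohomology (RR n).toDG :=
  ⟨(RB.proj n).ofCohomology, (RB.proj n).ofCohomology_bijective
    ((RB.proj n).isQuasiIso_of_acyclic (RB.proj_surjective n) RB.proj_acyclic)⟩

/-- The zigzag consists of two morphisms with target `R_n ⊗ R_n`: the projection, and the bijection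
which it induces on the cohomology algebra. -/
theorem RB.isFormal (n : ℕ) : (RB n).IsFormal := by
  have h := (RB.proj n).isQuasiIso_of_acyclic (RB.proj_surjective n) RB.proj_acyclic
  refine Relation.EqvGen.trans _ _ _ (Relation.EqvGen.rel _ _ ⟨_, h⟩)
    (Relation.EqvGen.symm _ _ (Relation.EqvGen.rel _ _ ⟨_,
      QDGAlgebra.Hom.isQuasiIso_of_bijective _ ((RB.proj n).ofCohomology_bijective h)⟩))

/-! ### Gradings on submodules and quotients -/

section Graded

variable {G : Type} [DecidableEq G] {R M : Type} [Ring R] [AddCommGroup M] [Module R M]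
  {ℳ : G → AddSubgroup M}

theorem exists_eq_sum_proj {π : G → M →+ M} (h : DirectSum.IsInternal ℳ)
    (hπ : ∀ g h m, m ∈ ℳ g → π h m = if g = h then m else 0) (a : M) :
    ∃ s : Finset G, a = ∑ p ∈ s, π p a := by
  -- Allowing all larger index sets makes it possible to pass to the union in the additive step.
  have : ∀ a : M, ∃ s : Finset G, ∀ t, s ⊆ t → a = ∑ p ∈ t, π p a := by
    intro a
    induction a using grade_induction h with
    | hom g m hm =>
      refine ⟨{g}, fun t ht => ?_⟩
      simp only [hπ g _ m hm]
      have : g ∈ t := ht (by simp)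
      simp [this]
    | zero => exact ⟨∅, by simp⟩
    | add x y hx hy =>
      obtain ⟨s, hs⟩ := hx
      obtain ⟨t, ht⟩ := hy
      refine ⟨s ∪ t, fun u hu => ?_⟩
      simp only [map_add, Finset.sum_add_distrib]
      rw [← hs u (Finset.union_subset_left hu), ← ht u (Finset.union_subset_right hu)]
  obtain ⟨s, hs⟩ := this a
  exact ⟨s, hs s subset_rfl⟩

/-- A submodule is graded if it is generated by homogeneous elements. -/
def IsGradedSub (ℳ : G → AddSubgroup M) (K : Submodule R M) : Prop :=
  ∀ k ∈ K, k ∈ AddSubmonoid.closure {x : M | (∃ g, x ∈ ℳ g) ∧ x ∈ K}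

theorem IsGradedSub.proj_mem {K : Submodule R M} (hK : IsGradedSub ℳ K) {π : G → M →+ M}
    (hπ : ∀ g h m, m ∈ ℳ g → π h m = if g = h then m else 0) (g : G) {k : M} (hk : k ∈ K) :
    π g k ∈ K := by
  induction hK k hk using AddSubmonoid.closure_induction with
  | mem x hx =>
    obtain ⟨⟨h, hh⟩, hx⟩ := hx
    rw [hπ h g x hh]
    split_ifs
    · exact hx
    · exact zero_mem _
  | zero => rw [map_zero]; exact zero_mem _
  | add x y hx' hy' hx hy =>
    have cl : ∀ z ∈ AddSubmonoid.closure {x : M | (∃ g, x ∈ ℳ g) ∧ x ∈ K}, z ∈ K := by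
      intro z hz
      exact (AddSubmonoid.closure_le (S := K.toAddSubmonoid)).2 (fun x hx => hx.2) hz
    rw [map_add]; exact add_mem (hx (cl _ hx')) (hy (cl _ hy'))

theorem IsGradedSub.isInternal_sub {K : Submodule R M} (hK : IsGradedSub ℳ K)
    (h : DirectSum.IsInternal ℳ) :
    DirectSum.IsInternal fun g => (ℳ g).comap K.subtype.toAddMonoidHom := by
  obtain ⟨π, hπ', hπ⟩ := exists_proj h
  refine isInternal_of_proj _ (fun g => AddMonoidHom.mk' (fun m => ⟨π g m, hK.proj_mem hπ g m.2⟩)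
    (by intros; ext; simp)) ?_ ?_
  · intro g k m hm
    ext
    simp only [AddMonoidHom.mk'_apply]
    rw [hπ g k m hm]
    split_ifs <;> rfl
  · intro m
    obtain ⟨s, hs⟩ := exists_eq_sum_proj h hπ (m : M)
    have : m = ∑ p ∈ s, (⟨π p m, hK.proj_mem hπ p m.2⟩ : K) := by
      ext
      refine hs.trans ?_
      rw [AddSubmonoidClass.coe_finsetSum]
    rw [this]
    exact sum_mem fun p _ => AddSubmonoid.subset_closure ⟨p, hπ' p m⟩

theorem IsGradedSub.isInternal_quot {K : Submodule R M} (hK : IsGradedSub ℳ K)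
    (h : DirectSum.IsInternal ℳ) :
    DirectSum.IsInternal fun g => (ℳ g).map K.mkQ.toAddMonoidHom := by
  obtain ⟨π, hπ', hπ⟩ := exists_proj h
  refine isInternal_of_proj _ (fun g => QuotientAddGroup.map K.toAddSubgroup K.toAddSubgroup (π g)
    fun k hk => hK.proj_mem hπ g hk) ?_ ?_
  · rintro g k _ ⟨m, hm, rfl⟩
    change K.mkQ (π k m) = _
    rw [hπ g k m hm]
    split_ifs
    · rfl
    · exact map_zero _
  · intro x
    obtain ⟨m, rfl⟩ := K.mkQ_surjective x
    obtain ⟨s, hs⟩ := exists_eq_sum_proj h hπ m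
    rw [hs, map_sum]
    exact sum_mem fun p _ => AddSubmonoid.subset_closure ⟨p, _, hπ' p m, rfl⟩

end Graded

/-! ### Base change along a surjection -/

namespace DGMod

variable {A B : QDGAlgebra} (f : QDGAlgebra.Hom A B)

/-- The submodule `I M` of a module `M`, where `I` is the kernel of a morphism. -/
def kerSub (M : DGMod A) : Submodule A.carrier M.carrier :=
  Submodule.span _ {x | ∃ a m, f.toAlgHom a = 0 ∧ a • m = x}

theorem smul_mem_kerSub {M : DGMod A} {a : A.carrier} (ha : f.toAlgHom a = 0) (m : M.carrier) :
    a • m ∈ kerSub f M := Submodule.subset_span ⟨a, m, ha, rfl⟩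

theorem proj_map {π : ℤ × ℤ → A.carrier →+ A.carrier} {ρ : ℤ × ℤ → B.carrier →+ B.carrier}
    (hπ : ∀ g h m, m ∈ A.grade g → π h m = if g = h then m else 0)
    (hρ : ∀ g h m, m ∈ B.grade g → ρ h m = if g = h then m else 0) (p : ℤ × ℤ) (a : A.carrier) :
    f.toAlgHom (π p a) = ρ p (f.toAlgHom a) := by
  induction a using grade_induction A.isInternal with
  | hom g m hm =>
    rw [hπ _ _ _ hm, hρ _ _ _ (f.map_grade hm)]
    split_ifs <;> simp
  | zero => simp
  | add x y hx hy => simp [hx, hy]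

/-- A morphism preserves bidegrees, so the homogeneous components of an element of `I` lie in `I`,
and a product `a • m` splits into homogeneous ones. Scalars are absorbed into `a` because `I` is an
ideal, so additive combinations are enough. -/
theorem kerSub_le_closure (M : DGMod A) {x : M.carrier} (hx : x ∈ kerSub f M) :
    x ∈ AddSubmonoid.closure {x | ∃ p r a m, a ∈ A.grade p ∧ m ∈ M.grade r ∧ f.toAlgHom a = 0 ∧
      a • m = x} := by
  obtain ⟨π, hπ', hπ⟩ := exists_proj A.isInternal
  obtain ⟨ρ, hρ', hρ⟩ := exists_proj B.isInternal
  have key : ∀ a : A.carrier, f.toAlgHom a = 0 → ∀ m : M.carrier,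
      a • m ∈ AddSubmonoid.closure {x | ∃ p r a m, a ∈ A.grade p ∧ m ∈ M.grade r ∧
        f.toAlgHom a = 0 ∧ a • m = x} := by
    intro a ha m
    induction m using grade_induction M.isInternal with
    | hom r m hm =>
      obtain ⟨s, hs⟩ := exists_eq_sum_proj
        (ℳ := fun g => (A.grade g).toAddSubgroup) A.isInternal hπ a
      rw [hs, Finset.sum_smul]
      refine sum_mem fun p _ => AddSubmonoid.subset_closure ⟨p, r, π p a, m, hπ' p a, hm, ?_, rfl⟩
      rw [proj_map f hπ hρ, ha, map_zero]
    | zero => rw [smul_zero]; exact zero_mem _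
    | add x y hx hy => rw [smul_add]; exact add_mem hx hy
  refine Submodule.span_induction (p := fun x _ => x ∈ AddSubmonoid.closure {x | ∃ p r a m,
    a ∈ A.grade p ∧ m ∈ M.grade r ∧ f.toAlgHom a = 0 ∧ a • m = x}) ?_ ?_ ?_ ?_ hx
  · rintro _ ⟨a, m, ha, rfl⟩
    exact key a ha m
  · exact zero_mem _
  · exact fun x y _ _ hx hy => add_mem hx hy
  · intro c x _ hx
    refine AddSubmonoid.closure_induction (motive := fun x _ => c • x ∈ AddSubmonoid.closure
      {x | ∃ p r a m, a ∈ A.grade p ∧ m ∈ M.grade r ∧ f.toAlgHom a = 0 ∧ a • m = x})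
      ?_ ?_ ?_ hx
    · rintro _ ⟨p, r, a, m, _, _, ha, rfl⟩
      rw [← mul_smul]
      exact key _ (by rw [map_mul, ha, mul_zero]) m
    · rw [smul_zero]; exact zero_mem _
    · intro x y _ _ hx hy
      rw [smul_add]; exact add_mem hx hy

theorem kerSub_graded (M : DGMod A) : IsGradedSub M.grade (kerSub f M) := by
  intro x hx
  refine AddSubmonoid.closure_mono ?_ (kerSub_le_closure f M hx)
  rintro _ ⟨p, r, a, m, ha, hm, h, rfl⟩
  exact ⟨⟨_, M.smul_mem ha hm⟩, smul_mem_kerSub f h m⟩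

/-- There is no scalar step, since a multiple of `a • m` is again of this form. -/
theorem kerSub_induction {M : DGMod A} {P : M.carrier → Prop}
    (h : ∀ a m, f.toAlgHom a = 0 → P (a • m)) (h0 : P 0) (hadd : ∀ x y, P x → P y → P (x + y))
    {x : M.carrier} (hx : x ∈ kerSub f M) : P x := by
  refine AddSubmonoid.closure_induction (motive := fun x _ => P x) ?_ h0
    (fun x y _ _ => hadd x y) (kerSub_le_closure f M hx)
  rintro _ ⟨_, _, a, m, _, _, ha, rfl⟩
  exact h a m ha

theorem map_mem_kerSub {M N : DGMod A} (g : M.carrier →ₗ[A.carrier] N.carrier) {x : M.carrier}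
    (hx : x ∈ kerSub f M) : g x ∈ kerSub f N := by
  refine kerSub_induction f (P := fun x => g x ∈ kerSub f N) (fun a m ha => ?_) ?_
    (fun x y hx hy => ?_) hx
  · rw [map_smul]; exact smul_mem_kerSub f ha _
  · rw [map_zero]; exact zero_mem _
  · rw [map_add]; exact add_mem hx hy

theorem d_mem_kerSub {M : DGMod A} {x : M.carrier} (hx : x ∈ kerSub f M) : M.d x ∈ kerSub f M := by
  refine kerSub_induction f (P := fun x => M.d x ∈ kerSub f M) (fun a m ha => ?_) ?_
    (fun x y hx hy => ?_) hx
  · rw [M.d_smul]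
    refine add_mem (smul_mem_kerSub f ?_ _) (smul_mem_kerSub f ha _)
    rw [f.map_d, ha, map_zero]
  · rw [map_zero]; exact zero_mem _
  · rw [map_add]; exact add_mem hx hy

/-- The submodule `I M` as a DG module. -/
def kerMod (M : DGMod A) : DGMod A where
  carrier := kerSub f M
  grade p := (M.grade p).comap (kerSub f M).subtype.toAddMonoidHom
  isInternal := (kerSub_graded f M).isInternal_sub M.isInternal
  smul_mem ha hm := M.smul_mem ha hm
  d := AddMonoidHom.mk' (fun x => ⟨M.d x, d_mem_kerSub f x.2⟩) (by intros; ext; simp)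
  d_mem hm := M.d_mem hm
  d_d m := by ext; exact M.d_d m
  d_smul a m := by ext; exact M.d_smul a m

/-- The quotient `M / I M` as a DG module. -/
def quotMod (M : DGMod A) : DGMod A where
  carrier := M.carrier ⧸ kerSub f M
  grade p := (M.grade p).map (kerSub f M).mkQ.toAddMonoidHom
  isInternal := (kerSub_graded f M).isInternal_quot M.isInternal
  smul_mem := by
    rintro p r a _ ha ⟨m, hm, rfl⟩
    exact ⟨a • m, M.smul_mem ha hm, rfl⟩
  d := QuotientAddGroup.map (kerSub f M).toAddSubgroup (kerSub f M).toAddSubgroup M.d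
    fun _ => d_mem_kerSub f
  d_mem := by
    rintro p _ ⟨m, hm, rfl⟩
    exact ⟨M.d m, M.d_mem hm, rfl⟩
  d_d := by
    intro x
    obtain ⟨m, rfl⟩ := (kerSub f M).mkQ_surjective x
    exact congrArg (kerSub f M).mkQ (M.d_d m)
  d_smul := by
    intro a x
    obtain ⟨m, rfl⟩ := (kerSub f M).mkQ_surjective x
    exact congrArg (kerSub f M).mkQ (M.d_smul a m)

/-- The projection `M ⟶ M / I M`. -/
def quotMap (M : DGMod A) : M ⟶ quotMod f M :=
  ⟨(kerSub f M).mkQ, mem_closed (fun _ m hm => ⟨m, hm, rfl⟩) (fun _ => rfl)⟩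

theorem quotMap_surjective (M : DGMod A) : Function.Surjective (quotMap f M).1 :=
  (kerSub f M).mkQ_surjective

theorem quotMap_eq_zero {M : DGMod A} {m : M.carrier} :
    (quotMap f M).1 m = 0 ↔ m ∈ kerSub f M := Submodule.Quotient.mk_eq_zero _

variable (hf : Function.Surjective f.toAlgHom)

theorem smul_quot_eq {M : DGMod A} {a b : A.carrier} (h : f.toAlgHom a = f.toAlgHom b)
    (x : (quotMod f M).carrier) : a • x = b • x := by
  obtain ⟨m, rfl⟩ := quotMap_surjective f M x
  rw [← sub_eq_zero, ← sub_smul, ← map_smul, quotMap_eq_zero]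
  exact smul_mem_kerSub f (by rw [map_sub, h, sub_self]) m

/-- The action of the target algebra on `M / I M`. -/
@[reducible] def baseModule (M : DGMod A) : Module B.carrier (quotMod f M).carrier :=
  letI : SMul B.carrier (quotMod f M).carrier := ⟨fun b x => (hf b).choose • x⟩
  Function.Surjective.moduleLeft f.toAlgHom.toRingHom hf fun c x =>
    smul_quot_eq f (hf (f.toAlgHom c)).choose_spec x

/-- The base change `M / I M` of a DG module along a surjection. -/
def base (M : DGMod A) : DGMod B :=
  letI := baseModule f hf M
  { carrier := (quotMod f M).carrier
    grade := (quotMod f M).grade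
    isInternal := (quotMod f M).isInternal
    smul_mem := by
      obtain ⟨π, hπ', hπ⟩ := exists_proj A.isInternal
      obtain ⟨ρ, hρ', hρ⟩ := exists_proj B.isInternal
      intro p r b x hb hx
      obtain ⟨a, rfl⟩ := hf b
      -- A homogeneous `b` has a homogeneous preimage, namely the component of degree `p` of any
      -- preimage.
      have : f.toAlgHom (π p a) = f.toAlgHom a := by
        rw [proj_map f hπ hρ, hρ _ _ _ hb, if_pos rfl]
      rw [← this]
      change (hf (f.toAlgHom (π p a))).choose • x ∈ _
      rw [smul_quot_eq f (hf (f.toAlgHom (π p a))).choose_spec]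
      exact (quotMod f M).smul_mem (hπ' p a) hx
    d := (quotMod f M).d
    d_mem := (quotMod f M).d_mem
    d_d := (quotMod f M).d_d
    d_smul := by
      intro b x
      obtain ⟨a, rfl⟩ := hf b
      change (quotMod f M).d ((hf (f.toAlgHom a)).choose • x) =
        (hf (B.d (f.toAlgHom a))).choose • x + (hf (f.toAlgHom a)).choose • (quotMod f M).d x
      rw [smul_quot_eq f (hf (f.toAlgHom a)).choose_spec x, smul_quot_eq f
        (hf (f.toAlgHom a)).choose_spec ((quotMod f M).d x), smul_quot_eq f
        (a := (hf (B.d (f.toAlgHom a))).choose) (b := A.d a)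
        (by rw [(hf _).choose_spec, f.map_d]), (quotMod f M).d_smul] }

/-- The projection to the base change. -/
def baseMap (M : DGMod A) : M.carrier →+ (base f hf M).carrier := (quotMap f M).1.toAddMonoidHom

theorem baseMap_surjective (M : DGMod A) : Function.Surjective (baseMap f hf M) :=
  quotMap_surjective f M

theorem baseMap_smul (M : DGMod A) (a : A.carrier) (m : M.carrier) :
    baseMap f hf M (a • m) = f.toAlgHom a • baseMap f hf M m :=
  (map_smul (quotMap f M).1 a m).trans
    (smul_quot_eq f (hf (f.toAlgHom a)).choose_spec ((quotMap f M).1 m)).symm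

theorem baseMap_d (M : DGMod A) (m : M.carrier) :
    baseMap f hf M (M.d m) = (base f hf M).d (baseMap f hf M m) := rfl

theorem baseMap_eq_zero {M : DGMod A} {m : M.carrier} :
    baseMap f hf M m = 0 ↔ m ∈ kerSub f M := quotMap_eq_zero f

/-- A linear map out of the base change, given by a semilinear map. -/
def baseLift {M : DGMod A} {N : DGMod B} (g : M.carrier →+ N.carrier)
    (hg : ∀ a m, g (a • m) = f.toAlgHom a • g m) :
    (base f hf M).carrier →ₗ[B.carrier] N.carrier where
  toFun := QuotientAddGroup.lift (kerSub f M).toAddSubgroup g (by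
    intro x hx
    refine kerSub_induction f (P := fun x => g x = 0) (fun a m ha => ?_) (map_zero g)
      (fun x y hx hy => ?_) hx
    · rw [hg, ha, zero_smul]
    · rw [map_add, hx, hy, add_zero])
  map_add' := map_add _
  map_smul' := by
    intro b x
    obtain ⟨a, rfl⟩ := hf b
    obtain ⟨m, rfl⟩ := baseMap_surjective f hf M x
    rw [← baseMap_smul]
    exact hg a m

/-- The map of base changes induced by a linear map. -/
def baseLin {M N : DGMod A} (g : M.carrier →ₗ[A.carrier] N.carrier) :
    (base f hf M).carrier →ₗ[B.carrier] (base f hf N).carrier :=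
  baseLift f hf ((baseMap f hf N).comp g.toAddMonoidHom) (by
    intro a m
    change baseMap f hf N (g (a • m)) = _
    rw [map_smul, baseMap_smul]; rfl)

theorem baseLin_baseMap {M N : DGMod A} (g : M.carrier →ₗ[A.carrier] N.carrier) (m : M.carrier) :
    baseLin f hf g (baseMap f hf M m) = baseMap f hf N (g m) := rfl

/-- The base change functor along a surjection. -/
def baseFunctor : DGMod A ⥤ DGMod B where
  obj := base f hf
  map g := ⟨baseLin f hf g.1, mem_closed
    (by
      rintro p _ ⟨m, hm, rfl⟩
      exact ⟨g.1 m, closed_mem g hm, rfl⟩)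
    (by
      intro x
      obtain ⟨m, rfl⟩ := baseMap_surjective f hf _ x
      rw [← baseMap_d, baseLin_baseMap, baseLin_baseMap, ← closed_comm g, baseMap_d])⟩
  map_id M := hom_ext fun x => by
    obtain ⟨m, rfl⟩ := baseMap_surjective f hf _ x
    rfl
  map_comp g h := hom_ext fun x => by
    obtain ⟨m, rfl⟩ := baseMap_surjective f hf _ x
    rfl

theorem baseFunctor_map_baseMap {M N : DGMod A} (g : M ⟶ N) (m : M.carrier) :
    ((baseFunctor f hf).map g).1 (baseMap f hf M m) = baseMap f hf N (g.1 m) := rfl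

theorem baseFunctor_homotopic {M N : DGMod A} {g g' : M ⟶ N} (h : homotopic g g') :
    homotopic ((baseFunctor f hf).map g) ((baseFunctor f hf).map g') := by
  obtain ⟨k, hk, e⟩ := h
  refine ⟨baseLin f hf k, ?_, ?_⟩
  · rintro p _ ⟨m, hm, rfl⟩
    exact ⟨k m, hk p m hm, rfl⟩
  · ext x
    obtain ⟨m, rfl⟩ := baseMap_surjective f hf _ x
    have := congrArg (baseMap f hf N) (LinearMap.congr_fun e m)
    rw [dHom_apply, map_add, LinearMap.sub_apply, map_sub] at this
    exact this

/-! ### Dévissage -/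

/-- Graded projectivity. -/
def LiftProp (M : DGMod A) : Prop :=
  ∀ (Y X : DGMod A) (φ : Y ⟶ X), (∀ p, ∀ x ∈ X.grade p, ∃ y ∈ Y.grade p, φ.1 y = x) →
    ∀ (u : ℤ × ℤ) (h : M.carrier →ₗ[A.carrier] X.carrier),
      (∀ p, ∀ m ∈ M.grade p, h m ∈ X.grade (p + u)) →
      ∃ k : M.carrier →ₗ[A.carrier] Y.carrier, (∀ p, ∀ m ∈ M.grade p, k m ∈ Y.grade (p + u)) ∧
        ∀ m, φ.1 (k m) = h m

/-- Homotopical projectivity: closed maps to acyclic modules are exact. -/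
def ExactProp (M : DGMod A) : Prop :=
  ∀ X : DGMod A, (∀ p, ∀ x ∈ X.grade p, X.d x = 0 → ∃ y ∈ X.grade (p - (1, 0)), X.d y = x) →
    ∀ (u : ℤ × ℤ) (h : M.carrier →ₗ[A.carrier] X.carrier),
      (∀ p, ∀ m ∈ M.grade p, h m ∈ X.grade (p + u)) → (∀ m, X.d (h m) = h (M.d m)) →
      ∃ k : M.carrier →ₗ[A.carrier] X.carrier,
        (∀ p, ∀ m ∈ M.grade p, k m ∈ X.grade (p + (u - (1, 0)))) ∧
        ∀ m, X.d (k m) + k (M.d m) = h m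

theorem ofIdem_mul {e : A.carrier} (he : e * e = e) (m : (Ideal.span {e} : Ideal A.carrier)) :
    (m : A.carrier) * e = m := by
  obtain ⟨m, hm⟩ := m
  obtain ⟨a, rfl⟩ := Ideal.mem_span_singleton'.1 hm
  change a * e * e = a * e
  rw [mul_assoc, he]

/-- The element `e` of `A e`. -/
def idemGen (e : A.carrier) (h0 : e ∈ A.grade 0) (hd : A.d e = 0) : (ofIdem A e h0 hd).carrier :=
  ⟨e, Ideal.mem_span_singleton_self e⟩

theorem idemGen_mem (e : A.carrier) (h0 : e ∈ A.grade 0) (hd : A.d e = 0) :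
    idemGen e h0 hd ∈ (ofIdem A e h0 hd).grade 0 := h0

theorem idemGen_d (e : A.carrier) (h0 : e ∈ A.grade 0) (hd : A.d e = 0) :
    (ofIdem A e h0 hd).d (idemGen e h0 hd) = 0 := Subtype.ext hd

theorem smul_idemGen {e : A.carrier} (he : e * e = e) (h0 : e ∈ A.grade 0) (hd : A.d e = 0)
    (m : (ofIdem A e h0 hd).carrier) : m.1 • idemGen e h0 hd = m :=
  Subtype.ext (ofIdem_mul he m)

/-- The map `A e → X` given by an element of `X`. -/
def idemLift {e : A.carrier} (h0 : e ∈ A.grade 0) (hd : A.d e = 0) {X : DGMod A} (x : X.carrier) :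
    (ofIdem A e h0 hd).carrier →ₗ[A.carrier] X.carrier :=
  (LinearMap.toSpanSingleton A.carrier X.carrier x).comp
    (Submodule.subtype (Ideal.span {e} : Ideal A.carrier))

theorem idemLift_apply {e : A.carrier} (h0 : e ∈ A.grade 0) (hd : A.d e = 0) {X : DGMod A}
    (x : X.carrier) (m : (ofIdem A e h0 hd).carrier) : idemLift h0 hd x m = m.1 • x := rfl

/-- A map out of `A e` is determined by the image of `e`. If `y` lifts this image then `m ↦ m • y`
lifts the map; whether `e` fixes `y` does not matter, since `h (m) = m • h (e)`. -/
theorem liftProp_ofIdem {e : A.carrier} (he : e * e = e) (h0 : e ∈ A.grade 0) (hd : A.d e = 0) :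
    LiftProp (ofIdem A e h0 hd) := by
  intro Y X φ hφ u h hh
  have h1 := hh 0 _ (idemGen_mem e h0 hd)
  obtain ⟨y, hy, hy'⟩ := hφ _ _ h1
  refine ⟨idemLift h0 hd y, ?_, ?_⟩
  · intro p m hm
    rw [idemLift_apply]
    have := Y.smul_mem (show m.1 ∈ A.grade p from hm) hy
    rwa [zero_add] at this
  · intro m
    rw [idemLift_apply, map_smul, hy', ← map_smul, smul_idemGen he]

/-- The image of `e` is a cocycle, with primitive `y` say. For `k m = m • y` the Leibniz rule
produces the term `d m • y` twice, and `m • d y` is left. -/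
theorem exactProp_ofIdem {e : A.carrier} (he : e * e = e) (h0 : e ∈ A.grade 0) (hd : A.d e = 0) :
    ExactProp (ofIdem A e h0 hd) := by
  intro X hX u h hh hc
  have h1 := hh 0 _ (idemGen_mem e h0 hd)
  obtain ⟨y, hy, hy'⟩ := hX _ _ h1 (by rw [hc, idemGen_d, map_zero])
  refine ⟨idemLift h0 hd y, ?_, ?_⟩
  · intro p m hm
    rw [idemLift_apply]
    have := X.smul_mem (show m.1 ∈ A.grade p from hm) hy
    rwa [zero_add] at this
  · intro m
    rw [idemLift_apply, idemLift_apply, X.d_smul, hy', ← map_smul, smul_idemGen he, add_right_comm]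
    have : A.d m.1 • y + ((ofIdem A e h0 hd).d m).1 • y = 0 := X.char_two _
    rw [this, zero_add]

theorem iso_hom_inv {M N : DGMod A} (e : M ≅ N) (m : M.carrier) : e.inv.1 (e.hom.1 m) = m :=
  LinearMap.congr_fun (congrArg Subtype.val e.hom_inv_id) m

theorem iso_inv_hom {M N : DGMod A} (e : M ≅ N) (m : N.carrier) : e.hom.1 (e.inv.1 m) = m :=
  LinearMap.congr_fun (congrArg Subtype.val e.inv_hom_id) m

theorem LiftProp.of_iso {M N : DGMod A} (e : M ≅ N) (h : LiftProp M) : LiftProp N := by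
  intro Y X φ hφ u g hg
  obtain ⟨k, hk, hk'⟩ := h Y X φ hφ u (g.comp e.hom.1) fun p m hm => hg p _ (closed_mem e.hom hm)
  refine ⟨k.comp e.inv.1, fun p m hm => hk p _ (closed_mem e.inv hm), fun m => ?_⟩
  rw [LinearMap.comp_apply, hk', LinearMap.comp_apply, iso_inv_hom]

theorem ExactProp.of_iso {M N : DGMod A} (e : M ≅ N) (h : ExactProp M) : ExactProp N := by
  intro X hX u g hg hc
  obtain ⟨k, hk, hk'⟩ := h X hX u (g.comp e.hom.1) (fun p m hm => hg p _ (closed_mem e.hom hm))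
    (fun m => by rw [LinearMap.comp_apply, hc, closed_comm e.hom]; rfl)
  refine ⟨k.comp e.inv.1, fun p m hm => hk p _ (closed_mem e.inv hm), fun m => ?_⟩
  rw [LinearMap.comp_apply, LinearMap.comp_apply, ← closed_comm e.inv, hk', LinearMap.comp_apply,
    iso_inv_hom]

theorem LiftProp.regrade {M : DGMod A} (h : LiftProp M) (v : ℤ × ℤ) : LiftProp (M.regrade v) := by
  intro Y X φ hφ u g hg
  obtain ⟨k, hk, hk'⟩ := h Y X φ hφ (u - v) g (fun p m hm => by
    have := hg (p - v) m (show m ∈ M.grade (p - v + v) by rwa [sub_add_cancel])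
    rwa [show p + (u - v) = p - v + u by abel])
  refine ⟨k, fun p m hm => ?_, hk'⟩
  have := hk _ m hm
  rwa [show p + v + (u - v) = p + u by abel] at this

theorem ExactProp.regrade {M : DGMod A} (h : ExactProp M) (v : ℤ × ℤ) :
    ExactProp (M.regrade v) := by
  intro X hX u g hg hc
  obtain ⟨k, hk, hk'⟩ := h X hX (u - v) g (fun p m hm => by
    have := hg (p - v) m (show m ∈ M.grade (p - v + v) by rwa [sub_add_cancel])
    rwa [show p + (u - v) = p - v + u by abel]) hc
  refine ⟨k, fun p m hm => ?_, hk'⟩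
  have := hk _ m hm
  rwa [show p + v + (u - v - (1, 0)) = p + (u - (1, 0)) by abel] at this

theorem inr_mem_cone {M N : DGMod A} (f : M ⟶ N) {p : ℤ × ℤ} {m : M.carrier} (hm : m ∈ M.grade p) :
    ((0, m) : N.carrier × M.carrier) ∈ (cone f).grade (p - (1, 0)) :=
  ⟨zero_mem _, by
    change m ∈ M.grade (p - (1, 0) + (1, 0))
    rwa [sub_add_cancel]⟩

theorem inl_mem_cone {M N : DGMod A} (f : M ⟶ N) {p : ℤ × ℤ} {n : N.carrier} (hn : n ∈ N.grade p) :
    ((n, 0) : N.carrier × M.carrier) ∈ (cone f).grade p := ⟨hn, zero_mem _⟩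

theorem LiftProp.cone {M N : DGMod A} (f : M ⟶ N) (hM : LiftProp M) (hN : LiftProp N) :
    LiftProp (cone f) := by
  intro Y X φ hφ u g hg
  obtain ⟨k, hk, hk'⟩ := hN Y X φ hφ u (g.comp (LinearMap.inl A.carrier N.carrier M.carrier))
    fun p n hn => hg p _ (inl_mem_cone f hn)
  -- The copy of `M` inside the cone has its cohomological degrees lowered by one, which changes the
  -- degree of the restricted map.
  obtain ⟨l, hl, hl'⟩ := hM Y X φ hφ (u - (1, 0))
    (g.comp (LinearMap.inr A.carrier N.carrier M.carrier))
    fun p m hm => by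
      have := hg _ _ (inr_mem_cone f hm)
      rwa [show p - (1, 0) + u = p + (u - (1, 0)) by abel] at this
  refine ⟨k.coprod l, ?_, ?_⟩
  · rintro p ⟨n, m⟩ ⟨hn, hm⟩
    refine add_mem (hk p n hn) ?_
    have := hl _ m hm
    rwa [show p + (1, 0) + (u - (1, 0)) = p + u by abel] at this
  · rintro ⟨n, m⟩
    change φ.1 (k n + l m) = _
    rw [map_add, hk', hl']
    exact (map_add g ((n, 0) : N.carrier × M.carrier) ((0, m) : N.carrier × M.carrier)).symm.trans
      (congrArg g (Prod.ext (add_zero n) (zero_add m)))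

/-- First write the restriction to the submodule `N` as the boundary of some `k`. The restriction to
the summand `M` is not closed by itself, but its defect is that of `k ∘ f`, so the sum of the two is
closed and is the boundary of some `l`. Then `k` and `l` together form a contraction. -/
theorem ExactProp.cone {M N : DGMod A} (f : M ⟶ N) (hM : ExactProp M) (hN : ExactProp N) :
    ExactProp (cone f) := by
  intro X hX u g hg hc
  have hc' : ∀ n m, X.d (g (n, m)) = g (N.d n + f.1 m, M.d m) := fun n m => hc (n, m)
  have hadd : ∀ n m, g (n, m) = g (n, 0) + g (0, m) := fun n m =>
    (congrArg g (Prod.ext (add_zero n).symm (zero_add m).symm)).trans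
      (map_add g ((n, 0) : N.carrier × M.carrier) ((0, m) : N.carrier × M.carrier))
  obtain ⟨k, hk, hk'⟩ := hN X hX u (g.comp (LinearMap.inl A.carrier N.carrier M.carrier))
    (fun p n hn => hg p _ (inl_mem_cone f hn))
    (fun n => by
      change X.d (g (n, 0)) = g (N.d n, 0)
      rw [hc', map_zero, map_zero, add_zero])
  have hk'' : ∀ n, X.d (k n) + k (N.d n) = g (n, 0) := hk'
  obtain ⟨l, hl, hl'⟩ := hM X hX (u - (1, 0))
    (g.comp (LinearMap.inr A.carrier N.carrier M.carrier) + k.comp f.1)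
    (fun p m hm => by
      refine add_mem ?_ (hk p _ (closed_mem f hm))
      have := hg _ _ (inr_mem_cone f hm)
      rwa [show p - (1, 0) + u = p + (u - (1, 0)) by abel] at this)
    (fun m => by
      change X.d (g (0, m) + k (f.1 m)) = g (0, M.d m) + k (f.1 (M.d m))
      rw [map_add, hc', map_zero, zero_add, hadd, ← hk'', closed_comm f]
      have := X.char_two (X.d (k (f.1 m)))
      calc _ = (X.d (k (f.1 m)) + X.d (k (f.1 m))) + (g (0, M.d m) + k (f.1 (M.d m))) := by abel
        _ = _ := by rw [this, zero_add])
  have hl'' : ∀ m, X.d (l m) + l (M.d m) = g (0, m) + k (f.1 m) := hl'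
  refine ⟨k.coprod l, ?_, ?_⟩
  · rintro p ⟨n, m⟩ ⟨hn, hm⟩
    refine add_mem (hk p n hn) ?_
    have := hl _ m hm
    rwa [show p + (1, 0) + (u - (1, 0) - (1, 0)) = p + (u - (1, 0)) by abel] at this
  · rintro ⟨n, m⟩
    change X.d (k n + l m) + (k (N.d n + f.1 m) + l (M.d m)) = g (n, m)
    rw [map_add, map_add, hadd n m, ← hk'']
    have := X.char_two (k (f.1 m))
    calc _ = X.d (k n) + k (N.d n) + (X.d (l m) + l (M.d m)) + k (f.1 m) := by abel
      _ = X.d (k n) + k (N.d n) + g (0, m) + (k (f.1 m) + k (f.1 m)) := by rw [hl'']; abel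
      _ = _ := by rw [this, add_zero]

/-- Acyclicity of `I M`. -/
def KerAcyclic (M : DGMod A) : Prop :=
  ∀ x ∈ kerSub f M, M.d x = 0 → ∃ y ∈ kerSub f M, M.d y = x

theorem KerAcyclic.of_iso {M N : DGMod A} (e : M ≅ N) (h : KerAcyclic f M) : KerAcyclic f N := by
  intro x hx hd
  obtain ⟨y, hy, hy'⟩ := h (e.inv.1 x) (map_mem_kerSub f _ hx)
    (by rw [closed_comm e.inv, hd, map_zero])
  refine ⟨e.hom.1 y, map_mem_kerSub f _ hy, ?_⟩
  rw [closed_comm e.hom, hy', iso_inv_hom]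

/-- For the cone, `I C(g)` is the sum of `I N` and `I M`. A cocycle is first solved in the component
`M`; the solution then changes the `N`-component to a cocycle, which is solved in `I N`. -/
theorem KerAcyclic.cone {M N : DGMod A} (g : M ⟶ N) (hM : KerAcyclic f M) (hN : KerAcyclic f N) :
    KerAcyclic f (DGMod.cone g) := by
  rintro ⟨n, m⟩ hx hd
  have hn : n ∈ kerSub f N :=
    map_mem_kerSub f (M := DGMod.cone g) (LinearMap.fst A.carrier N.carrier M.carrier) hx
  have hm : m ∈ kerSub f M :=
    map_mem_kerSub f (M := DGMod.cone g) (LinearMap.snd A.carrier N.carrier M.carrier) hx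
  have hd1 : N.d n + g.1 m = 0 := congrArg Prod.fst hd
  have hd2 : M.d m = 0 := congrArg Prod.snd hd
  obtain ⟨m', hm', rfl⟩ := hM m hm hd2
  obtain ⟨n', hn', e⟩ := hN (n + g.1 m') (add_mem hn (map_mem_kerSub f _ hm'))
    (by rw [map_add, closed_comm g, hd1])
  refine ⟨(n', m'), ?_, ?_⟩
  · have h1 := map_mem_kerSub f (N := DGMod.cone g) (LinearMap.inl A.carrier N.carrier M.carrier) hn'
    have h2 := map_mem_kerSub f (N := DGMod.cone g) (LinearMap.inr A.carrier N.carrier M.carrier) hm'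
    have h3 := add_mem h1 h2
    have : ((n', 0) + (0, m') : N.carrier × M.carrier) = (n', m') := by simp
    exact this ▸ h3
  · change ((N.d n' + g.1 m', M.d m') : N.carrier × M.carrier) = _
    rw [e, add_assoc, N.char_two, add_zero]

/-- Elements of `I (A e)` are elements of `I`, hence have primitives `b` in `I`. Since `d e = 0`,
the product `b e` is still a primitive, and it lies in `I (A e)`. -/
theorem KerAcyclic.ofIdem {e : A.carrier} (he : e * e = e) (h0 : e ∈ A.grade 0) (hd : A.d e = 0)
    (hk : ∀ a, f.toAlgHom a = 0 → A.d a = 0 → ∃ b, f.toAlgHom b = 0 ∧ A.d b = a) :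
    KerAcyclic f (ofIdem A e h0 hd) := by
  intro x hx hdx
  have hx' : f.toAlgHom x.1 = 0 := by
    refine kerSub_induction f (M := DGMod.ofIdem A e h0 hd)
      (P := fun x : (DGMod.ofIdem A e h0 hd).carrier => f.toAlgHom x.1 = 0) (fun a m ha => ?_)
      (map_zero f.toAlgHom) (fun x y hx hy => ?_) hx
    · change f.toAlgHom (a * m.1) = 0
      rw [map_mul, ha, zero_mul]
    · change f.toAlgHom (x.1 + y.1) = 0
      rw [map_add, hx, hy, add_zero]
  obtain ⟨b, hb, hb'⟩ := hk x.1 hx' (congrArg Subtype.val hdx)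
  refine ⟨b • idemGen e h0 hd, smul_mem_kerSub f hb _, ?_⟩
  rw [DGMod.d_smul, idemGen_d, smul_zero, add_zero, hb', smul_idemGen he]

/-- The component of a primitive in the appropriate degree is again a primitive, and stays in the
graded submodule `I M`. The definition of `ExactProp` asks for homogeneous primitives. -/
theorem KerAcyclic.homogeneous {M : DGMod A} (h : KerAcyclic f M) (p : ℤ × ℤ)
    (x : (kerMod f M).carrier) (hx : x ∈ (kerMod f M).grade p) (hd : (kerMod f M).d x = 0) :
    ∃ y ∈ (kerMod f M).grade (p - (1, 0)), (kerMod f M).d y = x := by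
  obtain ⟨y, hy, hy'⟩ := h x.1 x.2 (congrArg Subtype.val hd)
  obtain ⟨π, hπ', hπ⟩ := exists_proj M.isInternal
  have hπd : ∀ p m, π (p + (1, 0)) (M.d m) = M.d (π p m) := by
    intro p m
    induction m using grade_induction M.isInternal with
    | hom g m hm =>
      rw [hπ _ _ _ (M.d_mem hm), hπ _ _ _ hm]
      simp only [add_left_inj]
      split_ifs <;> simp
    | zero => simp
    | add x y hx hy => simp [hx, hy]
  refine ⟨⟨π (p - (1, 0)) y, (kerSub_graded f M).proj_mem hπ _ hy⟩, hπ' _ _, ?_⟩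
  refine Subtype.ext ?_
  change M.d (π (p - (1, 0)) y) = x.1
  rw [← hπd, hy', sub_add_cancel]
  exact (hπ p p _ hx).trans (if_pos rfl)

/-! ### Base change is fully faithful up to homotopy -/

variable {f}

/-- Homotopical projectivity of `M`, applied to the acyclic module `I N`. The contraction therefore
also takes values in `I N` and is invisible after base change. -/
theorem exists_null_of_baseMap_eq_zero {M N : DGMod A} (hM : ExactProp M) (hN : KerAcyclic f N)
    {u : ℤ × ℤ} (δ : M.carrier →ₗ[A.carrier] N.carrier)
    (hδ : ∀ p, ∀ m ∈ M.grade p, δ m ∈ N.grade (p + u)) (hc : ∀ m, N.d (δ m) = δ (M.d m))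
    (h0 : ∀ m, δ m ∈ kerSub f N) : ∃ k : M.carrier →ₗ[A.carrier] N.carrier,
      (∀ p, ∀ m ∈ M.grade p, k m ∈ N.grade (p + (u - (1, 0)))) ∧ (∀ m, k m ∈ kerSub f N) ∧
      ∀ m, N.d (k m) + k (M.d m) = δ m := by
  obtain ⟨k, hk, hk'⟩ := hM (kerMod f N) hN.homogeneous u (δ.codRestrict (kerSub f N) h0) hδ
    (fun m => Subtype.ext (hc m))
  exact ⟨(kerSub f N).subtype.comp k, hk, fun m => (k m).2,
    fun m => congrArg Subtype.val (hk' m)⟩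

/-- Graded projectivity of `M`, applied to the surjection `N → N / I N`, which is surjective in each
bidegree by the definition of the quotient grading. The differential plays no role. -/
theorem exists_lift_baseLin {M N : DGMod A} (hM : LiftProp M) {u : ℤ × ℤ}
    (φ : (base f hf M).carrier →ₗ[B.carrier] (base f hf N).carrier)
    (hφ : ∀ p, ∀ m ∈ (base f hf M).grade p, φ m ∈ (base f hf N).grade (p + u)) :
    ∃ k : M.carrier →ₗ[A.carrier] N.carrier, (∀ p, ∀ m ∈ M.grade p, k m ∈ N.grade (p + u)) ∧
      ∀ m, baseMap f hf N (k m) = φ (baseMap f hf M m) := by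
  let h : M.carrier →ₗ[A.carrier] (quotMod f N).carrier :=
    { toFun := fun m => φ (baseMap f hf M m)
      map_add' := fun x y => by rw [map_add, map_add]; rfl
      map_smul' := fun a m => by
        obtain ⟨n, hn⟩ := baseMap_surjective f hf N (φ (baseMap f hf M m))
        rw [baseMap_smul, map_smul, ← hn, ← baseMap_smul]
        exact map_smul (quotMap f N).1 a n }
  exact hM N (quotMod f N) (quotMap f N) (fun p x hx => hx) u h
    fun p m hm => hφ p _ ⟨m, hm, rfl⟩

/-- Base change is full on the nose. -/
theorem exists_baseFunctor_map_eq {M N : DGMod A} (hM : LiftProp M) (hM' : ExactProp M)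
    (hN : KerAcyclic f N) (φ : base f hf M ⟶ base f hf N) :
    ∃ g : M ⟶ N, (baseFunctor f hf).map g = φ := by
  obtain ⟨k, hk, hk'⟩ := exists_lift_baseLin hf hM (u := 0) φ.1 (fun p m hm => by
    rw [add_zero]; exact closed_mem φ hm)
  -- The lift `k` commutes with the differentials modulo `I N` only. Its defect is a closed map of
  -- degree one into `I N`, so it is the boundary of some `l` with values in `I N`; then `k + l` is
  -- closed and still lifts `φ`.
  obtain ⟨l, hl, hl0, hl'⟩ := exists_null_of_baseMap_eq_zero (f := f) hM' hN (u := (1, 0))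
    (dHom M N k)
    (fun p m hm => by
      rw [dHom_apply]
      have h1 := hk p m hm
      have h2 := hk _ _ (M.d_mem hm)
      rw [add_zero] at h1 h2
      exact add_mem (N.d_mem h1) h2)
    (fun m => by
      rw [dHom_apply, dHom_apply, map_add, N.d_d, M.d_d, map_zero, zero_add, add_zero])
    (fun m => by
      rw [← baseMap_eq_zero f hf, dHom_apply, map_add, baseMap_d, hk', hk', baseMap_d,
        closed_comm φ]
      exact (base f hf N).char_two _)
  refine ⟨⟨k + l, mem_closed (fun p m hm => ?_) (fun m => ?_)⟩, hom_ext fun x => ?_⟩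
  · have h1 := hk p m hm
    have h2 := hl p m hm
    rw [add_zero] at h1
    rw [sub_self, add_zero] at h2
    exact add_mem h1 h2
  · have := hl' m
    rw [dHom_apply] at this
    rw [LinearMap.add_apply, LinearMap.add_apply, map_add]
    have h2 := N.char_two (k (M.d m))
    have h3 := N.char_two (l (M.d m))
    calc N.d (k m) + N.d (l m) = N.d (k m) + (N.d (l m) + l (M.d m)) + l (M.d m) -
          (l (M.d m) + l (M.d m)) := by abel
      _ = (N.d (k m) + N.d (k m)) + k (M.d m) + l (M.d m) := by rw [this, h3]; abel
      _ = _ := by rw [N.char_two, zero_add]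
  · obtain ⟨m, rfl⟩ := baseMap_surjective f hf _ x
    rw [baseFunctor_map_baseMap]
    change baseMap f hf N (k m + l m) = _
    rw [map_add, (baseMap_eq_zero f hf).2 (hl0 m), add_zero, hk']
    rfl

/-- Base change is faithful up to homotopy. -/
theorem homotopic_of_baseFunctor {M N : DGMod A} (hM : LiftProp M) (hM' : ExactProp M)
    (hN : KerAcyclic f N) {g g' : M ⟶ N}
    (h : homotopic ((baseFunctor f hf).map g) ((baseFunctor f hf).map g')) : homotopic g g' := by
  obtain ⟨(h : (base f hf M).carrier →ₗ[B.carrier] (base f hf N).carrier), hh, e⟩ := h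
  obtain ⟨k, hk, hk'⟩ := exists_lift_baseLin hf hM (u := (0 - 1, 0)) h hh
  have e' : ∀ m, (base f hf N).d (h (baseMap f hf M m)) + h (baseMap f hf M (M.d m)) =
      baseMap f hf N (g.1 m) - baseMap f hf N (g'.1 m) :=
    fun m => LinearMap.congr_fun e (baseMap f hf M m)
  -- After lifting the homotopy to `k`, the error `g - g' - d k` is closed with values in `I N`, and
  -- a contraction of it completes the homotopy.
  obtain ⟨l, hl, -, hl'⟩ := exists_null_of_baseMap_eq_zero (f := f) hM' hN (u := (0, 0))
    (g.1 - g'.1 - dHom M N k)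
    (fun p m hm => by
      rw [LinearMap.sub_apply, LinearMap.sub_apply, dHom_apply]
      refine sub_mem (sub_mem (g.2.1 p m hm) (g'.2.1 p m hm)) (add_mem ?_ ?_)
      · have := N.d_mem (hk p m hm)
        rwa [show p + (0 - 1, 0) + (1, 0) = p + (0, 0) by ext <;> simp] at this
      · have := hk _ _ (M.d_mem hm)
        rwa [show p + (1, 0) + (0 - 1, 0) = p + (0, 0) by ext <;> simp] at this)
    (fun m => by
      simp only [LinearMap.sub_apply, dHom_apply, map_sub, map_add, N.d_d, M.d_d, map_zero,
        closed_comm g, closed_comm g', zero_add, add_zero])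
    (fun m => by
      rw [← baseMap_eq_zero f hf, LinearMap.sub_apply, map_sub, LinearMap.sub_apply, map_sub,
        dHom_apply, map_add, baseMap_d, hk', hk', e', sub_self])
  refine ⟨k + l, fun p m hm => add_mem (hk p m hm) ?_, ?_⟩
  · have := hl p m hm
    rwa [show ((0 : ℤ), (0 : ℤ)) - (1, 0) = (0 - 1, 0) by ext <;> simp] at this
  · ext m
    have := hl' m
    rw [LinearMap.sub_apply, LinearMap.sub_apply] at this
    rw [map_add, LinearMap.add_apply, LinearMap.sub_apply]
    have h2 : dHom M N l m = g.1 m - g'.1 m - dHom M N k m := this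
    rw [h2]; abel

end DGMod

open CategoryTheory.Pretriangulated CategoryTheory.Limits

/-! ### Functors on `H^0(DG(A))` -/

section Lift

variable {A : QDGAlgebra} {D : Type 1} [Category.{0} D] [HasShift D ℤ] (Φ : DGMod A ⥤ D)
  [Φ.CommShift ℤ]

/-- The image of the triangle `M → N → C(f) → M[1]` under a functor which commutes with `[n]`. -/
def mapConeTriangle {M N : DGMod A} (f : M ⟶ N) : Triangle D :=
  Triangle.mk (Φ.map f) (Φ.map (DGMod.coneIn f))
    (Φ.map (DGMod.coneOut f) ≫ (Φ.commShiftIso (1 : ℤ)).hom.app M)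

/-- The functor induced on `H^0(DG(A))` maps cones to the images of the cones. -/
def liftConeTriangleIso
    (hΦ : ∀ (M N : DGMod A) (f g : M ⟶ N), DGMod.homotopic f g → Φ.map f = Φ.map g)
    {M N : DGMod A} (f : M ⟶ N) :
    (CategoryTheory.Quotient.lift _ Φ hΦ).mapTriangle.obj (coneTriangle f) ≅
      mapConeTriangle Φ f :=
  Triangle.isoMk _ _ (Iso.refl _) (Iso.refl _) (Iso.refl _)
    ((Category.comp_id _).trans (Category.id_comp _).symm)
    ((Category.comp_id _).trans (Category.id_comp _).symm) (by
      have h : (CategoryTheory.Quotient.lift _ Φ hΦ).map (((toH0 A).map (DGMod.coneOut f) ≫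
          ((toH0 A).commShiftIso (1 : ℤ)).hom.app M)) ≫
          ((CategoryTheory.Quotient.lift _ Φ hΦ).commShiftIso (1 : ℤ)).hom.app ((toH0 A).obj M) =
          Φ.map (DGMod.coneOut f) ≫ (Φ.commShiftIso (1 : ℤ)).hom.app M := by
        rw [CategoryTheory.Quotient.liftCommShift_commShiftIso,
          CategoryTheory.Quotient.LiftCommShift.iso_hom_app, ← Functor.map_comp_assoc,
          Category.assoc, Iso.hom_inv_id_app]
        exact congrArg (· ≫ (Φ.commShiftIso (1 : ℤ)).hom.app M) (congrArg
          (CategoryTheory.Quotient.lift _ Φ hΦ).map (Category.comp_id _))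
      refine Eq.trans ?_ (h.trans (Category.id_comp _).symm)
      exact (congrArg (_ ≫ ·) (CategoryTheory.Functor.map_id _ _)).trans
        (Category.comp_id _))

end Lift

/-! ### Base change of cones and shifts -/

namespace DGMod

variable {A B : QDGAlgebra}

/-- Isomorphic morphisms have isomorphic cones. -/
def coneCongr {M N M' N' : DGMod A} {f : M ⟶ N} {f' : M' ⟶ N'} (e : M ≅ M') (e' : N ≅ N')
    (h : e.hom ≫ f' = f ≫ e'.hom) : cone f ≅ cone f' where
  hom := ⟨LinearMap.prodMap e'.hom.1 e.hom.1, mem_closed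
    (fun p x hx => ⟨closed_mem e'.hom hx.1, closed_mem e.hom hx.2⟩) (by
      rintro ⟨n, m⟩
      have h' : f'.1 (e.hom.1 m) = e'.hom.1 (f.1 m) :=
        LinearMap.congr_fun (congrArg Subtype.val h) m
      change ((N'.d (e'.hom.1 n) + f'.1 (e.hom.1 m), M'.d (e.hom.1 m)) : N'.carrier × M'.carrier) =
        (e'.hom.1 (N.d n + f.1 m), e.hom.1 (M.d m))
      rw [map_add, h', closed_comm e'.hom, closed_comm e.hom])⟩
  inv := ⟨LinearMap.prodMap e'.inv.1 e.inv.1, mem_closed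
    (fun p x hx => ⟨closed_mem e'.inv hx.1, closed_mem e.inv hx.2⟩) (by
      rintro ⟨n, m⟩
      have h' : f.1 (e.inv.1 m) = e'.inv.1 (f'.1 m) := by
        have : e.inv ≫ f = f' ≫ e'.inv := by
          rw [Iso.inv_comp_eq, ← Category.assoc, h, Category.assoc, Iso.hom_inv_id,
            Category.comp_id]
        exact LinearMap.congr_fun (congrArg Subtype.val this) m
      change ((N.d (e'.inv.1 n) + f.1 (e.inv.1 m), M.d (e.inv.1 m)) : N.carrier × M.carrier) =
        (e'.inv.1 (N'.d n + f'.1 m), e.inv.1 (M'.d m))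
      rw [map_add, h', closed_comm e'.inv, closed_comm e.inv])⟩
  hom_inv_id := hom_ext fun x => Prod.ext (iso_hom_inv e' x.1) (iso_hom_inv e x.2)
  inv_hom_id := hom_ext fun x => Prod.ext (iso_inv_hom e' x.1) (iso_inv_hom e x.2)

variable (f : QDGAlgebra.Hom A B) (hf : Function.Surjective f.toAlgHom)

/-- Base change commutes with the shifts of bidegrees. -/
def baseRegradeIso (M : DGMod A) (u : ℤ × ℤ) :
    base f hf (M.regrade u) ≅ (base f hf M).regrade u where
  hom := ⟨LinearMap.id, mem_closed (fun _ _ h => h) (fun _ => rfl)⟩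
  inv := ⟨LinearMap.id, mem_closed (fun _ _ h => h) (fun _ => rfl)⟩

instance : (baseFunctor f hf).CommShift ℤ where
  commShiftIso n := NatIso.ofComponents (fun M => baseRegradeIso f hf M (n, 0)) (by
    intro M N g
    refine hom_ext fun x => ?_
    obtain ⟨m, rfl⟩ := baseMap_surjective f hf _ x
    rfl)
  commShiftIso_zero := by
    ext M
    refine hom_ext fun x => ?_
    obtain ⟨m, rfl⟩ := baseMap_surjective f hf _ x
    rw [Functor.CommShift.isoZero_hom_app]
    rfl
  commShiftIso_add a b := by
    ext M
    refine hom_ext fun x => ?_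
    obtain ⟨m, rfl⟩ := baseMap_surjective f hf _ x
    rw [Functor.CommShift.isoAdd_hom_app]
    rfl

/-- Base change commutes with cones. -/
def baseConeIso {M N : DGMod A} (g : M ⟶ N) :
    base f hf (cone g) ≅ cone ((baseFunctor f hf).map g) where
  hom := ⟨baseLift f hf (N := cone ((baseFunctor f hf).map g))
      ((baseMap f hf N).prodMap (baseMap f hf M)) (fun a m => Prod.ext
        (baseMap_smul f hf N a m.1) (baseMap_smul f hf M a m.2)),
    mem_closed (by
      rintro p _ ⟨m, hm, rfl⟩
      exact ⟨⟨_, hm.1, rfl⟩, ⟨_, hm.2, rfl⟩⟩) (by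
      intro x
      obtain ⟨m, rfl⟩ := baseMap_surjective f hf _ x
      exact Prod.ext (map_add (baseMap f hf N) (N.d m.1) (g.1 m.2)).symm rfl)⟩
  inv := ⟨(baseLin f hf (N := cone g) (LinearMap.inl A.carrier N.carrier M.carrier)).coprod
      (baseLin f hf (N := cone g) (LinearMap.inr A.carrier N.carrier M.carrier)),
    mem_closed (by
      rintro p ⟨_, _⟩ ⟨⟨n, hn, rfl⟩, ⟨m, hm, rfl⟩⟩
      exact add_mem (S := AddSubgroup (base f hf (cone g)).carrier)
        ⟨((n, 0) : N.carrier × M.carrier), ⟨hn, zero_mem _⟩, rfl⟩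
        ⟨((0, m) : N.carrier × M.carrier), ⟨zero_mem _, hm⟩, rfl⟩) (by
      rintro ⟨x, y⟩
      obtain ⟨n, rfl⟩ := baseMap_surjective f hf _ x
      obtain ⟨m, rfl⟩ := baseMap_surjective f hf _ y
      have h : ∀ n m, baseMap f hf (cone g) ((n, 0) : N.carrier × M.carrier) +
          baseMap f hf (cone g) ((0, m) : N.carrier × M.carrier) =
          baseMap f hf (cone g) ((n, m) : N.carrier × M.carrier) := fun n m =>
        (map_add (baseMap f hf (cone g)) ((n, 0) : N.carrier × M.carrier) ((0, m) : N.carrier × M.carrier)).symm.trans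
          (congrArg (baseMap f hf (cone g)) (Prod.ext (add_zero n) (zero_add m)))
      refine (congrArg (base f hf (cone g)).d (h n m)).trans ?_
      refine Eq.trans ?_ (h (N.d n + g.1 m) (M.d m)).symm
      rfl)⟩
  hom_inv_id := hom_ext fun x => by
    obtain ⟨⟨n, m⟩, rfl⟩ := baseMap_surjective f hf _ x
    exact (map_add (baseMap f hf (cone g)) ((n, 0) : N.carrier × M.carrier) ((0, m) : N.carrier × M.carrier)).symm.trans
          (congrArg (baseMap f hf (cone g)) (Prod.ext (add_zero n) (zero_add m)))
  inv_hom_id := hom_ext fun x => by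
    obtain ⟨x, y⟩ := x
    obtain ⟨n, rfl⟩ := baseMap_surjective f hf _ x
    obtain ⟨m, rfl⟩ := baseMap_surjective f hf _ y
    exact Prod.ext ((map_add (baseMap f hf N) n 0).symm.trans (congrArg _ (add_zero n)))
      ((map_add (baseMap f hf M) 0 m).symm.trans (congrArg _ (zero_add m)))

/-- The map from the base change of `A e` to `B e'`, where `e'` is the image of `e`. -/
def baseIdemHom {e : A.carrier} (he : e * e = e) (h0 : e ∈ A.grade 0) (hd : A.d e = 0)
    {e' : B.carrier} (he' : f.toAlgHom e = e') (h0' : e' ∈ B.grade 0) (hd' : B.d e' = 0) :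
    (base f hf (ofIdem A e h0 hd)).carrier →ₗ[B.carrier] (ofIdem B e' h0' hd').carrier :=
  baseLift f hf (N := ofIdem B e' h0' hd') (M := ofIdem A e h0 hd)
    (AddMonoidHom.mk' (fun m => ⟨f.toAlgHom m.1, Ideal.mem_span_singleton'.2
      ⟨f.toAlgHom m.1, by
        rw [← he', ← map_mul]; exact congrArg f.toAlgHom (ofIdem_mul he m)⟩⟩)
      (fun x y => Subtype.ext (map_add f.toAlgHom x.1 y.1)))
    (fun a m => Subtype.ext (map_mul f.toAlgHom a m.1))

/-- The base change of `A e` is `B e'`, where `e'` is the image of `e`. -/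
def baseIdemIso {e : A.carrier} (he : e * e = e) (h0 : e ∈ A.grade 0) (hd : A.d e = 0)
    {e' : B.carrier} (he' : f.toAlgHom e = e') (h0' : e' ∈ B.grade 0) (hd' : B.d e' = 0) :
    base f hf (ofIdem A e h0 hd) ≅ ofIdem B e' h0' hd' where
  hom := ⟨baseIdemHom f hf he h0 hd he' h0' hd',
    mem_closed (by
      rintro p _ ⟨m, hm, rfl⟩
      exact f.map_grade hm) (by
      intro x
      obtain ⟨m, rfl⟩ := baseMap_surjective f hf _ x
      exact Subtype.ext (f.map_d m.1).symm)⟩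
  inv := ⟨idemLift h0' hd' (baseMap f hf (ofIdem A e h0 hd) (idemGen e h0 hd)),
    mem_closed (by
      intro p m hm
      rw [idemLift_apply]
      have h : baseMap f hf (ofIdem A e h0 hd) (idemGen e h0 hd) ∈
          (base f hf (ofIdem A e h0 hd)).grade 0 := ⟨_, idemGen_mem e h0 hd, rfl⟩
      have := (base f hf (ofIdem A e h0 hd)).smul_mem (show m.1 ∈ B.grade p from hm) h
      rwa [add_zero] at this) (by
      intro m
      rw [idemLift_apply, idemLift_apply, DGMod.d_smul, ← baseMap_d, idemGen_d, map_zero,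
        smul_zero, add_zero]
      rfl)⟩
  hom_inv_id := hom_ext fun x => by
    obtain ⟨m, rfl⟩ := baseMap_surjective f hf _ x
    refine Eq.trans (b := f.toAlgHom m.1 • baseMap f hf (ofIdem A e h0 hd) (idemGen e h0 hd)) rfl ?_
    rw [← baseMap_smul, smul_idemGen he]
    rfl
  inv_hom_id := hom_ext fun x => by
    obtain ⟨b, hb⟩ := hf x.1
    refine Subtype.ext ?_
    refine Eq.trans (b := ((baseIdemHom f hf he h0 hd he' h0' hd')
      (x.1 • baseMap f hf (ofIdem A e h0 hd) (idemGen e h0 hd))).1) rfl ?_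
    rw [map_smul]
    change x.1 * f.toAlgHom e = x.1
    rw [he']
    exact ofIdem_mul (by rw [← he', ← map_mul, he]) x

end DGMod

open CategoryTheory.Pretriangulated CategoryTheory.Limits

/-! ### DG modules over a graded algebra as complexes of graded modules -/

namespace DGMod

variable {A : QAlgebra}

instance (M : DGMod A.toDG) : Module A.carrier M.carrier := M.module

theorem smul_mem_toDG (M : DGMod A.toDG) {k i j : ℤ} {a : A.carrier} {m : M.carrier}
    (ha : a ∈ A.grade k) (hm : m ∈ M.grade (i, j)) : a • m ∈ M.grade (i, k + j) := by
  have h : a ∈ A.toDG.grade (0, k) := by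
    change a ∈ (if (0 : ℤ) = 0 then A.grade k else ⊥)
    rwa [if_pos rfl]
  have := M.smul_mem h hm
  rwa [Prod.mk_add_mk, zero_add] at this

theorem d_smul_toDG (M : DGMod A.toDG) (a : A.carrier) (m : M.carrier) :
    M.d (a • m) = a • M.d m :=
  (M.d_smul a m).trans ((congrArg (· + a • M.d m) (zero_smul A.toDG.carrier m)).trans (zero_add _))

/-- The part of cohomological degree `i`. -/
def partSub (M : DGMod A.toDG) (i : ℤ) : Submodule A.carrier M.carrier where
  toAddSubmonoid := (⨆ j, M.grade (i, j) : AddSubgroup M.carrier).toAddSubmonoid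
  smul_mem' := by
    intro a m hm
    change m ∈ (⨆ j, M.grade (i, j) : AddSubgroup M.carrier) at hm
    change a • m ∈ (⨆ j, M.grade (i, j) : AddSubgroup M.carrier)
    induction a using grade_induction A.isInternal with
    | hom k a ha =>
      refine AddSubgroup.iSup_induction (C := fun m => a • m ∈ (⨆ j, M.grade (i, j) :
        AddSubgroup M.carrier)) _ hm (fun j m hm => ?_) ?_ (fun x y hx hy => ?_)
      · exact AddSubgroup.mem_iSup_of_mem (k + j) (smul_mem_toDG M ha hm)
      · rw [smul_zero]; exact zero_mem _
      · rw [smul_add]; exact add_mem hx hy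
    | zero => rw [zero_smul]; exact zero_mem _
    | add a b ha hb => rw [add_smul]; exact add_mem ha hb

theorem grade_le_partSub (M : DGMod A.toDG) {i j : ℤ} {m : M.carrier} (hm : m ∈ M.grade (i, j)) :
    m ∈ partSub M i := AddSubgroup.mem_iSup_of_mem (S := fun j => M.grade (i, j)) j hm

theorem partSub_induction {M : DGMod A.toDG} {i : ℤ} {p : M.carrier → Prop}
    (hom : ∀ j, ∀ m ∈ M.grade (i, j), p m) (zero : p 0) (add : ∀ x y, p x → p y → p (x + y))
    {m : M.carrier} (hm : m ∈ partSub M i) : p m :=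
  AddSubgroup.iSup_induction (C := p) (fun j => M.grade (i, j)) hm hom zero add

theorem proj_of_mem_partSub {M : DGMod A.toDG} {π : ℤ × ℤ → M.carrier →+ M.carrier}
    (hπ : ∀ g h m, m ∈ M.grade g → π h m = if g = h then m else 0) {i : ℤ} {m : M.carrier}
    (hm : m ∈ partSub M i) {p : ℤ × ℤ} (hp : p.1 ≠ i) : π p m = 0 := by
  refine partSub_induction (p := fun m => π p m = 0) (fun j m hm => ?_) (map_zero _)
    (fun x y hx hy => by rw [map_add, hx, hy, add_zero]) hm
  rw [hπ _ _ _ hm, if_neg]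
  rintro rfl
  exact hp rfl

/-- The part of cohomological degree `i` as a graded module. -/
def part (M : DGMod A.toDG) (i : ℤ) : GrMod A where
  carrier := partSub M i
  grade j := (M.grade (i, j)).comap (partSub M i).subtype.toAddMonoidHom
  isInternal := by
    obtain ⟨π, hπ', hπ⟩ := exists_proj M.isInternal
    refine isInternal_of_proj _ (fun j => AddMonoidHom.mk'
      (fun m => (⟨π (i, j) m, grade_le_partSub M (hπ' _ _)⟩ : partSub M i))
      (fun x y => Subtype.ext (map_add (π (i, j)) x.1 y.1))) ?_ ?_
    · intro j k m hm
      refine Subtype.ext ((hπ (i, j) (i, k) m.1 hm).trans ?_)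
      by_cases h : j = k
      · subst h; simp
      · rw [if_neg (fun h' => h (congrArg Prod.snd h')), if_neg h]; rfl
    · intro m
      obtain ⟨s, hs⟩ := exists_eq_sum_proj M.isInternal hπ m.1
      have hmem : ∀ p, π p m.1 ∈ partSub M i := fun p => by
        by_cases hp : p.1 = i
        · subst hp; exact grade_le_partSub M (hπ' _ _)
        · rw [proj_of_mem_partSub hπ m.2 hp]; exact zero_mem _
      have : m = ∑ p ∈ s, (⟨π p m.1, hmem p⟩ : partSub M i) := by
        refine Subtype.ext (hs.trans ?_)
        rw [AddSubmonoidClass.coe_finsetSum]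
      rw [this]
      refine sum_mem fun p _ => ?_
      by_cases hp : p.1 = i
      · subst hp
        exact AddSubmonoid.subset_closure ⟨p.2, hπ' p m.1⟩
      · have : (⟨π p m.1, hmem p⟩ : partSub M i) = 0 :=
          Subtype.ext (proj_of_mem_partSub hπ m.2 hp)
        rw [this]; exact zero_mem _
  smul_mem ha hm := smul_mem_toDG M ha hm

theorem map_mem_partSub {M N : DGMod A.toDG} (g : M.carrier →ₗ[A.carrier] N.carrier) {i j : ℤ}
    (h : ∀ k, ∀ m ∈ M.grade (i, k), g m ∈ N.grade (j, k)) {m : M.carrier} (hm : m ∈ partSub M i) :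
    g m ∈ partSub N j :=
  partSub_induction (p := fun m => g m ∈ partSub N j)
    (fun k m hm => grade_le_partSub N (h k m hm)) (by rw [map_zero]; exact zero_mem _)
    (fun x y hx hy => by rw [map_add]; exact add_mem hx hy) hm

/-- The map between parts induced by a homogeneous linear map. -/
def partMap {M N : DGMod A.toDG} (g : M.carrier →ₗ[A.carrier] N.carrier) (i j : ℤ)
    (h : ∀ k, ∀ m ∈ M.grade (i, k), g m ∈ N.grade (j, k)) : part M i ⟶ part N j :=
  ⟨(g.comp (partSub M i).subtype).codRestrict (partSub N j) fun m => map_mem_partSub g h m.2,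
    fun k m hm => h k m.1 hm⟩

theorem part_ext {M N : DGMod A.toDG} {i j : ℤ} {f g : part M i ⟶ part N j}
    (h : ∀ m : (part M i).carrier, (f.1 m).1 = (g.1 m).1) : f = g :=
  GrMod.hom_ext fun m => Subtype.ext (h m)

/-- The differential as a linear map. -/
def dLin (M : DGMod A.toDG) : M.carrier →ₗ[A.carrier] M.carrier where
  toFun := M.d
  map_add' := map_add _
  map_smul' := d_smul_toDG M

/-- A linear map as a linear map over the underlying graded algebra. -/
def ofLin {M N : DGMod A.toDG} (g : M.carrier →ₗ[A.toDG.carrier] N.carrier) :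
    M.carrier →ₗ[A.carrier] N.carrier := g

theorem d_mem_toDG (M : DGMod A.toDG) {i j k : ℤ} (h : i + 1 = j) {m : M.carrier}
    (hm : m ∈ M.grade (i, k)) : M.d m ∈ M.grade (j, k) := by
  have := M.d_mem hm
  rwa [Prod.mk_add_mk, add_zero, h] at this

/-- The differential between two parts. -/
def dPart (M : DGMod A.toDG) (i j : ℤ) : part M i ⟶ part M j :=
  if h : i + 1 = j then partMap (dLin M) i j fun _ _ => d_mem_toDG M h else 0

theorem dPart_apply (M : DGMod A.toDG) {i j : ℤ} (h : i + 1 = j) (m : (part M i).carrier) :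
    ((dPart M i j).1 m).1 = M.d m.1 := by
  rw [dPart, dif_pos h]
  rfl

/-- The complex of graded modules underlying a DG module. -/
def toComplex (M : DGMod A.toDG) : CochainComplex (GrMod A) ℤ where
  X := part M
  d := dPart M
  shape _ _ h := dif_neg h
  d_comp_d' _ _ _ hij hjk := part_ext fun m =>
    (dPart_apply M hjk _).trans ((congrArg M.d (dPart_apply M hij m)).trans (M.d_d m.1))

theorem toComplex_d (M : DGMod A.toDG) {i j : ℤ} (h : i + 1 = j) (m : (part M i).carrier) :
    (((toComplex M).d i j).1 m).1 = M.d m.1 := dPart_apply M h m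

/-- A morphism of DG modules given by a linear map over the underlying graded algebra. -/
def homMk {M N : DGMod A.toDG} (g : M.carrier →ₗ[A.carrier] N.carrier)
    (h : ∀ p, ∀ m ∈ M.grade p, g m ∈ N.grade p)
    (h' : ∀ p, ∀ m ∈ M.grade p, N.d (g m) = g (M.d m)) : M ⟶ N :=
  ⟨(g : M.carrier →ₗ[A.carrier] N.carrier), mem_closed h fun m => by
    change N.d (g m) = g (M.d m)
    induction m using grade_induction M.isInternal with
    | hom p m hm => exact h' p m hm
    | zero => simp
    | add x y hx hy => rw [map_add, map_add, hx, hy, map_add, map_add]⟩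

variable (A) in
/-- The functor from DG modules to complexes. -/
def complexFunctor : DGMod A.toDG ⥤ CochainComplex (GrMod A) ℤ where
  obj := toComplex
  map g :=
    { f := fun i => partMap (ofLin g.1) i i fun _ _ hm => closed_mem g hm
      comm' := fun _ _ h => part_ext fun m =>
        (toComplex_d _ h _).trans ((closed_comm g m.1).trans
          (congrArg g.1 (toComplex_d _ h m)).symm) }
  map_id _ := rfl
  map_comp _ _ := rfl

theorem isInternal_partSub (M : DGMod A.toDG) : DirectSum.IsInternal (partSub M) := by
  obtain ⟨π, hπ', hπ⟩ := exists_proj M.isInternal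
  constructor
  · rw [injective_iff_map_eq_zero]
    intro x hx
    have key : ∀ (p : ℤ × ℤ) (x : DirectSum ℤ fun i => partSub M i),
        π p (DirectSum.coeAddMonoidHom (partSub M) x) = π p (x p.1).1 := by
      intro p x
      induction x using DirectSum.induction_on with
      | zero => simp
      | of i z =>
        rw [DirectSum.coeAddMonoidHom_of, DirectSum.of_apply]
        by_cases e : i = p.1
        · subst e; simp
        · rw [proj_of_mem_partSub hπ z.2 (Ne.symm e)]
          simp [e]
      | add a b ha hb =>
        rw [map_add, map_add, ha, hb, DirectSum.add_apply, Submodule.coe_add, map_add]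
    ext i
    obtain ⟨s, hs⟩ := exists_eq_sum_proj M.isInternal hπ (x i).1
    refine hs.trans (Finset.sum_eq_zero fun p _ => ?_)
    by_cases hp : p.1 = i
    · subst hp; rw [← key, hx, map_zero]
    · exact proj_of_mem_partSub hπ (x i).2 hp
  · intro m
    induction m using grade_induction M.isInternal with
    | hom g m hm =>
      exact ⟨DirectSum.of (fun i => partSub M i) g.1 ⟨m, grade_le_partSub M hm⟩,
        DirectSum.coeAddMonoidHom_of _ _ _⟩
    | zero => exact ⟨0, map_zero _⟩
    | add x y hx hy =>
      obtain ⟨a, rfl⟩ := hx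
      obtain ⟨b, rfl⟩ := hy
      exact ⟨a + b, map_add _ _ _⟩

/-- The linear map glued from linear maps on the parts. -/
def glue {M N : DGMod A.toDG} (φ : ∀ i, partSub M i →ₗ[A.carrier] N.carrier) :
    M.carrier →ₗ[A.carrier] N.carrier :=
  (DirectSum.toModule A.carrier ℤ N.carrier φ).comp
    (LinearEquiv.ofBijective (DirectSum.coeLinearMap (partSub M))
      (isInternal_partSub M)).symm.toLinearMap

theorem glue_apply {M N : DGMod A.toDG} (φ : ∀ i, partSub M i →ₗ[A.carrier] N.carrier) {i : ℤ}
    {m : M.carrier} (hm : m ∈ partSub M i) : glue φ m = φ i ⟨m, hm⟩ := by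
  have h : (LinearEquiv.ofBijective (DirectSum.coeLinearMap (partSub M))
      (isInternal_partSub M)).symm m = DirectSum.lof A.carrier ℤ (fun i => partSub M i) i ⟨m, hm⟩ := by
    rw [LinearEquiv.symm_apply_eq]
    exact (DirectSum.coeLinearMap_lof (partSub M) i ⟨m, hm⟩).symm
  change DirectSum.toModule A.carrier ℤ N.carrier φ ((LinearEquiv.ofBijective
    (DirectSum.coeLinearMap (partSub M)) (isInternal_partSub M)).symm m) = _
  rw [h, DirectSum.toModule_lof]

/-- The components of a chain map are glued along the decomposition of `M` into its cohomological
parts. -/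
theorem exists_complexFunctor_map_eq {M N : DGMod A.toDG} (φ : toComplex M ⟶ toComplex N) :
    ∃ g : M ⟶ N, (complexFunctor A).map g = φ := by
  let g := glue (N := N) fun i => (partSub N i).subtype.comp (φ.f i).1
  have hg : ∀ {i m} (hm : m ∈ partSub M i), g m = ((φ.f i).1 ⟨m, hm⟩).1 := fun hm => glue_apply _ hm
  refine ⟨homMk g (fun p m hm => ?_) (fun p m hm => ?_), ?_⟩
  · rw [hg (grade_le_partSub M hm)]
    exact (φ.f p.1).2 p.2 _ hm
  · have h := grade_le_partSub M hm
    have h' := grade_le_partSub M (d_mem_toDG M rfl hm)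
    rw [hg h, hg h']
    refine (toComplex_d N rfl _).symm.trans ?_
    have := congrArg (fun f => (f.1 ⟨m, h⟩).1) (φ.comm p.1 (p.1 + 1))
    refine Eq.trans this (congrArg (fun x => ((φ.f (p.1 + 1)).1 x).1) ?_)
    exact Subtype.ext (toComplex_d M rfl ⟨m, h⟩)
  · ext i
    exact part_ext fun m => hg m.2

/-- The components of the homotopy given by a linear map of degree `-1`. -/
def homotopyPart {M N : DGMod A.toDG} (k : M.carrier →ₗ[A.carrier] N.carrier)
    (hk : ∀ {i j : ℤ}, j + 1 = i → ∀ l, ∀ m ∈ M.grade (i, l), k m ∈ N.grade (j, l)) (i j : ℤ) :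
    part M i ⟶ part N j :=
  if h : j + 1 = i then partMap k i j (hk h) else 0

theorem homotopyPart_apply {M N : DGMod A.toDG} (k : M.carrier →ₗ[A.carrier] N.carrier)
    (hk : ∀ {i j : ℤ}, j + 1 = i → ∀ l, ∀ m ∈ M.grade (i, l), k m ∈ N.grade (j, l)) {i j : ℤ}
    (h : j + 1 = i) (m : (part M i).carrier) : ((homotopyPart k hk i j).1 m).1 = k m.1 := by
  rw [homotopyPart, dif_pos h]
  rfl

/-- A linear map of degree `-1` restricts to maps from each part to the preceding one. The identity
`d k + k d = g - g'` is, part by part, the homotopy identity for complexes. -/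
theorem complexFunctor_homotopic {M N : DGMod A.toDG} {g g' : M ⟶ N} (h : homotopic g g') :
    Nonempty (Homotopy ((complexFunctor A).map g) ((complexFunctor A).map g')) := by
  obtain ⟨k, hk, e⟩ := h
  have hk' : ∀ {i j : ℤ}, j + 1 = i → ∀ l, ∀ m ∈ M.grade (i, l), ofLin k m ∈ N.grade (j, l) := by
    intro i j h l m hm
    have := hk _ m hm
    rwa [Prod.mk_add_mk, add_zero, show i + (0 - 1) = j by omega] at this
  refine ⟨⟨homotopyPart (ofLin k) hk', fun i j h => dif_neg h, fun i => ?_⟩⟩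
  refine Eq.trans ?_ (congrArg₂ (fun a b => a + b + ((complexFunctor A).map g').f i)
    (dNext_eq _ (show (ComplexShape.up ℤ).Rel i (i + 1) from rfl)).symm
    (prevD_eq _ (show (ComplexShape.up ℤ).Rel (i - 1) i from sub_add_cancel i 1)).symm)
  refine part_ext fun m => ?_
  have h1 : ((homotopyPart (ofLin k) hk' (i + 1) i).1 ((dPart M i (i + 1)).1 m)).1 =
      k (M.d m.1) :=
    (homotopyPart_apply (ofLin k) hk' rfl _).trans (congrArg k (dPart_apply M rfl m))
  have h2 : ((dPart N (i - 1) i).1 ((homotopyPart (ofLin k) hk' i (i - 1)).1 m)).1 =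
      N.d (k m.1) :=
    (dPart_apply N (sub_add_cancel i 1) _).trans
      (congrArg N.d (homotopyPart_apply (ofLin k) hk' (sub_add_cancel i 1) m))
  have h3 : N.d (k m.1) + k (M.d m.1) = g.1 m.1 - g'.1 m.1 := LinearMap.congr_fun e m.1
  refine Eq.trans (sub_eq_iff_eq_add.1 h3.symm) ?_
  rw [add_comm (N.d _), ← h1, ← h2]
  rfl

/-- Only the components of the chain homotopy from degree `i` to degree `i - 1` are glued; the
homotopy identity is then checked on homogeneous elements. -/
theorem homotopic_of_homotopy {M N : DGMod A.toDG} {g g' : M ⟶ N}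
    (h : Homotopy ((complexFunctor A).map g) ((complexFunctor A).map g')) : homotopic g g' := by
  let k := glue (M := M) (N := N) fun i => (partSub N (i - 1)).subtype.comp (h.hom i (i - 1)).1
  have hk : ∀ {i j : ℤ} (_ : j + 1 = i) {m} (hm : m ∈ partSub M i),
      k m = ((h.hom i j).1 ⟨m, hm⟩).1 := by
    intro i j hij m hm
    obtain rfl : j = i - 1 := by omega
    exact glue_apply _ hm
  have hk1 : ∀ p, ∀ m ∈ M.grade p, k m ∈ N.grade (p + (0 - 1, 0)) := fun p m hm => by
    rw [hk (sub_add_cancel p.1 1) (grade_le_partSub M hm)]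
    have := (h.hom p.1 (p.1 - 1)).2 p.2 ⟨m, grade_le_partSub M hm⟩ hm
    have e : p + (0 - 1, 0) = (p.1 - 1, p.2) := by ext <;> simp [sub_eq_add_neg]
    rw [e]
    exact this
  have hk2 : ∀ m, N.d (k m) + k (M.d m) = g.1 m - g'.1 m := fun m => by
    induction m using grade_induction M.isInternal with
    | hom p m hm =>
      have hm' := grade_le_partSub M hm
      have := h.comm p.1
      rw [dNext_eq _ (show (ComplexShape.up ℤ).Rel p.1 (p.1 + 1) from rfl),
        prevD_eq _ (show (ComplexShape.up ℤ).Rel (p.1 - 1) p.1 from sub_add_cancel p.1 1)] at this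
      have h0 : g.1 m = ((h.hom (p.1 + 1) p.1).1 ((dPart M p.1 (p.1 + 1)).1 ⟨m, hm'⟩)).1 +
        ((dPart N (p.1 - 1) p.1).1 ((h.hom p.1 (p.1 - 1)).1 ⟨m, hm'⟩)).1 + g'.1 m :=
        congrArg (fun f => (f.1 ⟨m, hm'⟩).1) this
      have h1 : ((h.hom (p.1 + 1) p.1).1 ((dPart M p.1 (p.1 + 1)).1 ⟨m, hm'⟩)).1 = k (M.d m) := by
        rw [hk rfl (grade_le_partSub M (d_mem_toDG M rfl hm))]
        exact congrArg (fun x => ((h.hom (p.1 + 1) p.1).1 x).1) (Subtype.ext (dPart_apply M rfl _))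
      have h2 : ((dPart N (p.1 - 1) p.1).1 ((h.hom p.1 (p.1 - 1)).1 ⟨m, hm'⟩)).1 = N.d (k m) :=
        (dPart_apply N (sub_add_cancel p.1 1) _).trans
          (congrArg N.d (hk (sub_add_cancel p.1 1) hm').symm)
      rw [h1, h2] at h0
      rw [h0, add_sub_cancel_right, add_comm]
    | zero => simp only [map_zero, add_zero, sub_self]
    | add x y hx hy =>
      have : ∀ a b c d : N.carrier, a + b + (c + d) = a + c + (b + d) := fun a b c d => by abel
      rw [map_add k, map_add, map_add, map_add k, this, hx, hy, map_add, map_add]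
      abel
  exact ⟨k, hk1, LinearMap.ext hk2⟩

end DGMod

open CategoryTheory.Pretriangulated CategoryTheory.Limits

/-! ### The embedding of `H^0(DG(A))` in the homotopy category of graded modules -/

namespace GrMod

variable {A : QAlgebra}

theorem add_self (M : GrMod A) (m : M.carrier) : m + m = 0 := by
  have : ((1 : F) + 1) • (1 : A.carrier) = 0 := by rw [show (1 : F) + 1 = 0 from rfl, zero_smul]
  rw [add_smul, one_smul] at this
  have h : ((1 : A.carrier) + 1) • m = 0 := by rw [this, zero_smul]
  rwa [add_smul, one_smul] at h

theorem neg_hom {M N : GrMod A} (f : M ⟶ N) : -f = f :=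
  hom_ext fun m => neg_eq_of_add_eq_zero_left (add_self N (f.1 m))

/-- In characteristic two all the signs in the conventions for shifts and mapping cones of complexes
disappear. -/
theorem units_smul_hom {M N : GrMod A} (u : ℤˣ) (f : M ⟶ N) : u • f = f := by
  obtain rfl | rfl := Int.units_eq_one_or u
  · exact one_smul _ _
  · rw [Units.neg_smul, one_smul, neg_hom]

/-- Graded maps commute with the projections to the homogeneous components, so an injective one
detects degrees. Consequently the inverse of a bijective graded map is graded. -/
theorem mem_of_map_mem {M N : GrMod A} (f : M ⟶ N) (hf : Function.Injective f.1) {i : ℤ}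
    {m : M.carrier} (hm : f.1 m ∈ N.grade i) : m ∈ M.grade i := by
  obtain ⟨π, hπ', hπ⟩ := exists_proj M.isInternal
  obtain ⟨ρ, -, hρ⟩ := exists_proj N.isInternal
  have h : ∀ m, ρ i (f.1 m) = f.1 (π i m) := fun m => by
    induction m using grade_induction M.isInternal with
    | hom j m hm =>
      rw [hπ _ _ _ hm, hρ _ _ _ (f.2 j m hm)]
      split_ifs <;> simp
    | zero => simp
    | add x y hx hy => simp [hx, hy]
  have := h m
  rw [hρ i i _ hm, if_pos rfl] at this
  rw [hf this]
  exact hπ' i m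

theorem isIso_of_bijective {M N : GrMod A} (f : M ⟶ N) (hf : Function.Bijective f.1) :
    IsIso f := by
  let e := LinearEquiv.ofBijective f.1 hf
  have he : ∀ n, f.1 (e.symm n) = n := e.apply_symm_apply
  refine ⟨⟨e.symm.toLinearMap, fun i n hn => mem_of_map_mem f hf.1 ?_⟩,
    hom_ext fun m => e.symm_apply_apply m, hom_ext fun n => he n⟩
  change f.1 (e.symm n) ∈ N.grade i
  rwa [he]

end GrMod

/-! ### Shifts and cones under the passage to complexes -/

namespace DGMod

variable {A : QAlgebra}

theorem mem_shift_grade (M : DGMod A.toDG) (n : ℤ) {i j : ℤ} {m : M.carrier} :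
    m ∈ (M.regrade (n, 0)).grade (i, j) ↔ m ∈ M.grade (i + n, j) := by
  change m ∈ M.grade ((i, j) + (n, 0)) ↔ _
  rw [Prod.mk_add_mk, add_zero]

/-- The identification of the parts of a shift. -/
def shiftPart (M : DGMod A.toDG) (n i : ℤ) : part (M.regrade (n, 0)) i ⟶ part M (i + n) :=
  partMap (M := M.regrade (n, 0)) (N := M) LinearMap.id i (i + n)
    fun _ _ h => (mem_shift_grade M n).1 h

/-- The identification of the parts of a shift. -/
def shiftPartInv (M : DGMod A.toDG) (n i : ℤ) : part M (i + n) ⟶ part (M.regrade (n, 0)) i :=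
  partMap (M := M) (N := M.regrade (n, 0)) LinearMap.id (i + n) i
    fun _ _ h => (mem_shift_grade M n).2 h

theorem partMap_apply {M N : DGMod A.toDG} (g : M.carrier →ₗ[A.carrier] N.carrier) (i j : ℤ)
    (h : ∀ k, ∀ m ∈ M.grade (i, k), g m ∈ N.grade (j, k)) (m : (part M i).carrier) :
    ((partMap g i j h).1 m).1 = g m.1 := rfl

theorem shiftPart_apply (M : DGMod A.toDG) (n i : ℤ) (m : (part (M.regrade (n, 0)) i).carrier) :
    ((shiftPart M n i).1 m).1 = m.1 := partMap_apply _ _ _ _ m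

theorem shiftPartInv_apply (M : DGMod A.toDG) (n i : ℤ) (m : (part M (i + n)).carrier) :
    ((shiftPartInv M n i).1 m).1 = m.1 := partMap_apply _ _ _ _ m

theorem comp_part {X Y Z : GrMod A} (f : X ⟶ Y) (g : Y ⟶ Z) (m : X.carrier) :
    (f ≫ g).1 m = g.1 (f.1 m) := rfl

theorem shiftPart_inv (M : DGMod A.toDG) (n i : ℤ) :
    shiftPart M n i ≫ shiftPartInv M n i = 𝟙 _ := 
  part_ext fun m => by
    rw [comp_part, shiftPartInv_apply, shiftPart_apply]
    rfl

theorem inv_shiftPart (M : DGMod A.toDG) (n i : ℤ) :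
    shiftPartInv M n i ≫ shiftPart M n i = 𝟙 _ := 
  part_ext fun m => by
    exact ((shiftPart_apply M n i _).trans (shiftPartInv_apply M n i m))

theorem shiftPart_comm (M : DGMod A.toDG) (n i j : ℤ) (h : i + 1 = j) (u : ℤˣ) :
    shiftPart M n i ≫ (u • dPart M (i + n) (j + n)) =
      dPart (M.regrade (n, 0)) i j ≫ shiftPart M n j := by
  rw [GrMod.units_smul_hom]
  refine part_ext fun m => ?_
  rw [comp_part, comp_part, shiftPart_apply, dPart_apply _ h, dPart_apply _ 
    (show i + n + 1 = j + n by rw [← h]; exact add_right_comm _ _ _), shiftPart_apply]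
  rfl

/-- The complex of a shift is the shift of the complex. -/
def complexShiftIso (M : DGMod A.toDG) (n : ℤ) :
    toComplex (M.regrade (n, 0)) ≅ (CochainComplex.shiftFunctor (GrMod A) n).obj (toComplex M) where
  hom :=
    { f := fun i => shiftPart M n i
      comm' := fun i j h => shiftPart_comm M n i j h _ }
  inv :=
    { f := fun i => shiftPartInv M n i
      comm' := fun i j h => by
        have := shiftPart_comm M n i j h n.negOnePow
        have h2 := congrArg (fun f => shiftPartInv M n i ≫ f ≫ shiftPartInv M n j) this
        simp only [Category.assoc, shiftPart_inv, Category.comp_id] at h2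
        rw [reassoc_of% (inv_shiftPart M n i)] at h2
        exact h2.symm }
  hom_inv_id := HomologicalComplex.hom_ext _ _ fun i => shiftPart_inv M n i
  inv_hom_id := HomologicalComplex.hom_ext _ _ fun i => inv_shiftPart M n i

/-- The map between parts induced by a morphism. -/
def homPart {M N : DGMod A.toDG} (g : M ⟶ N) (i : ℤ) : part M i ⟶ part N i :=
  ((complexFunctor A).map g).f i

theorem homPart_apply {M N : DGMod A.toDG} (g : M ⟶ N) (i : ℤ) (m : (part M i).carrier) :
    ((homPart g i).1 m).1 = g.1 m.1 := rfl

theorem shiftPart_naturality {M N : DGMod A.toDG} (g : M ⟶ N) (n i : ℤ) :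
    homPart ((regradeFunctor (n, 0)).map g) i ≫ shiftPart N n i =
      shiftPart M n i ≫ homPart g (i + n) :=
  part_ext fun m => ((shiftPart_apply N n i _).trans
    (homPart_apply ((regradeFunctor (n, 0)).map g) i m)).trans
    ((homPart_apply g (i + n) _).trans (congrArg g.1 (shiftPart_apply M n i m))).symm

/-- The identification of parts of equal degree. -/
def reindex (M : DGMod A.toDG) {i j : ℤ} (h : i = j) : part M i ⟶ part M j :=
  ((toComplex M).XIsoOfEq h).hom

theorem reindex_apply (M : DGMod A.toDG) {i j : ℤ} (h : i = j) (m : (part M i).carrier) :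
    ((reindex M h).1 m).1 = m.1 := by
  subst h
  rw [reindex, HomologicalComplex.XIsoOfEq_rfl]
  rfl

theorem shiftPart_zero (M : DGMod A.toDG) (z : M.regrade (0, 0) ⟶ M) (hz : ∀ m, z.1 m = m) (i : ℤ)
    (h : i = i + 0) :
    shiftPart M 0 i = homPart z i ≫ reindex M h :=
  part_ext fun m => by
    rw [comp_part, shiftPart_apply, reindex_apply, homPart_apply, hz]

theorem shiftPart_add (M : DGMod A.toDG) (a b : ℤ)
    (z : M.regrade (a + b, 0) ⟶ (M.regrade (a, 0)).regrade (b, 0)) (hz : ∀ m, z.1 m = m) (i : ℤ)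
    (h : i + b + a = i + (a + b)) :
    shiftPart M (a + b) i = homPart z i ≫ shiftPart (M.regrade (a, 0)) b i ≫
      shiftPart M a (i + b) ≫ reindex M h :=
  part_ext fun m => by
    rw [comp_part, comp_part, comp_part, shiftPart_apply, reindex_apply, shiftPart_apply,
      shiftPart_apply, homPart_apply, hz]

/-- The complex of a shift is the shift of the complex, naturally. -/
def complexShiftNatIso (n : ℤ) : shiftFunctor (DGMod A.toDG) n ⋙ complexFunctor A ≅
    complexFunctor A ⋙ shiftFunctor (CochainComplex (GrMod A) ℤ) n :=
  NatIso.ofComponents (fun M => complexShiftIso M n) fun {M N} g =>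
    HomologicalComplex.hom_ext _ _ fun i => shiftPart_naturality g n i

instance : (complexFunctor A).CommShift ℤ where
  commShiftIso n := complexShiftNatIso n
  commShiftIso_zero := by
    ext M : 3
    refine HomologicalComplex.hom_ext _ _ fun i => ?_
    rw [Functor.CommShift.isoZero_hom_app, HomologicalComplex.comp_f]
    refine Eq.trans ?_ (congrArg (_ ≫ ·)
      (CochainComplex.shiftFunctorZero_inv_app_f (toComplex M) i)).symm
    exact shiftPart_zero M _ (fun m => rfl) i _
  commShiftIso_add a b := by
    ext M : 3
    refine HomologicalComplex.hom_ext _ _ fun i => ?_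
    rw [Functor.CommShift.isoAdd_hom_app, HomologicalComplex.comp_f, HomologicalComplex.comp_f,
      HomologicalComplex.comp_f]
    refine Eq.trans ?_ (congrArg (fun x => _ ≫ _ ≫ _ ≫ x)
      (CochainComplex.shiftFunctorAdd_inv_app_f (toComplex M) a b i)).symm
    exact shiftPart_add M a b _ (fun m => rfl) i _

/-- The inclusion of the shifted source in a cone. -/
def coneInr {M N : DGMod A.toDG} (f : M ⟶ N) (p q : ℤ) (h : p + -1 = q) :
    part M p ⟶ part (cone f) q :=
  partMap (M := M) (N := cone f) (LinearMap.inr A.carrier N.carrier M.carrier) p q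
    fun k m hm => ⟨zero_mem _, by
      change m ∈ M.grade ((q, k) + (1, 0))
      rw [Prod.mk_add_mk, add_zero, ← h, neg_add_cancel_right]
      exact hm⟩

/-- This says that the inclusion of `M`, as a cochain of degree `-1`, has coboundary `f` followed by
the inclusion of `N`. That is the condition for the two inclusions to define a map out of the
mapping cone. -/
theorem complexCone_comm {M N : DGMod A.toDG} (f : M ⟶ N) (p : ℤ) (u : ℤˣ) :
    coneInr f p (p - 1) rfl ≫ dPart (cone f) (p - 1) p +
      u • dPart M p (p + 1) ≫ coneInr f (p + 1) p (add_neg_cancel_right p 1) =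
    ((complexFunctor A).map (f ≫ coneIn f)).f p := by
  rw [GrMod.units_smul_hom]
  refine part_ext fun m => ?_
  have h1 := dPart_apply (cone f) (sub_add_cancel p 1) ((coneInr f p (p - 1) rfl).1 m)
  have h2 := dPart_apply M (rfl : p + 1 = p + 1) m
  refine (congrArg₂ (fun (x : N.carrier × M.carrier) (y : M.carrier) => x + (0, y)) h1 h2).trans ?_
  change ((N.d 0 + f.1 m.1, M.d m.1) : N.carrier × M.carrier) + (0, M.d m.1) = (f.1 m.1, 0)
  rw [map_zero, zero_add, Prod.mk_add_mk, add_zero, M.char_two]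

open CochainComplex in
/-- The comparison of the cone in complexes with the complex of the cone. -/
def complexConeHom {M N : DGMod A.toDG} (f : M ⟶ N) :
    mappingCone ((complexFunctor A).map f) ⟶ (complexFunctor A).obj (cone f) :=
  mappingCone.desc _ (HomComplex.Cochain.mk (coneInr f)) ((complexFunctor A).map (coneIn f)) (by
    ext p
    rw [HomComplex.δ_v (-1) 0 (neg_add_cancel 1) _ p p (add_zero p) (p - 1) (p + 1) rfl rfl,
      HomComplex.Cochain.ofHom_v, ← Functor.map_comp]
    exact complexCone_comm f p _)

open CochainComplex in
theorem complexConeHom_inl {M N : DGMod A.toDG} (f : M ⟶ N) (p q : ℤ) (h : p + -1 = q) :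
    (mappingCone.inl ((complexFunctor A).map f)).v p q h ≫ (complexConeHom f).f q =
      coneInr f p q h := mappingCone.inl_v_desc_f _ _ _ _ p q h

open CochainComplex in
theorem complexConeHom_inr {M N : DGMod A.toDG} (f : M ⟶ N) (p : ℤ) :
    (mappingCone.inr ((complexFunctor A).map f)).f p ≫ (complexConeHom f).f p =
      ((complexFunctor A).map (coneIn f)).f p := mappingCone.inr_f_desc_f _ _ _ _ p

-- In coordinates the comparison map exchanges the two components of the mapping cone, because here
-- a cone is written as `N ⊕ M[1]`. Bijectivity is read off from this.
open CochainComplex in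
theorem complexConeHom_apply {M N : DGMod A.toDG} (f : M ⟶ N) (p : ℤ)
    (x : ((mappingCone ((complexFunctor A).map f)).X p).carrier) :
    (((complexConeHom f).f p).1 x).1 =
      (((((mappingCone.snd ((complexFunctor A).map f)).v p p (add_zero p)).1 x).1,
        (((mappingCone.fst ((complexFunctor A).map f)).1.v p (p + 1) rfl).1 x).1) :
        N.carrier × M.carrier) := by
  have h : (complexConeHom f).f p = (mappingCone.fst ((complexFunctor A).map f)).1.v p (p + 1) rfl ≫
      coneInr f (p + 1) p (add_neg_cancel_right p 1) +
      (mappingCone.snd ((complexFunctor A).map f)).v p p (add_zero p) ≫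
        homPart (coneIn f) p := mappingCone.desc_f _ _ _ _ p (p + 1) rfl
  rw [h]
  exact Prod.ext (zero_add _) (add_zero _)

open CochainComplex in
instance {M N : DGMod A.toDG} (f : M ⟶ N) : IsIso (complexConeHom f) := by
  have (p : ℤ) : IsIso ((complexConeHom f).f p) := by
    refine GrMod.isIso_of_bijective _ ⟨?_, ?_⟩
    · rw [injective_iff_map_eq_zero]
      intro x hx
      have h := (complexConeHom_apply f p x).symm.trans (congrArg Subtype.val hx)
      have h1 : ((mappingCone.snd ((complexFunctor A).map f)).v p p (add_zero p)).1 x = 0 :=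
        Subtype.ext (congrArg Prod.fst h)
      have h2 : ((mappingCone.fst ((complexFunctor A).map f)).1.v p (p + 1) rfl).1 x = 0 :=
        Subtype.ext (congrArg Prod.snd h)
      have h3 := congrArg (fun g => g.1 x)
        (mappingCone.id_X ((complexFunctor A).map f) p (p + 1) rfl)
      refine h3.symm.trans ?_
      refine (congrArg₂ (fun a b =>
        ((mappingCone.inl ((complexFunctor A).map f)).v (p + 1) p (add_neg_cancel_right p 1)).1 a +
        ((mappingCone.inr ((complexFunctor A).map f)).f p).1 b) h2 h1).trans ?_
      rw [map_zero, map_zero, add_zero]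
    · intro y
      have h1 := map_mem_partSub (M := cone f) (N := N) (j := p)
        (LinearMap.fst A.carrier N.carrier M.carrier) (fun k m hm => hm.1) y.2
      have h2 := map_mem_partSub (M := cone f) (N := M) (j := p + 1)
        (LinearMap.snd A.carrier N.carrier M.carrier) (fun k m hm => by
          have := hm.2
          rwa [Prod.mk_add_mk, add_zero] at this) y.2
      refine ⟨((mappingCone.inl ((complexFunctor A).map f)).v (p + 1) p
        (add_neg_cancel_right p 1)).1 ⟨_, h2⟩ +
        ((mappingCone.inr ((complexFunctor A).map f)).f p).1 ⟨_, h1⟩, ?_⟩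
      rw [map_add]
      refine (congrArg₂ (· + ·) (congrArg (fun g => g.1 ⟨_, h2⟩) (complexConeHom_inl f _ _ _))
        (congrArg (fun g => g.1 ⟨_, h1⟩) (complexConeHom_inr f p))).trans (Subtype.ext ?_)
      exact Prod.ext (zero_add _) (add_zero _)
  exact HomologicalComplex.Hom.isIso_of_components _

end DGMod

open CategoryTheory.Pretriangulated CategoryTheory.Limits

/-! ### Comparison of cone triangles, and the embedding -/

section Triangles

variable {D D' : Type 1} [Category.{0} D] [HasShift D ℤ] [Category.{0} D'] [HasShift D' ℤ]

/-- Triangles which only differ by an isomorphism of the third objects. -/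
def isoOfThird {X Y Z Z' : D} (f : X ⟶ Y) (g : Y ⟶ Z) (h : Z ⟶ X⟦(1 : ℤ)⟧) (g' : Y ⟶ Z')
    (h' : Z' ⟶ X⟦(1 : ℤ)⟧) (e : Z ≅ Z') (hg : g ≫ e.hom = g') (hh : e.hom ≫ h' = h) :
    Triangle.mk f g h ≅ Triangle.mk f g' h' :=
  Triangle.isoMk _ _ (Iso.refl _) (Iso.refl _) e
    ((Category.comp_id _).trans (Category.id_comp _).symm) (hg.trans (Category.id_comp _).symm)
    (((congrArg (h ≫ ·) (CategoryTheory.Functor.map_id _ _)).trans (Category.comp_id _)).trans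
      hh.symm)

variable {A : QDGAlgebra}

/-- The images of a cone triangle under a composite functor. -/
def mapConeTriangleCompIso (Φ : DGMod A ⥤ D) [Φ.CommShift ℤ] (Ψ : D ⥤ D') [Ψ.CommShift ℤ]
    {M N : DGMod A} (f : M ⟶ N) :
    mapConeTriangle (Φ ⋙ Ψ) f ≅ Ψ.mapTriangle.obj (mapConeTriangle Φ f) :=
  isoOfThird _ _ _ _ _ (Iso.refl _) (Category.comp_id _) (by
    refine (Category.id_comp _).trans ?_
    refine Eq.trans ?_
      (congrArg ((Φ ⋙ Ψ).map (DGMod.coneOut f) ≫ ·)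
        (Functor.commShiftIso_comp_hom_app Φ Ψ (1 : ℤ) M).symm)
    refine (congrArg (· ≫ _) (Ψ.map_comp _ _)).trans (Category.assoc _ _ _))

end Triangles

namespace DGMod

variable {A : QAlgebra}

theorem coneInr_out {M N : DGMod A.toDG} (f : M ⟶ N) (i : ℤ) (h : i + 1 + -1 = i) :
    coneInr f (i + 1) i h ≫ homPart (coneOut f) i ≫ shiftPart M 1 i = 𝟙 (part M (i + 1)) :=
  part_ext fun _ => rfl

theorem homPart_coneIn_out {M N : DGMod A.toDG} (f : M ⟶ N) (i : ℤ) :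
    homPart (coneIn f) i ≫ homPart (coneOut f) i ≫ shiftPart M 1 i = 0 :=
  part_ext fun _ => rfl

open CochainComplex in
theorem complexConeHom_comm₃ {M N : DGMod A.toDG} (f : M ⟶ N) :
    complexConeHom f ≫ (complexFunctor A).map (coneOut f) ≫
      ((complexFunctor A).commShiftIso (1 : ℤ)).hom.app M =
    (mappingCone.triangle ((complexFunctor A).map f)).mor₃ := by
  refine HomologicalComplex.hom_ext _ _ fun i => ?_
  refine mappingCone.ext_from _ (i + 1) i rfl ?_ ?_
  · refine Eq.trans ?_ (mappingCone.inl_v_triangle_mor₃_f _ _ _ _).symm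
    refine (Category.assoc _ _ _).symm.trans ?_
    refine (congrArg (· ≫ _) (complexConeHom_inl f (i + 1) i _)).trans ?_
    refine (coneInr_out f i _).trans ?_
    -- The third map of the standard triangle of a mapping cone carries a sign, which is trivial
    -- here.
    refine Eq.trans ?_ (GrMod.neg_hom _).symm
    rw [shiftFunctorObjXIso, HomologicalComplex.XIsoOfEq_rfl]
    rfl
  · refine Eq.trans ?_ (mappingCone.inr_f_triangle_mor₃_f _ _).symm
    refine (Category.assoc _ _ _).symm.trans ?_
    refine (congrArg (· ≫ _) (complexConeHom_inr f i)).trans ?_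
    exact homPart_coneIn_out f i

open CochainComplex in
theorem inr_complexConeHom {M N : DGMod A.toDG} (f : M ⟶ N) :
    mappingCone.inr ((complexFunctor A).map f) ≫ complexConeHom f =
      (complexFunctor A).map (coneIn f) :=
  HomologicalComplex.hom_ext _ _ fun i => complexConeHom_inr f i

open CochainComplex in
/-- The functor to complexes maps cones to mapping cones. -/
def mapConeTriangleComplexIso {M N : DGMod A.toDG} (f : M ⟶ N) :
    mappingCone.triangle ((complexFunctor A).map f) ≅ mapConeTriangle (complexFunctor A) f :=
  isoOfThird ((complexFunctor A).map f) (mappingCone.inr _)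
    (mappingCone.triangle ((complexFunctor A).map f)).mor₃ _ _ (asIso (complexConeHom f))
    (inr_complexConeHom f) (complexConeHom_comm₃ f)

variable (A) in
/-- The functor from DG modules to the homotopy category of graded modules. -/
abbrev toHGr : DGMod A.toDG ⥤ HGr A :=
  complexFunctor A ⋙ HomotopyCategory.quotient (GrMod A) (ComplexShape.up ℤ)

theorem toHGr_map_eq {M N : DGMod A.toDG} (f g : M ⟶ N) (h : homotopic f g) :
    (toHGr A).map f = (toHGr A).map g := by
  obtain ⟨h⟩ := complexFunctor_homotopic h
  exact HomotopyCategory.eq_of_homotopy _ _ h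

theorem homotopic_of_toHGr_map_eq {M N : DGMod A.toDG} {f g : M ⟶ N}
    (h : (toHGr A).map f = (toHGr A).map g) : homotopic f g :=
  homotopic_of_homotopy (HomotopyCategory.homotopyOfEq _ _ h)

theorem exists_toHGr_map_eq {M N : DGMod A.toDG} (φ : (toHGr A).obj M ⟶ (toHGr A).obj N) :
    ∃ g : M ⟶ N, (toHGr A).map g = φ := by
  obtain ⟨ψ, rfl⟩ := (HomotopyCategory.quotient (GrMod A) (ComplexShape.up ℤ)).map_surjective φ
  obtain ⟨g, rfl⟩ := exists_complexFunctor_map_eq ψ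
  exact ⟨g, rfl⟩

theorem mapConeTriangle_toHGr_distinguished {M N : DGMod A.toDG} (f : M ⟶ N) :
    mapConeTriangle (toHGr A) f ∈ distTriang (HGr A) :=
  isomorphic_distinguished _ (HomotopyCategory.mappingCone_triangleh_distinguished _) _
    (mapConeTriangleCompIso (complexFunctor A) (HomotopyCategory.quotient _ _) f ≪≫
      (HomotopyCategory.quotient _ _).mapTriangle.mapIso (mapConeTriangleComplexIso f).symm)

end DGMod

variable (A : QAlgebra)

/-- The embedding of `H^0(DG(A))` in the homotopy category of graded modules. -/
def embed : H0DG A.toDG ⥤ HGr A :=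
  CategoryTheory.Quotient.lift _ (DGMod.toHGr A) fun _ _ _ _ h => DGMod.toHGr_map_eq _ _ h

instance : (embed A).CommShift ℤ :=
  CategoryTheory.Quotient.liftCommShift (DGMod.toHGr A) (DGMod.homotopic (A := A.toDG)) ℤ
    fun _ _ _ _ h => DGMod.toHGr_map_eq _ _ h

instance : (embed A).Full where
  map_surjective φ := by
    obtain ⟨g, hg⟩ := DGMod.exists_toHGr_map_eq φ
    exact ⟨(toH0 A.toDG).map g, hg⟩

instance : (embed A).Faithful where
  map_injective {M N f g} h := by
    obtain ⟨f, rfl⟩ := (toH0 A.toDG).map_surjective f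
    obtain ⟨g, rfl⟩ := (toH0 A.toDG).map_surjective g
    exact CategoryTheory.Quotient.sound _ (DGMod.homotopic_of_toHGr_map_eq h)

theorem embed_distinguished (T : Triangle (H0DG A.toDG))
    (hT : T ∈ TriangData.dist (C := H0DG A.toDG)) :
    (embed A).mapTriangle.obj T ∈ distTriang (HGr A) := by
  obtain ⟨M, N, f, ⟨e⟩⟩ := hT
  refine isomorphic_distinguished _ (DGMod.mapConeTriangle_toHGr_distinguished f) _ ?_
  exact (embed A).mapTriangle.mapIso e ≪≫ liftConeTriangleIso _ _ f

open CategoryTheory.Pretriangulated CategoryTheory.Limits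

/-! ### Restricting functors to full subcategories -/

section Restrict

variable {C D E : Type 1} [Category.{0} C] [HasShift C ℤ] [Category.{0} D] [HasShift D ℤ]
  [Category.{0} E] [HasShift E ℤ]

/-- A fully faithful functor to a pretriangulated category reflects distinguished triangles as
soon as it preserves them and every morphism can be completed to a distinguished triangle. -/
theorem mem_dist_of_map [TriangData C] [HasZeroObject E] [Preadditive E]
    [∀ n : ℤ, (shiftFunctor E n).Additive] [Pretriangulated E] (G : C ⥤ E) [G.CommShift ℤ]
    [G.Full] [G.Faithful]
    (hiso : ∀ T T' : Triangle C, (T ≅ T') → T ∈ TriangData.dist (C := C) →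
      T' ∈ TriangData.dist (C := C))
    (hcone : ∀ (X Y : C) (f : X ⟶ Y), ∃ (Z : C) (g : Y ⟶ Z) (h : Z ⟶ X⟦(1 : ℤ)⟧),
      Triangle.mk f g h ∈ TriangData.dist (C := C))
    (hG : ∀ T ∈ TriangData.dist (C := C), G.mapTriangle.obj T ∈ distTriang E)
    (T : Triangle C) (hT : G.mapTriangle.obj T ∈ distTriang E) : T ∈ TriangData.dist (C := C) := by
  obtain ⟨X, Y, Z, f, g, h⟩ := T
  obtain ⟨Z', g', h', hT'⟩ := hcone X Y f
  -- Complete the morphism `f` to a distinguished triangle in the source category. Its image and the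
  -- image of the given triangle start with the same morphism, so the identities extend to a
  -- morphism of triangles, whose third component is then invertible.
  obtain ⟨t, h₁, h₂⟩ := complete_distinguished_triangle_morphism _ _ (hG _ hT') hT (𝟙 _) (𝟙 _)
    ((Category.comp_id _).trans (Category.id_comp _).symm)
  let φ : G.mapTriangle.obj (Triangle.mk f g' h') ⟶ G.mapTriangle.obj (Triangle.mk f g h) :=
    { hom₁ := 𝟙 _
      hom₂ := 𝟙 _
      hom₃ := t
      comm₁ := (Category.comp_id _).trans (Category.id_comp _).symm
      comm₂ := h₁
      comm₃ := h₂ }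
  have ht : IsIso t := isIso₃_of_isIso₁₂ φ (hG _ hT') hT
    (inferInstanceAs (IsIso (𝟙 (G.obj X)))) (inferInstanceAs (IsIso (𝟙 (G.obj Y))))
  -- By full faithfulness the comparison comes from an isomorphism in the source category,
  -- compatible with the triangles.
  obtain ⟨s, rfl⟩ := G.map_surjective (X := Z') (Y := Z) t
  have ht' : IsIso (G.map s) := ht
  have hs : IsIso s := isIso_of_reflects_iso s G
  refine hiso _ _ (isoOfThird f g' h' g h (asIso s) (G.map_injective ?_) (G.map_injective ?_)) hT'
  · exact (G.map_comp _ _).trans (h₁.trans (Category.id_comp _))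
  · rw [← cancel_mono ((G.commShiftIso (1 : ℤ)).hom.app X)]
    refine Eq.trans ?_ h₂.symm |>.trans ?_
    · exact (congrArg (· ≫ _) (G.map_comp _ _)).trans (Category.assoc _ _ _)
    · exact (congrArg (_ ≫ ·) (CategoryTheory.Functor.map_id _ _)).trans (Category.comp_id _)

variable (P : ObjectProperty C) [P.IsStableUnderShift ℤ] (Q : ObjectProperty D)
  [Q.IsStableUnderShift ℤ] (F : C ⥤ D) [F.CommShift ℤ] (h : ∀ X, P X → Q (F.obj X))

/-- The restriction of a functor to full subcategories. -/
abbrev restrict : P.FullSubcategory ⥤ Q.FullSubcategory := Q.lift (P.ι ⋙ F) fun X => h _ X.property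

/-- The images of a triangle under the restriction of a functor. -/
def restrictTriangleIso (T : Triangle P.FullSubcategory) :
    Q.ι.mapTriangle.obj ((restrict P Q F h).mapTriangle.obj T) ≅
      F.mapTriangle.obj (P.ι.mapTriangle.obj T) :=
  ((Functor.mapTriangleCompIso (restrict P Q F h) Q.ι).app T).symm ≪≫
    (Functor.mapTriangleIso (Q.liftCompιIso (P.ι ⋙ F) fun X => h _ X.property)).app T ≪≫
    (Functor.mapTriangleCompIso P.ι F).app T

theorem full_ι_comp
    (hF : ∀ X Y, P X → P Y → Function.Bijective (F.map : (X ⟶ Y) → (F.obj X ⟶ F.obj Y))) :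
    (P.ι ⋙ F).Full where
  map_surjective {X Y} φ := by
    obtain ⟨g, hg⟩ := (hF _ _ X.property Y.property).2 φ
    obtain ⟨g, rfl⟩ := P.ι.map_surjective g
    exact ⟨g, hg⟩

theorem faithful_ι_comp
    (hF : ∀ X Y, P X → P Y → Function.Bijective (F.map : (X ⟶ Y) → (F.obj X ⟶ F.obj Y))) :
    (P.ι ⋙ F).Faithful where
  map_injective {X Y} _ _ e := P.ι.map_injective ((hF _ _ X.property Y.property).1 e)

theorem isEquivalence_restrict
    (hF : ∀ X Y, P X → P Y → Function.Bijective (F.map : (X ⟶ Y) → (F.obj X ⟶ F.obj Y)))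
    (hQ : ∀ Y, Q Y → ∃ X, P X ∧ Nonempty (F.obj X ≅ Y)) :
    (restrict P Q F h).IsEquivalence := by
  have h1 := full_ι_comp P F hF
  have h2 := faithful_ι_comp P F hF
  have h3 : (restrict P Q F h).EssSurj := ⟨fun Y => by
    obtain ⟨X, hX, ⟨e⟩⟩ := hQ _ Y.property
    exact ⟨⟨X, hX⟩, ⟨Q.ι.preimageIso e⟩⟩⟩
  exact { }

variable [TriangData C] [TriangData D]
  (hPq : ∀ X, P X → P ((TriangData.q (C := C)).obj X))
  (hQq : ∀ X, Q X → Q ((TriangData.q (C := D)).obj X))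

/-- The restriction of a functor which commutes with `{1}`. -/
def restrictQIso (α : TriangData.q (C := C) ⋙ F ≅ F ⋙ TriangData.q (C := D)) :
    (TriangData.fullSub P hPq).q ⋙ restrict P Q F h ≅
      restrict P Q F h ⋙ (TriangData.fullSub Q hQq).q :=
  NatIso.ofComponents (fun X => Q.isoMk (α.app X.obj)) fun f =>
    Q.ι.map_injective (α.hom.naturality f.hom)

/-- The equivalence of full subcategories induced by a functor. -/
def restrictEquiv
    (hF : ∀ X Y, P X → P Y → Function.Bijective (F.map : (X ⟶ Y) → (F.obj X ⟶ F.obj Y)))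
    (hQ : ∀ Y, Q Y → ∃ X, P X ∧ Nonempty (F.obj X ≅ Y))
    (α : TriangData.q (C := C) ⋙ F ≅ F ⋙ TriangData.q (C := D))
    (hdist : ∀ T : Triangle P.FullSubcategory,
      P.ι.mapTriangle.obj T ∈ TriangData.dist (C := C) ↔
        F.mapTriangle.obj (P.ι.mapTriangle.obj T) ∈ TriangData.dist (C := D))
    (hiso : ∀ T T' : Triangle D, (T ≅ T') → T ∈ TriangData.dist (C := D) →
      T' ∈ TriangData.dist (C := D)) :
    letI := TriangData.fullSub P hPq
    letI := TriangData.fullSub Q hQq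
    TriangEquiv P.FullSubcategory Q.FullSubcategory :=
  letI := TriangData.fullSub P hPq
  letI := TriangData.fullSub Q hQq
  letI := isEquivalence_restrict P Q F h hF hQ
  { equiv := (restrict P Q F h).asEquivalence
    commShift := inferInstanceAs ((restrict P Q F h).CommShift ℤ)
    dist_iff := fun T => (hdist T).trans
      ⟨hiso _ _ (restrictTriangleIso P Q F h T).symm, hiso _ _ (restrictTriangleIso P Q F h T)⟩
    qIso := restrictQIso P Q F h hPq hQq α }

end Restrict

theorem H0DG.dist_of_iso {A : QDGAlgebra} (T T' : Triangle (H0DG A)) (e : T ≅ T')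
    (hT : T ∈ TriangData.dist (C := H0DG A)) : T' ∈ TriangData.dist (C := H0DG A) := by
  obtain ⟨M, N, f, ⟨e'⟩⟩ := hT
  exact ⟨M, N, f, ⟨e.symm ≪≫ e'⟩⟩

theorem H0DGP.dist_of_iso {A : QDGAlgebra} {ι : Type} {P : ι → DGMod A} (T T' : Triangle (H0DGP P))
    (e : T ≅ T') (hT : T ∈ TriangData.dist (C := H0DGP P)) : T' ∈ TriangData.dist (C := H0DGP P) :=
  H0DG.dist_of_iso _ _ ((genProp P).ι.mapTriangle.mapIso e) hT

/-- Triangles in a full subcategory may be constructed in the ambient category. -/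
theorem exists_ι_mapTriangle_iso {C : Type 1} [Category.{0} C] [HasShift C ℤ]
    (P : ObjectProperty C) [P.IsStableUnderShift ℤ] {X Y Z : P.FullSubcategory} (f : X ⟶ Y)
    (g : Y.obj ⟶ Z.obj) (h : Z.obj ⟶ X.obj⟦(1 : ℤ)⟧) :
    ∃ (g' : Y ⟶ Z) (h' : Z ⟶ X⟦(1 : ℤ)⟧),
      P.ι.mapTriangle.obj (Triangle.mk f g' h') = Triangle.mk f.hom g h := by
  obtain ⟨h', hh⟩ := P.ι.map_surjective (X := Z) (Y := X⟦(1 : ℤ)⟧)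
    (h ≫ (P.ι.commShiftIso (1 : ℤ)).inv.app X)
  refine ⟨P.homMk g, h', ?_⟩
  refine congrArg (Triangle.mk f.hom g) ?_
  refine (congrArg (· ≫ _) hh).trans ((Category.assoc _ _ _).trans ?_)
  exact (congrArg (h ≫ ·) ((P.ι.commShiftIso (1 : ℤ)).inv_hom_id_app X)).trans (Category.comp_id _)

/-- The cone of a morphism as an object of `H^0(DGP(A))`. -/
def H0DGP.cone {A : QDGAlgebra} {ι : Type} {P : ι → DGMod A} (X Y : H0DGP P)
    (φ : X.obj.as ⟶ Y.obj.as) : H0DGP P :=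
  ⟨(toH0 A).obj (DGMod.cone φ), Gen.cone _ _ φ X.property Y.property⟩

theorem H0DGP.exists_dist_cone {A : QDGAlgebra} {ι : Type} {P : ι → DGMod A} (X Y : H0DGP P)
    (φ : X.obj.as ⟶ Y.obj.as) (f : X ⟶ Y) (hφ : (toH0 A).map φ = f.hom) :
    ∃ (g : Y ⟶ H0DGP.cone X Y φ) (h : H0DGP.cone X Y φ ⟶ X⟦(1 : ℤ)⟧),
      Triangle.mk f g h ∈ TriangData.dist (C := H0DGP P) := by
  obtain ⟨g, h, e⟩ := exists_ι_mapTriangle_iso (genProp P) (Z := H0DGP.cone X Y φ) f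
    (coneTriangle φ).mor₂ (coneTriangle φ).mor₃
  refine ⟨g, h, X.obj.as, Y.obj.as, φ, ⟨eqToIso (e.trans ?_)⟩⟩
  rw [← hφ]
  rfl

theorem H0DGP.exists_dist {A : QDGAlgebra} {ι : Type} {P : ι → DGMod A} (X Y : H0DGP P)
    (f : X ⟶ Y) : ∃ (Z : H0DGP P) (g : Y ⟶ Z) (h : Z ⟶ X⟦(1 : ℤ)⟧),
      Triangle.mk f g h ∈ TriangData.dist (C := H0DGP P) := by
  obtain ⟨φ, hφ⟩ := (toH0 A).map_surjective (X := X.obj.as) (Y := Y.obj.as) f.hom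
  exact ⟨_, H0DGP.exists_dist_cone X Y φ f hφ⟩

/-! ### Base change on `H^0(DGP(A))` -/

section Base

variable {A B : QDGAlgebra} (f : QDGAlgebra.Hom A B) (hf : Function.Surjective f.toAlgHom)

theorem toH0_baseFunctor_map {M N : DGMod A} (g g' : M ⟶ N) (h : DGMod.homotopic g g') :
    (DGMod.baseFunctor f hf ⋙ toH0 B).map g = (DGMod.baseFunctor f hf ⋙ toH0 B).map g' :=
  CategoryTheory.Quotient.sound _ (DGMod.baseFunctor_homotopic f hf h)

/-- Base change on `H^0(DG(A))`. -/
def baseH0 : H0DG A ⥤ H0DG B :=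
  CategoryTheory.Quotient.lift _ (DGMod.baseFunctor f hf ⋙ toH0 B) fun _ _ _ _ h =>
    toH0_baseFunctor_map f hf _ _ h

instance : (baseH0 f hf).CommShift ℤ :=
  CategoryTheory.Quotient.liftCommShift (DGMod.baseFunctor f hf ⋙ toH0 B)
    (DGMod.homotopic (A := A)) ℤ fun _ _ _ _ h => toH0_baseFunctor_map f hf _ _ h

/-- Base change maps cone triangles to cone triangles. -/
def baseConeTriangleIso {M N : DGMod A} (g : M ⟶ N) :
    (baseH0 f hf).mapTriangle.obj (coneTriangle g) ≅
      coneTriangle ((DGMod.baseFunctor f hf).map g) :=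
  liftConeTriangleIso _ _ g ≪≫ mapConeTriangleCompIso _ _ g ≪≫
    (isoOfThird _ _ _ _ _ ((toH0 B).mapIso (DGMod.baseConeIso f hf g))
      (((toH0 B).map_comp _ _).symm.trans (congrArg (toH0 B).map (DGMod.hom_ext fun x => by
        obtain ⟨m, rfl⟩ := DGMod.baseMap_surjective f hf _ x
        exact Prod.ext rfl (map_zero (DGMod.baseMap f hf M)))))
      (((Category.assoc _ _ _).symm.trans (congrArg (· ≫ _)
        ((toH0 B).map_comp _ _).symm)).trans (congrArg (fun t => (toH0 B).map t ≫ _)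
          (DGMod.hom_ext fun x => by
            obtain ⟨m, rfl⟩ := DGMod.baseMap_surjective f hf _ x
            rfl))))

theorem baseH0_dist (T : Triangle (H0DG A)) (hT : T ∈ TriangData.dist (C := H0DG A)) :
    (baseH0 f hf).mapTriangle.obj T ∈ TriangData.dist (C := H0DG B) := by
  obtain ⟨M, N, g, ⟨e⟩⟩ := hT
  exact ⟨_, _, _, ⟨(baseH0 f hf).mapTriangle.mapIso e ≪≫ baseConeTriangleIso f hf g⟩⟩

variable {ι : Type} {P : ι → DGMod A} {P' : ι → DGMod B}

theorem Gen.base_of (hP : ∀ i, Nonempty (DGMod.base f hf (P i) ≅ P' i)) {M : DGMod A}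
    (h : Gen P M) : Gen P' (DGMod.base f hf M) := by
  induction h with
  | base i => exact Gen.iso _ _ (hP i).some.symm (Gen.base i)
  | iso M N e _ ih => exact Gen.iso _ _ ((DGMod.baseFunctor f hf).mapIso e) ih
  | shift n M _ ih => exact Gen.iso _ _ (DGMod.baseRegradeIso f hf M (n, 0)).symm (Gen.shift n _ ih)
  | qShift k M _ ih =>
    exact Gen.iso _ _ (DGMod.baseRegradeIso f hf M (0, k)).symm (Gen.qShift k _ ih)
  | cone M N g _ _ ihM ihN =>
    exact Gen.iso _ _ (DGMod.baseConeIso f hf g).symm (Gen.cone _ _ _ ihM ihN)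

theorem Gen.liftProp (hP : ∀ i, DGMod.LiftProp (P i)) {M : DGMod A} (h : Gen P M) :
    DGMod.LiftProp M := by
  induction h with
  | base i => exact hP i
  | iso M N e _ ih => exact ih.of_iso e
  | shift n M _ ih => exact ih.regrade _
  | qShift k M _ ih => exact ih.regrade _
  | cone M N g _ _ ihM ihN => exact ihM.cone g ihN

theorem Gen.exactProp (hP : ∀ i, DGMod.ExactProp (P i)) {M : DGMod A} (h : Gen P M) :
    DGMod.ExactProp M := by
  induction h with
  | base i => exact hP i
  | iso M N e _ ih => exact ih.of_iso e
  | shift n M _ ih => exact ih.regrade _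
  | qShift k M _ ih => exact ih.regrade _
  | cone M N g _ _ ihM ihN => exact ihM.cone g ihN

theorem Gen.kerAcyclic (hP : ∀ i, DGMod.KerAcyclic f (P i)) {M : DGMod A} (h : Gen P M) :
    DGMod.KerAcyclic f M := by
  induction h with
  | base i => exact hP i
  | iso M N e _ ih => exact ih.of_iso f e
  | shift n M _ ih => exact ih
  | qShift k M _ ih => exact ih
  | cone M N g _ _ ihM ihN => exact ihM.cone f g ihN

theorem baseH0_bijective (h₁ : ∀ i, DGMod.LiftProp (P i))
    (h₂ : ∀ i, DGMod.ExactProp (P i)) (h₃ : ∀ i, DGMod.KerAcyclic f (P i))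
    (X Y : H0DG A) (hX : genProp P X) (hY : genProp P Y) :
    Function.Bijective ((baseH0 f hf).map : (X ⟶ Y) → _) := by
  obtain ⟨M⟩ := X
  obtain ⟨N⟩ := Y
  have hX' : Gen P M := hX
  have hY' : Gen P N := hY
  constructor
  · intro φ ψ e
    obtain ⟨φ, rfl⟩ := (toH0 A).map_surjective (X := M) (Y := N) φ
    obtain ⟨ψ, rfl⟩ := (toH0 A).map_surjective (X := M) (Y := N) ψ
    refine CategoryTheory.Quotient.sound _ (DGMod.homotopic_of_baseFunctor hf (hX'.liftProp h₁)
      (hX'.exactProp h₂) (hY'.kerAcyclic f h₃) ?_)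
    exact (CategoryTheory.Quotient.functor_map_eq_iff _ _ _).1 e
  · intro φ
    obtain ⟨φ, rfl⟩ := (toH0 B).map_surjective (X := DGMod.base f hf M) (Y := DGMod.base f hf N) φ
    obtain ⟨g, rfl⟩ := DGMod.exists_baseFunctor_map_eq hf (hX'.liftProp h₁)
      (hX'.exactProp h₂) (hY'.kerAcyclic f h₃) φ
    exact ⟨(toH0 A).map g, rfl⟩

/-- Induction on the construction of `N`. In the case of a cone its defining morphism has to be
lifted as a closed morphism, and not merely up to homotopy, in order to form the cone upstairs; this
is why fullness is proved on closed morphisms. -/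
theorem exists_base_iso (hP : ∀ i, Nonempty (DGMod.base f hf (P i) ≅ P' i))
    (h₁ : ∀ i, DGMod.LiftProp (P i))
    (h₂ : ∀ i, DGMod.ExactProp (P i)) (h₃ : ∀ i, DGMod.KerAcyclic f (P i))
    {N : DGMod B} (hN : Gen P' N) : ∃ M, Gen P M ∧ Nonempty (DGMod.base f hf M ≅ N) := by
  induction hN with
  | base i => exact ⟨P i, Gen.base i, hP i⟩
  | iso M N e _ ih =>
    obtain ⟨M', h, ⟨e'⟩⟩ := ih
    exact ⟨M', h, ⟨e' ≪≫ e⟩⟩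
  | shift n M _ ih =>
    obtain ⟨M', h, ⟨e'⟩⟩ := ih
    exact ⟨_, Gen.shift n M' h, ⟨DGMod.baseRegradeIso f hf M' (n, 0) ≪≫
      (DGMod.regradeFunctor (n, 0)).mapIso e'⟩⟩
  | qShift k M _ ih =>
    obtain ⟨M', h, ⟨e'⟩⟩ := ih
    exact ⟨_, Gen.qShift k M' h, ⟨DGMod.baseRegradeIso f hf M' (0, k) ≪≫
      (DGMod.regradeFunctor (0, k)).mapIso e'⟩⟩
  | cone M N g _ _ ihM ihN =>
    obtain ⟨M', hM, ⟨e⟩⟩ := ihM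
    obtain ⟨N', hN, ⟨e'⟩⟩ := ihN
    obtain ⟨φ, hφ⟩ := DGMod.exists_baseFunctor_map_eq hf (hM.liftProp h₁)
      (hM.exactProp h₂) (hN.kerAcyclic f h₃) (e.hom ≫ g ≫ e'.inv)
    refine ⟨_, Gen.cone _ _ φ hM hN, ⟨DGMod.baseConeIso f hf φ ≪≫ DGMod.coneCongr e e' ?_⟩⟩
    refine Eq.symm ((congrArg (· ≫ e'.hom) hφ).trans ((Category.assoc _ _ _).trans
      (congrArg (e.hom ≫ ·) ?_)))
    exact (Category.assoc _ _ _).trans ((congrArg (g ≫ ·) e'.inv_hom_id).trans (Category.comp_id g))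

end Base

/-- Base change commutes with `{1}`. -/
def baseH0QIso {A B : QDGAlgebra} (f : QDGAlgebra.Hom A B) (hf : Function.Surjective f.toAlgHom) :
    TriangData.q (C := H0DG A) ⋙ baseH0 f hf ≅ baseH0 f hf ⋙ TriangData.q (C := H0DG B) :=
  NatIso.ofComponents (fun X => (toH0 B).mapIso (DGMod.baseRegradeIso f hf X.as (0, 1)))
    fun {X Y} φ => by
      obtain ⟨φ, rfl⟩ := (toH0 A).map_surjective (X := X.as) (Y := Y.as) φ
      exact ((toH0 B).map_comp _ _).symm.trans
        ((congrArg (toH0 B).map (DGMod.hom_ext fun x => by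
          obtain ⟨m, rfl⟩ := DGMod.baseMap_surjective f hf _ x
          rfl)).trans ((toH0 B).map_comp _ _))

/-- Base change along a surjective quasi-isomorphism onto an algebra with trivial differential is
an equivalence of the categories `H^0(DGP(-))`. -/
def baseEquiv {A : QDGAlgebra} {B : QAlgebra} (f : QDGAlgebra.Hom A B.toDG)
    (hf : Function.Surjective f.toAlgHom) {ι : Type} {P : ι → DGMod A} {P' : ι → DGMod B.toDG}
    (hP : ∀ i, Nonempty (DGMod.base f hf (P i) ≅ P' i)) (h₁ : ∀ i, DGMod.LiftProp (P i))
    (h₂ : ∀ i, DGMod.ExactProp (P i)) (h₃ : ∀ i, DGMod.KerAcyclic f (P i)) :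
    TriangEquiv (H0DGP P) (H0DGP P') :=
  restrictEquiv (genProp P) (genProp P') (baseH0 f hf) (fun _ hX => Gen.base_of f hf hP hX)
    (fun _ h => Gen.qShift 1 _ h) (fun _ h => Gen.qShift 1 _ h)
    (baseH0_bijective f hf h₁ h₂ h₃)
    (fun Y hY => by
      obtain ⟨M, hM, ⟨e⟩⟩ := exists_base_iso f hf hP h₁ h₂ h₃ hY
      exact ⟨(toH0 A).obj M, hM, ⟨(toH0 B.toDG).mapIso e⟩⟩)
    (baseH0QIso f hf)
    (fun T => by
      refine ⟨baseH0_dist f hf _, fun hT => ?_⟩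
      have h4 := full_ι_comp (genProp P) (baseH0 f hf) (baseH0_bijective f hf h₁ h₂ h₃)
      have h5 := faithful_ι_comp (genProp P) (baseH0 f hf) (baseH0_bijective f hf h₁ h₂ h₃)
      -- Composing with `embed B` leads into a pretriangulated category, where distinguished
      -- triangles are reflected. This is where the trivial differential of the target algebra
      -- enters.
      refine mem_dist_of_map (((genProp P).ι ⋙ baseH0 f hf) ⋙ embed B) H0DGP.dist_of_iso
        H0DGP.exists_dist (fun T hT => ?_) T ?_
      · refine isomorphic_distinguished _ (embed_distinguished B _ (baseH0_dist f hf _ hT)) _ ?_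
        exact (Functor.mapTriangleCompIso _ (embed B)).app T ≪≫
          (embed B).mapTriangle.mapIso ((Functor.mapTriangleCompIso _ (baseH0 f hf)).app T)
      · refine isomorphic_distinguished _ (embed_distinguished B _ hT) _ ?_
        exact (Functor.mapTriangleCompIso _ (embed B)).app T ≪≫
          (embed B).mapTriangle.mapIso ((Functor.mapTriangleCompIso _ (baseH0 f hf)).app T))
    H0DG.dist_of_iso

theorem RB.base_P (n : ℕ) (p : V n × V n) :
    Nonempty (DGMod.base (RB.proj n) (RB.proj_surjective n) (RB.P n p) ≅ RR.P n p) :=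
  ⟨DGMod.baseIdemIso _ _ (RB.e_mul_e p.1 p.2) _ _ (PB.proj_gen _) _ _⟩

/-- The equivalence of `H^0(DGP(R_n ⊠ R_n))` and `H^0(DGP(R_n ⊗ R_n))`. -/
def RB.equivRR (n : ℕ) : TriangEquiv (H0DGP (RB.P n)) (H0DGP (RR.P n)) :=
  baseEquiv (RB.proj n) (RB.proj_surjective n) (RB.base_P n)
    (fun p => DGMod.liftProp_ofIdem (RB.e_mul_e p.1 p.2) _ _)
    (fun p => DGMod.exactProp_ofIdem (RB.e_mul_e p.1 p.2) _ _)
    (fun p => DGMod.KerAcyclic.ofIdem _ (RB.e_mul_e p.1 p.2) _ _ RB.proj_acyclic)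

theorem RB.equivRR_base (n : ℕ) (p : V n × V n) :
    Nonempty ((RB.equivRR n).equiv.functor.obj (H0DGP.base (RB.P n) p) ≅
      H0DGP.base (RR.P n) p) :=
  let e : (toH0 (RR n).toDG).obj (DGMod.base (RB.proj n) (RB.proj_surjective n) (RB.P n p)) ≅
      (toH0 (RR n).toDG).obj (RR.P n p) := (toH0 (RR n).toDG).mapIso (RB.base_P n p).some
  ⟨(genProp (RR.P n)).isoMk e⟩

open CategoryTheory.Pretriangulated CategoryTheory.Limits

/-! ### Directed algebras -/

/-- A complete system of orthogonal idempotents in a graded algebra with trivial differential, such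
that the algebra is directed: `e x A e y` vanishes unless `x = y` or the height of `y` is larger
than the height of `x`, and `e x A e x` is spanned by `e x`. -/
structure Directed (B : QDGAlgebra) (ι : Type) [Fintype ι] [DecidableEq ι] where
  e : ι → B.carrier
  e_mem : ∀ i, e i ∈ B.grade 0
  d_eq_zero : ∀ a, B.d a = 0
  e_mul_e : ∀ i, e i * e i = e i
  sum_e : ∑ i, e i = 1
  ht : ι → ℕ
  ε : ι → B.carrier →ₐ[F] F
  ε_e : ∀ i j, ε i (e j) = if i = j then 1 else 0
  ε_mem : ∀ i p a, a ∈ B.grade p → p ≠ 0 → ε i a = 0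
  directed : ∀ a i j, ht j ≤ ht i → e i * a * e j = if i = j then ε i a • e i else 0

namespace Directed

variable {B : QDGAlgebra} {ι : Type} [Fintype ι] [DecidableEq ι] (D : Directed B ι)

/-- The indecomposable projective modules. -/
def P (i : ι) : DGMod B := DGMod.ofIdem B (D.e i) (D.e_mem i) (D.d_eq_zero _)

/-- The elements of the radical. -/
def IsRad (a : B.carrier) : Prop := ∀ i, D.ε i a = 0

theorem sum_e_smul {M : Type} [AddCommGroup M] [Module B.carrier M] (m : M) :
    ∑ i, D.e i • m = m := by
  rw [← Finset.sum_smul, D.sum_e, one_smul]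

/-- Nakayama's lemma. -/
theorem eq_bot_of_le_rad {M : Type} [AddCommGroup M] [Module B.carrier M]
    (K : Submodule B.carrier M)
    (hK : K ≤ Submodule.span B.carrier {x | ∃ a, ∃ k ∈ K, D.IsRad a ∧ a • k = x}) : K = ⊥ := by
  obtain ⟨N, hN⟩ : ∃ N, ∀ i, D.ht i ≤ N :=
    ⟨∑ i, D.ht i, fun i => Finset.single_le_sum (fun _ _ => Nat.zero_le _) (Finset.mem_univ i)⟩
  -- Descending induction on the height. In `e i * c * a` with `a` in the radical, only the
  -- components `e j` with `j` of larger height survive, and on those the elements of `K` are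
  -- already known to vanish.
  have key : ∀ n i, N - D.ht i < n → ∀ k ∈ K, D.e i • k = 0 := by
    intro n
    induction n with
    | zero => intro i h; omega
    | succ n ih =>
      intro i hi k hk
      have h1 : ∀ c k, k ∈ K → ∀ a, D.IsRad a → D.e i • (c * a) • k = 0 := by
        intro c k hk a ha
        rw [← D.sum_e_smul k, Finset.smul_sum, Finset.smul_sum]
        refine Finset.sum_eq_zero fun j _ => ?_
        by_cases hj : D.ht j ≤ D.ht i
        · rw [smul_smul, smul_smul, D.directed _ _ _ hj, map_mul, ha i, mul_zero, zero_smul]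
          split_ifs <;> exact zero_smul _ _
        · have := hN j
          rw [ih j (by omega) k hk, smul_zero, smul_zero]
      have h2 : ∀ x ∈ Submodule.span B.carrier {x | ∃ a, ∃ k ∈ K, D.IsRad a ∧ a • k = x},
          ∀ c : B.carrier, D.e i • c • x = 0 := by
        intro x hx
        induction hx using Submodule.span_induction with
        | mem x hx =>
          obtain ⟨a, k, hk, ha, rfl⟩ := hx
          intro c
          rw [smul_smul c]
          exact h1 c k hk a ha
        | zero => simp
        | add x y _ _ hx hy => intro c; rw [smul_add, smul_add, hx, hy, add_zero]
        | smul b x _ hx => intro c; rw [smul_smul c]; exact hx _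
      have := h2 k (hK hk) 1
      rwa [one_smul] at this
  rw [eq_bot_iff]
  intro k hk
  rw [← D.sum_e_smul k, Finset.sum_eq_zero fun i _ => key _ i (Nat.lt_succ_self _) k hk]
  exact zero_mem _

/-! ### Finitely generated projective modules -/

/-- A homogeneous element `x` of a module with `e i x = x`. -/
structure Cell (M : DGMod B) where
  i : ι
  p : ℤ × ℤ
  x : M.carrier
  mem : x ∈ M.grade p
  e_smul : D.e i • x = x

/-- The zero module. -/
def _root_.QDG.DGMod.zeroMod (B : QDGAlgebra) : DGMod B where
  carrier := PUnit
  grade _ := ⊤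
  isInternal := isInternal_punit
  smul_mem _ _ := trivial
  d := 0
  d_mem _ := trivial
  d_d _ := rfl
  d_smul _ _ := rfl

/-- The zero morphism. -/
def _root_.QDG.DGMod.zeroHom (M N : DGMod B) : M ⟶ N := (0 : DGMod.closed M N 0)

variable {D} {M : DGMod B}

/-- The shifted projective module with a generator in the degree of a cell. -/
def Cell.P (c : D.Cell M) : DGMod B := (D.P c.i).regrade (-c.p - (1, 0))

/-- The direct sum of the projective modules which belong to a list of cells. -/
def free : List (D.Cell M) → DGMod B
  | [] => DGMod.zeroMod B
  | c :: l => DGMod.cone (DGMod.zeroHom c.P (free l))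

/-- The map to `M` given by a list of cells. -/
def freeMap : (l : List (D.Cell M)) → (free l).carrier →ₗ[B.carrier] M.carrier
  | [] => 0
  | c :: l => LinearMap.coprod (M₂ := (D.P c.i).carrier) (freeMap l)
      (DGMod.idemLift (D.e_mem c.i) (D.d_eq_zero _) c.x)

/-- The components of an element of `free (c :: l)`. -/
def uncons {c : D.Cell M} {l : List (D.Cell M)} (y : (free (c :: l)).carrier) :
    (free l).carrier × (D.P c.i).carrier := y

/-- The element of `free (c :: l)` with given components. -/
def consElt {c : D.Cell M} {l : List (D.Cell M)} (y : (free l).carrier × (D.P c.i).carrier) :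
    (free (c :: l)).carrier := y

theorem freeMap_cons {c : D.Cell M} {l : List (D.Cell M)} (y : (free (c :: l)).carrier) :
    freeMap (c :: l) y = freeMap l (uncons y).1 + (uncons y).2.1 • c.x := rfl

theorem freeMap_consElt {c : D.Cell M} {l : List (D.Cell M)}
    (y : (free l).carrier × (D.P c.i).carrier) :
    freeMap (c :: l) (consElt y) = freeMap l y.1 + y.2.1 • c.x := rfl

/-- The generator of `P i`. -/
def top (D : Directed B ι) (i : ι) : (D.P i).carrier :=
  DGMod.idemGen _ (D.e_mem i) (D.d_eq_zero _)

/-- The submodule generated by a list of cells. -/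
def cellSpan (l : List (D.Cell M)) : Submodule B.carrier M.carrier :=
  Submodule.span B.carrier {x | ∃ c ∈ l, c.x = x}

theorem mem_cellSpan {l : List (D.Cell M)} {c : D.Cell M} (h : c ∈ l) : c.x ∈ cellSpan l :=
  Submodule.subset_span ⟨c, h, rfl⟩

theorem cellSpan_mono {l l' : List (D.Cell M)} (h : l ⊆ l') : cellSpan l ≤ cellSpan l' :=
  Submodule.span_mono fun _ ⟨c, hc, e⟩ => ⟨c, h hc, e⟩

theorem freeMap_mem (l : List (D.Cell M)) (y : (free l).carrier) : freeMap l y ∈ cellSpan l := by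
  induction l with
  | nil => exact zero_mem _
  | cons c l ih =>
    rw [freeMap_cons]
    exact add_mem (cellSpan_mono (List.subset_cons_self _ _) (ih _))
      (Submodule.smul_mem _ _ (mem_cellSpan List.mem_cons_self))

theorem cellSpan_le_range (l : List (D.Cell M)) : cellSpan l ≤ LinearMap.range (freeMap l) := by
  refine Submodule.span_le.2 ?_
  rintro _ ⟨c, hc, rfl⟩
  induction l with
  | nil => simp at hc
  | cons c' l ih =>
    rcases List.mem_cons.1 hc with rfl | hc
    · refine ⟨consElt (0, D.top c.i), ?_⟩
      rw [freeMap_consElt, map_zero, zero_add]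
      exact c.e_smul
    · obtain ⟨y, hy⟩ := ih hc
      refine ⟨consElt (y, 0), ?_⟩
      rw [freeMap_consElt, hy]
      exact (congrArg (c.x + ·) (zero_smul _ _)).trans (add_zero _)

theorem freeMap_grade (l : List (D.Cell M)) (p : ℤ × ℤ) (y : (free l).carrier)
    (hy : y ∈ (free l).grade p) : freeMap l y ∈ M.grade p := by
  induction l with
  | nil => exact zero_mem _
  | cons c l ih =>
    rw [freeMap_cons]
    refine add_mem (ih _ hy.1) ?_
    -- Forming a cone shifts its source by `(1, 0)`; the extra `-(1, 0)` in `Cell.P` undoes this, so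
    -- that the generator has the degree of the cell.
    have h : (uncons y).2.1 ∈ B.grade (p + (1, 0) + (-c.p - (1, 0))) := hy.2
    have := M.smul_mem h c.mem
    rwa [show p + (1, 0) + (-c.p - (1, 0)) + c.p = p by abel] at this

theorem free_d (l : List (D.Cell M)) (y : (free l).carrier) : (free l).d y = 0 := by
  induction l with
  | nil => rfl
  | cons c l ih =>
    obtain ⟨y, m⟩ := y
    refine Prod.ext ?_ (Subtype.ext (D.d_eq_zero _))
    change (free l).d y + 0 = 0
    rw [ih, add_zero]

/-- The map to a module with trivial differential given by a list of cells. -/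
def freeHom (hM : ∀ m, M.d m = 0) (l : List (D.Cell M)) : free l ⟶ M :=
  ⟨freeMap l, DGMod.mem_closed (freeMap_grade l) fun m => by rw [hM, free_d, map_zero]⟩

/-- An element of `B e i` is a multiple of `e i`, so all the other augmentations vanish on it
anyway. -/
theorem isRad_of_ε {i : ι} (m : (D.P i).carrier) (h : D.ε i m.1 = 0) : D.IsRad m.1 := by
  intro j
  have hm : m.1 * D.e i = m.1 := DGMod.ofIdem_mul (D.e_mul_e i) m
  rw [← hm, map_mul, D.ε_e]
  split_ifs with hj
  · subst hj; rw [h, zero_mul]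
  · rw [mul_zero]

/-- If an element of `free l` is not in the radical then some cell may be expressed by the image of
the element and the other cells. -/
theorem mem_rad_or_exists (l : List (D.Cell M)) (y : (free l).carrier) :
    y ∈ Submodule.span B.carrier {x | ∃ a, ∃ k : (free l).carrier, D.IsRad a ∧ a • k = x} ∨
      ∃ (c : D.Cell M) (l' : List (D.Cell M)) (a : B.carrier), l'.length < l.length ∧
        (∀ c' ∈ l, c' = c ∨ c' ∈ l') ∧ a • freeMap l y - c.x ∈ cellSpan l' := by
  induction l with
  | nil => exact Or.inl (by rw [show y = 0 from rfl]; exact zero_mem _)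
  | cons c l ih =>
    by_cases h : D.ε c.i (uncons y).2.1 = 0
    -- Here the coefficient of the head is radical, so the head is a radical multiple of its
    -- generator and the alternative for the tail decides.
    · rcases ih (uncons y).1 with hy | ⟨c', l', a, h1, h2, h3⟩
      · left
        have e : y = LinearMap.inl B.carrier (free l).carrier (D.P c.i).carrier (uncons y).1 +
            (uncons y).2.1 • ((0, D.top c.i) : (free l).carrier × (D.P c.i).carrier) := by
          refine Prod.ext ?_ ?_
          · exact ((congrArg ((uncons y).1 + ·) (smul_zero _)).trans (add_zero _)).symm
          · exact ((zero_add _).trans (DGMod.smul_idemGen (D.e_mul_e c.i) _ _ _)).symm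
        have h1 : LinearMap.inl B.carrier (free l).carrier (D.P c.i).carrier (uncons y).1 ∈
            Submodule.span B.carrier {x | ∃ a, ∃ k : (free l).carrier × (D.P c.i).carrier,
              D.IsRad a ∧ a • k = x} := by
          have := Submodule.mem_map_of_mem
            (f := LinearMap.inl B.carrier (free l).carrier (D.P c.i).carrier) hy
          rw [Submodule.map_span] at this
          refine Submodule.span_mono ?_ this
          rintro _ ⟨_, ⟨a, k, ha, rfl⟩, rfl⟩
          exact ⟨a, _, ha, (map_smul _ _ _).symm⟩
        have h2 := Submodule.add_mem _ h1
          (Submodule.subset_span ⟨_, ((0, D.top c.i) : (free l).carrier × (D.P c.i).carrier),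
            isRad_of_ε _ h, rfl⟩)
        exact e ▸ h2
      · refine Or.inr ⟨c', c :: l', a, by simpa using h1, ?_, ?_⟩
        · intro c'' hc
          rcases List.mem_cons.1 hc with rfl | hc
          · exact Or.inr List.mem_cons_self
          · exact (h2 c'' hc).imp id (List.mem_cons_of_mem _)
        · rw [freeMap_cons, smul_add, add_sub_right_comm]
          exact add_mem (cellSpan_mono (List.subset_cons_self _ _) h3)
            (Submodule.smul_mem _ _ (Submodule.smul_mem _ _ (mem_cellSpan List.mem_cons_self)))
    -- Over the field with two elements a nonzero augmentation equals one. By directedness `e i`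
    -- times the coefficient is then `e i` itself, so `e i` times the image of `y` is the generator
    -- of the head, modulo the other cells.
    · refine Or.inr ⟨c, l, D.e c.i, by simp, fun c' => by simp, ?_⟩
      have h1 : D.ε c.i (uncons y).2.1 = 1 := by
        generalize D.ε c.i (uncons y).2.1 = z at h
        revert z
        decide
      have hm : (uncons y).2.1 * D.e c.i = (uncons y).2.1 :=
        DGMod.ofIdem_mul (D.e_mul_e c.i) _
      have h2 := D.directed (uncons y).2.1 c.i c.i le_rfl
      rw [mul_assoc, hm, if_pos rfl, h1, one_smul] at h2
      rw [freeMap_cons, smul_add, smul_smul, h2, c.e_smul, add_sub_cancel_right]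
      exact Submodule.smul_mem _ _ (freeMap_mem l _)

/-- Take a generating list of cells of minimal length. By projectivity the surjection from the sum
of the corresponding modules splits. By minimality every element of its kernel lies in the radical
of the sum; projecting onto the kernel shows that the kernel equals its own radical, and Nakayama's
lemma makes it zero. -/
theorem exists_free (M : DGMod B) [Module.Finite B.carrier M.carrier]
    [Module.Projective B.carrier M.carrier] :
    ∃ l : List (D.Cell M), Function.Bijective (freeMap l) := by
  -- A finite generating set is cut into homogeneous pieces, and these are cut by the idempotents.
  have h1 : ∃ n, ∃ l : List (D.Cell M), l.length = n ∧ cellSpan l = ⊤ := by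
    obtain ⟨s, hs⟩ := Module.Finite.fg_top (R := B.carrier) (M := M.carrier)
    have h : ∀ m : M.carrier, ∃ l : List (D.Cell M), m ∈ cellSpan l := by
      intro m
      induction m using grade_induction M.isInternal with
      | hom p m hm =>
        have : ∀ i, D.e i • m ∈ M.grade p := fun i => by
          have := M.smul_mem (D.e_mem i) hm
          rwa [zero_add] at this
        let C : ι → D.Cell M := fun i =>
          ⟨i, p, D.e i • m, this i, by rw [smul_smul, D.e_mul_e]⟩
        have h : ∑ i, (C i).x ∈ cellSpan ((Finset.univ : Finset ι).toList.map C) :=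
          sum_mem fun i _ => mem_cellSpan (List.mem_map.2 ⟨i, by simp, rfl⟩)
        exact ⟨_, (D.sum_e_smul m) ▸ h⟩
      | zero => exact ⟨[], zero_mem _⟩
      | add x y hx hy =>
        obtain ⟨l, hl⟩ := hx
        obtain ⟨l', hl'⟩ := hy
        exact ⟨l ++ l', add_mem (cellSpan_mono (List.subset_append_left _ _) hl)
          (cellSpan_mono (List.subset_append_right _ _) hl')⟩
    choose L hL using h
    refine ⟨_, s.toList.flatMap L, rfl, top_le_iff.1 ?_⟩
    rw [← hs]
    refine Submodule.span_le.2 fun m hm => cellSpan_mono ?_ (hL m)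
    intro c hc
    exact List.mem_flatMap.2 ⟨m, Finset.mem_toList.2 hm, hc⟩
  classical
  obtain ⟨l, hl, hs⟩ := Nat.find_spec h1
  have hmin : ∀ l' : List (D.Cell M), l'.length < l.length → cellSpan l' ≠ ⊤ := by
    intro l' h h'
    exact Nat.find_min h1 (hl ▸ h) ⟨l', rfl, h'⟩
  have hsurj : LinearMap.range (freeMap l) = ⊤ := top_le_iff.1 (hs ▸ cellSpan_le_range l)
  refine ⟨l, LinearMap.ker_eq_bot.1 ?_, LinearMap.range_eq_top.1 hsurj⟩
  obtain ⟨σ, hσ⟩ := Module.projective_lifting_property (freeMap l) LinearMap.id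
    (LinearMap.range_eq_top.1 hsurj)
  have hσ' : ∀ m, freeMap l (σ m) = m := LinearMap.congr_fun hσ
  refine D.eq_bot_of_le_rad _ fun y hy => ?_
  -- The projection onto the kernel along the splitting. It fixes `y` and moves an expression of `y`
  -- by radical multiples into the kernel.
  let ρ : (free l).carrier →ₗ[B.carrier] (free l).carrier := LinearMap.id - σ.comp (freeMap l)
  have hρ : ρ y = y := by
    change y - σ (freeMap l y) = y
    rw [LinearMap.mem_ker.1 hy, map_zero, sub_zero]
  rcases mem_rad_or_exists l y with h | ⟨c, l', a, h1, h2, h3⟩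
  · have := Submodule.mem_map_of_mem (f := ρ) h
    rw [Submodule.map_span, hρ] at this
    refine Submodule.span_mono ?_ this
    rintro _ ⟨_, ⟨a, k, ha, rfl⟩, rfl⟩
    refine ⟨a, ρ k, LinearMap.mem_ker.2 ?_, ha, (map_smul _ _ _).symm⟩
    change freeMap l (k - σ (freeMap l k)) = 0
    rw [map_sub, hσ', sub_self]
  -- Since `y` maps to zero, the distinguished cell lies in the span of the others, so a shorter
  -- list generates.
  · refine absurd ?_ (hmin l' h1)
    rw [LinearMap.mem_ker.1 hy, smul_zero, zero_sub, neg_mem_iff] at h3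
    refine top_le_iff.1 (hs ▸ Submodule.span_le.2 ?_)
    rintro _ ⟨c', hc, rfl⟩
    rcases h2 c' hc with rfl | h
    · exact h3
    · exact mem_cellSpan h

end Directed

namespace DGMod

variable {B : QDGAlgebra}

theorem mem_of_map_mem {M N : DGMod B} (f : M ⟶ N) (hf : Function.Injective f.1) {p : ℤ × ℤ}
    {m : M.carrier} (hm : f.1 m ∈ N.grade p) : m ∈ M.grade p := by
  obtain ⟨π, hπ', hπ⟩ := exists_proj M.isInternal
  obtain ⟨ρ, -, hρ⟩ := exists_proj N.isInternal
  have h : ∀ m, ρ p (f.1 m) = f.1 (π p m) := fun m => by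
    induction m using grade_induction M.isInternal with
    | hom j m hm =>
      rw [hπ _ _ _ hm, hρ _ _ _ (closed_mem f hm)]
      split_ifs <;> simp
    | zero => simp
    | add x y hx hy => simp [hx, hy]
  have := h m
  rw [hρ p p _ hm, if_pos rfl] at this
  rw [hf this]
  exact hπ' p m

/-- A bijective closed morphism is an isomorphism. -/
def isoOfBijective {M N : DGMod B} (f : M ⟶ N) (hf : Function.Bijective f.1) : M ≅ N :=
  let e := LinearEquiv.ofBijective f.1 hf
  have he : ∀ n, f.1 (e.symm n) = n := e.apply_symm_apply
  { hom := f
    inv := ⟨e.symm.toLinearMap, mem_closed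
      (fun i n hn => mem_of_map_mem f hf.1 (by
        change f.1 (e.symm n) ∈ N.grade i
        rwa [he]))
      (fun n => hf.1 (by
        change f.1 (M.d (e.symm n)) = f.1 (e.symm (N.d n))
        rw [he, ← closed_comm f, he]))⟩
    hom_inv_id := hom_ext fun m => e.symm_apply_apply m
    inv_hom_id := hom_ext fun n => he n }

end DGMod

/-! ### Modules generated by projective modules -/

section Gen₀

variable {B : QDGAlgebra} {ι : Type} {P : ι → DGMod B}

variable (P) in
/-- The class of modules which are zero or belong to `DGP`. -/
def Gen₀ (M : DGMod B) : Prop := Gen P M ∨ Subsingleton M.carrier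

theorem Gen.regrade {M : DGMod B} (h : Gen P M) (u : ℤ × ℤ) : Gen P (M.regrade u) := by
  have h' := Gen.qShift u.2 _ (Gen.shift u.1 M h)
  refine Gen.iso _ _ (DGMod.isoOfBijective (M := (M.regrade (u.1, 0)).regrade (0, u.2))
    (N := M.regrade u) ⟨LinearMap.id, DGMod.mem_closed (fun p m hm => ?_) fun _ => rfl⟩
    Function.bijective_id) h'
  change m ∈ M.grade (p + (0, u.2) + (u.1, 0)) at hm
  change m ∈ M.grade (p + u)
  have e : p + (0, u.2) + (u.1, 0) = p + u := by ext <;> simp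
  rwa [e] at hm

theorem Gen₀.regrade {M : DGMod B} (h : Gen₀ P M) (u : ℤ × ℤ) : Gen₀ P (M.regrade u) :=
  h.imp (fun h => h.regrade u) id

theorem Gen₀.of_iso {M N : DGMod B} (e : M ≅ N) (h : Gen₀ P M) : Gen₀ P N :=
  h.imp (Gen.iso M N e) fun h => ⟨fun x y => by
    rw [← DGMod.iso_inv_hom e x, ← DGMod.iso_inv_hom e y]
    exact congrArg e.hom.1 (h.allEq _ _)⟩

/-- Zero modules are carried along as a separate alternative: the cone of a map out of zero is the
target, and the cone of a map to zero is the shifted source. -/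
theorem Gen₀.cone {M N : DGMod B} (f : M ⟶ N) (hM : Gen₀ P M) (hN : Gen₀ P N) :
    Gen₀ P (DGMod.cone f) := by
  rcases hM with hM | hM
  · rcases hN with hN | hN
    · exact Or.inl (Gen.cone _ _ f hM hN)
    · refine Gen₀.of_iso (DGMod.isoOfBijective (DGMod.coneOut f) ⟨fun x y h => Prod.ext
        (Subsingleton.elim _ _) h, fun m => ⟨(0, m), rfl⟩⟩).symm (Or.inl (Gen.shift 1 M hM))
  · exact Gen₀.of_iso (DGMod.isoOfBijective (DGMod.coneIn f) ⟨fun x y h => congrArg Prod.fst h,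
      fun m => ⟨m.1, Prod.ext rfl (Subsingleton.elim _ _)⟩⟩) hN

variable [Fintype ι] [DecidableEq ι] (D : Directed B ι)

/-- Direct sums were realised as cones of zero morphisms, so that closure under cones applies
directly. -/
theorem Directed.gen₀_free {M : DGMod B} (l : List (D.Cell M)) : Gen₀ D.P (Directed.free l) := by
  induction l with
  | nil => exact Or.inr (inferInstanceAs (Subsingleton PUnit))
  | cons c l ih => exact Gen₀.cone _ (Gen₀.regrade (Or.inl (Gen.base c.i)) _) ih

theorem Directed.gen₀_of_d_eq_zero (M : DGMod B) [Module.Finite B.carrier M.carrier]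
    [Module.Projective B.carrier M.carrier] (hM : ∀ m, M.d m = 0) : Gen₀ D.P M := by
  obtain ⟨l, hl⟩ := Directed.exists_free (D := D) M
  exact Gen₀.of_iso (DGMod.isoOfBijective (Directed.freeHom hM l) hl) (D.gen₀_free l)

end Gen₀

open CategoryTheory.Pretriangulated CategoryTheory.Limits

/-! ### Perfect DG modules -/

/-- A bounded DG module whose underlying module is finitely generated projective. -/
structure Perf {B : QDGAlgebra} (M : DGMod B) : Prop where
  finite : Module.Finite B.carrier M.carrier
  projective : Module.Projective B.carrier M.carrier
  bounded : ∃ a b : ℤ, ∀ i j m, m ∈ M.grade (i, j) → (i < a ∨ b < i) → m = 0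

namespace Perf

variable {B : QDGAlgebra}

theorem of_iso {M N : DGMod B} (e : M ≅ N) (h : Perf M) : Perf N := by
  obtain ⟨h1, h2, a, b, h3⟩ := h
  let e' : M.carrier ≃ₗ[B.carrier] N.carrier := LinearEquiv.ofLinearMap e.hom.1 e.inv.1
    (congrArg Subtype.val e.inv_hom_id) (congrArg Subtype.val e.hom_inv_id)
  refine ⟨Module.Finite.equiv e', Module.Projective.of_equiv e', a, b, fun i j m hm hi => ?_⟩
  rw [← DGMod.iso_inv_hom e m, h3 i j _ (DGMod.closed_mem e.inv hm) hi, map_zero]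

theorem regrade {M : DGMod B} (h : Perf M) (u : ℤ × ℤ) : Perf (M.regrade u) := by
  obtain ⟨h1, h2, a, b, h3⟩ := h
  exact ⟨h1, h2, a - u.1, b - u.1, fun i j m hm hi => h3 (i + u.1) (j + u.2) m hm (by omega)⟩

theorem cone {M N : DGMod B} (f : M ⟶ N) (hM : Perf M) (hN : Perf N) : Perf (DGMod.cone f) := by
  obtain ⟨h1, h2, a, b, h3⟩ := hM
  obtain ⟨k1, k2, a', b', k3⟩ := hN
  refine ⟨inferInstanceAs (Module.Finite B.carrier (N.carrier × M.carrier)),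
    inferInstanceAs (Module.Projective B.carrier (N.carrier × M.carrier)),
    min (a - 1) a', max (b - 1) b', fun i j m hm hi => ?_⟩
  exact Prod.ext (k3 i j _ hm.1 (by omega)) (h3 (i + 1) (j + 0) _ hm.2 (by omega))

end Perf

theorem Gen.perf {B : QDGAlgebra} {ι : Type} {P : ι → DGMod B} (hP : ∀ i, Perf (P i))
    {M : DGMod B} (h : Gen P M) : Perf M := by
  induction h with
  | base i => exact hP i
  | iso M N e _ ih => exact ih.of_iso e
  | shift n M _ ih => exact ih.regrade _
  | qShift k M _ ih => exact ih.regrade _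
  | cone M N g _ _ ihM ihN => exact ihM.cone g ihN

theorem perf_ofIdem {A : QAlgebra} {e : A.carrier} (he : e * e = e) (h0 : e ∈ A.toDG.grade 0) :
    Perf (DGMod.ofIdem A.toDG e h0 rfl) := by
  have h0' : e ∈ A.grade 0 := h0
  obtain ⟨h1, h2⟩ := GrMod.isFGProj_ofIdem A e h0' he
  refine ⟨h1, h2, 0, 0, fun i j m hm hi => ?_⟩
  have h : m.1 ∈ (if i = 0 then A.grade j else ⊥) := hm
  rw [if_neg (by omega)] at h
  exact Subtype.ext h

namespace DGMod

variable {A : QAlgebra}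

/-! ### The parts of a DG module as direct summands -/

/-- The projection to the part of degree `i`. -/
def partEnd (M : DGMod A.toDG) (i : ℤ) : M.carrier →ₗ[A.carrier] M.carrier :=
  glue (M := M) (N := M) fun j => if j = i then (partSub M j).subtype else 0

theorem partEnd_apply (M : DGMod A.toDG) {i j : ℤ} {m : M.carrier} (hm : m ∈ partSub M j) :
    partEnd M i m = if j = i then m else 0 := by
  rw [partEnd, glue_apply _ hm]
  split_ifs <;> rfl

theorem partEnd_mem (M : DGMod A.toDG) (i : ℤ) (m : M.carrier) : partEnd M i m ∈ partSub M i := by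
  induction m using grade_induction M.isInternal with
  | hom p m hm =>
    rw [partEnd_apply M (grade_le_partSub M hm)]
    split_ifs with h
    · subst h; exact grade_le_partSub M hm
    · exact zero_mem _
  | zero => rw [map_zero]; exact zero_mem _
  | add x y hx hy => rw [map_add]; exact add_mem hx hy

theorem partEnd_self (M : DGMod A.toDG) {i : ℤ} {m : M.carrier} (hm : m ∈ partSub M i) :
    partEnd M i m = m := by rw [partEnd_apply M hm, if_pos rfl]

theorem partEnd_partEnd (M : DGMod A.toDG) (i : ℤ) (m : M.carrier) :
    partEnd M i (partEnd M i m) = partEnd M i m := partEnd_self M (partEnd_mem M i m)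

theorem isFGProj_part {M : DGMod A.toDG} (h1 : Module.Finite A.carrier M.carrier)
    (h2 : Module.Projective A.carrier M.carrier) (i : ℤ) : (part M i).IsFGProj := by
  let s : M.carrier →ₗ[A.carrier] partSub M i := (partEnd M i).codRestrict _ (partEnd_mem M i)
  have hs : s.comp (partSub M i).subtype = LinearMap.id :=
    LinearMap.ext fun m => Subtype.ext (partEnd_self M m.2)
  exact ⟨Module.Finite.of_surjective s fun m => ⟨m.1, LinearMap.congr_fun hs m⟩,
    Module.Projective.of_split _ s hs⟩

theorem isBddFGProj_toComplex {M : DGMod A.toDG} (h : Perf M) : IsBddFGProj A (toComplex M) := by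
  obtain ⟨h1, h2, a, b, h3⟩ := h
  refine ⟨fun i => isFGProj_part h1 h2 i, a, b, fun i hi => ?_⟩
  have : Subsingleton (part M i).carrier := by
    refine subsingleton_of_forall_eq 0 fun m => Subtype.ext ?_
    exact partSub_induction (p := fun m => m = 0) (fun j m hm => h3 i j m hm hi) rfl
      (fun x y hx hy => by rw [hx, hy, add_zero]) m.2
  exact GrMod.isZero_of_subsingleton (part M i)

/-! ### The stupid filtration -/

theorem isGradedSub_partSub (M : DGMod A.toDG) (i : ℤ) : IsGradedSub M.grade (partSub M i) :=
  fun _ hk => partSub_induction (p := fun k => k ∈ AddSubmonoid.closure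
      {x : M.carrier | (∃ g, x ∈ M.grade g) ∧ x ∈ partSub M i})
    (fun _ _ hm => AddSubmonoid.subset_closure ⟨⟨_, hm⟩, grade_le_partSub M hm⟩) (zero_mem _)
    (fun _ _ hx hy => add_mem hx hy) hk

theorem isGradedSub_ker_partEnd (M : DGMod A.toDG) (i : ℤ) :
    IsGradedSub M.grade (LinearMap.ker (partEnd M i)) := by
  intro k hk
  obtain ⟨π, hπ', hπ⟩ := exists_proj M.isInternal
  have h : ∀ p m, partEnd M i (π p m) = π p (partEnd M i m) := fun p m => by
    induction m using grade_induction M.isInternal with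
    | hom g m hm =>
      rw [hπ g p m hm, partEnd_apply M (grade_le_partSub M hm)]
      split_ifs with h1 h2 h2
      · rw [partEnd_apply M (grade_le_partSub M hm), if_pos h2, hπ g p m hm, if_pos h1]
      · rw [partEnd_apply M (grade_le_partSub M hm), if_neg h2, map_zero]
      · rw [map_zero, hπ g p m hm, if_neg h1]
      · rw [map_zero, map_zero]
    | zero => simp
    | add x y hx hy => simp only [map_add, hx, hy]
  obtain ⟨s, hs⟩ := exists_eq_sum_proj M.isInternal hπ k
  rw [hs]
  refine sum_mem fun p _ => AddSubmonoid.subset_closure ⟨⟨p, hπ' p k⟩, ?_⟩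
  rw [LinearMap.mem_ker, h, LinearMap.mem_ker.1 hk, map_zero]

/-- The part of degree `i` as a DG module with trivial differential. -/
def layer (M : DGMod A.toDG) (i : ℤ) : DGMod A.toDG where
  carrier := partSub M i
  module := (partSub M i).module
  grade p := (M.grade p).comap (partSub M i).subtype.toAddMonoidHom
  isInternal := (isGradedSub_partSub M i).isInternal_sub M.isInternal
  smul_mem ha hm := M.smul_mem ha hm
  d := 0
  d_mem _ := zero_mem _
  d_d _ := rfl
  d_smul a m := ((congrArg₂ (· + ·) (zero_smul A.carrier m)
    (smul_zero (M := A.carrier) (A := partSub M i) a)).trans (add_zero 0)).symm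

variable {M : DGMod A.toDG} {a : ℤ} (ha : ∀ i j m, m ∈ M.grade (i, j) → i < a → m = 0)

/-- A differential with a nonzero component in the lowest degree `a` would have to start in degree
`a - 1`, where the module vanishes. So the parts of higher degree form a DG submodule. -/
theorem partEnd_d (ha : ∀ i j m, m ∈ M.grade (i, j) → i < a → m = 0) (m : M.carrier) :
    partEnd M a (M.d m) = 0 := by
  induction m using grade_induction M.isInternal with
  | hom p m hm =>
    rw [partEnd_apply M (grade_le_partSub M (M.d_mem hm))]
    split_ifs with h
    · rw [ha p.1 p.2 m hm (by simp at h; omega), map_zero]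
    · rfl
  | zero => simp
  | add x y hx hy => rw [map_add, map_add, hx, hy, add_zero]

/-- The submodule of a DG module in degrees `≥ a` which consists of the parts of degrees `> a`. -/
def above : DGMod A.toDG where
  carrier := LinearMap.ker (partEnd M a)
  module := (LinearMap.ker (partEnd M a)).module
  grade p := (M.grade p).comap (LinearMap.ker (partEnd M a)).subtype.toAddMonoidHom
  isInternal := (isGradedSub_ker_partEnd M a).isInternal_sub M.isInternal
  smul_mem ha hm := M.smul_mem ha hm
  d := AddMonoidHom.mk' (fun x => ⟨M.d x.1, partEnd_d ha x.1⟩)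
    (fun x y => Subtype.ext (map_add M.d x.1 y.1))
  d_mem hm := M.d_mem hm
  d_d m := Subtype.ext (M.d_d m.1)
  d_smul a m := Subtype.ext (M.d_smul a m.1)

/-- The differential from the lowest part. -/
def layerHom : (layer M a).regrade (-1, 0) ⟶ above ha :=
  ⟨((dLin M).comp (partSub M a).subtype).codRestrict (LinearMap.ker (partEnd M a))
      fun m => partEnd_d ha m.1,
    mem_closed (fun p m hm => by
      have h : M.d m.1 ∈ M.grade (p + (-1, 0) + (1, 0)) := M.d_mem hm
      rwa [show p + (-1, 0) + (1, 0) = p by ext <;> simp] at h)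
      (fun m => Subtype.ext ((M.d_d m.1).trans (map_zero M.d).symm))⟩

/-- The inclusion of the parts of degrees `> a`. -/
def aboveIn : (above ha).carrier →ₗ[A.toDG.carrier] M.carrier :=
  (LinearMap.ker (partEnd M a)).subtype

/-- The inclusion of the part of degree `i`. -/
def layerIn (M : DGMod A.toDG) (i : ℤ) : (layer M i).carrier →ₗ[A.toDG.carrier] M.carrier :=
  (partSub M i).subtype

/-- A DG module as the cone of the differential from its lowest part. -/
def coneLayerHom : cone (layerHom ha) ⟶ M :=
  ⟨LinearMap.coprod (M := (above ha).carrier) (M₂ := (layer M a).carrier)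
      (aboveIn ha) (layerIn M a),
    mem_closed (fun p m hm => by
      refine add_mem (show m.1.1 ∈ M.grade p from hm.1) ?_
      have h : m.2.1 ∈ M.grade (p + (1, 0) + (-1, 0)) := hm.2
      rwa [show p + (1, 0) + (-1, 0) = p by ext <;> simp] at h)
      (fun m => by
        change M.d (m.1.1 + m.2.1) = M.d m.1.1 + M.d m.2.1 + 0
        rw [map_add, add_zero])⟩

theorem coneLayerHom_apply (m : (cone (layerHom ha)).carrier) :
    (coneLayerHom ha).1 m = m.1.1 + m.2.1 := rfl

theorem coneLayerHom_bijective : Function.Bijective (coneLayerHom ha).1 := by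
  constructor
  · refine (injective_iff_map_eq_zero _).2 fun m hm => ?_
    rw [coneLayerHom_apply] at hm
    have h1 := congrArg (partEnd M a) hm
    rw [map_add, LinearMap.mem_ker.1 m.1.2, partEnd_self M m.2.2, zero_add, map_zero] at h1
    rw [h1, add_zero] at hm
    exact Prod.ext (Subtype.ext hm) (Subtype.ext h1)
  · intro m
    refine ⟨(⟨m - partEnd M a m, LinearMap.mem_ker.2 ?_⟩, ⟨partEnd M a m, partEnd_mem M a m⟩), ?_⟩
    · rw [map_sub, partEnd_partEnd, sub_self]
    · exact sub_add_cancel m _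

end DGMod

/-- Induction on the number of cohomological degrees. The module is the cone of the differential
from its lowest part, shifted and with zero differential, to the submodule of the other parts. The
first is a finitely generated projective module and so a sum of shifted generators; the second has
one degree less. -/
theorem Directed.gen₀_of_perf {A : QAlgebra} {ι : Type} [Fintype ι] [DecidableEq ι]
    (D : Directed A.toDG ι) {M : DGMod A.toDG} (hM : Perf M) : Gen₀ D.P M := by
  obtain ⟨h1, h2, a, b, h3⟩ := hM
  have key : ∀ (n : ℕ) (a : ℤ) (M : DGMod A.toDG), Module.Finite A.carrier M.carrier →
      Module.Projective A.carrier M.carrier →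
      (∀ i j m, m ∈ M.grade (i, j) → (i < a ∨ a + n ≤ i) → m = 0) → Gen₀ D.P M := by
    intro n
    induction n with
    | zero =>
      intro a M _ _ h
      refine Or.inr (subsingleton_of_forall_eq 0 fun m => ?_)
      induction m using grade_induction M.isInternal with
      | hom p m hm => exact h p.1 p.2 m hm (by omega)
      | zero => rfl
      | add x y hx hy => rw [hx, hy, add_zero]
    | succ n ih =>
      intro a M h1 h2 h
      have ha : ∀ i j m, m ∈ M.grade (i, j) → i < a → m = 0 :=
        fun i j m hm hi => h i j m hm (Or.inl hi)
      refine Gen₀.of_iso (DGMod.isoOfBijective _ (DGMod.coneLayerHom_bijective ha))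
        (Gen₀.cone _ (Gen₀.regrade ?_ _) (ih (a + 1) _ ?_ ?_ ?_))
      · obtain ⟨k1, k2⟩ := DGMod.isFGProj_part h1 h2 a
        have k1' : Module.Finite A.toDG.carrier (DGMod.layer M a).carrier := k1
        have k2' : Module.Projective A.toDG.carrier (DGMod.layer M a).carrier := k2
        exact D.gen₀_of_d_eq_zero _ fun _ => rfl
      -- The parts of higher degree are the kernel of an idempotent, so they are a direct summand
      -- and inherit finiteness and projectivity.
      · let s : M.carrier →ₗ[A.carrier] LinearMap.ker (DGMod.partEnd M a) :=
          (LinearMap.id - DGMod.partEnd M a).codRestrict _ fun m => by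
            rw [LinearMap.mem_ker, LinearMap.sub_apply, map_sub, DGMod.partEnd_partEnd]
            exact sub_self _
        exact Module.Finite.of_surjective s fun m => ⟨m.1, Subtype.ext (by
          change m.1 - DGMod.partEnd M a m.1 = m.1
          rw [LinearMap.mem_ker.1 m.2, sub_zero])⟩
      · let s : M.carrier →ₗ[A.carrier] LinearMap.ker (DGMod.partEnd M a) :=
          (LinearMap.id - DGMod.partEnd M a).codRestrict _ fun m => by
            rw [LinearMap.mem_ker, LinearMap.sub_apply, map_sub, DGMod.partEnd_partEnd]
            exact sub_self _
        exact Module.Projective.of_split (LinearMap.ker (DGMod.partEnd M a)).subtype s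
          (LinearMap.ext fun m => Subtype.ext (by
            change m.1 - DGMod.partEnd M a m.1 = m.1
            rw [LinearMap.mem_ker.1 m.2, sub_zero]))
      · intro i j m hm hi
        refine Subtype.ext ?_
        have hm' : m.1 ∈ M.grade (i, j) := hm
        by_cases hia : i = a
        · subst hia
          rw [← DGMod.partEnd_self M (DGMod.grade_le_partSub M hm')]
          exact LinearMap.mem_ker.1 m.2
        · exact h i j m.1 hm' (by push_cast; omega)
  -- The truncation at zero is harmless: `b < a + n` holds also when the interval from `a` to `b` is
  -- empty.
  exact key (b + 1 - a).toNat a M h1 h2 fun i j m hm hi => h3 i j m hm (by omega)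

open CategoryTheory.Pretriangulated CategoryTheory.Limits

/-! ### Complexes of graded modules as DG modules -/

namespace DGMod

section

variable {R : Type} [Ring R] (X : ℤ → Type) [∀ i, AddCommGroup (X i)] [∀ i, Module R (X i)]
  (d : ∀ i, X i →ₗ[R] X (i + 1))

/-- The differential on the direct sum of the terms of a complex. -/
def sumD : DirectSum ℤ X →ₗ[R] DirectSum ℤ X :=
  DirectSum.toModule R ℤ _ fun i => (DirectSum.lof R ℤ X (i + 1)).comp (d i)

theorem sumD_of (i : ℤ) (x : X i) :
    sumD X d (DirectSum.of X i x) = DirectSum.of X (i + 1) (d i x) := by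
  rw [← DirectSum.lof_eq_of R]
  exact DirectSum.toModule_lof R i x

theorem sumD_sumD (h : ∀ i x, d (i + 1) (d i x) = 0) (m : DirectSum ℤ X) :
    sumD X d (sumD X d m) = 0 := by
  induction m using DirectSum.induction_on with
  | zero => simp
  | of i x => rw [sumD_of, sumD_of, h, map_zero]
  | add x y hx hy => rw [map_add, map_add, hx, hy, add_zero]

end

variable {A : QAlgebra} (K : CochainComplex (GrMod A) ℤ)

/-- The direct sum of the terms of a complex. -/
abbrev SumC : Type := DirectSum ℤ fun i => (K.X i).carrier

/-- The homogeneous elements of the direct sum of the terms of a complex. -/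
def gradeC (p : ℤ × ℤ) : AddSubgroup (SumC K) :=
  ((K.X p.1).grade p.2).map (DirectSum.of (fun i => (K.X i).carrier) p.1)

theorem isInternal_gradeC : DirectSum.IsInternal (gradeC K) := by
  choose π hπ' hπ using fun i => exists_proj (K.X i).isInternal
  refine isInternal_of_proj _ (fun p => ((DirectSum.of (fun i => (K.X i).carrier) p.1).comp
    (π p.1 p.2)).comp (DFinsupp.evalAddMonoidHom p.1)) ?_ ?_
  · rintro ⟨i, j⟩ ⟨k, l⟩ _ ⟨m, hm, rfl⟩
    change DirectSum.of (fun i => (K.X i).carrier) k (π k l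
      ((DirectSum.of (fun i => (K.X i).carrier) i m) k)) = _
    by_cases h : i = k
    · subst h
      rw [DirectSum.of_eq_same, hπ i j l m hm]
      by_cases h' : j = l
      · subst h'; simp
      · rw [if_neg h', if_neg (fun e => h' (congrArg Prod.snd e)), map_zero]
    · rw [DirectSum.of_eq_of_ne _ _ _ (Ne.symm h), map_zero, map_zero,
        if_neg (fun e => h (congrArg Prod.fst e))]
  · intro m
    induction m using DirectSum.induction_on with
    | zero => exact zero_mem _
    | of i x =>
      induction x using grade_induction (K.X i).isInternal with
      | hom j x hx => exact AddSubmonoid.subset_closure ⟨(i, j), x, hx, rfl⟩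
      | zero => rw [map_zero]; exact zero_mem _
      | add x y hx hy => rw [map_add]; exact add_mem hx hy
    | add x y hx hy => exact add_mem hx hy

theorem smul_mem_gradeC {p r : ℤ × ℤ} {a : A.carrier} {m : SumC K}
    (ha : a ∈ A.toDG.grade p) (hm : m ∈ gradeC K r) : a • m ∈ gradeC K (p + r) := by
  obtain ⟨i, j⟩ := p
  obtain ⟨k, l⟩ := r
  obtain ⟨m, hm, rfl⟩ := hm
  have ha' : a ∈ (if i = 0 then A.grade j else ⊥) := ha
  split_ifs at ha' with h
  · subst h
    rw [Prod.mk_add_mk, zero_add]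
    exact ⟨a • m, (K.X k).smul_mem ha' hm,
      (DirectSum.lof A.carrier ℤ (fun i => (K.X i).carrier) k).map_smul a m⟩
  · have h0 : a = 0 := ha'
    rw [h0, zero_smul]
    exact zero_mem _

/-- The inclusion of a term of a complex in the direct sum. -/
def ofC (i : ℤ) : (K.X i).carrier →ₗ[A.carrier] SumC K :=
  DirectSum.lof A.carrier ℤ (fun i => (K.X i).carrier) i

theorem ofC_induction {p : SumC K → Prop} (hom : ∀ i x, p (ofC K i x)) (zero : p 0)
    (add : ∀ x y, p x → p y → p (x + y)) (m : SumC K) : p m := by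
  induction m using DirectSum.induction_on with
  | zero => exact zero
  | of i x => exact hom i x
  | add x y hx hy => exact add x y hx hy

/-- The differential between consecutive terms of a complex. -/
def dX (i : ℤ) : (K.X i).carrier →ₗ[A.carrier] (K.X (i + 1)).carrier := (K.d i (i + 1)).1

theorem dX_dX (i : ℤ) (x : (K.X i).carrier) : dX K (i + 1) (dX K i x) = 0 :=
  congrArg (fun f => f.1 x) (K.d_comp_d i (i + 1) (i + 1 + 1))

/-- The differential on the direct sum of the terms of a complex. -/
def dC : SumC K →ₗ[A.carrier] SumC K := sumD (fun i => (K.X i).carrier) (dX K)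

theorem dC_of (i : ℤ) (x : (K.X i).carrier) : dC K (ofC K i x) = ofC K (i + 1) (dX K i x) :=
  sumD_of (fun i => (K.X i).carrier) (dX K) i x

theorem dC_dC (m : SumC K) : dC K (dC K m) = 0 :=
  sumD_sumD (fun i => (K.X i).carrier) (dX K) (dX_dX K) m

theorem dC_mem {p : ℤ × ℤ} {m : SumC K} (hm : m ∈ gradeC K p) :
    dC K m ∈ gradeC K (p + (1, 0)) := by
  obtain ⟨i, j⟩ := p
  obtain ⟨m, hm, rfl⟩ := hm
  rw [Prod.mk_add_mk, add_zero]
  exact ⟨dX K i m, (K.d i (i + 1)).2 j m hm, (dC_of K i m).symm⟩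

theorem dC_smul (a : A.carrier) (m : SumC K) : dC K (a • m) = (0 : A.carrier) • m + a • dC K m := by
  rw [map_smul, zero_smul, zero_add]

/-- The direct sum of the terms of a complex, as a DG module. -/
def ofComplex : DGMod A.toDG where
  carrier := SumC K
  module := (inferInstance : Module A.carrier (SumC K))
  grade := gradeC K
  isInternal := isInternal_gradeC K
  smul_mem := @smul_mem_gradeC A K
  d := (dC K).toAddMonoidHom
  d_mem := dC_mem K
  d_d := dC_dC K
  d_smul := by exact dC_smul K

theorem ofC_mem (i : ℤ) (x : (K.X i).carrier) : ofC K i x ∈ (partSub (ofComplex K) i).carrier := by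
  induction x using grade_induction (K.X i).isInternal with
  | hom j x hx => exact grade_le_partSub (ofComplex K) (j := j) ⟨x, hx, rfl⟩
  | zero => exact (map_zero (ofC K i)).symm ▸ (partSub (ofComplex K) i).zero_mem
  | add x y hx hy =>
    exact (map_add (ofC K i) x y).symm ▸ (partSub (ofComplex K) i).add_mem hx hy

/-- The inclusion of a term of a complex in the direct sum. -/
def ofCLin (i : ℤ) : (K.X i).carrier →ₗ[A.carrier] (ofComplex K).carrier := ofC K i

/-- The inclusion of a term of a complex in the part of the direct sum. -/
def ofPart (i : ℤ) : K.X i ⟶ part (ofComplex K) i :=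
  ⟨(ofCLin K i).codRestrict (partSub (ofComplex K) i) (ofC_mem K i), fun _ m hm => ⟨m, hm, rfl⟩⟩

theorem ofC_injective (i : ℤ) : Function.Injective (ofC K i) :=
  DirectSum.of_injective (β := fun i => (K.X i).carrier) i

theorem ofPart_bijective (i : ℤ) : Function.Bijective (ofPart K i).1 := by
  constructor
  · intro x y h
    exact ofC_injective K i (congrArg Subtype.val h)
  · rintro ⟨m, hm⟩
    suffices h : ∃ x, ofC K i x = m by
      obtain ⟨x, hx⟩ := h
      exact ⟨x, Subtype.ext hx⟩
    refine partSub_induction (p := fun m => ∃ x, ofC K i x = m) ?_ ?_ ?_ hm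
    · rintro j _ ⟨x, -, rfl⟩
      exact ⟨x, rfl⟩
    · exact ⟨0, map_zero _⟩
    · rintro _ _ ⟨x, rfl⟩ ⟨y, rfl⟩
      exact ⟨x + y, map_add (ofC K i) x y⟩

theorem ofPart_comm (i : ℤ) (x : (K.X i).carrier) :
    (((toComplex (ofComplex K)).d i (i + 1)).1 ((ofPart K i).1 x)).1 =
      ((ofPart K (i + 1)).1 (dX K i x)).1 :=
  (toComplex_d (ofComplex K) rfl ((ofPart K i).1 x)).trans (dC_of K i x)

/-- A bijective morphism as an isomorphism. -/
def _root_.QDG.GrMod.isoOfBijective {M N : GrMod A} (f : M ⟶ N) (hf : Function.Bijective f.1) :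
    M ≅ N := @asIso _ _ _ _ f (GrMod.isIso_of_bijective f hf)

/-- A complex is recovered from the direct sum of its terms. -/
def ofComplexIso : K ≅ toComplex (ofComplex K) :=
  HomologicalComplex.Hom.isoOfComponents
    (fun i => GrMod.isoOfBijective (ofPart K i) (ofPart_bijective K i))
    (fun i j h => by
      obtain rfl : i + 1 = j := h
      exact GrMod.hom_ext fun x => Subtype.ext (ofPart_comm K i x))

theorem finite_sumC {a b : ℤ} (h1 : ∀ i, Module.Finite A.carrier (K.X i).carrier)
    (h0 : ∀ i (x : (K.X i).carrier), (i < a ∨ b < i) → x = 0) :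
    Module.Finite A.carrier (SumC K) := by
  refine ⟨?_⟩
  have h3 : (⨆ i ∈ Finset.Icc a b, LinearMap.range (ofC K i)) = ⊤ := by
    refine top_le_iff.1 fun m _ => ?_
    induction m using ofC_induction with
    | zero => exact zero_mem _
    | hom i x =>
      by_cases hi : i < a ∨ b < i
      · rw [h0 i x hi, map_zero]; exact zero_mem _
      · exact Submodule.mem_iSup_of_mem i (Submodule.mem_iSup_of_mem
          (Finset.mem_Icc.2 (by omega)) ⟨x, rfl⟩)
    | add x y hx hy => exact add_mem (hx trivial) (hy trivial)
  rw [← h3]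
  refine Submodule.fg_biSup (Finset.Icc a b) _ fun i _ => ?_
  rw [LinearMap.range_eq_map]
  exact (h1 i).fg_top.map _

theorem perf_ofComplex (hK : IsBddFGProj A K) : Perf (ofComplex K) := by
  obtain ⟨h, a, b, hab⟩ := hK
  have h1 := fun i => (h i).1
  have h2 := fun i => (h i).2
  have h0 : ∀ i (x : (K.X i).carrier), (i < a ∨ b < i) → x = 0 := fun i x hi =>
    have := GrMod.subsingleton_of_isZero (hab i hi)
    Subsingleton.elim _ _
  refine ⟨finite_sumC K h1 h0,
    Module.Projective.directSum (R := A.carrier) (M := fun i => (K.X i).carrier), a, b, ?_⟩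
  rintro i j _ ⟨x, -, rfl⟩ hi
  exact (congrArg (ofC K i) (h0 i x hi)).trans (map_zero _)

theorem isZero_toComplex (M : DGMod A.toDG) (h : Subsingleton M.carrier) :
    IsZero (toComplex M) := by
  refine (IsZero.iff_id_eq_zero _).2 (HomologicalComplex.hom_ext _ _ fun i => ?_)
  exact part_ext fun m => h.allEq _ _

/-- The complex of a DG module `A e` is concentrated in degree `0`. -/
theorem isZero_part_ofIdem {e : A.carrier} (h0 : e ∈ A.grade 0) (i : ℤ) (hi : i ≠ 0) :
    IsZero (part (ofIdem A.toDG e h0 rfl) i) := by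
  have : Subsingleton (part (ofIdem A.toDG e h0 rfl) i).carrier := by
    refine subsingleton_of_forall_eq 0 fun m => Subtype.ext ?_
    refine partSub_induction (p := fun m => m = 0) (fun j m hm => ?_) rfl
      (fun x y hx hy => by rw [hx, hy, add_zero]) m.2
    have h : m.1 ∈ (if i = 0 then A.grade j else ⊥) := hm
    rw [if_neg hi] at h
    exact Subtype.ext h
  exact GrMod.isZero_of_subsingleton _

/-- The part of degree `0` of `A e`. -/
def partIdemHom {e : A.carrier} (h0 : e ∈ A.grade 0) :
    part (ofIdem A.toDG e h0 rfl) 0 ⟶ GrMod.ofIdem A e h0 :=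
  ⟨(partSub (ofIdem A.toDG e h0 rfl) 0).subtype, fun j m hm => by
    have h : m.1.1 ∈ (if (0 : ℤ) = 0 then A.grade j else ⊥) := hm
    rwa [if_pos rfl] at h⟩

theorem partIdemHom_bijective {e : A.carrier} (h0 : e ∈ A.grade 0) :
    Function.Bijective (partIdemHom h0).1 := by
  refine ⟨Subtype.val_injective, fun m => ⟨⟨m, ?_⟩, rfl⟩⟩
  induction m using grade_induction (GrMod.ofIdem A e h0).isInternal with
  | hom j m hm =>
    refine grade_le_partSub (ofIdem A.toDG e h0 rfl) (j := j) ?_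
    change m.1 ∈ (if (0 : ℤ) = 0 then A.grade j else ⊥)
    rw [if_pos rfl]
    exact hm
  | zero => exact zero_mem _
  | add x y hx hy => exact add_mem hx hy

end DGMod

/-- A complex which is concentrated in one degree. -/
theorem nonempty_iso_single {V : Type 1} [Category.{0} V] [HasZeroMorphisms V] [HasZeroObject V]
    (K : CochainComplex V ℤ) (X : V) (e : K.X 0 ≅ X) (h : ∀ i, i ≠ 0 → IsZero (K.X i)) :
    Nonempty (K ≅ (HomologicalComplex.single V (ComplexShape.up ℤ) 0).obj X) := by
  refine ⟨⟨HomologicalComplex.mkHomToSingle e.hom fun i hi => ?_,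
    HomologicalComplex.mkHomFromSingle e.inv fun i hi => ?_, ?_, ?_⟩⟩
  · exact (h i (by rintro rfl; simp at hi)).eq_of_src _ _
  · exact (h i (by rintro rfl; simp at hi)).eq_of_tgt _ _
  · ext i
    by_cases hi : i = 0
    · subst hi; simp
    · exact (h i hi).eq_of_src _ _
  · refine HomologicalComplex.from_single_hom_ext ?_
    simp

/-! ### The shift of `q`-degrees under the passage to complexes -/

namespace DGMod

variable {A : QAlgebra}

theorem mem_qShift_grade (M : DGMod A.toDG) {i j : ℤ} {m : M.carrier} :
    m ∈ (M.regrade (0, 1)).grade (i, j) ↔ m ∈ M.grade (i, j + 1) := by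
  change m ∈ M.grade ((i, j) + (0, 1)) ↔ _
  rw [Prod.mk_add_mk, add_zero]

theorem mem_partSub_qShift (M : DGMod A.toDG) (i : ℤ) (m : (partSub (M.regrade (0, 1)) i)) :
    (m.1 : M.carrier) ∈ partSub M i :=
  partSub_induction (M := M.regrade (0, 1)) (p := fun m : M.carrier => m ∈ partSub M i)
    (fun j _ hm => grade_le_partSub M (j := j + 1) ((mem_qShift_grade M).1 hm))
    (partSub M i).zero_mem (fun _ _ => (partSub M i).add_mem) m.2

theorem mem_partSub_of_qShift (M : DGMod A.toDG) (i : ℤ) (m : partSub M i) :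
    (m.1 : (M.regrade (0, 1)).carrier) ∈ partSub (M.regrade (0, 1)) i :=
  partSub_induction (M := M)
    (p := fun m : (M.regrade (0, 1)).carrier => m ∈ partSub (M.regrade (0, 1)) i)
    (fun j m hm => grade_le_partSub (M.regrade (0, 1)) (j := j - 1)
      ((mem_qShift_grade M).2 (by rwa [sub_add_cancel])))
    (partSub (M.regrade (0, 1)) i).zero_mem (fun _ _ => (partSub (M.regrade (0, 1)) i).add_mem) m.2

/-- The underlying linear map of the identification of a module with its shift. -/
def qShiftId (M : DGMod A.toDG) : (M.regrade (0, 1)).carrier →ₗ[A.carrier] M.carrier :=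
  LinearMap.id

/-- The identification of the parts of a module with shifted `q`-degrees. -/
def qShiftLin (M : DGMod A.toDG) (i : ℤ) :
    (part (M.regrade (0, 1)) i).carrier →ₗ[A.carrier] (part M i).carrier :=
  ((qShiftId M).comp (partSub (M.regrade (0, 1)) i).subtype).codRestrict (partSub M i)
    (mem_partSub_qShift M i)

/-- The identification of the parts of a module with shifted `q`-degrees. -/
def qShiftPart (M : DGMod A.toDG) (i : ℤ) :
    part (M.regrade (0, 1)) i ⟶ (GrMod.qShift 1).obj (part M i) :=
  ⟨qShiftLin M i, fun _ _ hm => (mem_qShift_grade M).1 hm⟩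

theorem qShiftLin_bijective (M : DGMod A.toDG) (i : ℤ) : Function.Bijective (qShiftLin M i) :=
  ⟨fun x y h => by
      have h' : (qShiftLin M i x).1 = (qShiftLin M i y).1 := by rw [h]
      exact Subtype.ext h',
    fun m => ⟨⟨m.1, mem_partSub_of_qShift M i m⟩, rfl⟩⟩

theorem qShiftLin_comm (M : DGMod A.toDG) {i j : ℤ} (h : i + 1 = j)
    (m : (part (M.regrade (0, 1)) i).carrier) :
    (dPart M i j).1 (qShiftLin M i m) = qShiftLin M j ((dPart (M.regrade (0, 1)) i j).1 m) :=
  Subtype.ext ((dPart_apply M h _).trans (dPart_apply (M.regrade (0, 1)) h m).symm)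

theorem qShiftLin_naturality {M N : DGMod A.toDG} (f : M ⟶ N) (i : ℤ)
    (m : (part (M.regrade (0, 1)) i).carrier) :
    qShiftLin N i ((homPart ((qShift 1).map f) i).1 m) = (homPart f i).1 (qShiftLin M i m) :=
  Subtype.ext (homPart_apply ((qShift 1).map f) i m)

/-- The complex of a module with shifted `q`-degrees. -/
def complexQIso (M : DGMod A.toDG) :
    toComplex (M.regrade (0, 1)) ≅
      ((GrMod.qShift 1).mapHomologicalComplex _).obj (toComplex M) :=
  HomologicalComplex.Hom.isoOfComponents
    (fun i => GrMod.isoOfBijective (qShiftPart M i) (qShiftLin_bijective M i))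
    (fun i j h => GrMod.hom_ext fun m => qShiftLin_comm M h m)

theorem complexQIso_naturality {M N : DGMod A.toDG} (f : M ⟶ N) :
    (complexFunctor A).map ((qShift 1).map f) ≫ (complexQIso N).hom =
      (complexQIso M).hom ≫ ((GrMod.qShift 1).mapHomologicalComplex _).map
        ((complexFunctor A).map f) :=
  HomologicalComplex.hom_ext _ _ fun i => GrMod.hom_ext fun m => qShiftLin_naturality f i m

end DGMod

/-! ### The equivalence with bounded complexes of projective modules -/

section

variable (A : QAlgebra)

/-- The embedding commutes with `{1}`. -/
def embedQIso : TriangData.q (C := H0DG A.toDG) ⋙ embed A ≅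
    embed A ⋙ TriangData.q (C := HGr A) :=
  NatIso.ofComponents (fun X => (HomotopyCategory.quotient _ _).mapIso (DGMod.complexQIso X.as))
    fun {X Y} φ => by
      obtain ⟨φ, rfl⟩ := (toH0 A.toDG).map_surjective (X := X.as) (Y := Y.as) φ
      refine ((HomotopyCategory.quotient _ _).map_comp _ _).symm.trans
        ((congrArg (HomotopyCategory.quotient (GrMod A) (ComplexShape.up ℤ)).map
          (DGMod.complexQIso_naturality φ)).trans ((HomotopyCategory.quotient _ _).map_comp _ _))

variable {A} {ι : Type}

theorem exists_embed_iso [Fintype ι] [DecidableEq ι] [Nonempty ι] (D : Directed A.toDG ι)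
    (K : HGr A) (hK : kbProp A K) : ∃ X, genProp D.P X ∧ Nonempty ((embed A).obj X ≅ K) := by
  obtain ⟨K, rfl⟩ := K.quotient_obj_surjective
  have e : (embed A).obj ((toH0 A.toDG).obj (DGMod.ofComplex K)) ≅
      (HomotopyCategory.quotient _ _).obj K :=
    (HomotopyCategory.quotient _ _).mapIso (DGMod.ofComplexIso K).symm
  rcases D.gen₀_of_perf (DGMod.perf_ofComplex K hK) with h | h
  · exact ⟨_, h, ⟨e⟩⟩
  -- A zero complex is reached by the cone of an identity morphism, which becomes a zero object in
  -- the homotopy category. This needs at least one generator.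
  · let M := D.P (Classical.arbitrary ι)
    have h1 := embed_distinguished A (coneTriangle (𝟙 M)) ⟨M, M, 𝟙 M, ⟨Iso.refl _⟩⟩
    have h2 := Triangle.isZero₃_of_isIso₁ _ h1
      (inferInstanceAs (IsIso ((embed A).map ((toH0 A.toDG).map (𝟙 M)))))
    have h3 : IsZero ((HomotopyCategory.quotient _ _).obj
        (DGMod.toComplex (DGMod.ofComplex K))) :=
      Functor.map_isZero (HomotopyCategory.quotient (GrMod A) (ComplexShape.up ℤ))
        (DGMod.isZero_toComplex _ h)
    exact ⟨(toH0 A.toDG).obj (DGMod.cone (𝟙 M)),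
      Gen.cone _ _ _ (Gen.base _) (Gen.base _), ⟨IsZero.iso h2 h3 ≪≫ e⟩⟩

theorem HGr.dist_of_iso (T T' : Triangle (HGr A)) (e : T ≅ T')
    (hT : T ∈ TriangData.dist (C := HGr A)) : T' ∈ TriangData.dist (C := HGr A) :=
  isomorphic_distinguished _ hT _ e.symm

/-- The functor from `H^0(DGP(A))` to the homotopy category. -/
abbrev embedP (P : ι → DGMod A.toDG) : H0DGP P ⥤ HGr A := (genProp P).ι ⋙ embed A

/-- This makes the axioms of the triangulated homotopy category available for the triangles of
`H^0(DGP(A))`, which are defined by hand. -/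
theorem embedP_dist_iff (P : ι → DGMod A.toDG) (T : Triangle (H0DGP P)) :
    T ∈ TriangData.dist (C := H0DGP P) ↔ (embedP P).mapTriangle.obj T ∈ distTriang (HGr A) := by
  have h : ∀ T ∈ TriangData.dist (C := H0DGP P),
      (embedP P).mapTriangle.obj T ∈ distTriang (HGr A) := fun T hT =>
    isomorphic_distinguished _ (embed_distinguished A _ hT) _
      ((Functor.mapTriangleCompIso _ (embed A)).app T)
  exact ⟨h T, mem_dist_of_map (embedP P) H0DGP.dist_of_iso H0DGP.exists_dist h T⟩

/-- The equivalence of `H^0(DGP(A))` and `K^b(A)`. -/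
def equivKb [Fintype ι] [DecidableEq ι] [Nonempty ι] (D : Directed A.toDG ι) :
    TriangEquiv (H0DGP D.P) (Kb A) :=
  restrictEquiv (genProp D.P) (kbProp A) (embed A)
    (fun _ hX => DGMod.isBddFGProj_toComplex
      (Gen.perf (fun i => perf_ofIdem (D.e_mul_e i) (D.e_mem i)) hX))
    (fun _ h => Gen.qShift 1 _ h) (kbProp_q A)
    (fun _ _ _ _ => ⟨(embed A).map_injective, (embed A).map_surjective⟩)
    (exists_embed_iso D) (embedQIso A)
    (fun T => (embedP_dist_iff D.P T).trans
      ⟨fun h => isomorphic_distinguished _ h _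
        ((Functor.mapTriangleCompIso (genProp D.P).ι (embed A)).app T).symm,
      fun h => isomorphic_distinguished _ h _
        ((Functor.mapTriangleCompIso (genProp D.P).ι (embed A)).app T)⟩)
    HGr.dist_of_iso

theorem equivKb_base [Fintype ι] [DecidableEq ι] [Nonempty ι] (D : Directed A.toDG ι) (i : ι)
    (h0 : D.e i ∈ A.grade 0) :
    Nonempty ((equivKb D).equiv.functor.obj (H0DGP.base D.P i) ≅
      Kb.single (GrMod.ofIdem A (D.e i) h0) (GrMod.isFGProj_ofIdem A _ h0 (D.e_mul_e i))) := by
  obtain ⟨e⟩ := nonempty_iso_single (DGMod.toComplex (D.P i)) _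
    (GrMod.isoOfBijective (DGMod.partIdemHom h0) (DGMod.partIdemHom_bijective h0)) (DGMod.isZero_part_ofIdem h0)
  let e' : (embed A).obj ((toH0 A.toDG).obj (D.P i)) ≅ (HomotopyCategory.quotient _ _).obj _ :=
    (HomotopyCategory.quotient _ _).mapIso e
  exact ⟨(kbProp A).isoMk e'⟩

end

/-! ### The algebras `R_n` and `R_n ⊗ R_n` are directed -/

namespace PR

open GenR (Rel)

variable {n : ℕ}

/-- The augmentation of `R_n` at a vertex. -/
def ε (x : V n) : Pres (Rel n) →ₐ[F] F :=
  lift (fun g => match g with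
    | .e y => if x = y then 1 else 0
    | .r _ _ _ _ => 0)
    (fun y => by by_cases h : x = y <;> simp [h])
    (fun y z h => by
      by_cases h1 : x = y
      · simp [h1, h]
      · simp [h1])
    (by simp) (by simp) (by simp) (by simp)

theorem ε_e (x y : V n) : ε x (e y) = if x = y then 1 else 0 := lift_gen _ _ _ _ _ _ _ _

theorem ε_r (x : V n) (s y z h) : ε x (gen (Rel n) (.r s y z h)) = 0 := lift_gen _ _ _ _ _ _ _ _

/-- The augmentation kills every monomial that contains an arrow, and a monomial in idempotents has
degree zero. Arrows of degree zero are killed as well, so no condition on their degrees is needed.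
-/
theorem ε_grade (x : V n) {j : ℤ} (hj : j ≠ 0) {a : Pres (Rel n)}
    (ha : a ∈ gradeOf (Rel n) GenR.deg j) : ε x a = 0 := by
  induction ha using Submodule.span_induction with
  | mem a ha =>
    obtain ⟨l, rfl, rfl⟩ := ha
    suffices h : ∀ l : List (GenR n), ε x (l.map (gen (Rel n))).prod = 0 ∨
      (l.map GenR.deg).sum = 0 from (h l).resolve_right hj
    intro l
    induction l with
    | nil => simp
    | cons g l ih =>
      rw [List.map_cons, List.prod_cons, map_mul, List.map_cons, List.sum_cons]
      cases g with
      | r s y z h => rw [ε_r]; simp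
      | e y =>
        rcases ih with h | h
        · rw [h]; simp
        · rw [h]; simp [GenR.deg]
  | zero => exact map_zero _
  | add a b _ _ ha hb => rw [map_add, ha, hb, add_zero]
  | smul c a _ ha => rw [map_smul, ha, smul_zero]

theorem e_mul_e (x y : V n) : e x * e y = if x = y then e x else 0 := by
  split_ifs with h
  · rw [← h, e_mul_self]
  · exact e_mul_ne h

theorem card_of_isArrow {s : Fin n} {x y : V n} (h : IsArrow s x y) : y.card = x.card + 2 := by
  obtain ⟨h1, h2, rfl⟩ := h
  rw [Finset.card_insert_of_notMem, Finset.card_insert_of_notMem h1]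
  rw [Finset.mem_insert, not_or]
  exact ⟨fun h => (Fin.castSucc_lt_succ (i := s)).ne h.symm, h2⟩

/-- An arrow enlarges a vertex by two elements, so a path of positive length ends at a strictly
larger set. Products are treated by inserting the sum of the idempotents between the factors. -/
theorem e_mul_mul_e (a : Pres (Rel n)) : ∀ x y : V n, y.card ≤ x.card →
    e x * a * e y = if x = y then ε x a • e x else 0 := by
  induction a using pres_induction with
  | one =>
    intro x y _
    rw [mul_one, e_mul_e, map_one, one_smul]
  | gen g =>
    intro x y hxy
    cases g with
    | e z =>
      rw [e_mul_e, ε_e]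
      by_cases h : x = z
      · rw [if_pos h, if_pos h, e_mul_e, one_smul]
      · rw [if_neg h, if_neg h, zero_mul, zero_smul, ite_self]
    | r s z w h =>
      rw [ε_r, zero_smul, ite_self, ← rel_single (Rel.source s z w h),
        ← rel_single (Rel.target s z w h)]
      by_cases h1 : x = z
      · have h2 : w ≠ y := by
          rintro rfl
          have := card_of_isArrow h
          subst h1
          omega
        rw [mul_assoc, mul_assoc, mul_assoc, e_mul_ne h2, mul_zero, mul_zero, mul_zero]
      · rw [← mul_assoc, e_mul_ne h1, zero_mul, zero_mul]
  | mul a b ha hb =>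
    intro x y hxy
    have h1 : e x * (a * b) * e y = ∑ z, (e x * a * e z) * (e z * b * e y) := by
      calc e x * (a * b) * e y = e x * a * (∑ z, e z) * (b * e y) := by
            rw [sum_e, mul_one]; simp only [mul_assoc]
        _ = _ := by
            rw [Finset.mul_sum, Finset.sum_mul]
            refine Finset.sum_congr rfl fun z _ => ?_
            nth_rewrite 1 [← e_mul_self z]
            simp only [mul_assoc]
    rw [h1, Finset.sum_eq_single x]
    · rw [ha x x le_rfl, if_pos rfl, hb x y hxy, smul_mul_assoc, map_mul, mul_smul]
      split_ifs
      · rw [mul_smul_comm, e_mul_self]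
      · rw [mul_zero, smul_zero]
    -- An intermediate vertex `z ≠ x` kills the first factor if it is not larger than `x`. If it is
    -- larger, then it is also larger than `y` and kills the second factor.
    · intro z _ hz
      by_cases h : z.card ≤ x.card
      · rw [ha x z h, if_neg (Ne.symm hz), zero_mul]
      · rw [hb z y (by omega), if_neg (by rintro rfl; omega), mul_zero]
    · exact fun h => absurd (Finset.mem_univ x) h
  | add a b ha hb =>
    intro x y hxy
    rw [mul_add, add_mul, ha x y hxy, hb x y hxy, map_add, add_smul]
    split_ifs <;> simp
  | zero => simp

end PR

theorem QAlgebra.toDG_grade_of_ne {A : QAlgebra} {p : ℤ × ℤ} {a : A.carrier}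
    (ha : a ∈ A.toDG.grade p) (hp : p ≠ 0) : a = 0 ∨ (p.2 ≠ 0 ∧ a ∈ A.grade p.2) := by
  have ha' : a ∈ (if p.1 = 0 then A.grade p.2 else ⊥) := ha
  split_ifs at ha' with h
  · exact Or.inr ⟨fun h' => hp (Prod.ext h h'), ha'⟩
  · exact Or.inl ha'

/-- `R_n` is directed. -/
def R.directed (n : ℕ) : Directed (R n).toDG (V n) where
  e x := R.e x
  e_mem x := R.e_mem x
  d_eq_zero _ := rfl
  e_mul_e := PR.e_mul_self
  sum_e := PR.sum_e
  ht := Finset.card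
  ε := PR.ε
  ε_e := PR.ε_e
  ε_mem x p a ha hp := by
    rcases QAlgebra.toDG_grade_of_ne ha hp with h | ⟨h, h'⟩
    · exact (congrArg (PR.ε x) h).trans (map_zero _)
    · exact PR.ε_grade x h h'
  directed := PR.e_mul_mul_e

/-- The augmentation of `R_n ⊗ R_n` at a pair of vertices. -/
def RR.ε {n : ℕ} (p : V n × V n) :
    (Pres (GenR.Rel n)) ⊗[F] (Pres (GenR.Rel n)) →ₐ[F] F :=
  (Algebra.TensorProduct.lmul' F).comp (Algebra.TensorProduct.map (PR.ε p.1) (PR.ε p.2))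

theorem RR.ε_tmul {n : ℕ} (p : V n × V n) (a b : Pres (GenR.Rel n)) :
    RR.ε p (a ⊗ₜ b) = PR.ε p.1 a * PR.ε p.2 b := by
  simp [RR.ε]

/-- The sum of the cardinalities serves as height. If the total does not grow while the first
coordinate does, then the second one shrinks strictly, and its factor vanishes. -/
theorem RR.e_mul_mul_e {n : ℕ} (a : (Pres (GenR.Rel n)) ⊗[F] (Pres (GenR.Rel n))) (p r : V n × V n)
    (h : r.1.card + r.2.card ≤ p.1.card + p.2.card) :
    (PR.e p.1 ⊗ₜ[F] PR.e p.2) * a * (PR.e r.1 ⊗ₜ[F] PR.e r.2) =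
      if p = r then RR.ε p a • (PR.e p.1 ⊗ₜ[F] PR.e p.2) else 0 := by
  induction a using TensorProduct.induction_on with
  | zero => simp
  | add a b ha hb =>
    rw [mul_add, add_mul, ha, hb, map_add, add_smul]
    split_ifs <;> simp
  | tmul a b =>
    rw [Algebra.TensorProduct.tmul_mul_tmul, Algebra.TensorProduct.tmul_mul_tmul, RR.ε_tmul]
    by_cases h1 : r.1.card ≤ p.1.card
    · rw [PR.e_mul_mul_e a _ _ h1]
      by_cases h2 : p.1 = r.1
      · have h3 : r.2.card ≤ p.2.card := by rw [h2] at h; omega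
        rw [if_pos h2, PR.e_mul_mul_e b _ _ h3]
        by_cases h4 : p.2 = r.2
        · rw [if_pos h4, if_pos (Prod.ext h2 h4), TensorProduct.smul_tmul_smul]
        · rw [if_neg h4, if_neg (fun e => h4 (congrArg Prod.snd e)), TensorProduct.tmul_zero]
      · rw [if_neg h2, if_neg (fun e => h2 (congrArg Prod.fst e)), TensorProduct.zero_tmul]
    · rw [PR.e_mul_mul_e b _ _ (by omega), if_neg (by intro e; rw [e] at h; omega),
        if_neg (by rintro rfl; omega), TensorProduct.tmul_zero]

theorem RR.sum_e (n : ℕ) : ∑ p : V n × V n, (PR.e p.1 ⊗ₜ[F] PR.e p.2) =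
    (1 : (Pres (GenR.Rel n)) ⊗[F] (Pres (GenR.Rel n))) := by
  rw [Fintype.sum_prod_type]
  simp only [← TensorProduct.tmul_sum, PR.sum_e, ← TensorProduct.sum_tmul]
  rfl

theorem RR.ε_grade {n : ℕ} (p : V n × V n) {j : ℤ} (hj : j ≠ 0) {a : (RR n).carrier}
    (ha : a ∈ (RR n).grade j) : RR.ε p a = 0 := by
  have ha' : a ∈ QAlgebra.gradeTensor (R n) (R n) j := ha
  refine Submodule.span_induction (p := fun a _ => RR.ε p a = 0) ?_ (map_zero _) ?_ ?_ ha'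
  · rintro _ ⟨k, l, a, b, rfl, ha, hb, rfl⟩
    refine (RR.ε_tmul p a b).trans ?_
    by_cases hk : k = 0
    · rw [PR.ε_grade p.2 (by omega) hb, mul_zero]
    · rw [PR.ε_grade p.1 hk ha, zero_mul]
  · intro a b _ _ ha hb
    exact (map_add (RR.ε p) a b).trans (by rw [ha, hb, add_zero])
  · intro c a _ ha
    exact (map_smul (RR.ε p) c a).trans (by rw [ha, smul_zero])

/-- `R_n ⊗ R_n` is directed. -/
def RR.directed (n : ℕ) : Directed (RR n).toDG (V n × V n) where
  e p := RR.e p.1 p.2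
  e_mem p := RR.e_mem p.1 p.2
  d_eq_zero _ := rfl
  e_mul_e p := RR.e_mul_e p.1 p.2
  sum_e := RR.sum_e n
  ht p := p.1.card + p.2.card
  ε := RR.ε
  ε_e p r := (RR.ε_tmul p (PR.e r.1) (PR.e r.2)).trans (by
    rw [PR.ε_e, PR.ε_e]
    by_cases h1 : p.1 = r.1
    · by_cases h2 : p.2 = r.2
      · rw [if_pos h1, if_pos h2, if_pos (Prod.ext h1 h2), one_mul]
      · rw [if_neg h2, if_neg (fun e => h2 (congrArg Prod.snd e)), mul_zero]
    · rw [if_neg h1, if_neg (fun e => h1 (congrArg Prod.fst e)), zero_mul])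
  ε_mem p r a ha hr := by
    rcases QAlgebra.toDG_grade_of_ne ha hr with h | ⟨h, h'⟩
    · exact (congrArg (RR.ε p) h).trans (map_zero _)
    · exact RR.ε_grade p h h'
  directed := RR.e_mul_mul_e

open CategoryTheory.Pretriangulated CategoryTheory.Limits

/-! ### Grothendieck groups -/

section

variable {C : Type 1} [Category.{0} C] [HasShift C ℤ] [TriangData C]

theorem K0.mk_q (X : C) : K0.mk ((TriangData.q (C := C)).obj X) =
    (LaurentPolynomial.T 1 : ℤ[T;T⁻¹]) • K0.mk X := by
  rw [K0.mk, K0.mk, ← map_smul, ← sub_eq_zero, ← map_sub, Finsupp.smul_single, smul_eq_mul, mul_one]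
  exact (Submodule.Quotient.mk_eq_zero _).2 (Submodule.subset_span (Or.inl ⟨X, rfl⟩))

theorem K0.mk_dist {T : Triangle C} (hT : T ∈ TriangData.dist (C := C)) :
    K0.mk T.obj₂ = K0.mk T.obj₁ + K0.mk T.obj₃ := by
  rw [K0.mk, K0.mk, K0.mk, ← map_add, ← sub_eq_zero, ← map_sub]
  exact (Submodule.Quotient.mk_eq_zero _).2 (Submodule.subset_span (Or.inr ⟨T, hT, rfl⟩))

/-- The linear map out of the Grothendieck group induced by an additive function. -/
def K0.lift {M : Type*} [AddCommGroup M] [Module ℤ[T;T⁻¹] M] (φ : C → M)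
    (hq : ∀ X, φ ((TriangData.q (C := C)).obj X) = (LaurentPolynomial.T 1 : ℤ[T;T⁻¹]) • φ X)
    (hd : ∀ T ∈ TriangData.dist (C := C), φ T.obj₂ = φ T.obj₁ + φ T.obj₃) :
    K0 C →ₗ[ℤ[T;T⁻¹]] M :=
  (K0Rel C).liftQ (Finsupp.linearCombination _ φ) <| Submodule.span_le.2 <| by
    rintro _ (⟨X, rfl⟩ | ⟨T, hT, rfl⟩)
    · simp [hq]
    · simp [hd T hT]

theorem K0.lift_mk {M : Type*} [AddCommGroup M] [Module ℤ[T;T⁻¹] M] (φ : C → M) (hq hd) (X : C) :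
    K0.lift φ hq hd (K0.mk X) = φ X := by
  refine ((K0Rel C).liftQ_apply _ _).trans ?_
  rw [Finsupp.linearCombination_single, one_smul]

theorem K0.span_mk : Submodule.span ℤ[T;T⁻¹] (Set.range (K0.mk : C → K0 C)) = ⊤ := by
  refine top_le_iff.1 fun x _ => ?_
  obtain ⟨v, rfl⟩ := (K0Rel C).mkQ_surjective x
  induction v using Finsupp.induction_linear with
  | zero => rw [map_zero]; exact zero_mem _
  | add v w hv hw => rw [map_add]; exact add_mem (hv trivial) (hw trivial)
  | single X a =>
    rw [← mul_one a, ← smul_eq_mul, ← Finsupp.smul_single, map_smul]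
    exact Submodule.smul_mem _ _ (Submodule.subset_span ⟨X, rfl⟩)

theorem K0.hom_ext {M : Type*} [AddCommGroup M] [Module ℤ[T;T⁻¹] M] {f g : K0 C →ₗ[ℤ[T;T⁻¹]] M}
    (h : ∀ X, f (K0.mk X) = g (K0.mk X)) : f = g :=
  LinearMap.ext_on_range K0.span_mk h

variable (C) in
/-- The distinguished triangles are closed under isomorphisms, and the identity morphisms are part
of distinguished triangles. -/
structure DistRegular : Prop where
  of_iso : ∀ T T' : Triangle C, (T ≅ T') → T ∈ TriangData.dist (C := C) →
    T' ∈ TriangData.dist (C := C)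
  exists_id : ∀ X : C, ∃ (Z : C) (g : X ⟶ Z) (h : Z ⟶ X⟦(1 : ℤ)⟧),
    Triangle.mk (𝟙 X) g h ∈ TriangData.dist (C := C)

/-- The triangle on the identity of `X` is isomorphic to one with first map `e : X ≅ Y` and the same
third object `Z`. The two give `[X] = [X] + [Z]` and `[Y] = [X] + [Z]`. -/
theorem DistRegular.mk_eq_of_iso (hC : DistRegular C) {X Y : C} (e : X ≅ Y) :
    K0.mk X = K0.mk Y := by
  obtain ⟨Z, g, h, hT⟩ := hC.exists_id X
  have e' : Triangle.mk (𝟙 X) g h ≅ Triangle.mk e.hom (e.inv ≫ g) h :=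
    Triangle.isoMk _ _ (Iso.refl _) e (Iso.refl _) rfl
      ((Category.comp_id _).trans (e.hom_inv_id_assoc g).symm)
      (((congrArg (h ≫ ·) (CategoryTheory.Functor.map_id _ _)).trans (Category.comp_id _)).trans
        (Category.id_comp _).symm)
  have h1 := K0.mk_dist hT
  have h2 := K0.mk_dist (hC.of_iso _ _ e' hT)
  exact h1.trans h2.symm

end

/-! ### Equivalences and Grothendieck groups -/

namespace TriangEquiv

variable {C D : Type 1} [Category.{0} C] [HasShift C ℤ] [TriangData C] [Category.{0} D]
  [HasShift D ℤ] [TriangData D] (E : TriangEquiv C D)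

/-- The preimage of a triangle under an equivalence. -/
theorem exists_mapTriangle_iso (T : Triangle D) :
    ∃ T' : Triangle C, T'.obj₁ = E.equiv.inverse.obj T.obj₁ ∧
      T'.obj₂ = E.equiv.inverse.obj T.obj₂ ∧ T'.obj₃ = E.equiv.inverse.obj T.obj₃ ∧
      letI := E.commShift
      Nonempty (T ≅ E.equiv.functor.mapTriangle.obj T') := by
  letI := E.commShift
  let c := E.equiv.counitIso
  obtain ⟨m, hm⟩ := E.equiv.functor.map_surjective
    (X := E.equiv.inverse.obj T.obj₃) (Y := (E.equiv.inverse.obj T.obj₁)⟦(1 : ℤ)⟧)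
    (c.hom.app T.obj₃ ≫ T.mor₃ ≫ (c.inv.app T.obj₁)⟦(1 : ℤ)⟧' ≫
      (E.equiv.functor.commShiftIso (1 : ℤ)).inv.app _)
  refine ⟨Triangle.mk (E.equiv.inverse.map T.mor₁) (E.equiv.inverse.map T.mor₂) m, rfl, rfl, rfl,
    ⟨Triangle.isoMk _ _ (c.symm.app _) (c.symm.app _) (c.symm.app _) ?_ ?_ ?_⟩⟩
  · exact c.inv.naturality T.mor₁
  · exact c.inv.naturality T.mor₂
  · change T.mor₃ ≫ (c.inv.app T.obj₁)⟦(1 : ℤ)⟧' = c.inv.app T.obj₃ ≫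
      E.equiv.functor.map m ≫ (E.equiv.functor.commShiftIso (1 : ℤ)).hom.app _
    rw [hm]
    simp only [Category.assoc, Iso.inv_hom_id_app, Iso.inv_hom_id_app_assoc]
    erw [Category.comp_id]

/-- The inverse of an equivalence commutes with `{1}`. -/
def inverseQIso (Y : D) : (E.equiv.inverse.obj (TriangData.q.obj Y)) ≅
    TriangData.q.obj (E.equiv.inverse.obj Y) :=
  E.equiv.functor.preimageIso (E.equiv.counitIso.app _ ≪≫
    TriangData.q.mapIso (E.equiv.counitIso.app Y).symm ≪≫ (E.qIso.app _).symm)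

theorem mk_functor_dist (T : Triangle C) (hT : T ∈ TriangData.dist (C := C)) :
    K0.mk (E.equiv.functor.obj T.obj₂) =
      K0.mk (E.equiv.functor.obj T.obj₁) + K0.mk (E.equiv.functor.obj T.obj₃) :=
  letI := E.commShift
  K0.mk_dist ((E.dist_iff T).1 hT)

theorem mk_inverse_dist (hD : DistRegular D) (T : Triangle D)
    (hT : T ∈ TriangData.dist (C := D)) :
    K0.mk (E.equiv.inverse.obj T.obj₂) =
      K0.mk (E.equiv.inverse.obj T.obj₁) + K0.mk (E.equiv.inverse.obj T.obj₃) := by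
  letI := E.commShift
  obtain ⟨T', h1, h2, h3, ⟨e⟩⟩ := E.exists_mapTriangle_iso T
  rw [← h1, ← h2, ← h3]
  exact K0.mk_dist ((E.dist_iff T').2 (hD.of_iso _ _ e hT))

/-- The map of Grothendieck groups induced by an equivalence. -/
def k0Hom (hD : DistRegular D) : K0 C →ₗ[ℤ[T;T⁻¹]] K0 D :=
  K0.lift (fun X => K0.mk (E.equiv.functor.obj X))
    (fun X => (hD.mk_eq_of_iso (E.qIso.app X)).trans (K0.mk_q _)) E.mk_functor_dist

theorem k0Hom_mk (hD : DistRegular D) (X : C) :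
    E.k0Hom hD (K0.mk X) = K0.mk (E.equiv.functor.obj X) :=
  K0.lift_mk (fun X => K0.mk (E.equiv.functor.obj X)) _ E.mk_functor_dist X

/-- The inverse of the map of Grothendieck groups induced by an equivalence. -/
def k0Inv (hC : DistRegular C) (hD : DistRegular D) : K0 D →ₗ[ℤ[T;T⁻¹]] K0 C :=
  K0.lift (fun Y => K0.mk (E.equiv.inverse.obj Y))
    (fun Y => (hC.mk_eq_of_iso (E.inverseQIso Y)).trans (K0.mk_q _)) (E.mk_inverse_dist hD)

theorem k0Inv_mk (hC : DistRegular C) (hD : DistRegular D) (Y : D) :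
    E.k0Inv hC hD (K0.mk Y) = K0.mk (E.equiv.inverse.obj Y) :=
  K0.lift_mk (fun Y => K0.mk (E.equiv.inverse.obj Y)) _ (E.mk_inverse_dist hD) Y

/-- The isomorphism of Grothendieck groups induced by an equivalence. -/
def k0 (hC : DistRegular C) (hD : DistRegular D) : K0 C ≃ₗ[ℤ[T;T⁻¹]] K0 D :=
  LinearEquiv.ofLinearMap (E.k0Hom hD) (E.k0Inv hC hD)
    (K0.hom_ext fun Y => by
      rw [LinearMap.comp_apply, k0Inv_mk, k0Hom_mk]
      exact hD.mk_eq_of_iso (E.equiv.counitIso.app Y))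
    (K0.hom_ext fun X => by
      rw [LinearMap.comp_apply, k0Hom_mk, k0Inv_mk]
      exact hC.mk_eq_of_iso (E.equiv.unitIso.app X).symm)

theorem k0_mk (hC : DistRegular C) (hD : DistRegular D) (X : C) :
    E.k0 hC hD (K0.mk X) = K0.mk (E.equiv.functor.obj X) := E.k0Hom_mk hD X

/-- Regularity is preserved by equivalences. -/
theorem distRegular (E : TriangEquiv C D) (hC : DistRegular C)
    (hD : ∀ T T' : Triangle D, (T ≅ T') → T ∈ TriangData.dist (C := D) →
      T' ∈ TriangData.dist (C := D)) : DistRegular D := by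
  refine ⟨hD, fun Y => ?_⟩
  letI := E.commShift
  obtain ⟨Z, g, h, hT⟩ := hC.exists_id (E.equiv.inverse.obj Y)
  let c : E.equiv.functor.obj (E.equiv.inverse.obj Y) ≅ Y := E.equiv.counitIso.app Y
  let T := E.equiv.functor.mapTriangle.obj (Triangle.mk (𝟙 (E.equiv.inverse.obj Y)) g h)
  refine ⟨_, _, _, hD T (Triangle.mk (𝟙 Y) (c.inv ≫ T.mor₂) (T.mor₃ ≫ c.hom⟦(1 : ℤ)⟧'))
    (Triangle.isoMk _ _ c c (Iso.refl _) ?_ ?_ ?_) ((E.dist_iff _).1 hT)⟩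
  · exact ((congrArg (· ≫ c.hom) (CategoryTheory.Functor.map_id _ _)).trans
      (Category.id_comp _)).trans (Category.comp_id _).symm
  · exact (Category.comp_id _).trans (c.hom_inv_id_assoc T.mor₂).symm
  · exact (Category.id_comp _).symm

end TriangEquiv

theorem H0DGP.distRegular {A : QDGAlgebra} {ι : Type} (P : ι → DGMod A) :
    DistRegular (H0DGP P) :=
  ⟨H0DGP.dist_of_iso, fun X => H0DGP.exists_dist X X (𝟙 X)⟩

theorem Kb.dist_of_iso {A : QAlgebra} (T T' : Triangle (Kb A))
    (e : T ≅ T') (hT : T ∈ TriangData.dist (C := Kb A)) : T' ∈ TriangData.dist (C := Kb A) :=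
  HGr.dist_of_iso _ _ ((kbProp A).ι.mapTriangle.mapIso e) hT

open CategoryTheory.Pretriangulated CategoryTheory.Limits

namespace DGMod

variable {A : QDGAlgebra}

/-- Two changes of the bidegrees compose. -/
def regradeAddIso (M : DGMod A) {u v w : ℤ × ℤ} (h : v + u = w) :
    (M.regrade u).regrade v ≅ M.regrade w where
  hom := ⟨LinearMap.id, mem_closed (fun p m hm => by
    change m ∈ M.grade (p + w)
    rw [← h, ← add_assoc]
    exact hm) (fun _ => rfl)⟩
  inv := ⟨LinearMap.id, mem_closed (fun p m hm => by
    change m ∈ M.grade (p + v + u)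
    rw [add_assoc, h]
    exact hm) (fun _ => rfl)⟩

/-- The trivial change of the bidegrees. -/
def regradeZeroIso (M : DGMod A) {u : ℤ × ℤ} (h : u = 0) : M.regrade u ≅ M where
  hom := ⟨LinearMap.id, mem_closed (fun p m hm => by
    subst h
    have hm : m ∈ M.grade (p + 0) := hm
    rwa [add_zero] at hm) (fun _ => rfl)⟩
  inv := ⟨LinearMap.id, mem_closed (fun p m hm => by
    subst h
    change m ∈ M.grade (p + 0)
    rwa [add_zero]) (fun _ => rfl)⟩

end DGMod

/-! ### Generators of the Grothendieck group -/

section Span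

variable {A : QAlgebra} {ι : Type} {P : ι → DGMod A.toDG}

/-- The object of `H^0(DGP(A))` given by a DG module. -/
def H0DGP.of {M : DGMod A.toDG} (h : Gen P M) : H0DGP P := ⟨(toH0 A.toDG).obj M, h⟩

theorem H0DGP.mk_of_iso {M N : DGMod A.toDG} (hM : Gen P M) (hN : Gen P N) (e : M ≅ N) :
    K0.mk (H0DGP.of hM) = K0.mk (H0DGP.of hN) := by
  let e' : (H0DGP.of hM).obj ≅ (H0DGP.of hN).obj := (toH0 A.toDG).mapIso e
  exact (H0DGP.distRegular P).mk_eq_of_iso ((genProp P).isoMk e')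

/-- The cone `Z` of the identity has class zero and becomes a zero object after the embedding. In a
triangle `X → Z → W → X[1]` the last map is therefore an isomorphism, while the relation for this
triangle says `[W] = -[X]`. -/
theorem H0DGP.mk_shift_one (X : H0DGP P) : K0.mk (X⟦(1 : ℤ)⟧) = -K0.mk X := by
  obtain ⟨Z, g, h, hT⟩ := H0DGP.exists_dist X X (𝟙 X)
  obtain ⟨W, g', h', hT'⟩ := H0DGP.exists_dist X Z g
  have hZ : K0.mk X = K0.mk X + K0.mk Z := K0.mk_dist hT
  have hW : K0.mk Z = K0.mk X + K0.mk W := K0.mk_dist hT'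
  rw [left_eq_add.1 hZ] at hW
  have h1 : IsZero ((embedP P).obj Z) := Triangle.isZero₃_of_isIso₁ _
    ((embedP_dist_iff P _).1 hT) (inferInstanceAs (IsIso ((embedP P).map (𝟙 X))))
  have h2 : IsIso ((embedP P).map h' ≫ ((embedP P).commShiftIso (1 : ℤ)).hom.app X) :=
    (Triangle.isZero₂_iff_isIso₃ _ ((embedP_dist_iff P _).1 hT')).1 h1
  have h3 : IsIso ((embedP P).map h') := IsIso.of_isIso_comp_right
    ((embedP P).map h') (((embedP P).commShiftIso (1 : ℤ)).hom.app X)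
  have h4 : IsIso h' := isIso_of_reflects_iso h' (embedP P)
  exact ((H0DGP.distRegular P).mk_eq_of_iso (asIso h')).symm.trans
    (eq_neg_of_add_eq_zero_right hW.symm)

variable (P) in
/-- The submodule generated by the classes of the generators. -/
def baseSpan : Submodule ℤ[T;T⁻¹] (K0 (H0DGP P)) :=
  Submodule.span _ (Set.range fun i => K0.mk (H0DGP.base P i))

theorem mk_shift_mem_baseSpan (X : H0DGP P) (hX : K0.mk X ∈ baseSpan P) (n : ℤ) :
    K0.mk (X⟦n⟧) ∈ baseSpan P := by
  have hC := H0DGP.distRegular P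
  induction n using Int.induction_on with
  | zero => rwa [hC.mk_eq_of_iso ((shiftFunctorZero (H0DGP P) ℤ).app X)]
  | succ i ih =>
    rw [hC.mk_eq_of_iso ((shiftFunctorAdd (H0DGP P) (i : ℤ) 1).app X)]
    exact (H0DGP.mk_shift_one (X⟦(i : ℤ)⟧)).symm ▸ neg_mem ih
  | pred i ih =>
    rw [hC.mk_eq_of_iso ((shiftFunctorAdd' (H0DGP P) (-(i : ℤ) - 1) 1 (-i) (by ring)).app X)] at ih
    exact neg_mem_iff.1 ((H0DGP.mk_shift_one (X⟦-(i : ℤ) - 1⟧)) ▸ ih)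

theorem H0DGP.mk_of_qShift {M : DGMod A.toDG} (h : Gen P M) :
    K0.mk (H0DGP.of (Gen.qShift 1 M h)) =
      (LaurentPolynomial.T 1 : ℤ[T;T⁻¹]) • K0.mk (H0DGP.of h) :=
  K0.mk_q (H0DGP.of h)

theorem mk_qShift_mem_baseSpan {M : DGMod A.toDG} (h : Gen P M)
    (hM : K0.mk (H0DGP.of h) ∈ baseSpan P) (k : ℤ) :
    K0.mk (H0DGP.of (Gen.qShift k M h)) ∈ baseSpan P := by
  induction k using Int.induction_on with
  | zero => rwa [H0DGP.mk_of_iso (Gen.qShift 0 M h) h (M.regradeZeroIso rfl)]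
  | succ i ih =>
    rw [← H0DGP.mk_of_iso (Gen.qShift 1 _ (Gen.qShift i M h)) (Gen.qShift (i + 1) M h)
      (M.regradeAddIso (by simp [add_comm])), H0DGP.mk_of_qShift (Gen.qShift i M h)]
    exact Submodule.smul_mem _ _ ih
  | pred i ih =>
    rw [← H0DGP.mk_of_iso (Gen.qShift 1 _ (Gen.qShift (-(i : ℤ) - 1) M h)) (Gen.qShift (-i) M h)
      (M.regradeAddIso (by simp)), H0DGP.mk_of_qShift (Gen.qShift (-(i : ℤ) - 1) M h)] at ih
    have := Submodule.smul_mem _ (LaurentPolynomial.T (-1) : ℤ[T;T⁻¹]) ih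
    rwa [smul_smul, ← LaurentPolynomial.T_add, neg_add_cancel, LaurentPolynomial.T_zero,
      one_smul] at this

/-- The generators are closed under all the constructions up to the relations of the Grothendieck
group: a shift `[n]` contributes a sign, `{k}` a power of `q`, and a cone is a difference of
classes. The proof `h'` is kept apart from `h` so that the induction on `h` applies to the goal. -/
theorem mk_mem_baseSpan {M : DGMod A.toDG} (h : Gen P M) :
    ∀ h' : Gen P M, K0.mk (H0DGP.of h') ∈ baseSpan P := by
  induction h with
  | base i => exact fun _ => Submodule.subset_span ⟨i, rfl⟩
  | iso M N e hM ih => exact fun h' => H0DGP.mk_of_iso hM h' e ▸ ih hM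
  | shift n M hM ih => 
    intro h'
    have e : ((H0DGP.of hM)⟦n⟧).obj ≅ (H0DGP.of h').obj :=
      ((genProp P).ι.commShiftIso n).app (H0DGP.of hM) ≪≫
        ((toH0 A.toDG).commShiftIso n).symm.app M
    rw [← (H0DGP.distRegular P).mk_eq_of_iso ((genProp P).isoMk e)]
    exact mk_shift_mem_baseSpan (H0DGP.of hM) (ih hM) n
  | qShift k M hM ih => exact fun _ => mk_qShift_mem_baseSpan hM (ih hM) k
  | cone M N f hM hN ihM ihN =>
    intro h'
    obtain ⟨g, h, hT⟩ := H0DGP.exists_dist_cone (H0DGP.of hM) (H0DGP.of hN) f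
      ((genProp P).homMk ((toH0 A.toDG).map f)) rfl
    have := K0.mk_dist hT
    have h2 : K0.mk (H0DGP.of h') = K0.mk (H0DGP.of hN) - K0.mk (H0DGP.of hM) :=
      eq_sub_of_add_eq' this.symm
    exact h2 ▸ sub_mem (ihN hN) (ihM hM)

theorem baseSpan_eq_top : baseSpan P = ⊤ := by
  rw [eq_top_iff, ← K0.span_mk]
  refine Submodule.span_le.2 ?_
  rintro _ ⟨X, rfl⟩
  exact mk_mem_baseSpan (M := X.obj.as) X.property X.property

end Span

open CategoryTheory.Pretriangulated CategoryTheory.Limits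

/-! ### Euler characteristics -/

section Euler

/-- The summand `(-1)^i a q^j` of an Euler characteristic. -/
def eulerTerm (p : ℤ × ℤ) (a : ℕ) : ℤ[T;T⁻¹] :=
  LaurentPolynomial.C ((p.1.negOnePow : ℤ) * a) * LaurentPolynomial.T p.2

theorem eulerTerm_zero (p : ℤ × ℤ) : eulerTerm p 0 = 0 := by
  rw [eulerTerm, Nat.cast_zero, mul_zero, map_zero, zero_mul]

theorem eulerTerm_add (p : ℤ × ℤ) (a b : ℕ) :
    eulerTerm p (a + b) = eulerTerm p a + eulerTerm p b := by
  rw [eulerTerm, eulerTerm, eulerTerm, Nat.cast_add, mul_add, map_add, add_mul]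

theorem eulerTerm_shift (p : ℤ × ℤ) (a : ℕ) : eulerTerm p a = -eulerTerm (p + (1, 0)) a := by
  rw [eulerTerm, eulerTerm, Prod.fst_add, Prod.snd_add, Int.negOnePow_succ, add_zero,
    Units.val_neg, neg_mul, map_neg, neg_mul, neg_neg]

theorem eulerTerm_qShift (p : ℤ × ℤ) (a : ℕ) :
    eulerTerm ((0, 1) + p) a = LaurentPolynomial.T 1 * eulerTerm p a := by
  rw [eulerTerm, eulerTerm, Prod.fst_add, Prod.snd_add, zero_add, LaurentPolynomial.T_add]
  exact mul_left_comm _ _ _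

/-- The Euler characteristic of a family of dimensions. -/
def euler (r : ℤ × ℤ → ℕ) : ℤ[T;T⁻¹] := ∑ᶠ p, eulerTerm p (r p)

/-- The infinite sum in `euler` takes the default value zero when its support is infinite, so
additivity needs finite supports. Reindexing by a bijection does not. -/
theorem finite_support_eulerTerm {r : ℤ × ℤ → ℕ} (h : r.support.Finite) :
    (fun p => eulerTerm p (r p)).support.Finite :=
  h.subset fun p hp hr => hp (by
    have hr : r p = 0 := hr
    exact (congrArg (eulerTerm p) hr).trans (eulerTerm_zero p))

theorem euler_add {r s : ℤ × ℤ → ℕ} (hr : r.support.Finite) (hs : s.support.Finite) :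
    euler (fun p => r p + s p) = euler r + euler s := by
  simp only [euler, eulerTerm_add]
  exact finsum_add_distrib (finite_support_eulerTerm hr) (finite_support_eulerTerm hs)

theorem euler_shift (r : ℤ × ℤ → ℕ) : euler (fun p => r (p + (1, 0))) = -euler r := by
  have h := finsum_comp_equiv (f := fun p => -eulerTerm p (r p)) (Equiv.addRight ((1, 0) : ℤ × ℤ))
  rw [euler, euler, ← finsum_neg_distrib, ← h]
  exact finsum_congr fun p => eulerTerm_shift p (r (p + (1, 0)))

theorem euler_qShift {r s : ℤ × ℤ → ℕ} (hr : r.support.Finite) (h : ∀ p, s ((0, 1) + p) = r p) :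
    euler s = LaurentPolynomial.T 1 * euler r := by
  have h' := finsum_comp_equiv (f := fun p => eulerTerm p (s p)) (Equiv.addLeft ((0, 1) : ℤ × ℤ))
  rw [euler, euler, mul_finsum' _ _ (finite_support_eulerTerm hr), ← h']
  refine finsum_congr fun p => ?_
  rw [Equiv.coe_addLeft, eulerTerm_qShift, h]

theorem euler_single {r : ℤ × ℤ → ℕ} (h0 : r 0 = 1) (h : ∀ p, p ≠ 0 → r p = 0) : euler r = 1 := by
  rw [euler, finsum_eq_single _ 0 fun p hp => by rw [h p hp, eulerTerm_zero], h0, eulerTerm]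
  simp

theorem euler_zero {r : ℤ × ℤ → ℕ} (h : ∀ p, r p = 0) : euler r = 0 := by
  simp only [euler, h, eulerTerm_zero, finsum_zero]

variable {E : Type 1} [Category.{0} E]

/-- The dimension (over the field with two elements) of a space of morphisms. -/
def homRank (X W : E) : ℕ := padicValNat 2 (Nat.card (X ⟶ W))

/-- The rank of the map `Hom(Y, W) → Hom(X, W)` induced by a morphism. -/
def precompRank {X Y : E} (u : X ⟶ Y) (W : E) : ℕ :=
  padicValNat 2 (Nat.card (Set.range fun g : Y ⟶ W => u ≫ g))

theorem homRank_congr {X W X' W' : E} (e : (X ⟶ W) ≃ (X' ⟶ W')) : homRank X W = homRank X' W' := by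
  rw [homRank, homRank, Nat.card_congr e]

theorem homRank_eq_zero {X W : E} (h : Subsingleton (X ⟶ W)) : homRank X W = 0 := by
  have := Finite.card_le_one_iff_subsingleton (α := X ⟶ W) |>.2 h
  rw [homRank]
  interval_cases Nat.card (X ⟶ W) <;> simp

theorem precompRank_eq_zero {X Y W : E} (u : X ⟶ Y) (h : Subsingleton (X ⟶ W)) :
    precompRank u W = 0 := by
  have h' : Subsingleton (Set.range fun g : Y ⟶ W => u ≫ g) := inferInstance
  have := Finite.card_le_one_iff_subsingleton.2 h'
  rw [precompRank]
  interval_cases Nat.card (Set.range fun g : Y ⟶ W => u ≫ g) <;> simp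

/-- The spaces of morphisms to the objects of a family are finite, and almost all of them vanish. -/
structure FinHom (W : ℤ × ℤ → E) (X : E) : Prop where
  finite : ∀ p, Finite (X ⟶ W p)
  support : {p | Nontrivial (X ⟶ W p)}.Finite

theorem FinHom.of_equiv {W : ℤ × ℤ → E} {X Y : E} (hX : FinHom W X) (σ : ℤ × ℤ ≃ ℤ × ℤ)
    (e : ∀ p, (X ⟶ W p) ≃ (Y ⟶ W (σ p))) : FinHom W Y := by
  refine ⟨fun p => ?_, (hX.support.image σ).subset fun p hp => ?_⟩
  · have := hX.finite (σ.symm p)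
    have h := Finite.of_equiv _ (e (σ.symm p))
    rwa [σ.apply_symm_apply] at h
  · refine ⟨σ.symm p, ?_, σ.apply_symm_apply p⟩
    have h : Nontrivial (Y ⟶ W (σ (σ.symm p))) := by
      rw [σ.apply_symm_apply]
      exact hp
    exact (e (σ.symm p)).nontrivial

theorem FinHom.homRank_support {W : ℤ × ℤ → E} {X : E} (hX : FinHom W X) :
    (fun p => homRank X (W p)).support.Finite :=
  hX.support.subset fun _ hp => not_subsingleton_iff_nontrivial.1 fun h => hp (homRank_eq_zero h)

theorem FinHom.precompRank_support {W : ℤ × ℤ → E} {X Y : E} (hX : FinHom W X) (u : X ⟶ Y) :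
    (fun p => precompRank u (W p)).support.Finite :=
  hX.support.subset fun _ hp =>
    not_subsingleton_iff_nontrivial.1 fun h => hp (precompRank_eq_zero u h)

theorem precompRank_neg [Preadditive E] {X Y : E} (u : X ⟶ Y) (W : E) :
    precompRank (-u) W = precompRank u W := by
  have : (Set.range fun g : Y ⟶ W => (-u) ≫ g) = Set.range fun g : Y ⟶ W => u ≫ g := by
    ext f
    constructor
    · rintro ⟨g, rfl⟩
      exact ⟨-g, by simp⟩
    · rintro ⟨g, rfl⟩
      exact ⟨-g, by simp⟩
  rw [precompRank, precompRank, this]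

variable [HasShift E ℤ]

/-- Morphisms between shifted objects. -/
def shiftHomEquiv (X : E) {W W' : E} (ω : W' ≅ W⟦(1 : ℤ)⟧) : (X ⟶ W) ≃ (X⟦(1 : ℤ)⟧ ⟶ W') :=
  (Functor.FullyFaithful.ofFullyFaithful (shiftFunctor E (1 : ℤ))).homEquiv.trans
    ((Iso.refl _).homCongr ω.symm)

theorem shiftHomEquiv_apply {X W W' : E} (ω : W' ≅ W⟦(1 : ℤ)⟧) (f : X ⟶ W) :
    shiftHomEquiv X ω f = f⟦(1 : ℤ)⟧' ≫ ω.inv :=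
  Category.id_comp _

theorem precompRank_shift {X Y W W' : E} (u : X ⟶ Y) (ω : W' ≅ W⟦(1 : ℤ)⟧) :
    precompRank (u⟦(1 : ℤ)⟧') W' = precompRank u W := by
  have : (Set.range fun g : Y⟦(1 : ℤ)⟧ ⟶ W' => u⟦(1 : ℤ)⟧' ≫ g) =
      shiftHomEquiv X ω '' Set.range fun g : Y ⟶ W => u ≫ g := by
    ext f
    constructor
    · rintro ⟨g, rfl⟩
      obtain ⟨g, rfl⟩ := (shiftHomEquiv Y ω).surjective g
      refine ⟨_, ⟨g, rfl⟩, ?_⟩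
      simp only [shiftHomEquiv_apply, Functor.map_comp, Category.assoc]
    · rintro ⟨_, ⟨g, rfl⟩, rfl⟩
      refine ⟨shiftHomEquiv Y ω g, ?_⟩
      simp only [shiftHomEquiv_apply, Functor.map_comp, Category.assoc]
  rw [precompRank, precompRank, this, Nat.card_image_of_injective (shiftHomEquiv X ω).injective]

theorem FinHom.shift {W : ℤ × ℤ → E} (ω : ∀ p, W (p + (1, 0)) ≅ (W p)⟦(1 : ℤ)⟧) {X : E}
    (hX : FinHom W X) : FinHom W (X⟦(1 : ℤ)⟧) :=
  hX.of_equiv (Equiv.addRight ((1, 0) : ℤ × ℤ)) fun p => shiftHomEquiv X (ω p)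

variable [Preadditive E] [HasZeroObject E] [∀ n : ℤ, (shiftFunctor E n).Additive] [Pretriangulated E]

theorem ker_leftComp {T : Triangle E} (hT : T ∈ distTriang E) (W : E) :
    ((Preadditive.leftComp W T.mor₁).ker : Set (T.obj₂ ⟶ W)) =
      Set.range fun g : T.obj₃ ⟶ W => T.mor₂ ≫ g := by
  ext f
  constructor
  · intro hf
    obtain ⟨g, rfl⟩ := T.yoneda_exact₂ hT f hf
    exact ⟨g, rfl⟩
  · rintro ⟨g, rfl⟩
    change T.mor₁ ≫ T.mor₂ ≫ g = 0
    rw [comp_distTriang_mor_zero₁₂_assoc _ hT, zero_comp]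

/-- Exactness identifies the kernel of precomposition with `mor₁` with the image of precomposition
with `mor₂`. Orders of finite groups are multiplicative, hence their 2-adic valuations add. Working
with orders avoids a vector space structure on the morphisms. -/
theorem homRank_eq_add {T : Triangle E} (hT : T ∈ distTriang E) (W : E) (h : Finite (T.obj₂ ⟶ W)) :
    homRank T.obj₂ W = precompRank T.mor₁ W + precompRank T.mor₂ W := by
  let φ := Preadditive.leftComp W T.mor₁
  have h1 : Nat.card φ.range = Nat.card (Set.range fun g : T.obj₂ ⟶ W => T.mor₁ ≫ g) := rfl
  have h2 : Nat.card φ.ker = Nat.card (Set.range fun g : T.obj₃ ⟶ W => T.mor₂ ≫ g) :=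
    Nat.card_congr (Equiv.setCongr (ker_leftComp hT W))
  have h3 : Finite φ.range := Set.finite_range _
  rw [homRank, precompRank, precompRank, ← h1, ← h2,
    ← padicValNat.mul Nat.card_pos.ne' Nat.card_pos.ne',
    AddSubgroup.card_eq_card_quotient_mul_card_addSubgroup φ.ker,
    Nat.card_congr (QuotientAddGroup.quotientKerEquivRange φ).toEquiv]

theorem finite_hom₂ {T : Triangle E} (hT : T ∈ distTriang E) (W : E) (h1 : Finite (T.obj₁ ⟶ W))
    (h3 : Finite (T.obj₃ ⟶ W)) : Finite (T.obj₂ ⟶ W) := by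
  let φ := Preadditive.leftComp W T.mor₁
  have h4 : Finite φ.ker :=
    Set.Finite.subset (Set.finite_range _) (ker_leftComp hT W).le
  have h5 : Finite ((T.obj₂ ⟶ W) ⧸ φ.ker) :=
    .of_equiv _ (QuotientAddGroup.quotientKerEquivRange φ).toEquiv.symm
  exact .of_addSubgroup_quotient (H := φ.ker)

theorem FinHom.obj₂ {W : ℤ × ℤ → E} {T : Triangle E} (hT : T ∈ distTriang E)
    (h1 : FinHom W T.obj₁) (h3 : FinHom W T.obj₃) : FinHom W T.obj₂ := by
  refine ⟨fun p => finite_hom₂ hT _ (h1.finite p) (h3.finite p),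
    (h1.support.union h3.support).subset fun p hp => ?_⟩
  by_contra h
  obtain ⟨h, h'⟩ := not_or.1 h
  have h : Subsingleton (T.obj₁ ⟶ W p) := not_nontrivial_iff_subsingleton.1 h
  have h' : Subsingleton (T.obj₃ ⟶ W p) := not_nontrivial_iff_subsingleton.1 h'
  refine not_subsingleton_iff_nontrivial.2 hp (subsingleton_of_forall_eq 0 fun f => ?_)
  obtain ⟨g, rfl⟩ := T.yoneda_exact₂ hT f (Subsingleton.elim _ _)
  rw [Subsingleton.elim g 0, comp_zero]

/-- The Euler characteristic of the spaces of morphisms to the objects of a family. -/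
def eulerHom (W : ℤ × ℤ → E) (X : E) : ℤ[T;T⁻¹] := euler fun p => homRank X (W p)

/-- In the long exact sequence every term splits into the ranks of its two neighbouring maps. If
`f`, `g`, `h` are the contributions of the three maps, then the three Euler characteristics are `f -
h`, `f + g` and `g + h`; the sign comes from the shift in the connecting map. -/
theorem eulerHom_dist {W : ℤ × ℤ → E} (ω : ∀ p, W (p + (1, 0)) ≅ (W p)⟦(1 : ℤ)⟧) {T : Triangle E}
    (hT : T ∈ distTriang E) (h1 : FinHom W T.obj₁) (h2 : FinHom W T.obj₂)
    (h3 : FinHom W T.obj₃) : eulerHom W T.obj₂ = eulerHom W T.obj₁ + eulerHom W T.obj₃ := by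
  have hT' := rot_of_distTriang _ hT
  let f := fun p => precompRank T.mor₁ (W p)
  let g := fun p => precompRank T.mor₂ (W p)
  let h := fun p => precompRank T.mor₃ (W p)
  have hf : f.support.Finite := h1.precompRank_support _
  have hg : g.support.Finite := h2.precompRank_support _
  have hh : h.support.Finite := h3.precompRank_support _
  have hh' : (fun p => h (p + (1, 0))).support.Finite :=
    hh.preimage (f := fun p : ℤ × ℤ => p + (1, 0)) (add_left_injective _).injOn
  have e2 : eulerHom W T.obj₂ = euler f + euler g :=
    (congrArg euler (funext fun p => homRank_eq_add hT _ (h2.finite p))).trans (euler_add hf hg)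
  have e3 : eulerHom W T.obj₃ = euler g + euler h :=
    (congrArg euler (funext fun p => homRank_eq_add hT' _ (h3.finite p))).trans (euler_add hg hh)
  have e1 : eulerHom W T.obj₁ = -euler h + euler f := by
    rw [← euler_shift, ← euler_add hh' hf]
    refine congrArg euler (funext fun p => ?_)
    -- The first object at `p` is replaced by its shift at `p + (1, 0)`, where it is the middle term
    -- of the triangle rotated twice.
    refine (homRank_congr (shiftHomEquiv T.obj₁ (ω p))).trans ?_
    refine (homRank_eq_add (rot_of_distTriang _ hT') (W (p + (1, 0)))
      ((h1.shift ω).finite _)).trans ?_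
    exact congrArg (h (p + (1, 0)) + ·) ((precompRank_neg _ _).trans (precompRank_shift _ (ω p)))
  rw [e1, e2, e3]
  ring

end Euler

open CategoryTheory.Pretriangulated CategoryTheory.Limits

/-! ### Regrading as an equivalence -/

section Regrade

variable {A : QDGAlgebra}

theorem DGMod.homotopic_of_regrade (u : ℤ × ℤ) {M N : DGMod A} {f g : M ⟶ N}
    (h : homotopic ((regradeFunctor u).map f) ((regradeFunctor u).map g)) : homotopic f g := by
  obtain ⟨k, hk, e⟩ := h
  refine ⟨k, fun p m hm => ?_, e⟩
  have h := hk (p - u) m (by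
    change m ∈ M.grade (p - u + u)
    rwa [sub_add_cancel])
  change k m ∈ N.grade (p - u + _ + u) at h
  rwa [add_right_comm, sub_add_cancel] at h

/-- A morphism of regraded modules as a morphism of modules. -/
def DGMod.unregrade (u : ℤ × ℤ) {M N : DGMod A} (f : M.regrade u ⟶ N.regrade u) : M ⟶ N :=
  ⟨f.1, mem_closed (fun p m hm => by
    have h := closed_mem f (p := p - u) (m := m) (by
      change m ∈ M.grade (p - u + u)
      rwa [sub_add_cancel])
    change f.1 m ∈ N.grade (p - u + u) at h
    rwa [sub_add_cancel] at h) (closed_comm f)⟩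

variable (A) in
/-- The change of bidegrees on `H^0(DG(A))`. -/
def regradeH0 (u : ℤ × ℤ) : H0DG A ⥤ H0DG A :=
  CategoryTheory.Quotient.lift _ (DGMod.regradeFunctor u ⋙ toH0 A) fun _ _ _ _ h =>
    CategoryTheory.Quotient.sound _ (DGMod.homotopic_regrade u h)

instance (u : ℤ × ℤ) : (regradeH0 A u).Full where
  map_surjective {X Y} φ := by
    obtain ⟨φ, rfl⟩ := (toH0 A).map_surjective (X := X.as.regrade u) (Y := Y.as.regrade u) φ
    exact ⟨(toH0 A).map (DGMod.unregrade u φ), rfl⟩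

instance (u : ℤ × ℤ) : (regradeH0 A u).Faithful where
  map_injective {X Y} φ ψ h := by
    obtain ⟨φ, rfl⟩ := (toH0 A).map_surjective (X := X.as) (Y := Y.as) φ
    obtain ⟨ψ, rfl⟩ := (toH0 A).map_surjective (X := X.as) (Y := Y.as) ψ
    exact CategoryTheory.Quotient.sound _ (DGMod.homotopic_of_regrade u
      ((CategoryTheory.Quotient.functor_map_eq_iff _ _ _).1 h))

end Regrade

/-! ### Euler characteristics of objects of `H^0(DGP(A))` -/

section Family

variable {A : QAlgebra} (S : DGMod A.toDG)

/-- The image of a DG module in the homotopy category. -/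
abbrev embObj (M : DGMod A.toDG) : HGr A := (embed A).obj ((toH0 A.toDG).obj M)

/-- The shifts of a DG module in the homotopy category. -/
def family (p : ℤ × ℤ) : HGr A := embObj (S.regrade p)

/-- Morphisms in the homotopy category are morphisms of DG modules. -/
def embHomEquiv (M N : DGMod A.toDG) :
    (embObj M ⟶ embObj N) ≃ ((toH0 A.toDG).obj M ⟶ (toH0 A.toDG).obj N) :=
  (Functor.FullyFaithful.ofFullyFaithful (embed A)).homEquiv.symm

/-- An isomorphism of DG modules in the homotopy category. -/
def embIso {M N : DGMod A.toDG} (e : M ≅ N) : embObj M ≅ embObj N :=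
  (embed A).mapIso ((toH0 A.toDG).mapIso e)

/-- Morphisms between regraded modules. -/
def regradeHomEquiv (u : ℤ × ℤ) (M : DGMod A.toDG) (p : ℤ × ℤ) :
    (embObj M ⟶ family S p) ≃ (embObj (M.regrade u) ⟶ family S (u + p)) :=
  (embHomEquiv M (S.regrade p)).trans
    (((Functor.FullyFaithful.ofFullyFaithful (regradeH0 A.toDG u)).homEquiv
      (X := (toH0 A.toDG).obj M) (Y := (toH0 A.toDG).obj (S.regrade p))).trans
      ((embHomEquiv (M.regrade u) ((S.regrade p).regrade u)).symm.trans
        ((Iso.refl _).homCongr (embIso (S.regradeAddIso rfl)))))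

/-- The shifts of the objects of the family. -/
def familyShift (p : ℤ × ℤ) : family S (p + (1, 0)) ≅ (family S p)⟦(1 : ℤ)⟧ :=
  embIso (S.regradeAddIso (add_comm _ _)).symm ≪≫
    (embed A).mapIso (((toH0 A.toDG).commShiftIso (1 : ℤ)).app (S.regrade p)) ≪≫
    ((embed A).commShiftIso (1 : ℤ)).app ((toH0 A.toDG).obj (S.regrade p))

theorem FinHom.regrade {M : DGMod A.toDG} (h : FinHom (family S) (embObj M)) (u : ℤ × ℤ) :
    FinHom (family S) (embObj (M.regrade u)) :=
  h.of_equiv (Equiv.addLeft u) fun p => regradeHomEquiv S u M p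

theorem Gen.finHom {ι : Type} {P : ι → DGMod A.toDG}
    (hP : ∀ i, FinHom (family S) (embObj (P i))) {M : DGMod A.toDG} (h : Gen P M) :
    FinHom (family S) (embObj M) := by
  induction h with
  | base i => exact hP i
  | iso M N e _ ih => exact ih.of_equiv (Equiv.refl _) fun p => (embIso e).homCongr (Iso.refl _)
  | shift n M _ ih => exact ih.regrade S (n, 0)
  | qShift k M _ ih => exact ih.regrade S (0, k)
  | cone M N f _ _ ihM ihN =>
    -- Rotation puts the cone in the middle, between `N` and `M[1]`.
    have hT := rot_of_distTriang _
      (embed_distinguished A (coneTriangle f) ⟨M, N, f, ⟨Iso.refl _⟩⟩)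
    exact FinHom.obj₂ hT ihN (ihM.shift (familyShift S))

variable {ι : Type} {P : ι → DGMod A.toDG}

theorem eulerHom_qShift {M : DGMod A.toDG} (h : FinHom (family S) (embObj M)) :
    eulerHom (family S) (embObj (M.regrade (0, 1))) =
      LaurentPolynomial.T 1 * eulerHom (family S) (embObj M) :=
  euler_qShift h.homRank_support fun p => (homRank_congr (regradeHomEquiv S (0, 1) M p)).symm

/-- The Euler characteristic of an object of `H^0(DGP(A))`. -/
def eulerObj (X : H0DGP P) : ℤ[T;T⁻¹] := eulerHom (family S) ((embedP P).obj X)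

theorem H0DGP.finHom (hP : ∀ i, FinHom (family S) (embObj (P i))) (X : H0DGP P) :
    FinHom (family S) ((embedP P).obj X) :=
  Gen.finHom S hP (M := X.obj.as) X.property

theorem eulerObj_q (hP : ∀ i, FinHom (family S) (embObj (P i))) (X : H0DGP P) :
    eulerObj S ((TriangData.q (C := H0DGP P)).obj X) =
      (LaurentPolynomial.T 1 : ℤ[T;T⁻¹]) • eulerObj S X :=
  eulerHom_qShift S (M := X.obj.as) (H0DGP.finHom S hP X)

theorem eulerObj_dist (hP : ∀ i, FinHom (family S) (embObj (P i))) (T : Triangle (H0DGP P))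
    (hT : T ∈ TriangData.dist (C := H0DGP P)) :
    eulerObj S T.obj₂ = eulerObj S T.obj₁ + eulerObj S T.obj₃ := by
  have hT' := (embedP_dist_iff P T).1 hT
  have h1 : FinHom (family S) ((embedP P).mapTriangle.obj T).obj₁ := H0DGP.finHom S hP T.obj₁
  have h2 : FinHom (family S) ((embedP P).mapTriangle.obj T).obj₂ := H0DGP.finHom S hP T.obj₂
  have h3 : FinHom (family S) ((embedP P).mapTriangle.obj T).obj₃ := H0DGP.finHom S hP T.obj₃
  have h := eulerHom_dist (familyShift S) hT' h1 h2 h3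
  exact h

/-- The Euler characteristic as a map out of the Grothendieck group. -/
def eulerK0 (hP : ∀ i, FinHom (family S) (embObj (P i))) :
    K0 (H0DGP P) →ₗ[ℤ[T;T⁻¹]] ℤ[T;T⁻¹] :=
  K0.lift (eulerObj S) (eulerObj_q S hP) (eulerObj_dist S hP)

theorem eulerK0_mk (hP : ∀ i, FinHom (family S) (embObj (P i))) (X : H0DGP P) :
    eulerK0 S hP (K0.mk X) = eulerObj S X := K0.lift_mk _ _ _ X

end Family

/-! ### Simple modules and the morphisms to them -/

namespace Directed

variable {B : QDGAlgebra} {ι : Type} [Fintype ι] [DecidableEq ι] (D : Directed B ι)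

/-- The simple modules. -/
def simple (i : ι) : DGMod B where
  carrier := F
  module := Module.compHom F (D.ε i : B.carrier →+* F)
  grade p := if p = 0 then ⊤ else ⊥
  isInternal := by
    refine isInternal_of_proj _ (fun p => if p = 0 then AddMonoidHom.id F else 0) ?_ ?_
    · intro g h m hm
      by_cases hg : g = 0
      · subst hg
        by_cases hh : h = 0
        · subst hh; simp
        · simp [hh, Ne.symm hh]
      · have hm : m ∈ (if g = 0 then ⊤ else ⊥ : AddSubgroup F) := hm
        rw [if_neg hg] at hm
        obtain rfl : m = 0 := hm
        simp
    · intro m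
      exact AddSubmonoid.subset_closure ⟨0, by simp⟩
  smul_mem := by
    intro p r a m ha hm
    by_cases hr : r = 0
    · by_cases hp : p = 0
      · subst hr hp
        rw [add_zero, if_pos rfl]
        trivial
      · change D.ε i a * m ∈ _
        rw [D.ε_mem i p a ha hp, zero_mul]
        exact zero_mem _
    · rw [if_neg hr] at hm
      obtain rfl : m = 0 := hm
      change D.ε i a * 0 ∈ _
      rw [mul_zero]
      exact zero_mem _
  d := 0
  d_mem _ := zero_mem _
  d_d _ := rfl
  d_smul a m := by
    rw [D.d_eq_zero]
    exact (show (0 : F) = D.ε i 0 * m + D.ε i a * 0 by simp)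

theorem map_P_apply {i j : ι} {p : ℤ × ℤ} (f : D.P i ⟶ (D.simple j).regrade p)
    (m : (D.P i).carrier) : @id F (f.1 m) = D.ε j m.1 * @id F (f.1 (D.top i)) := by
  have h : m.1 • D.top i = m := Subtype.ext (DGMod.ofIdem_mul (D.e_mul_e i) m)
  exact (congrArg f.1 h.symm).trans (map_smul f.1 m.1 (D.top i))

/-- The image of the generator is fixed by `e i`, which acts by zero on the other simple modules; it
also has to lie in the degree where the simple module lives. -/
theorem map_P_top {i j : ι} {p : ℤ × ℤ} (f : D.P i ⟶ (D.simple j).regrade p) (h : i ≠ j ∨ p ≠ 0) :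
    @id F (f.1 (D.top i)) = 0 := by
  rcases h with h | h
  · have h1 : D.ε j (D.e i) = 0 := (D.ε_e j i).trans (if_neg h.symm)
    exact (D.map_P_apply f (D.top i)).trans
      ((congrArg (fun c : F => c * @id F (f.1 (D.top i))) h1).trans (zero_mul _))
  · have h1 : f.1 (D.top i) ∈ (if 0 + p = 0 then ⊤ else ⊥ : AddSubgroup F) :=
      DGMod.closed_mem f (D.e_mem i)
    rw [zero_add, if_neg h] at h1
    exact h1

theorem subsingleton_hom {i j : ι} {p : ℤ × ℤ} (h : i ≠ j ∨ p ≠ 0) :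
    Subsingleton ((toH0 B).obj (D.P i) ⟶ (toH0 B).obj ((D.simple j).regrade p)) := by
  refine ⟨fun φ ψ => ?_⟩
  obtain ⟨f, rfl⟩ := (toH0 B).map_surjective φ
  obtain ⟨g, rfl⟩ := (toH0 B).map_surjective ψ
  refine congrArg _ (DGMod.hom_ext fun m => ?_)
  refine (D.map_P_apply f m).trans (Eq.trans ?_ (D.map_P_apply g m).symm)
  exact congrArg (fun c : F => D.ε j m.1 * c) ((D.map_P_top f h).trans (D.map_P_top g h).symm)

/-- The morphisms from an indecomposable projective module to its simple quotient. -/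
def toSimple (i : ι) (c : F) : D.P i ⟶ (D.simple i).regrade 0 :=
  ⟨{  toFun := fun m => (D.ε i m.1 * c : F)
      map_add' := fun x y => (congrArg (· * c) (map_add (D.ε i) x.1 y.1)).trans (add_mul _ _ _)
      map_smul' := fun a x => (congrArg (· * c) (map_mul (D.ε i) a x.1)).trans (mul_assoc _ _ _) },
    DGMod.mem_closed (fun p m hm => by
      change (D.ε i m.1 * c : F) ∈ (if p + 0 = 0 then ⊤ else ⊥ : AddSubgroup F)
      rw [add_zero]
      by_cases hp : p = 0
      · rw [if_pos hp]; trivial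
      · rw [D.ε_mem i p m.1 hm hp, zero_mul]; exact zero_mem _)
    fun m => ((congrArg (fun a => D.ε i a * c) (D.d_eq_zero m.1)).trans
      (show D.ε i 0 * c = 0 by rw [map_zero, zero_mul])).symm⟩

theorem card_hom (i : ι) :
    Nat.card ((toH0 B).obj (D.P i) ⟶ (toH0 B).obj ((D.simple i).regrade 0)) = 2 := by
  have h : Function.Bijective fun c : F => (toH0 B).map (D.toSimple i c) := by
    constructor
    · intro c c' h
      -- All differentials vanish, so homotopic maps agree on the generator, and the scalar `c` is
      -- recovered from its image.
      obtain ⟨k, -, e⟩ := (CategoryTheory.Quotient.functor_map_eq_iff _ _ _).1 h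
      have h1 := LinearMap.congr_fun e (D.top i)
      have h2 : (D.P i).d (D.top i) = 0 := Subtype.ext (D.d_eq_zero _)
      rw [DGMod.dHom_apply, h2, map_zero, add_zero] at h1
      have h3 : D.ε i (D.e i) = 1 := (D.ε_e i i).trans (if_pos rfl)
      have h4 : (0 : F) = D.ε i (D.e i) * c - D.ε i (D.e i) * c' := h1
      rw [h3, one_mul, one_mul] at h4
      exact (sub_eq_zero.1 h4.symm)
    · intro φ
      obtain ⟨f, rfl⟩ := (toH0 B).map_surjective φ
      exact ⟨f.1 (D.top i), congrArg _ (DGMod.hom_ext fun m => (D.map_P_apply f m).symm)⟩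
  rw [← Nat.card_congr (Equiv.ofBijective _ h), Nat.card_eq_fintype_card, ZMod.card]

end Directed

/-! ### A basis of the Grothendieck group -/

section Independence

variable {A : QAlgebra} {ι : Type} [Fintype ι] [DecidableEq ι] (D : Directed A.toDG ι)

theorem Directed.finHom (i j : ι) : FinHom (family (D.simple j)) (embObj (D.P i)) := by
  have h : ∀ p, i ≠ j ∨ p ≠ 0 → Subsingleton (embObj (D.P i) ⟶ family (D.simple j) p) :=
    fun p hp => have := D.subsingleton_hom hp; (embHomEquiv _ _).subsingleton
  refine ⟨fun p => ?_, (Set.finite_singleton 0).subset fun p hp => ?_⟩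
  · by_cases hp : i ≠ j ∨ p ≠ 0
    · have := h p hp
      infer_instance
    · obtain ⟨rfl, rfl⟩ : i = j ∧ p = 0 := by tauto
      have h2 := Nat.card_congr (embHomEquiv (D.P i) ((D.simple i).regrade 0))
      rw [D.card_hom i] at h2
      exact Nat.finite_of_card_ne_zero (h2.trans_ne two_ne_zero)
  · by_contra hp0
    exact not_subsingleton_iff_nontrivial.2 hp (h p (Or.inr hp0))

theorem Directed.eulerHom_P (i j : ι) :
    eulerHom (family (D.simple j)) (embObj (D.P i)) = if i = j then 1 else 0 := by
  have h : ∀ p, i ≠ j ∨ p ≠ 0 → homRank (embObj (D.P i)) (family (D.simple j) p) = 0 :=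
    fun p hp => homRank_eq_zero
      (have := D.subsingleton_hom hp; (embHomEquiv _ _).subsingleton)
  split_ifs with hij
  · subst hij
    refine euler_single ?_ fun p hp => h p (Or.inr hp)
    have h2 := Nat.card_congr (embHomEquiv (D.P i) ((D.simple i).regrade 0))
    rw [D.card_hom i] at h2
    exact (congrArg (padicValNat 2) h2).trans (padicValNat.self one_lt_two)
  · exact euler_zero fun p => h p (Or.inl hij)

/-- The Euler characteristics against the simple modules map the classes of the projective modules
to the standard basis vectors. The simple modules themselves need not belong to `DGP`. -/
theorem Directed.linearIndependent :
    LinearIndependent ℤ[T;T⁻¹] fun i => K0.mk (H0DGP.base D.P i) := by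
  let φ : K0 (H0DGP D.P) →ₗ[ℤ[T;T⁻¹]] (ι → ℤ[T;T⁻¹]) :=
    LinearMap.pi fun j => eulerK0 (D.simple j) fun i => D.finHom i j
  refine LinearIndependent.of_comp φ ?_
  have : (φ ∘ fun i => K0.mk (H0DGP.base D.P i)) = fun i => Pi.single i 1 := by
    funext i j
    refine (eulerK0_mk (D.simple j) (fun i => D.finHom i j) (H0DGP.base D.P i)).trans ?_
    refine (D.eulerHom_P i j).trans ?_
    rw [Pi.single_apply]
    simp only [eq_comm]
  rw [this]
  have h := (Pi.basisFun ℤ[T;T⁻¹] ι).linearIndependent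
  rwa [show (⇑(Pi.basisFun ℤ[T;T⁻¹] ι)) = fun i => Pi.single i 1 from
    funext fun i => Pi.basisFun_apply _ _ i] at h

/-- The classes of the indecomposable projective modules are a basis of the Grothendieck group. -/
def Directed.basis : Module.Basis ι ℤ[T;T⁻¹] (K0 (H0DGP D.P)) :=
  Module.Basis.mk D.linearIndependent (baseSpan_eq_top (P := D.P)).ge

theorem Directed.basis_apply (i : ι) : D.basis i = K0.mk (H0DGP.base D.P i) :=
  Module.Basis.mk_apply _ _ i

end Independence

/-! ### The Grothendieck groups of `R_n` and `R_n ⊗ R_n` -/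

section Final

theorem Kb.distRegular {A : QAlgebra} {ι : Type} [Fintype ι] [DecidableEq ι] [Nonempty ι]
    (D : Directed A.toDG ι) : DistRegular (Kb A) :=
  (equivKb D).distRegular (H0DGP.distRegular D.P) Kb.dist_of_iso

/-- The isomorphism of Grothendieck groups induced by the equivalence with `K^b(A)`. -/
def k0Kb {A : QAlgebra} {ι : Type} [Fintype ι] [DecidableEq ι] [Nonempty ι]
    (D : Directed A.toDG ι) : K0 (H0DGP D.P) ≃ₗ[ℤ[T;T⁻¹]] K0 (Kb A) :=
  (equivKb D).k0 (H0DGP.distRegular D.P) (Kb.distRegular D)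

theorem k0Kb_mk {A : QAlgebra} {ι : Type} [Fintype ι] [DecidableEq ι] [Nonempty ι]
    (D : Directed A.toDG ι) (X : H0DGP D.P) :
    k0Kb D (K0.mk X) = K0.mk ((equivKb D).equiv.functor.obj X) :=
  (equivKb D).k0_mk _ _ X

/-- The classes of the indecomposable projective modules are a basis of the Grothendieck group. -/
def Directed.basisKb {A : QAlgebra} {ι : Type} [Fintype ι] [DecidableEq ι] [Nonempty ι]
    (D : Directed A.toDG ι) : Module.Basis ι ℤ[T;T⁻¹] (K0 (Kb A)) :=
  D.basis.map (k0Kb D)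

theorem Directed.basisKb_apply {A : QAlgebra} {ι : Type} [Fintype ι] [DecidableEq ι] [Nonempty ι]
    (D : Directed A.toDG ι) (i : ι) (h0 : D.e i ∈ A.grade 0) : D.basisKb i =
      K0.mk (Kb.single (GrMod.ofIdem A (D.e i) h0) (GrMod.isFGProj_ofIdem A _ h0 (D.e_mul_e i))) := by
  rw [Directed.basisKb, Module.Basis.map_apply, Directed.basis_apply, k0Kb_mk]
  exact (Kb.distRegular D).mk_eq_of_iso (equivKb_base D i h0).some

/-- The Grothendieck group of `R_n ⊗ R_n`. -/
def RR.k0Tensor (n : ℕ) : K0 (Kb (RR n)) ≃ₗ[ℤ[T;T⁻¹]]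
    K0 (Kb (R n)) ⊗[ℤ[T;T⁻¹]] K0 (Kb (R n)) :=
  (RR.directed n).basisKb.equiv
    ((R.directed n).basisKb.tensorProduct (R.directed n).basisKb) (Equiv.refl _)

theorem RR.k0Tensor_mk (n : ℕ) (x y : V n) : RR.k0Tensor n (K0.mk (RR.PKb n (x, y))) =
    K0.mk (R.PKb n x) ⊗ₜ[ℤ[T;T⁻¹]] K0.mk (R.PKb n y) := by
  have h1 := (RR.directed n).basisKb_apply (x, y) (RR.e_mem x y)
  have h2 := (R.directed n).basisKb_apply x (R.e_mem x)
  have h3 := (R.directed n).basisKb_apply y (R.e_mem y)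
  refine (congrArg (RR.k0Tensor n) h1.symm).trans ?_
  refine (Module.Basis.equiv_apply _ _ _ _).trans ?_
  exact (Module.Basis.tensorProduct_apply _ _ _ _).trans (congrArg₂ _ h2 h3)

end Final

end QDG

end

theorem mainTheorem3 (n : ℕ) (hn : 0 < n) :
    (QDG.RB n).IsFormal ∧
    QDG.QDGAlgebra.Isomorphic (QDG.RB n).cohomology (QDG.RR n).toDG ∧
    ∃ (E₁ : QDG.TriangEquiv (QDG.H0DGP (QDG.RB.P n)) (QDG.H0DGP (QDG.RR.P n)))
      (E₂ : QDG.TriangEquiv (QDG.H0DGP (QDG.RR.P n)) (QDG.Kb (QDG.RR n)))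
      (k₁ : QDG.K0 (QDG.H0DGP (QDG.RB.P n)) ≃ₗ[ℤ[T;T⁻¹]] QDG.K0 (QDG.H0DGP (QDG.RR.P n)))
      (k₂ : QDG.K0 (QDG.H0DGP (QDG.RR.P n)) ≃ₗ[ℤ[T;T⁻¹]] QDG.K0 (QDG.Kb (QDG.RR n)))
      (k₃ : QDG.K0 (QDG.Kb (QDG.RR n)) ≃ₗ[ℤ[T;T⁻¹]]
        QDG.K0 (QDG.Kb (QDG.R n)) ⊗[ℤ[T;T⁻¹]] QDG.K0 (QDG.Kb (QDG.R n))),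
      (∀ p : QDG.V n × QDG.V n, Nonempty
        (E₁.equiv.functor.obj (QDG.H0DGP.base (QDG.RB.P n) p) ≅
          QDG.H0DGP.base (QDG.RR.P n) p)) ∧
      (∀ p : QDG.V n × QDG.V n, Nonempty
        (E₂.equiv.functor.obj (QDG.H0DGP.base (QDG.RR.P n) p) ≅ QDG.RR.PKb n p)) ∧
      (∀ X, k₁ (QDG.K0.mk X) = QDG.K0.mk (E₁.equiv.functor.obj X)) ∧
      (∀ X, k₂ (QDG.K0.mk X) = QDG.K0.mk (E₂.equiv.functor.obj X)) ∧
      (∀ x y : QDG.V n, k₃ (QDG.K0.mk (QDG.RR.PKb n (x, y))) =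
        QDG.K0.mk (QDG.R.PKb n x) ⊗ₜ[ℤ[T;T⁻¹]] QDG.K0.mk (QDG.R.PKb n y)) :=
  ⟨QDG.RB.isFormal n, QDG.RB.cohomology_isomorphic n, QDG.RB.equivRR n,
    QDG.equivKb (QDG.RR.directed n),
    (QDG.RB.equivRR n).k0 (QDG.H0DGP.distRegular _) (QDG.H0DGP.distRegular _),
    QDG.k0Kb (QDG.RR.directed n), QDG.RR.k0Tensor n, QDG.RB.equivRR_base n,
    fun p => QDG.equivKb_base (QDG.RR.directed n) p (QDG.RR.e_mem p.1 p.2),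
    (QDG.RB.equivRR n).k0_mk _ _, QDG.k0Kb_mk (QDG.RR.directed n), QDG.RR.k0Tensor_mk n⟩
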